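/- All groups are finite. A fusion system $\mathcal F$ on a finite $p$-group $P$ is a category whose objects are the subgroups of $P$, whose morphisms are injective group homomorphisms, which contains all maps between subgroups induced by conjugation in $P$, and which contains with every $\varphi\colon S\to T$ the isomorphism $S\to\varphi(S)$ and its inverse. It is assumed to be saturated: $\operatorname{Inn}(P)$ is a Sylow $p$-subgroup of $\operatorname{Aut}_{\mathcal F}(P)$, and every morphism $\varphi\colon Q\to P$ with $\varphi(Q)$ fully $\mathcal F$-normalized extends to a morphism $N_\varphi\to P$, where $N_\varphi$ is the set of $y\in N_P(Q)$ for which there is $z\in N_P(\varphi(Q))$ with $\varphi(yuy^{-1})=z\varphi(u)z^{-1}$ for all $u\in Q$. Here $Q\le P$ is fully $\mathcal F$-normalized if $|N_P(R)|\le|N_P(Q)|$ for all $R\le P$ that are $\mathcal F$-isomorphic to $Q$. For a finite group $G$ with Sylow $p$-subgroup $P$, $\mathcal F_P(G)$ is the fusion system on $P$ whose morphisms are the maps induced by conjugation in $G$; $\mathcal F$ is nilpotent if $\mathcal F=\mathcal F_P(P)$. A subgroup $Q\le P$ is $\mathcal F$-essential if it is fully $\mathcal F$-normalized, if $C_P(R)=Z(R)$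 for every $R\le P$ that is $\mathcal F$-isomorphic to $Q$, and if $\operatorname{Out}_{\mathcal F}(Q)=\operatorname{Aut}_{\mathcal F}(Q)/\operatorname{Inn}(Q)$ has a strongly $p$-embedded subgroup $H$, i.e. $p\mid |H|$, $p\nmid|\operatorname{Out}_{\mathcal F}(Q):H|>1$, and $p\nmid|H\cap xHx^{-1}|$ for all $x\in\operatorname{Out}_{\mathcal F}(Q)\setminus H$. Two fusion systems $\mathcal F,\mathcal F'$ on $P$ are considered equal if there is $\gamma\in\operatorname{Aut}(P)$ with $\operatorname{Hom}_{\mathcal F'}(\gamma(S),\gamma(T))=\gamma\circ\operatorname{Hom}_{\mathcal F}(S,T)\circ\gamma^{-1}$ for all $S,T\le P$. A group $P$ is bicyclic if $P=\langle x\rangle\langle y\rangle$ for some $x,y\in P$. A $p$-group $P$ is minimal nonabelian of type $(r,s)$ if \[P\cong\langle x,y\mid x^{p^r}=y^{p^s}=[x,y]^p=[x,[x,y]]=[y,[x,y]]=1\rangle,\qquad [x,y]=xyx^{-1}y^{-1}.\] **Proposition.** Let $\mathcal F$ be a nonnilpotent (saturated) fusion system on a bicyclic $2$-group $P$. Suppose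 that $P$ contains an elementary abelian normal subgroup of order $8$. Then there is an integer $n\ge 2$ such that $P$ is minimal nonabelian of type $(n,1)$, and $P$ has exactly one $\mathcal F$-essential subgroup, which is isomorphic to $C_{2^{n-1}}\times C_2^2$. Moreover, let $C_{2^n}$ act on the alternating group $A_4$ such that a generator acts as a transposition in $\operatorname{Aut}(A_4)\cong S_4$. Such an action exists, the group $A_4\rtimes C_{2^n}$ is unique up to isomorphism, $P$ is isomorphic to its Sylow $2$-subgroups, and (under any identification of $P$ with a Sylow $2$-subgroup) $\mathcal F$ is equal to $\mathcal F_P(A_4\rtimes C_{2^n})$. -/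

import Mathlib

/-- A (not necessarily saturated) fusion system on a group `P`: a category whose objects are the
subgroups of `P`, whose morphisms are injective group homomorphisms composed as maps, which contains
all the maps induced by conjugation in `P` (in particular all inclusions), and which contains, with
every morphism `φ : S → T`, the induced isomorphism `S → φ(S)` and its inverse. -/
@[ext]
structure FusionSystem (P : Type*) [Group P] where
  /-- The set `Hom_F(S, T)`. -/
  Hom : ∀ S T : Subgroup P, Set (S →* T)
  injective_of_mem : ∀ {S T : Subgroup P} {φ : S →* T}, φ ∈ Hom S T → Function.Injective φ
  mem_of_conj : ∀ {S T : Subgroup P} (g : P) (φ : S →* T),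
    (∀ s : S, (φ s : P) = g * (s : P) * g⁻¹) → φ ∈ Hom S T
  comp_mem : ∀ {S T U : Subgroup P} {φ : S →* T} {ψ : T →* U},
    φ ∈ Hom S T → ψ ∈ Hom T U → ψ.comp φ ∈ Hom S U
  isoOntoImage_mem : ∀ {S T R : Subgroup P} {φ : S →* T} (e : S ≃* R),
    φ ∈ Hom S T → (∀ s : S, (e s : P) = (φ s : P)) →
      e.toMonoidHom ∈ Hom S R ∧ e.symm.toMonoidHom ∈ Hom R S

namespace FusionSystem

/-- For a group `G` in which `P` is embedded by `ι`, the fusion system `F_P(G)`: its morphisms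
`S → T` are the maps induced by conjugation with elements of `G`. -/
def ofGroup {P G : Type*} [Group P] [Group G] (ι : P →* G) (hι : Function.Injective ι) :
    FusionSystem P where
  Hom S T := {φ | ∃ g : G, ∀ s : S, ι (φ s : P) = g * ι (s : P) * g⁻¹}
  injective_of_mem := by
    rintro S T φ ⟨g, hg⟩ a b hab
    have h : g * ι (a : P) * g⁻¹ = g * ι (b : P) * g⁻¹ := by rw [← hg a, ← hg b, hab]
    exact Subtype.ext (hι (by simpa using h))
  mem_of_conj := by
    intro S T g φ h
    exact ⟨ι g, fun s => by rw [h s]; simp⟩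
  comp_mem := by
    rintro S T U φ ψ ⟨g, hg⟩ ⟨k, hk⟩
    refine ⟨k * g, fun s => ?_⟩
    rw [MonoidHom.comp_apply, hk, hg]
    group
  isoOntoImage_mem := by
    rintro S T R φ e ⟨g, hg⟩ h
    refine ⟨⟨g, fun s => ?_⟩, ⟨g⁻¹, fun r => ?_⟩⟩
    · change ι (e s : P) = _
      rw [h s, hg s]
    · change ι (e.symm r : P) = _
      have h2 := h (e.symm r)
      rw [MulEquiv.apply_symm_apply] at h2
      rw [h2, hg]
      group

/-- The fusion system `F_P(P)`. -/
def inner (P : Type*) [Group P] : FusionSystem P :=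
  ofGroup (MonoidHom.id P) Function.injective_id

section

variable {P : Type*} [Group P]

/-- `F` is nilpotent if `F = F_P(P)`. -/
def IsNilpotent (F : FusionSystem P) : Prop :=
  F = inner P

/-- Two fusion systems on `P` are considered as equal if some automorphism `γ` of `P` satisfies
`Hom_{F'}(γ(S), γ(T)) = γ ∘ Hom_F(S, T) ∘ γ⁻¹` for all subgroups `S, T` of `P`. -/
def EqualUpToAut (F F' : FusionSystem P) : Prop :=
  ∃ γ : P ≃* P, ∀ S T : Subgroup P,
    F'.Hom (S.map (γ : P →* P)) (T.map (γ : P →* P)) =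
      {ψ | ∃ φ ∈ F.Hom S T,
        ψ = (γ.subgroupMap T).toMonoidHom.comp (φ.comp (γ.subgroupMap S).symm.toMonoidHom)}

/-- `S` and `T` are `F`-isomorphic. -/
def Isomorphic (F : FusionSystem P) (S T : Subgroup P) : Prop :=
  ∃ e : S ≃* T, e.toMonoidHom ∈ F.Hom S T

/-- The group `Aut_F(Q)`. -/
def autGroup (F : FusionSystem P) (Q : Subgroup P) : Subgroup (MulAut Q) where
  carrier := {α | MulEquiv.toMonoidHom α ∈ F.Hom Q Q}
  one_mem' := F.mem_of_conj 1 _ (fun s => by simp)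
  mul_mem' := by
    intro α β hα hβ
    exact F.comp_mem hβ hα
  inv_mem' := by
    intro α hα
    exact (F.isoOntoImage_mem (φ := MulEquiv.toMonoidHom α) α hα (fun _ => rfl)).2

/-- The group `Inn(Q)` of inner automorphisms is normal in `Aut(Q)`. -/
instance innNormal (Q : Type*) [Group Q] : (MulAut.conj (G := Q)).range.Normal where
  conj_mem := by
    rintro _ ⟨g, rfl⟩ α
    exact ⟨α g, by ext x; simp⟩

/-- `Out_F(Q) = Aut_F(Q) / Inn(Q)`. -/
abbrev outGroup (F : FusionSystem P) (Q : Subgroup P) : Type _ :=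
  F.autGroup Q ⧸ ((MulAut.conj (G := Q)).range.subgroupOf (F.autGroup Q))

/-- The image `φ(Q)` of `φ : Q → T` as a subgroup of `P`. -/
def image {Q T : Subgroup P} (φ : Q →* T) : Subgroup P :=
  φ.range.map T.subtype

/-- The largest subgroup `N_φ` of `N_P(Q)` to which `φ : Q → T` can possibly extend: it consists of
those `y ∈ N_P(Q)` for which there is a `z ∈ N_P(φ(Q))` such that
`φ(y u y⁻¹) = z φ(u) z⁻¹` for all `u ∈ Q`. -/
def extender {Q T : Subgroup P} (φ : Q →* T) : Subgroup P where
  carrier := {y | y ∈ Subgroup.normalizer (Q : Set P) ∧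
    ∃ z ∈ Subgroup.normalizer (image φ : Set P), ∀ u v : Q, (v : P) = y * (u : P) * y⁻¹ →
      (φ v : P) = z * (φ u : P) * z⁻¹}
  one_mem' := by
    refine ⟨Subgroup.one_mem _, 1, Subgroup.one_mem _, fun u v h => ?_⟩
    have : v = u := Subtype.ext (by simpa using h)
    simp [this]
  mul_mem' := by
    rintro a b ⟨ha, z, hz, hza⟩ ⟨hb, w, hw, hwb⟩
    refine ⟨Subgroup.mul_mem _ ha hb, z * w, Subgroup.mul_mem _ hz hw, fun u v h => ?_⟩
    have hbu : b * (u : P) * b⁻¹ ∈ Q := (Subgroup.mem_normalizer_iff.mp hb u).mp u.2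
    rw [hza ⟨_, hbu⟩ v (by rw [h]; group), hwb u ⟨_, hbu⟩ rfl]
    group
  inv_mem' := by
    rintro a ⟨ha, z, hz, hza⟩
    refine ⟨Subgroup.inv_mem _ ha, z⁻¹, Subgroup.inv_mem _ hz, fun u v h => ?_⟩
    rw [hza v u (by rw [h]; group)]
    group

/-- `Q` is fully `F`-normalized. -/
def IsFullyNormalized (F : FusionSystem P) (Q : Subgroup P) : Prop :=
  ∀ R : Subgroup P, F.Isomorphic Q R →
    Nat.card (Subgroup.normalizer (R : Set P)) ≤ Nat.card (Subgroup.normalizer (Q : Set P))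

/-- `Q` is `F`-centric. -/
def IsCentric (F : FusionSystem P) (Q : Subgroup P) : Prop :=
  ∀ R : Subgroup P, F.Isomorphic Q R →
    Subgroup.centralizer (R : Set P) = (Subgroup.center R).map R.subtype

/-- A fusion system on a finite `p`-group `P` is saturated if `Inn(P) = Aut_P(P)` is a Sylow
`p`-subgroup of `Aut_F(P)` and every morphism `φ : Q → P` whose image is fully `F`-normalized
extends to a morphism `N_φ → P`. -/
structure IsSaturated (p : ℕ) (F : FusionSystem P) : Prop where
  inn_sylow : ∃ S : Sylow p (F.autGroup (⊤ : Subgroup P)),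
    (S : Subgroup (F.autGroup (⊤ : Subgroup P))) =
      (MulAut.conj (G := (⊤ : Subgroup P))).range.subgroupOf (F.autGroup ⊤)
  extends_of_fullyNormalized : ∀ (Q : Subgroup P) (φ : Q →* (⊤ : Subgroup P)),
    φ ∈ F.Hom Q ⊤ → F.IsFullyNormalized (image φ) →
      ∃ ψ ∈ F.Hom (extender φ) ⊤, ∀ (u : Q) (v : extender φ), (v : P) = u → ψ v = φ u

end

end FusionSystem

/-- `H` is a strongly `p`-embedded subgroup of the finite group `X`. -/
def IsStronglyEmbedded (p : ℕ) {X : Type*} [Group X] (H : Subgroup X) : Prop :=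
  p ∣ Nat.card H ∧ ¬ p ∣ H.index ∧ 1 < H.index ∧
    ∀ x : X, x ∉ H → ¬ p ∣ Nat.card (H ⊓ H.map (MulAut.conj x).toMonoidHom : Subgroup X)

/-- `Q` is an `F`-essential subgroup of `P`. -/
structure FusionSystem.IsEssential (p : ℕ) {P : Type*} [Group P] (F : FusionSystem P)
    (Q : Subgroup P) : Prop where
  fullyNormalized : F.IsFullyNormalized Q
  centric : F.IsCentric Q
  stronglyEmbedded : ∃ H : Subgroup (F.outGroup Q), IsStronglyEmbedded p H

/-- `P` is bicyclic, i.e. `P = ⟨x⟩⟨y⟩` for some `x, y ∈ P`. -/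
def IsBicyclic (P : Type*) [Group P] : Prop :=
  ∃ x y : P, ∀ g : P, ∃ a ∈ Subgroup.zpowers x, ∃ b ∈ Subgroup.zpowers y, g = a * b

/-- `E` is an elementary abelian `p`-group. -/
def IsElementaryAbelianGroup (p : ℕ) (E : Type*) [Group E] : Prop :=
  (∀ a b : E, a * b = b * a) ∧ ∀ a : E, a ^ p = 1

/-- The cyclic group `C_m`, written multiplicatively. -/
abbrev CyclicGroup (m : ℕ) : Type :=
  Multiplicative (ZMod m)

/-- The relators of
`⟨x, y ∣ x^{p^r} = y^{p^s} = [x,y]^p = [x,x,y] = [y,x,y] = 1⟩`, where `[x,y] = x y x⁻¹ y⁻¹`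
and `[x,x,y] = [x,[x,y]]`. -/
def minimalNonabelianRels (p r s : ℕ) : Set (FreeGroup (Fin 2)) :=
  let x : FreeGroup (Fin 2) := FreeGroup.of 0
  let y : FreeGroup (Fin 2) := FreeGroup.of 1
  let c : FreeGroup (Fin 2) := x * y * x⁻¹ * y⁻¹
  {x ^ p ^ r, y ^ p ^ s, c ^ p, x * c * x⁻¹ * c⁻¹, y * c * y⁻¹ * c⁻¹}

/-- The `p`-group `P` is minimal nonabelian of type `(r, s)`. -/
def IsMinimalNonabelianOfType (p r s : ℕ) (P : Type*) [Group P] : Prop :=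
  Nonempty (P ≃* PresentedGroup (minimalNonabelianRels p r s))

/-- The automorphism of `A_4` induced by conjugation with a permutation in `S_4`. -/
abbrev conjA4 (τ : Equiv.Perm (Fin 4)) : MulAut (alternatingGroup (Fin 4)) :=
  MulAut.conjNormal τ

/-- The cyclic group `C_m` acts on `A_4` as a transposition: its canonical generator acts as
conjugation by a transposition of `S_4`. -/
def ActsAsTransposition {m : ℕ} (θ : CyclicGroup m →* MulAut (alternatingGroup (Fin 4))) : Prop :=
  ∃ τ : Equiv.Perm (Fin 4), τ.IsSwap ∧ θ (Multiplicative.ofAdd 1) = conjA4 τ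

/-- `ι` identifies `P` with a Sylow `p`-subgroup of `G`. -/
def IsSylowEmbedding (p : ℕ) {P G : Type*} [Group P] [Group G] (ι : P →* G) : Prop :=
  Function.Injective ι ∧ ∃ S : Sylow p G, ι.range = (S : Subgroup G)

/-!
Let `P = ⟨x⟩⟨y⟩` and let `E` be a normal elementary abelian subgroup of order `8`. Counting the
cosets of `E ∩ ⟨x⟩` in `E` (`exists_odd_pow_mul_mem_zpowers`) shows that `P = E⟨x⟩` and that `x` acts
on `E = ⟨a, d, b⟩` with `⟨b⟩ = E ∩ ⟨x⟩` by `a ↦ ad`, `d ↦ d b ^ e`, where `e ∈ {0, 1}`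
(`exists_cyclicExtension_of_isBicyclic`). The derived subgroup of `P` is `⟨d⟩` or `⟨d, b⟩`.

By Alperin's fusion theorem, in the weak form `FusionSystem.IsSaturated.induction`, `F` is generated
by conjugations in `P` and by the automorphisms of odd order of fully normalized subgroups `R` that
contain their centralizer. A large part of the argument consists in finding the possible `R`: an
automorphism of odd order of a `2`-group is trivial as soon as it is unipotent, so most subgroups
of `P` are excluded by invariants such as squares, commutators and central involutions.

* If `e = 1`, a subgroup `R` with a nontrivial automorphism of odd order lies in `E⟨x ^ 2⟩`, and the
  conjugation with `x ^ 2` acts on it as a transvection with centre `b`. Fusion of the involutions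
  of `R` shows that `Aut_F(R)` fixes `b`, and a transvection is determined by its centre
  (`CyclicExtension.fixed_of_one`). Therefore no automorphism of odd order occurs in `F`, which is
  nilpotent.
* If `e = 0`, the elements `x` and `a` generate `P`, which is minimal nonabelian, and the only
  possible `R` is the abelian maximal subgroup `Q = C(a) = E⟨x ^ 2⟩`
  (`CyclicExtension.eq_centralizer`). Conjugation with `x` is a transvection of `Q` and generates a
  Sylow `2`-subgroup of `Aut_F(Q)`, which has a normal complement by Burnside's transfer theorem. As
  a transvection is determined by its centre (`conj_transvection_eq`), it follows that `Aut_F(Q)`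
  fixes an element `X'` with which `x ^ 2` agrees up to the centre of the transvection
  (`IsTransvectionGroup.exists_fixed`). After a change of generators `X' = x ^ 2`, and `Aut_F(Q)`
  consists of all automorphisms that fix `x ^ 2` and permute the involutions of a complementary
  four-group; it is isomorphic to `S_3`.

The outcome is the description `FusionSystem.IsStandard` of `F` in terms of generators of `P`
(`CyclicExtension.exists_isStandard`). Two fusion systems that satisfy it, for possibly different
generators with the same relations, differ by the automorphism of `P` between these generators
(`FusionSystem.IsStandard.equalUpToAut`). The stabilizer of an involution in `Aut_F(Q) ≅ S_3` is
strongly embedded, which makes `Q` the only essential subgroup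
(`FusionSystem.IsStandard.isEssential`). In `A_4 ⋊ C_{2 ^ n}` the fusion is induced by the
projection to `S_4`, whose kernel is central; it is standard as well, since `S_4` induces all
permutations of the involutions of the Klein four-group.
-/

/-! ### Morphisms of fusion systems as functions -/

namespace FusionSystem

section Morphisms

variable {P : Type*} [Group P] {F : FusionSystem P}

/-- `f` represents an `F`-morphism on `S`: some `φ ∈ Hom_F(S, P)` agrees with `f` on `S`. The values
of `f` outside `S` are irrelevant. Since `Hom_F(S, T)` consists of the morphisms `S → P` with image
in `T`, this predicate determines `F`, and composition becomes composition of functions. -/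
def IsMor (F : FusionSystem P) (S : Subgroup P) (f : P → P) : Prop :=
  ∃ φ ∈ F.Hom S ⊤, ∀ s : S, ((φ s : (⊤ : Subgroup P)) : P) = f s

namespace IsMor

variable {S T : Subgroup P} {f g : P → P}

theorem congr (h : F.IsMor S f) (hfg : ∀ s ∈ S, f s = g s) : F.IsMor S g := by
  obtain ⟨φ, hφ, H⟩ := h
  exact ⟨φ, hφ, fun s => (H s).trans (hfg s s.2)⟩

theorem map_mul (h : F.IsMor S f) {s t : P} (hs : s ∈ S) (ht : t ∈ S) :
    f (s * t) = f s * f t := by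
  obtain ⟨φ, hφ, H⟩ := h
  have h1 := H (⟨s, hs⟩ * ⟨t, ht⟩)
  rw [_root_.map_mul] at h1
  simpa [H] using h1.symm

theorem map_one (h : F.IsMor S f) : f 1 = 1 := by
  have := h.map_mul S.one_mem S.one_mem
  simpa using this

theorem map_inv (h : F.IsMor S f) {s : P} (hs : s ∈ S) : f s⁻¹ = (f s)⁻¹ := by
  have := h.map_mul hs (S.inv_mem hs)
  rw [mul_inv_cancel, h.map_one] at this
  exact (inv_eq_of_mul_eq_one_right this.symm).symm

theorem injOn (h : F.IsMor S f) {s t : P} (hs : s ∈ S) (ht : t ∈ S) (hst : f s = f t) :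
    s = t := by
  obtain ⟨φ, hφ, H⟩ := h
  have : φ ⟨s, hs⟩ = φ ⟨t, ht⟩ := Subtype.ext (by rw [H, H]; exact hst)
  simpa using F.injective_of_mem hφ this

theorem conj (F : FusionSystem P) (S : Subgroup P) (g : P) : F.IsMor S (fun s => g * s * g⁻¹) :=
  ⟨(MonoidHom.codRestrict ((MulAut.conj g).toMonoidHom.comp S.subtype) ⊤ (fun _ => trivial)),
    F.mem_of_conj g _ (fun _ => rfl), fun _ => rfl⟩

theorem refl (F : FusionSystem P) (S : Subgroup P) : F.IsMor S id :=
  (conj F S 1).congr (fun s _ => by simp)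

theorem mono (h : F.IsMor S f) (hTS : T ≤ S) : F.IsMor T f := by
  obtain ⟨φ, hφ, H⟩ := h
  refine ⟨φ.comp (Subgroup.inclusion hTS), F.comp_mem (F.mem_of_conj 1 _ ?_) hφ, fun s => ?_⟩
  · intro s; simp
  · rw [MonoidHom.comp_apply, H]; rfl

end IsMor

variable {S T : Subgroup P} {f g : P → P}

/-- The image of a morphism as an element of `Hom_F(S, T)`. -/
theorem mem_hom_iff {φ : S →* T} (hf : ∀ s : S, (φ s : P) = f s) :
    φ ∈ F.Hom S T ↔ F.IsMor S f := by
  constructor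
  · intro h
    refine ⟨(Subgroup.inclusion le_top).comp φ, F.comp_mem h (F.mem_of_conj 1 _ ?_), fun s => ?_⟩
    · intro s; simp
    · rw [← hf]; rfl
  · rintro ⟨ψ, hψ, H⟩
    have hinj : Function.Injective φ := by
      intro s t hst
      refine F.injective_of_mem hψ (Subtype.ext ?_)
      rw [H, H, ← hf, ← hf, hst]
    let R : Subgroup P := φ.range.map T.subtype
    have hR : ∀ s : S, (φ s : P) ∈ R := fun s => ⟨φ s, ⟨s, rfl⟩, rfl⟩
    let e : S ≃* R := MulEquiv.ofBijective
      (MonoidHom.codRestrict (T.subtype.comp φ) R hR) (by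
        constructor
        · intro s t hst
          exact hinj (Subtype.ext (congrArg (fun r : R => (r : P)) hst))
        · rintro ⟨_, _, ⟨s, rfl⟩, rfl⟩
          exact ⟨s, rfl⟩)
    have he := (F.isoOntoImage_mem e hψ (fun s => by rw [H, ← hf]; rfl)).1
    have hRT : R ≤ T := by
      rintro _ ⟨t, _, rfl⟩
      exact t.2
    have : φ = (Subgroup.inclusion hRT).comp e.toMonoidHom := by
      ext s; rfl
    rw [this]
    exact F.comp_mem he (F.mem_of_conj 1 _ (fun s => by simp))

theorem IsMor.comp (hf : F.IsMor S f) (hg : F.IsMor T g) (hfT : ∀ s ∈ S, f s ∈ T) :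
    F.IsMor S (g ∘ f) := by
  have hf' := hf
  obtain ⟨φ, hφ, H⟩ := hf
  obtain ⟨ψ, hψ, H'⟩ := hg
  let φ' : S →* T := MonoidHom.codRestrict ((⊤ : Subgroup P).subtype.comp φ) T
    (fun s => by simpa [H] using hfT s s.2)
  have hφ' : ∀ s : S, (φ' s : P) = f s := fun s => H s
  refine ⟨ψ.comp φ', F.comp_mem ((mem_hom_iff hφ').2 hf') hψ, fun s => ?_⟩
  rw [MonoidHom.comp_apply, H', hφ']
  rfl

/-- The subgroup generated by `f(S)`; for a morphism `f` on `S` it is the image of `S`. -/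
def mapSub (S : Subgroup P) (f : P → P) : Subgroup P := Subgroup.closure (f '' S)

theorem mem_mapSub_of_mem (f : P → P) {s : P} (hs : s ∈ S) : f s ∈ mapSub S f :=
  Subgroup.subset_closure ⟨s, hs, rfl⟩

theorem IsMor.mem_mapSub_iff (h : F.IsMor S f) {t : P} : t ∈ mapSub S f ↔ ∃ s ∈ S, f s = t := by
  refine ⟨fun ht => ?_, fun ⟨s, hs, hst⟩ => hst ▸ mem_mapSub_of_mem f hs⟩
  induction ht using Subgroup.closure_induction with
  | mem t ht => exact ht
  | one => exact ⟨1, S.one_mem, h.map_one⟩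
  | mul a b _ _ ha hb =>
    obtain ⟨s, hs, rfl⟩ := ha
    obtain ⟨t, ht, rfl⟩ := hb
    exact ⟨s * t, S.mul_mem hs ht, h.map_mul hs ht⟩
  | inv a _ ha =>
    obtain ⟨s, hs, rfl⟩ := ha
    exact ⟨s⁻¹, S.inv_mem hs, h.map_inv hs⟩

theorem mapSub_congr (h : ∀ s ∈ S, f s = g s) : mapSub S f = mapSub S g := by
  unfold mapSub
  congr 1
  exact Set.image_congr h

theorem IsMor.mapSub_le (h : F.IsMor S f) (hT : ∀ s ∈ S, f s ∈ T) : mapSub S f ≤ T := by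
  intro t ht
  obtain ⟨s, hs, rfl⟩ := h.mem_mapSub_iff.1 ht
  exact hT s hs

theorem mapSub_comp (hf : F.IsMor S f) : mapSub (mapSub S f) g = mapSub S (g ∘ f) := by
  unfold mapSub
  congr 1
  ext t
  constructor
  · rintro ⟨u, hu, rfl⟩
    obtain ⟨s, hs, rfl⟩ := hf.mem_mapSub_iff.1 hu
    exact ⟨s, hs, rfl⟩
  · rintro ⟨s, hs, rfl⟩
    exact ⟨f s, mem_mapSub_of_mem f hs, rfl⟩

/-- The isomorphism of `S` onto its image under a morphism. -/
noncomputable def IsMor.equiv (h : F.IsMor S f) : S ≃* mapSub S f :=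
  MulEquiv.ofBijective
    (⟨⟨fun s => ⟨f s, mem_mapSub_of_mem f s.2⟩, Subtype.ext h.map_one⟩,
      fun s t => Subtype.ext (h.map_mul s.2 t.2)⟩ : S →* mapSub S f) (by
    constructor
    · intro s t hst
      exact Subtype.ext (h.injOn s.2 t.2 (congrArg (fun r : mapSub S f => (r : P)) hst))
    · rintro ⟨t, ht⟩
      obtain ⟨s, hs, rfl⟩ := h.mem_mapSub_iff.1 ht
      exact ⟨⟨s, hs⟩, rfl⟩)

theorem IsMor.coe_equiv (h : F.IsMor S f) (s : S) : (h.equiv s : P) = f s := rfl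

theorem IsMor.card_mapSub (h : F.IsMor S f) : Nat.card (mapSub S f) = Nat.card S :=
  (Nat.card_congr h.equiv.toEquiv).symm

open Classical in
/-- The inverse of a morphism on its image. -/
theorem IsMor.exists_inv (h : F.IsMor S f) :
    ∃ g, F.IsMor (mapSub S f) g ∧ ∀ s ∈ S, g (f s) = s := by
  obtain ⟨φ, hφ, H⟩ := id h
  have h2 := (F.isoOntoImage_mem h.equiv hφ (fun s => by rw [H]; rfl)).2
  have h3 : ∀ t : mapSub S f, ((h.equiv.symm t : S) : P) =
      (fun p => if hp : p ∈ mapSub S f then ((h.equiv.symm ⟨p, hp⟩ : S) : P) else 1) t := by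
    intro t
    simp
  refine ⟨_, (mem_hom_iff (φ := h.equiv.symm.toMonoidHom)
    (f := fun p => if hp : p ∈ mapSub S f then ((h.equiv.symm ⟨p, hp⟩ : S) : P) else 1) h3).1 h2,
    fun s hs => ?_⟩
  have hm := mem_mapSub_of_mem f hs
  simp only [hm, dif_pos]
  have : (⟨f s, hm⟩ : mapSub S f) = h.equiv ⟨s, hs⟩ := rfl
  rw [this, MulEquiv.symm_apply_apply]

theorem IsMor.inv_apply (h : F.IsMor S f) (hg : ∀ s ∈ S, g (f s) = s) {t : P}
    (ht : t ∈ mapSub S f) : g t ∈ S ∧ f (g t) = t := by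
  obtain ⟨s, hs, rfl⟩ := h.mem_mapSub_iff.1 ht
  rw [hg s hs]
  exact ⟨hs, rfl⟩

/-- The subgroups `F`-isomorphic to `S` are the images of `S` under the functions representing
morphisms. -/
theorem isomorphic_iff {R : Subgroup P} :
    F.Isomorphic S R ↔ ∃ f, F.IsMor S f ∧ mapSub S f = R := by
  classical
  constructor
  · rintro ⟨e, he⟩
    have h3 : ∀ s : S, (e.toMonoidHom s : P) =
        (fun p => if hp : p ∈ S then (e ⟨p, hp⟩ : P) else 1) s := by
      intro t
      simp
    have hm := (mem_hom_iff
      (f := fun p => if hp : p ∈ S then (e ⟨p, hp⟩ : P) else 1) h3).1 he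
    refine ⟨_, hm, ?_⟩
    ext t
    rw [hm.mem_mapSub_iff]
    constructor
    · rintro ⟨s, hs, rfl⟩
      simp [hs]
    · intro ht
      refine ⟨e.symm ⟨t, ht⟩, (e.symm ⟨t, ht⟩).2, ?_⟩
      simp
  · rintro ⟨f, hf, rfl⟩
    exact ⟨hf.equiv, (mem_hom_iff (fun s => hf.coe_equiv s)).2 hf⟩

theorem isFullyNormalized_iff {Q : Subgroup P} : F.IsFullyNormalized Q ↔
    ∀ f, F.IsMor Q f → Nat.card (Subgroup.normalizer (mapSub Q f : Set P)) ≤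
      Nat.card (Subgroup.normalizer (Q : Set P)) := by
  constructor
  · intro h f hf
    exact h _ (isomorphic_iff.2 ⟨f, hf, rfl⟩)
  · intro h R hR
    obtain ⟨f, hf, rfl⟩ := isomorphic_iff.1 hR
    exact h f hf

/-- Among the images of `S` under morphisms one has a normalizer of maximal order. -/
theorem exists_isFullyNormalized [Finite P] (F : FusionSystem P) (S : Subgroup P) :
    ∃ f, F.IsMor S f ∧ F.IsFullyNormalized (mapSub S f) := by
  classical
  let C : Set (Subgroup P) := {R | ∃ f, F.IsMor S f ∧ mapSub S f = R}
  obtain ⟨R, ⟨f, hf, rfl⟩, hR⟩ := Set.exists_max_image C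
    (fun R => Nat.card (Subgroup.normalizer (R : Set P))) (Set.toFinite _)
    ⟨_, id, IsMor.refl F S, rfl⟩
  refine ⟨f, hf, isFullyNormalized_iff.2 fun g hg => hR _ ⟨g ∘ f, ?_, ?_⟩⟩
  · exact hf.comp hg fun s hs => mem_mapSub_of_mem f hs
  · exact (mapSub_comp hf).symm

theorem isFullyNormalized_of_normal [Finite P] {Q : Subgroup P} (hQ : Q.Normal) :
    F.IsFullyNormalized Q := by
  intro R _
  have hn : Subgroup.normalizer (Q : Set P) = ⊤ := Subgroup.normalizer_eq_top Q
  rw [hn]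
  exact Nat.card_le_card_of_injective _ (Set.inclusion_injective (fun _ _ => trivial))

open Classical in
/-- An automorphism of `Q` as a function on the whole group, extended by the identity. -/
noncomputable def extFun {Q : Subgroup P} (α : MulAut Q) (p : P) : P :=
  if hp : p ∈ Q then (α ⟨p, hp⟩ : P) else p

theorem extFun_coe {Q : Subgroup P} (α : MulAut Q) (q : Q) : extFun α q = α q := by
  simp [extFun]

theorem extFun_mem {Q : Subgroup P} (α : MulAut Q) {q : P} (hq : q ∈ Q) : extFun α q ∈ Q := by
  have := extFun_coe α ⟨q, hq⟩
  simp only at this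
  rw [this]
  exact (α _).2

theorem mem_autGroup_iff {Q : Subgroup P} {α : MulAut Q} :
    α ∈ F.autGroup Q ↔ F.IsMor Q (extFun α) :=
  mem_hom_iff (φ := MulEquiv.toMonoidHom α) (fun s => (extFun_coe α s).symm)

theorem mem_autGroup_iff' {Q : Subgroup P} {α : MulAut Q} (h : ∀ q : Q, (α q : P) = f q) :
    α ∈ F.autGroup Q ↔ F.IsMor Q f :=
  mem_hom_iff (φ := MulEquiv.toMonoidHom α) h

theorem IsMor.mapSub_eq_of_maps [Finite P] (h : F.IsMor S f) (hS : ∀ s ∈ S, f s ∈ S) :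
    mapSub S f = S := by
  refine Subgroup.eq_of_le_of_card_ge (h.mapSub_le hS) ?_
  rw [h.card_mapSub]

/-- A morphism mapping `Q` into itself is an element of `Aut_F(Q)`. -/
theorem IsMor.exists_mulAut [Finite P] {Q : Subgroup P} (h : F.IsMor Q f) (hQ : ∀ q ∈ Q, f q ∈ Q) :
    ∃ α ∈ F.autGroup Q, ∀ q : Q, (α q : P) = f q := by
  have hm := h.mapSub_eq_of_maps hQ
  let α : MulAut Q := h.equiv.trans (MulEquiv.subgroupCongr hm)
  have : ∀ q : Q, (α q : P) = f q := fun q => rfl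
  exact ⟨α, (mem_autGroup_iff' this).2 h, this⟩

/-- The saturation axiom in terms of `IsMor`. -/
theorem IsSaturated.exists_extension {p : ℕ} (hF : F.IsSaturated p) {Q N : Subgroup P}
    (hf : F.IsMor Q f) (hR : F.IsFullyNormalized (mapSub Q f))
    (hN : ∀ y ∈ N, y ∈ Subgroup.normalizer (Q : Set P) ∧
      ∃ z ∈ Subgroup.normalizer (mapSub Q f : Set P), ∀ u ∈ Q, f (y * u * y⁻¹) = z * f u * z⁻¹) :
    ∃ g, F.IsMor N g ∧ ∀ u ∈ Q, u ∈ N → g u = f u := by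
  classical
  obtain ⟨φ, hφ, H⟩ := id hf
  have him : image φ = mapSub Q f := by
    ext t
    rw [hf.mem_mapSub_iff]
    constructor
    · rintro ⟨_, ⟨s, rfl⟩, rfl⟩
      exact ⟨s, s.2, (H s).symm⟩
    · rintro ⟨s, hs, rfl⟩
      exact ⟨φ ⟨s, hs⟩, ⟨_, rfl⟩, H ⟨s, hs⟩⟩
  obtain ⟨ψ, hψ, hext⟩ := hF.extends_of_fullyNormalized Q φ hφ (him ▸ hR)
  have hNle : N ≤ extender φ := by
    intro y hy
    obtain ⟨h1, z, hz, h2⟩ := hN y hy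
    refine ⟨h1, z, by rw [him]; exact hz, fun u v huv => ?_⟩
    rw [H, H, huv, h2 u u.2]
  have h3 : ∀ s : extender φ, (ψ s : P) =
      (fun p => if hp : p ∈ extender φ then (ψ ⟨p, hp⟩ : P) else 1) s := by
    intro t
    simp
  refine ⟨_, ((mem_hom_iff
    (f := fun p => if hp : p ∈ extender φ then (ψ ⟨p, hp⟩ : P) else 1) h3).1 hψ).mono hNle,
    fun u hu huN => ?_⟩
  have := hext ⟨u, hu⟩ ⟨u, hNle huN⟩ rfl
  simp only [hNle huN, dif_pos, this, H]

/-- The group `Aut_P(Q)` of automorphisms of `Q` induced by conjugation in `P`. -/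
def conjAut (Q : Subgroup P) : Subgroup (MulAut Q) where
  carrier := {α | ∃ g : P, ∀ q : Q, (α q : P) = g * q * g⁻¹}
  one_mem' := ⟨1, fun q => by simp⟩
  mul_mem' := by
    rintro α β ⟨g, hg⟩ ⟨k, hk⟩
    refine ⟨g * k, fun q => ?_⟩
    rw [MulAut.mul_apply, hg, hk]
    group
  inv_mem' := by
    rintro α ⟨g, hg⟩
    refine ⟨g⁻¹, fun q => ?_⟩
    have := hg (α⁻¹ q)
    rw [MulAut.apply_inv_self] at this
    rw [this]
    group

theorem conjAut_le_autGroup (F : FusionSystem P) (Q : Subgroup P) : conjAut Q ≤ F.autGroup Q := by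
  rintro α ⟨g, hg⟩
  exact (mem_autGroup_iff' hg).2 (IsMor.conj F Q g)

end Morphisms

end FusionSystem

/-! ### Alperin's fusion theorem -/

namespace FusionSystem

section Alperin

variable {P : Type*} [Group P] [Finite P] {F : FusionSystem P} {p : ℕ} [Fact p.Prime]

omit [Finite P] in
theorem exists_mem_conjAut {Q : Subgroup P} {y : P}
    (hy : y ∈ Subgroup.normalizer (Q : Set P)) :
    ∃ α ∈ conjAut Q, ∀ q : Q, (α q : P) = y * q * y⁻¹ :=
  ⟨Q.normalizerMonoidHom ⟨y, hy⟩, ⟨y, fun _ => rfl⟩, fun _ => rfl⟩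

theorem mem_normalizer_of_conj_mem {Q : Subgroup P} {y : P} (h : ∀ q ∈ Q, y * q * y⁻¹ ∈ Q) :
    y ∈ Subgroup.normalizer (Q : Set P) :=
  Subgroup.mem_normalizer_fintype h

omit [Finite P] [Fact p.Prime] in
theorem isPGroup_conjAut (hP : IsPGroup p P) (Q : Subgroup P) : IsPGroup p (conjAut Q) := by
  rintro ⟨α, g, hg⟩
  obtain ⟨k, hk⟩ := hP g
  refine ⟨k, Subtype.ext ?_⟩
  have : ∀ n : ℕ, ∀ q : Q, ((α ^ n) q : P) = g ^ n * q * (g ^ n)⁻¹ := by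
    intro n
    induction n with
    | zero => intro q; simp
    | succ n ih =>
      intro q
      rw [pow_succ, MulAut.mul_apply, ih, hg, pow_succ]
      group
  ext q
  simp [this, hk]

omit [Finite P] in
/-- The conjugate of an `F`-automorphism by an `F`-isomorphism is an `F`-automorphism. -/
theorem IsMor.congr_mem_autGroup {S : Subgroup P} {f : P → P} (hf : F.IsMor S f) {α : MulAut S}
    (hα : α ∈ F.autGroup S) : MulAut.congr hf.equiv α ∈ F.autGroup (mapSub S f) := by
  have h1 : hf.equiv.toMonoidHom ∈ F.Hom S (mapSub S f) :=
    (mem_hom_iff (fun s => hf.coe_equiv s)).2 hf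
  have h2 := (F.isoOntoImage_mem hf.equiv h1 (fun _ => rfl)).2
  exact F.comp_mem h2 (F.comp_mem (show MulEquiv.toMonoidHom α ∈ F.Hom S S from hα) h1)

/-- In a saturated fusion system `Aut_P(Q)` is a Sylow subgroup of `Aut_F(Q)` for every fully
normalized `Q`. Otherwise a `p`-element `φ ∉ Aut_P(Q)` normalizes `Aut_P(Q)`, so it extends to
`N_P(Q)`; by induction on the index, a `p`-part of this extension is conjugation by an element
which has to lie in the image of `N_P(Q)`. -/
theorem IsSaturated.exists_sylow_eq_conjAut (hF : F.IsSaturated p) (hP : IsPGroup p P)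
    (Q : Subgroup P) (hQ : F.IsFullyNormalized Q) :
    ∃ S : Sylow p (F.autGroup Q),
      (S : Subgroup (F.autGroup Q)) = (conjAut Q).subgroupOf (F.autGroup Q) := by
  induction h : Nat.card P - Nat.card Q using Nat.strong_induction_on generalizing Q with
  | _ n ih =>
  subst h
  by_cases htop : Q = ⊤
  · subst htop
    obtain ⟨S, hS⟩ := hF.inn_sylow
    refine ⟨S, hS.trans ?_⟩
    congr 1
    ext α
    constructor
    · rintro ⟨g, rfl⟩
      exact ⟨g, fun q => rfl⟩
    · rintro ⟨g, hg⟩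
      exact ⟨⟨g, trivial⟩, MulEquiv.ext fun q => Subtype.ext (hg q).symm⟩
  set A := F.autGroup Q with hA
  set B := (conjAut Q).subgroupOf A with hB
  have hBp : IsPGroup p B :=
    (isPGroup_conjAut hP Q).comap_of_injective A.subtype A.subtype_injective
  obtain ⟨S, hBS⟩ := hBp.exists_le_sylow
  refine ⟨S, ?_⟩
  by_contra hne
  -- normalizers grow in the `p`-group `S`, so some `φ ∈ S` outside `B` normalizes `B`
  have hlt : B.subgroupOf (S : Subgroup A) < ⊤ := by
    rw [lt_top_iff_ne_top]
    intro h
    rw [Subgroup.subgroupOf_eq_top] at h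
    exact hne (le_antisymm h hBS)
  have : Group.IsNilpotent (S : Subgroup A) := S.2.isNilpotent
  have hnc := Group.normalizerCondition_of_isNilpotent (G := (S : Subgroup A)) _ hlt
  obtain ⟨φ, hφN, hφB⟩ := SetLike.exists_of_lt hnc
  have hφB' : (φ : A) ∉ B := fun h => hφB (Subgroup.mem_subgroupOf.2 h)
  set f := extFun ((φ : A) : MulAut Q) with hf
  have hfm : F.IsMor Q f := mem_autGroup_iff.1 (φ : A).2
  have hfQ : mapSub Q f = Q := hfm.mapSub_eq_of_maps fun q hq => extFun_mem _ hq
  set N := Subgroup.normalizer (Q : Set P) with hN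
  have hQN : Q ≤ N := Subgroup.le_normalizer
  -- as `φ` normalizes `Aut_P(Q)`, the whole of `N_P(Q)` satisfies the extension condition
  obtain ⟨ψ, hψ, hψf⟩ := hF.exists_extension (N := N) hfm (hfQ.symm ▸ hQ) (by
    intro y hy
    refine ⟨hy, ?_⟩
    rw [hfQ]
    obtain ⟨β, hβ, hβy⟩ := exists_mem_conjAut hy
    have hβS : (⟨β, conjAut_le_autGroup F Q hβ⟩ : A) ∈ B := hβ
    have h1 := (Subgroup.mem_normalizer_iff.1 hφN ⟨_, hBS hβS⟩).1 hβS
    obtain ⟨z, hz⟩ := h1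
    have hz' : ∀ u : Q, (((φ : A) : MulAut Q) (β u) : P) =
        z * (((φ : A) : MulAut Q) u) * z⁻¹ := by
      intro u
      have := hz (((φ : A) : MulAut Q) u)
      simpa [MulAut.mul_apply] using this
    refine ⟨z, mem_normalizer_of_conj_mem fun q hq => ?_, fun u hu => ?_⟩
    · have := hz ⟨q, hq⟩
      rw [← this]
      exact Subtype.coe_prop _
    · have h2 := hz' ⟨u, hu⟩
      have h3 : y * u * y⁻¹ = ((β ⟨u, hu⟩ : Q) : P) := (hβy ⟨u, hu⟩).symm
      rw [h3, hf, extFun_coe, h2, ← extFun_coe])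
  have hψf' : ∀ u ∈ Q, ψ u = f u := fun u hu => hψf u hu (hQN hu)
  have hψN : ∀ y ∈ N, ψ y ∈ N := by
    intro y hy
    refine mem_normalizer_of_conj_mem fun q hq => ?_
    rw [← hfQ, hfm.mem_mapSub_iff] at hq
    obtain ⟨u, hu, rfl⟩ := hq
    have h1 : y * u * y⁻¹ ∈ Q := (Subgroup.mem_normalizer_iff.1 hy u).1 hu
    have h2 : ψ (y * u * y⁻¹) = ψ y * f u * (ψ y)⁻¹ := by
      rw [hψ.map_mul (N.mul_mem hy (hQN hu)) (N.inv_mem hy), hψ.map_mul hy (hQN hu),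
        hψ.map_inv hy, hψf' u hu]
    rw [← h2, hψf' _ h1]
    exact extFun_mem _ h1
  obtain ⟨α, hα, hαψ⟩ := hψ.exists_mulAut hψN
  have hαf : ∀ u (hu : u ∈ Q), (α ⟨u, hQN hu⟩ : P) = f u := fun u hu => by
    rw [hαψ]; exact hψf' u hu
  -- the power `α ^ m` is the part of `α` whose order is a power of `p`
  obtain ⟨k, m, hpm, hkm⟩ := Nat.exists_eq_pow_mul_and_not_dvd (orderOf_pos α).ne' p
    (Fact.out : p.Prime).ne_one
  have hαm : ∀ j : ℕ, ∀ u : Q, ((α ^ j) ⟨u, hQN u.2⟩ : P) = ((((φ : A) : MulAut Q) ^ j) u : P) := by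
    intro j
    induction j with
    | zero => intro u; simp
    | succ j ihj =>
      intro u
      rw [pow_succ, pow_succ, MulAut.mul_apply, MulAut.mul_apply, ← ihj]
      congr 2
      apply Subtype.ext
      rw [hαf u u.2, hf, extFun_coe]
  -- `N` is larger than `Q`, so the claim holds for a fully normalized subgroup `M` isomorphic to
  -- `N`
  have hcard : Nat.card Q < Nat.card N := by
    refine lt_of_le_of_ne (Nat.card_le_card_of_injective _ (Set.inclusion_injective hQN)) ?_
    intro h
    have : Group.IsNilpotent P := hP.isNilpotent
    have := Group.normalizerCondition_of_isNilpotent (G := P) Q (lt_top_iff_ne_top.2 htop)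
    exact this.ne (Subgroup.eq_of_le_of_card_ge this.le h.ge)
  have hNP : Nat.card N ≤ Nat.card P := Nat.card_le_card_of_injective _ N.subtype_injective
  obtain ⟨τ, hτ, hM⟩ := exists_isFullyNormalized F N
  set M := mapSub N τ with hMdef
  obtain ⟨S', hS'⟩ := ih (Nat.card P - Nat.card M) (by rw [hτ.card_mapSub]; omega) M hM rfl
  have hα'' := hτ.congr_mem_autGroup (Subgroup.pow_mem _ hα m)
  set α' : F.autGroup M := ⟨MulAut.congr hτ.equiv (α ^ m), hα''⟩ with hα'
  have hα'p : IsPGroup p (Subgroup.zpowers α') := by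
    have h1 : α' ^ p ^ k = 1 := by
      apply Subtype.ext
      change (MulAut.congr hτ.equiv (α ^ m)) ^ p ^ k = 1
      rw [← map_pow, ← pow_mul, mul_comm m, ← hkm, pow_orderOf_eq_one, map_one]
    rintro ⟨_, i, rfl⟩
    refine ⟨k, Subtype.ext ?_⟩
    change (α' ^ i) ^ p ^ k = 1
    rw [← zpow_natCast, ← zpow_mul, mul_comm, zpow_mul, zpow_natCast, h1, one_zpow]
  -- by Sylow's theorem a conjugate of the transport of `α ^ m` to `M` is conjugation by some `y ∈
  -- P`
  obtain ⟨T, hT⟩ := hα'p.exists_le_sylow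
  obtain ⟨β, hβ⟩ := MulAction.exists_smul_eq (F.autGroup M) T S'
  have hmem : β * α' * β⁻¹ ∈ (S' : Subgroup (F.autGroup M)) := by
    rw [← hβ, Sylow.coe_subgroup_smul, Subgroup.mem_pointwise_smul_iff_inv_smul_mem]
    have : (MulAut.conj β)⁻¹ • (β * α' * β⁻¹) = α' := by
      rw [← map_inv, MulAut.smul_def, MulAut.conj_apply]; group
    rw [this]
    exact hT (Subgroup.mem_zpowers α')
  rw [hS'] at hmem
  obtain ⟨y, hy⟩ := hmem
  have hβm : F.IsMor M (extFun (β : MulAut M)) := mem_autGroup_iff.1 β.2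
  set τ' : P → P := extFun (β : MulAut M) ∘ τ with hτ'
  have hτ'm : F.IsMor N τ' := hτ.comp hβm fun s hs => mem_mapSub_of_mem τ hs
  have key : ∀ n : N, τ' ((α ^ m) n : N) = y * τ' n * y⁻¹ := by
    intro n
    have h1 := hy ((β : MulAut M) (hτ.equiv n))
    have h2 : ((β * α' * β⁻¹ : F.autGroup M) : MulAut M) ((β : MulAut M) (hτ.equiv n)) =
        (β : MulAut M) (hτ.equiv ((α ^ m) n)) := by
      simp [hα', MulAut.mul_apply, MulAut.congr]
    change (((β * α' * β⁻¹ : F.autGroup M) : MulAut M) ((β : MulAut M) (hτ.equiv n)) : P) = _ at h1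
    rw [h2, ← extFun_coe, ← extFun_coe] at h1
    exact h1
  have hMτ' : mapSub N τ' = M := by
    rw [hτ', ← mapSub_comp hτ]
    exact hβm.mapSub_eq_of_maps fun q hq => extFun_mem _ hq
  have hQ' := isFullyNormalized_iff.1 hQ τ' (hτ'm.mono hQN)
  set Q' := mapSub Q τ' with hQ'def
  have hMle : M ≤ Subgroup.normalizer (Q' : Set P) := by
    intro x hx
    rw [← hMτ', hτ'm.mem_mapSub_iff] at hx
    obtain ⟨n, hn, rfl⟩ := hx
    refine mem_normalizer_of_conj_mem fun q hq => ?_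
    obtain ⟨u, hu, rfl⟩ := (hτ'm.mono hQN).mem_mapSub_iff.1 hq
    have h1 : n * u * n⁻¹ ∈ Q := (Subgroup.mem_normalizer_iff.1 hn u).1 hu
    have h2 : τ' (n * u * n⁻¹) = τ' n * τ' u * (τ' n)⁻¹ := by
      rw [hτ'm.map_mul (N.mul_mem hn (hQN hu)) (N.inv_mem hn), hτ'm.map_mul hn (hQN hu),
        hτ'm.map_inv hn]
    rw [← h2]
    exact mem_mapSub_of_mem τ' h1
  -- `M` normalizes the image of `Q`, and it is the full normalizer since `Q` is fully normalized
  have hMeq : M = Subgroup.normalizer (Q' : Set P) := by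
    refine Subgroup.eq_of_le_of_card_ge hMle ?_
    rw [hτ.card_mapSub]
    exact hQ'
  -- `y` normalizes the image of `Q`, so it lies in `M` and comes from an element `w` of `N`
  have hyM : y ∈ M := by
    rw [hMeq]
    refine mem_normalizer_of_conj_mem fun q hq => ?_
    obtain ⟨u, hu, rfl⟩ := (hτ'm.mono hQN).mem_mapSub_iff.1 hq
    rw [← key ⟨u, hQN hu⟩]
    refine mem_mapSub_of_mem τ' ?_
    rw [hαm m ⟨u, hu⟩]
    exact Subtype.coe_prop _
  rw [← hMτ', hτ'm.mem_mapSub_iff] at hyM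
  obtain ⟨w, hw, rfl⟩ := hyM
  have hφm : (φ : A) ^ m ∈ B := by
    refine ⟨w, fun u => ?_⟩
    have h1 := key ⟨u, hQN u.2⟩
    have h2 : τ' w * τ' u * (τ' w)⁻¹ = τ' (w * u * w⁻¹) := by
      rw [hτ'm.map_mul (N.mul_mem hw (hQN u.2)) (N.inv_mem hw), hτ'm.map_mul hw (hQN u.2),
        hτ'm.map_inv hw]
    rw [h2] at h1
    have h3 := hτ'm.injOn (Subtype.coe_prop _)
      (N.mul_mem (N.mul_mem hw (hQN u.2)) (N.inv_mem hw)) h1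
    rw [hαm m u] at h3
    exact h3
  refine hφB' ?_
  -- `φ` is a `p`-element and `p` does not divide `m`, so `φ` is a power of `φ ^ m`
  have hcop : m.gcd (orderOf (φ : A)) = 1 := by
    obtain ⟨j, hj⟩ := S.2 φ
    have hj' : (φ : A) ^ p ^ j = 1 := congrArg (fun s : S => (s : A)) hj
    have h1 : orderOf (φ : A) ∣ p ^ j := orderOf_dvd_of_pow_eq_one hj'
    refine Nat.Coprime.coprime_dvd_right h1 ?_
    exact (Nat.Coprime.pow_left _ ((Nat.Prime.coprime_iff_not_dvd Fact.out).2 hpm)).symm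
  have := mem_zpowers_pow_iff.2 hcop
  obtain ⟨i, hi⟩ := this
  rw [← hi]
  exact B.zpow_mem hφm i

/-- If `R` is fully normalized, some isomorphism of `S` onto `R` extends to `N_P(S)`. -/
theorem IsSaturated.exists_isMor_normalizer (hF : F.IsSaturated p) (hP : IsPGroup p P)
    {S : Subgroup P} {f : P → P} (hf : F.IsMor S f) (hR : F.IsFullyNormalized (mapSub S f)) :
    ∃ g, F.IsMor (Subgroup.normalizer (S : Set P)) g ∧ mapSub S g = mapSub S f := by
  set R := mapSub S f with hRdef
  set A := F.autGroup R
  obtain ⟨T, hT⟩ : ∃ T : Sylow p A, (T : Subgroup A) = (conjAut R).subgroupOf A :=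
    hF.exists_sylow_eq_conjAut hP R hR
  set D := ((conjAut S).map (MulAut.congr hf.equiv).toMonoidHom).subgroupOf A with hD
  have hDp : IsPGroup p D :=
    ((isPGroup_conjAut hP S).map _).comap_of_injective A.subtype A.subtype_injective
  -- after composing `f` with an automorphism `β` of `R`, it carries `Aut_P(S)` into `Aut_P(R)`
  obtain ⟨T', hT'⟩ := hDp.exists_le_sylow
  obtain ⟨β, hβ⟩ := MulAction.exists_smul_eq A T' T
  have hβm : F.IsMor R (extFun (β : MulAut R)) := mem_autGroup_iff.1 β.2
  set g := extFun (β : MulAut R) ∘ f with hg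
  have hgm : F.IsMor S g := hf.comp hβm fun s hs => mem_mapSub_of_mem f hs
  have hgR : mapSub S g = R := by
    rw [hg, ← mapSub_comp hf]
    exact hβm.mapSub_eq_of_maps fun q hq => extFun_mem _ hq
  obtain ⟨ψ, hψ, hψg⟩ := hF.exists_extension (N := Subgroup.normalizer (S : Set P)) hgm
      (by rw [hgR]; exact hR) (by
    intro y hy
    refine ⟨hy, ?_⟩
    rw [hgR]
    obtain ⟨α, hα, hαy⟩ := exists_mem_conjAut hy
    have hαA : α ∈ F.autGroup S := conjAut_le_autGroup F S hα
    let α' : A := ⟨MulAut.congr hf.equiv α, hf.congr_mem_autGroup hαA⟩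
    have h1 : α' ∈ D := ⟨α, hα, rfl⟩
    have hmem : β * α' * β⁻¹ ∈ (T : Subgroup A) := by
      rw [← hβ, Sylow.coe_subgroup_smul, Subgroup.mem_pointwise_smul_iff_inv_smul_mem]
      have : (MulAut.conj β)⁻¹ • (β * α' * β⁻¹) = α' := by
        rw [← map_inv, MulAut.smul_def, MulAut.conj_apply]; group
      rw [this]
      exact hT' h1
    rw [hT] at hmem
    obtain ⟨z, hz⟩ := hmem
    refine ⟨z, mem_normalizer_of_conj_mem fun q hq => ?_, fun u hu => ?_⟩
    · rw [← hz ⟨q, hq⟩]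
      exact Subtype.coe_prop _
    · have h1 := hz ((β : MulAut R) (hf.equiv ⟨u, hu⟩))
      have h2 : ((β * α' * β⁻¹ : A) : MulAut R) ((β : MulAut R) (hf.equiv ⟨u, hu⟩)) =
          (β : MulAut R) (hf.equiv (α ⟨u, hu⟩)) := by
        simp [α', MulAut.mul_apply, MulAut.congr]
      change (((β * α' * β⁻¹ : A) : MulAut R) ((β : MulAut R) (hf.equiv ⟨u, hu⟩)) : P) = _ at h1
      rw [h2, ← extFun_coe, ← extFun_coe, hf.coe_equiv, hf.coe_equiv, hαy] at h1
      exact h1)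
  refine ⟨ψ, hψ, ?_⟩
  rw [← hgR]
  exact mapSub_congr fun s hs => hψg s hs (Subgroup.le_normalizer hs)

/-- A weak form of Alperin's fusion theorem: a property of morphisms that is inherited by
compositions, restrictions and inverses, and holds for all `F`-automorphisms of fully normalized
subgroups containing their centralizer, holds for all morphisms. Every morphism on `S` is composed
of restrictions of morphisms on larger subgroups, their inverses, and an automorphism of a fully
normalized subgroup isomorphic to `S`. -/
theorem IsSaturated.induction (hF : F.IsSaturated p) (hP : IsPGroup p P)
    (G : Subgroup P → (P → P) → Prop)
    (hcongr : ∀ S f g, G S f → (∀ s ∈ S, f s = g s) → G S g)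
    (hmono : ∀ S T f, G S f → T ≤ S → G T f)
    (hcomp : ∀ S T f g, F.IsMor S f → G S f → G T g → (∀ s ∈ S, f s ∈ T) → G S (g ∘ f))
    (hinv : ∀ S f g, F.IsMor S f → G S f → (∀ s ∈ S, g (f s) = s) → G (mapSub S f) g)
    (haut : ∀ R f, F.IsFullyNormalized R → Subgroup.centralizer (R : Set P) ≤ R → F.IsMor R f →
      (∀ r ∈ R, f r ∈ R) → G R f)
    (S : Subgroup P) (f : P → P) (hf : F.IsMor S f) : G S f := by
  induction h : Nat.card P - Nat.card S using Nat.strong_induction_on generalizing S f with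
  | _ n ih =>
  subst h
  -- larger subgroups are covered by the induction hypothesis
  have ih' : ∀ (T : Subgroup P) (g : P → P), S ≤ T → S ≠ T → F.IsMor T g → G T g := by
    intro T g hST hne hg
    refine ih _ ?_ T g hg rfl
    have h1 : Nat.card S < Nat.card T := by
      refine lt_of_le_of_ne (Nat.card_le_card_of_injective _ (Set.inclusion_injective hST)) ?_
      exact fun h => hne (Subgroup.eq_of_le_of_card_ge hST h.ge)
    have h2 : Nat.card T ≤ Nat.card P := Nat.card_le_card_of_injective _ T.subtype_injective
    omega
  have ihc : ∀ (T : Subgroup P) (g : P → P), Nat.card S < Nat.card T → F.IsMor T g → G T g := by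
    intro T g hST hg
    refine ih _ ?_ T g hg rfl
    have h2 : Nat.card T ≤ Nat.card P := Nat.card_le_card_of_injective _ T.subtype_injective
    omega
  have haut' : ∀ (R : Subgroup P) (g : P → P), Nat.card R = Nat.card S →
      F.IsFullyNormalized R → F.IsMor R g → (∀ r ∈ R, g r ∈ R) → G R g := by
    intro R g hRS hR hg hgR
    by_cases hc : Subgroup.centralizer (R : Set P) ≤ R
    · exact haut R g hR hc hg hgR
    -- otherwise the automorphism extends to `R C_P(R)`
    have hRC : R ≤ Subgroup.normalizer (Subgroup.centralizer (R : Set P) : Set P) := by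
      intro r hr
      refine mem_normalizer_of_conj_mem fun c hc => ?_
      intro u hu
      have h1 : r⁻¹ * u * r ∈ R := R.mul_mem (R.mul_mem (R.inv_mem hr) hu) hr
      have h2 : r⁻¹ * u * r * c = c * (r⁻¹ * u * r) := hc _ h1
      have h3 : u * (r * c * r⁻¹) = r * (r⁻¹ * u * r * c) * r⁻¹ := by group
      rw [h3, h2]
      group
    have hmapR : mapSub R g = R := hg.mapSub_eq_of_maps hgR
    obtain ⟨ψ, hψ, hψg⟩ := hF.exists_extension (N := R ⊔ Subgroup.centralizer (R : Set P)) hg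
        (by rw [hmapR]; exact hR) (by
      intro y hy
      rw [hmapR]
      have hyC := hy
      rw [← SetLike.mem_coe, Subgroup.coe_mul_of_left_le_normalizer_right _ _ hRC] at hyC
      obtain ⟨r, hr, c, hcc, rfl⟩ := hyC
      have hconj : ∀ u ∈ R, r * c * u * (r * c)⁻¹ = r * u * r⁻¹ := by
        intro u hu
        have h1 : u * c = c * u := hcc u hu
        rw [mul_assoc r c u, ← h1]
        group
      refine ⟨mem_normalizer_of_conj_mem fun u hu => ?_, g r, Subgroup.le_normalizer (hgR r hr),
        fun u hu => ?_⟩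
      · dsimp only
        rw [hconj u hu]
        exact R.mul_mem (R.mul_mem hr hu) (R.inv_mem hr)
      · dsimp only
        rw [hconj u hu, hg.map_mul (R.mul_mem hr hu) (R.inv_mem hr), hg.map_mul hr hu,
          hg.map_inv hr])
    have := ihc _ ψ (by
      rw [← hRS]
      have hle : R ≤ R ⊔ Subgroup.centralizer (R : Set P) := le_sup_left
      refine lt_of_le_of_ne (Nat.card_le_card_of_injective _ (Set.inclusion_injective hle)) ?_
      intro h
      exact hc (le_sup_right.trans (Subgroup.eq_of_le_of_card_ge hle h.ge).ge)) hψ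
    exact hcongr _ _ _ (hmono _ _ _ this le_sup_left)
      fun r hr => hψg r hr (Subgroup.mem_sup_left hr)
  by_cases htop : S = ⊤
  · subst htop
    refine haut _ _ (isFullyNormalized_of_normal inferInstance) le_top hf fun _ _ => trivial
  have hSN : S ≠ Subgroup.normalizer (S : Set P) := by
    have : Group.IsNilpotent P := hP.isNilpotent
    exact (Group.normalizerCondition_of_isNilpotent (G := P) S (lt_top_iff_ne_top.2 htop)).ne
  -- `R` is a fully normalized subgroup isomorphic to `S` and to `f(S)`; both isomorphisms can be
  -- chosen to extend to normalizers
  obtain ⟨k, hk, hR⟩ := exists_isFullyNormalized F (mapSub S f)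
  rw [mapSub_comp hf] at hR
  have hkf : F.IsMor S (k ∘ f) := hf.comp hk fun s hs => mem_mapSub_of_mem f hs
  set R := mapSub S (k ∘ f) with hRdef
  obtain ⟨g₁, hg₁, hg₁R⟩ : ∃ g, F.IsMor (Subgroup.normalizer (S : Set P)) g ∧ mapSub S g = R :=
    hF.exists_isMor_normalizer hP hkf hR
  have hG₁ : G S g₁ := hmono _ _ _ (ih' _ g₁ Subgroup.le_normalizer hSN hg₁) Subgroup.le_normalizer
  have hg₁S : F.IsMor S g₁ := hg₁.mono Subgroup.le_normalizer
  have hkR : mapSub (mapSub S f) k = R := mapSub_comp hf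
  obtain ⟨g₂, hg₂, hg₂R⟩ := hF.exists_isMor_normalizer hP hk (by rw [hkR]; exact hR)
  rw [hkR] at hg₂R
  have hfN : mapSub S f ≤ Subgroup.normalizer (mapSub S f : Set P) := Subgroup.le_normalizer
  have hG₂ : G (mapSub S f) g₂ := by
    refine hmono _ _ _ (ihc _ g₂ ?_ hg₂) hfN
    rw [← hf.card_mapSub]
    refine lt_of_le_of_ne (Nat.card_le_card_of_injective _ (Set.inclusion_injective hfN)) ?_
    intro h
    have h1 := Subgroup.eq_of_le_of_card_ge hfN h.ge
    have : Group.IsNilpotent P := hP.isNilpotent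
    have htop' : mapSub S f ≠ ⊤ := by
      intro h2
      apply htop
      refine Subgroup.eq_top_of_card_eq _ ?_
      rw [← hf.card_mapSub, h2, Subgroup.card_top]
    exact (Group.normalizerCondition_of_isNilpotent (G := P) _ (lt_top_iff_ne_top.2 htop')).ne h1
  have hg₂S : F.IsMor (mapSub S f) g₂ := hg₂.mono hfN
  obtain ⟨h₁, hh₁, hh₁g⟩ := hg₁S.exists_inv
  obtain ⟨h₂, hh₂, hh₂g⟩ := hg₂S.exists_inv
  have hH₁ := hinv _ _ h₁ hg₁S hG₁ hh₁g
  have hH₂ := hinv _ _ h₂ hg₂S hG₂ hh₂g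
  rw [hg₁R] at hh₁ hH₁
  rw [hg₂R] at hh₂ hH₂
  -- `f = h₂ ∘ (g₂ ∘ f ∘ h₁) ∘ g₁`, and the map in the middle is an automorphism of `R`
  have hR1 : ∀ r ∈ R, h₁ r ∈ S := fun r hr =>
    (hg₁S.inv_apply hh₁g (by rw [hg₁R]; exact hr)).1
  have hR2 : ∀ s ∈ S, g₂ (f s) ∈ R := fun s hs => by
    rw [← hg₂R]; exact mem_mapSub_of_mem g₂ (mem_mapSub_of_mem f hs)
  have hmid : F.IsMor R (g₂ ∘ f ∘ h₁) :=
    (hh₁.comp hf hR1).comp hg₂S fun r hr => mem_mapSub_of_mem f (hR1 r hr)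
  have hGmid : G R (g₂ ∘ f ∘ h₁) :=
    haut' R _ hkf.card_mapSub hR hmid fun r hr => hR2 _ (hR1 r hr)
  have hS1 : ∀ s ∈ S, g₁ s ∈ R := fun s hs => by
    rw [← hg₁R]; exact mem_mapSub_of_mem g₁ hs
  have h3 := hcomp _ _ _ _ hg₁S hG₁ hGmid hS1
  have h4 := hcomp _ _ _ _ (hg₁S.comp hmid hS1) h3 hH₂
    (fun s hs => hR2 _ (hR1 _ (hS1 s hs)))
  refine hcongr _ _ _ h4 fun s hs => ?_
  simp only [Function.comp_apply]
  rw [hh₁g s hs, hh₂g _ (mem_mapSub_of_mem f hs)]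

end Alperin

end FusionSystem

/-! ### Automorphisms of odd order -/

section OddAutomorphisms

variable {P : Type*} [Group P]

/-- `f` restricts to an automorphism of odd order of `R`. The values of `f` outside `R` are
irrelevant. -/
structure IsOddAut (R : Subgroup P) (f : P → P) : Prop where
  maps : ∀ r ∈ R, f r ∈ R
  map_mul : ∀ r ∈ R, ∀ s ∈ R, f (r * s) = f r * f s
  odd : ∃ k, Odd k ∧ ∀ r ∈ R, f^[k] r = r

namespace IsOddAut

variable {R : Subgroup P} {f : P → P}

theorem map_one (h : IsOddAut R f) : f 1 = 1 := by
  have := h.map_mul 1 R.one_mem 1 R.one_mem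
  simpa using this

theorem map_inv (h : IsOddAut R f) {r : P} (hr : r ∈ R) : f r⁻¹ = (f r)⁻¹ := by
  have := h.map_mul r hr r⁻¹ (R.inv_mem hr)
  rw [mul_inv_cancel, h.map_one] at this
  exact (inv_eq_of_mul_eq_one_right this.symm).symm

theorem map_pow (h : IsOddAut R f) {r : P} (hr : r ∈ R) (n : ℕ) : f (r ^ n) = f r ^ n := by
  induction n with
  | zero => simpa using h.map_one
  | succ n ih => rw [pow_succ, h.map_mul _ (R.pow_mem hr n) _ hr, ih, pow_succ]

theorem iterate_maps (h : IsOddAut R f) {r : P} (hr : r ∈ R) (n : ℕ) : f^[n] r ∈ R := by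
  induction n with
  | zero => exact hr
  | succ n ih => rw [Function.iterate_succ_apply']; exact h.maps _ ih

theorem injOn (h : IsOddAut R f) {r s : P} (hr : r ∈ R) (hs : s ∈ R) (hrs : f r = f s) :
    r = s := by
  obtain ⟨k, hk, H⟩ := h.odd
  obtain ⟨m, rfl⟩ := hk
  have h1 := H r hr
  have h2 := H s hs
  rw [Function.iterate_add_apply, Function.iterate_one] at h1 h2
  rw [← h1, ← h2, hrs]

/-- The subgroup of fixed points of an automorphism of odd order. -/
def fixed (h : IsOddAut R f) : Subgroup P where
  carrier := {r | r ∈ R ∧ f r = r}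
  one_mem' := ⟨R.one_mem, h.map_one⟩
  mul_mem' := by
    rintro a b ⟨ha, ha'⟩ ⟨hb, hb'⟩
    exact ⟨R.mul_mem ha hb, by rw [h.map_mul a ha b hb, ha', hb']⟩
  inv_mem' := by
    rintro a ⟨ha, ha'⟩
    exact ⟨R.inv_mem ha, by rw [h.map_inv ha, ha']⟩

/-- If the displacement `r⁻¹ f(r)` is fixed, then `f^j(r) = r (r⁻¹ f(r))^j`, so the displacement
has odd order and is trivial. -/
theorem mem_fixed_of_inv_mul_mem (hP : IsPGroup 2 P) (h : IsOddAut R f) {r : P} (hr : r ∈ R)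
    (hf : r⁻¹ * f r ∈ h.fixed) : r ∈ h.fixed := by
  obtain ⟨k, hk, H⟩ := h.odd
  set n := r⁻¹ * f r with hn
  have hfr : f r = r * n := by rw [hn]; group
  have hj : ∀ j : ℕ, f^[j] r = r * n ^ j := by
    intro j
    induction j with
    | zero => simp
    | succ j ih =>
      rw [Function.iterate_succ_apply', ih, h.map_mul _ hr _ (R.pow_mem hf.1 j), h.map_pow hf.1,
        hf.2, hfr, pow_succ', mul_assoc]
  have h1 : n ^ k = 1 := by
    have := (hj k).symm.trans (H r hr)
    simpa using this
  obtain ⟨s, hs⟩ := hP n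
  have h2 : orderOf n ∣ 1 := by
    have hc : Nat.Coprime k (2 ^ s) := Nat.Coprime.pow_right _ (Nat.coprime_two_right.2 hk)
    rw [← hc]
    exact Nat.dvd_gcd (orderOf_dvd_of_pow_eq_one h1) (orderOf_dvd_of_pow_eq_one hs)
  have h3 : n = 1 := orderOf_eq_one_iff.1 (Nat.dvd_one.1 h2)
  exact ⟨hr, by rw [hfr, h3, mul_one]⟩

theorem mem_fixed_of_apply_mem (h : IsOddAut R f) {r : P} (hr : r ∈ R) (hf : f r ∈ h.fixed) :
    r ∈ h.fixed :=
  ⟨hr, h.injOn (h.maps _ hr) hr hf.2⟩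

/-- An even power of `g` is fixed, so either `f g` or the displacement `g⁻¹ * f g` is fixed,
according to the parity of `i`. -/
theorem mem_fixed_of_sq (hP : IsPGroup 2 P) (h : IsOddAut R f) {g n : P} {i : ℤ} (hg : g ∈ R)
    (hg2 : g ^ 2 ∈ h.fixed) (hn : n ∈ h.fixed) (hf : f g = g ^ i * n) : g ∈ h.fixed := by
  have hpow : ∀ j : ℤ, g ^ (2 * j) ∈ h.fixed := fun j => by
    rw [zpow_mul]
    exact h.fixed.zpow_mem (by exact_mod_cast hg2) j
  rcases Int.even_or_odd' i with ⟨j, rfl | rfl⟩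
  · refine h.mem_fixed_of_apply_mem hg ?_
    rw [hf]
    exact h.fixed.mul_mem (hpow j) hn
  · refine h.mem_fixed_of_inv_mul_mem hP hg ?_
    have : g⁻¹ * f g = g ^ (2 * j) * n := by
      rw [hf, zpow_add, zpow_one, ← mul_assoc]
      congr 1
      rw [((Commute.refl g).zpow_left (2 * j)).eq, inv_mul_cancel_left]
    rw [this]
    exact h.fixed.mul_mem (hpow j) hn

/-- An automorphism of odd order that maps `g` into `⟨g⟩N`, where `N` is fixed and normalized by
`g`, fixes `g`. -/
theorem mem_fixed_of_zpow_mul (hP : IsPGroup 2 P) (h : IsOddAut R f) {N : Subgroup P}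
    (hN : N ≤ h.fixed) {g n : P} {i : ℤ} (hg : g ∈ R) (hgN : g ∈ Subgroup.normalizer (N : Set P))
    (hn : n ∈ N) (hf : f g = g ^ i * n) : g ∈ h.fixed := by
  obtain ⟨s, hs⟩ := hP g
  induction s generalizing g n with
  | zero =>
    have : g = 1 := by simpa using hs
    rw [this]
    exact h.fixed.one_mem
  | succ s ih =>
    refine h.mem_fixed_of_sq hP hg ?_ (hN hn) hf
    have hc : (g ^ i)⁻¹ * n * g ^ i ∈ N :=
      (Subgroup.mem_normalizer_iff''.1 (Subgroup.zpow_mem _ hgN i) n).1 hn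
    refine ih (g := g ^ 2) (n := ((g ^ i)⁻¹ * n * g ^ i) * n) (R.pow_mem hg 2)
      (Subgroup.pow_mem _ hgN 2) (N.mul_mem hc hn) ?_ ?_
    · rw [h.map_pow hg, hf, ← zpow_natCast g 2, ← zpow_mul, mul_comm ((2 : ℕ) : ℤ) i, zpow_mul,
        zpow_natCast, pow_two, pow_two]
      group
    · rw [← pow_mul, ← pow_succ']
      exact hs

theorem mem_fixed_of_zpow (hP : IsPGroup 2 P) (h : IsOddAut R f) {g : P} {i : ℤ} (hg : g ∈ R)
    (hf : f g = g ^ i) : g ∈ h.fixed :=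
  h.mem_fixed_of_zpow_mul hP (N := ⊥) bot_le hg
    (by rw [Subgroup.normalizer_eq_top]; trivial) (Subgroup.mem_bot.2 rfl)
    (by rw [hf, mul_one])

end IsOddAut

namespace FusionSystem

variable [Finite P] {F : FusionSystem P}

omit [Finite P] in
theorem isOddAut_extFun {R : Subgroup P} {α : MulAut R} {k : ℕ} (hk : Odd k) (hα : α ^ k = 1) :
    IsOddAut R (extFun α) := by
  refine ⟨fun r hr => extFun_mem α hr, fun r hr s hs => ?_, k, hk, fun r hr => ?_⟩
  · have h1 := extFun_coe α (⟨r, hr⟩ * ⟨s, hs⟩)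
    have h2 := extFun_coe α ⟨r, hr⟩
    have h3 := extFun_coe α ⟨s, hs⟩
    simp only [Subgroup.coe_mul, map_mul] at h1 h2 h3
    rw [h1, h2, h3]
  · have : ∀ n : ℕ, (extFun α)^[n] r = ((α ^ n) ⟨r, hr⟩ : R) := by
      intro n
      induction n with
      | zero => simp
      | succ n ih =>
        rw [Function.iterate_succ_apply', ih, extFun_coe, pow_succ', MulAut.mul_apply]
    rw [this, hα]
    rfl

/-- If `R` has no nontrivial `F`-automorphism of odd order, then `Aut_F(R)` is a `2`-group. -/
theorem isPGroup_autGroup {R : Subgroup P}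
    (h : ∀ f, F.IsMor R f → IsOddAut R f → ∀ r ∈ R, f r = r) : IsPGroup 2 (F.autGroup R) := by
  rintro ⟨α, hα⟩
  obtain ⟨k, m, hm, hkm⟩ := Nat.exists_eq_two_pow_mul_odd (orderOf_pos α).ne'
  refine ⟨k, Subtype.ext ?_⟩
  have h1 : (α ^ 2 ^ k) ^ m = 1 := by rw [← pow_mul, ← hkm, pow_orderOf_eq_one]
  have h2 := h _ (mem_autGroup_iff.1 (Subgroup.pow_mem _ hα (2 ^ k))) (isOddAut_extFun hm h1)
  ext r
  change ((α ^ 2 ^ k) r : P) = r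
  rw [← extFun_coe]
  exact h2 r r.2

/-- If `R` is fully normalized and has no nontrivial `F`-automorphism of odd order, then every
`F`-automorphism of `R` is a conjugation. -/
theorem IsSaturated.exists_conj (hF : F.IsSaturated 2) (hP : IsPGroup 2 P) {R : Subgroup P}
    (hR : F.IsFullyNormalized R)
    (h : ∀ f, F.IsMor R f → IsOddAut R f → ∀ r ∈ R, f r = r) {f : P → P} (hf : F.IsMor R f)
    (hfR : ∀ r ∈ R, f r ∈ R) : ∃ g, ∀ r ∈ R, f r = g * r * g⁻¹ := by
  obtain ⟨S, hS⟩ := hF.exists_sylow_eq_conjAut hP R hR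
  obtain ⟨α, hα, hαf⟩ := hf.exists_mulAut hfR
  have hp := isPGroup_autGroup h
  have htop : (⊤ : Subgroup (F.autGroup R)) = S :=
    S.3 (hp.to_subgroup ⊤) le_top
  have : (⟨α, hα⟩ : F.autGroup R) ∈ (S : Subgroup (F.autGroup R)) := by
    rw [← htop]; trivial
  rw [hS] at this
  obtain ⟨g, hg⟩ := this
  refine ⟨g, fun r hr => ?_⟩
  rw [← hαf ⟨r, hr⟩]
  exact hg ⟨r, hr⟩

end FusionSystem

end OddAutomorphisms

/-! ### Cyclic extensions of an elementary abelian group of order 8 -/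

section CyclicExtension

variable {P : Type*} [Group P]

/-- `P = E⟨x⟩`, where `E = ⟨a, d, b⟩` is a normal elementary abelian subgroup of order `8`, the
element `x` has order `2 ^ m`, `E ∩ ⟨x⟩ = ⟨b⟩`, and `x` acts on `E` by `a ↦ ad`, `d ↦ d b ^ e`
with `e ∈ {0, 1}`. -/
structure CyclicExtension (E : Subgroup P) (x a d b : P) (m e : ℕ) : Prop where
  normal : E.Normal
  comm : ∀ u ∈ E, ∀ v ∈ E, u * v = v * u
  sq : ∀ u ∈ E, u * u = 1
  card : Nat.card E = 8
  ha : a ∈ E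
  hd : d ∈ E
  hbE : b ∈ E
  form : ∀ u ∈ E, ∃ i j k : ℕ, u = a ^ i * d ^ j * b ^ k
  two_le : 2 ≤ m
  he : e = 0 ∨ e = 1 ∧ 3 ≤ m
  xa : x * a = a * d * x
  xd : x * d = d * b ^ e * x
  hb : x ^ 2 ^ (m - 1) = b
  ord : orderOf x = 2 ^ m
  gen : ∀ g : P, ∃ i j k : ℕ, g = x ^ i * a ^ j * d ^ k
  indep : ∀ i j k : ℕ, x ^ i * a ^ j * d ^ k = 1 → Even j ∧ Even k

theorem pow_eq_one_or_self {u : P} (hu : u * u = 1) (n : ℕ) : u ^ n = 1 ∨ u ^ n = u := by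
  rcases Nat.even_or_odd' n with ⟨k, rfl | rfl⟩
  · left; rw [pow_mul, pow_two, hu, one_pow]
  · right; rw [pow_succ, pow_mul, pow_two, hu, one_pow, one_mul]

theorem pow_eq_one_of_even {u : P} (hu : u * u = 1) {n : ℕ} (hn : Even n) : u ^ n = 1 := by
  obtain ⟨k, rfl⟩ := hn
  rw [← two_mul, pow_mul, pow_two, hu, one_pow]

theorem pow_eq_self_of_odd {u : P} (hu : u * u = 1) {n : ℕ} (hn : Odd n) : u ^ n = u := by
  obtain ⟨k, rfl⟩ := hn
  rw [pow_succ, pow_mul, pow_two, hu, one_pow, one_mul]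

theorem mem_zpowers_pow_of_odd [Finite P] (hP : IsPGroup 2 P) (x : P) {n : ℕ} (hn : Odd n) :
    x ∈ Subgroup.zpowers (x ^ n) := by
  rw [mem_zpowers_pow_iff]
  obtain ⟨k, hk⟩ := hP x
  exact Nat.Coprime.coprime_dvd_right (orderOf_dvd_of_pow_eq_one hk)
    (Nat.Coprime.pow_right _ (Nat.coprime_two_right.2 hn))

/-- Three independent elements generate an elementary abelian group of order `8`. -/
theorem exists_eq_mul_of_card_eq_eight {E : Subgroup P} (hcomm : ∀ u ∈ E, ∀ v ∈ E, u * v = v * u)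
    (hsq : ∀ u ∈ E, u * u = 1) (hcard : Nat.card E = 8) {a d b : P} (ha : a ∈ E) (hd : d ∈ E)
    (hb : b ∈ E) (hb1 : b ≠ 1) (hdb : ∀ k : ℕ, d ≠ b ^ k) (hadb : ∀ j k : ℕ, a ≠ d ^ j * b ^ k)
    {u : P} (hu : u ∈ E) : ∃ i j k : ℕ, u = a ^ i * d ^ j * b ^ k := by
  let φ : Fin 2 × Fin 2 × Fin 2 → E := fun t =>
    ⟨a ^ t.1.1 * d ^ t.2.1.1 * b ^ t.2.2.1,
      E.mul_mem (E.mul_mem (E.pow_mem ha _) (E.pow_mem hd _)) (E.pow_mem hb _)⟩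
  have hinj : Function.Injective φ := by
    rintro ⟨i, j, k⟩ ⟨i', j', k'⟩ h
    have h1 : a ^ i.1 * d ^ j.1 * b ^ k.1 = a ^ i'.1 * d ^ j'.1 * b ^ k'.1 :=
      congrArg (fun r : E => (r : P)) h
    have hii : i = i' := by
      by_contra hne
      have : i.1 = 0 ∧ i'.1 = 1 ∨ i.1 = 1 ∧ i'.1 = 0 := by omega
      have key : ∀ p q r s : ℕ, d ^ p * b ^ q = a * d ^ r * b ^ s → False := by
        intro p q r s h2
        have hdp := E.pow_mem hd p
        have hdr := E.pow_mem hd r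
        have hbs := E.pow_mem hb s
        have hbq := E.pow_mem hb q
        apply hadb (p + r) (q + s)
        calc a = (a * d ^ r * b ^ s) * (b ^ s * d ^ r) := by
              rw [mul_assoc (a * d ^ r), ← mul_assoc (b ^ s), hsq _ hbs, one_mul, mul_assoc,
                hsq _ hdr, mul_one]
          _ = d ^ p * b ^ q * (b ^ s * d ^ r) := by rw [h2]
          _ = d ^ (p + r) * b ^ (q + s) := by
              rw [hcomm _ hbs _ hdr, pow_add, pow_add, mul_assoc, mul_assoc, ← mul_assoc (b ^ q),
                hcomm _ hbq _ hdr, mul_assoc]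
      rcases this with ⟨h2, h3⟩ | ⟨h2, h3⟩
      · rw [h2, h3] at h1
        simp only [pow_zero, pow_one, one_mul] at h1
        exact key _ _ _ _ h1
      · rw [h2, h3] at h1
        simp only [pow_zero, pow_one, one_mul] at h1
        exact key _ _ _ _ h1.symm
    subst hii
    rw [mul_assoc, mul_assoc] at h1
    have h1 := mul_left_cancel h1
    have hjj : j = j' := by
      by_contra hne
      have : j.1 = 0 ∧ j'.1 = 1 ∨ j.1 = 1 ∧ j'.1 = 0 := by omega
      have key : ∀ q s : ℕ, b ^ q = d * b ^ s → False := by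
        intro q s h2
        apply hdb (q + s)
        rw [pow_add, h2, mul_assoc, hsq _ (E.pow_mem hb s), mul_one]
      rcases this with ⟨h2, h3⟩ | ⟨h2, h3⟩
      · rw [h2, h3] at h1
        simp only [pow_zero, pow_one, one_mul] at h1
        exact key _ _ h1
      · rw [h2, h3] at h1
        simp only [pow_zero, pow_one, one_mul] at h1
        exact key _ _ h1.symm
    subst hjj
    have h1 := mul_left_cancel h1
    have hkk : k = k' := by
      by_contra hne
      have : k.1 = 0 ∧ k'.1 = 1 ∨ k.1 = 1 ∧ k'.1 = 0 := by omega
      rcases this with ⟨h2, h3⟩ | ⟨h2, h3⟩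
      · rw [h2, h3] at h1
        exact hb1 (by simpa using h1.symm)
      · rw [h2, h3] at h1
        exact hb1 (by simpa using h1)
    rw [hkk]
  have : Finite E := Nat.finite_of_card_ne_zero (by rw [hcard]; norm_num)
  have hbij : Function.Bijective φ := by
    rw [Nat.bijective_iff_injective_and_card]
    exact ⟨hinj, by rw [hcard]; simp⟩
  obtain ⟨t, ht⟩ := hbij.2 ⟨u, hu⟩
  exact ⟨_, _, _, (congrArg (fun r : E => (r : P)) ht).symm⟩

/-- If `P = E⟨x⟩` with `E ∩ ⟨x⟩ ≠ 1`, and `x` does not centralize `a ∈ E` modulo `⟨x⟩`, then `d =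
[x, a]` and the involution `b` of `⟨x⟩` complete `a` to a basis of `E`. As `x` acts on `E` with
order a power of two, it acts unipotently, so that `[x, d] ∈ ⟨b⟩`. -/
theorem exists_cyclicExtension [Finite P] (hP : IsPGroup 2 P) {E : Subgroup P} (hE : E.Normal)
    (hcomm : ∀ u ∈ E, ∀ v ∈ E, u * v = v * u) (hsq : ∀ u ∈ E, u * u = 1)
    (hcard : Nat.card E = 8) {x a : P} (hgen : ∀ g : P, ∃ i : ℕ, ∃ u ∈ E, g = x ^ i * u)
    (hx : ∃ i : ℕ, x ^ i ∈ E ∧ x ^ i ≠ 1) (ha : a ∈ E)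
    (hxa : x * a * x⁻¹ * a⁻¹ ∉ Subgroup.zpowers x) :
    ∃ d b m e, CyclicExtension E x a d b m e := by
  obtain ⟨m, hm⟩ := (IsPGroup.iff_orderOf.1 hP) x
  have hinv : ∀ u ∈ E, u⁻¹ = u := fun u hu => inv_eq_of_mul_eq_one_right (hsq u hu)
  have hm1 : m ≠ 0 := by
    rintro rfl
    obtain ⟨i, _, hi⟩ := hx
    rw [pow_zero, orderOf_eq_one_iff] at hm
    rw [hm, one_pow] at hi
    exact hi rfl
  set b := x ^ 2 ^ (m - 1) with hb
  have h2m : 2 ^ (m - 1) * 2 = 2 ^ m := by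
    rw [← pow_succ]; congr 1; omega
  have hb2 : b * b = 1 := by
    rw [← pow_two, hb, ← pow_mul, h2m, ← hm, pow_orderOf_eq_one]
  have hb1 : b ≠ 1 := by
    intro h
    have h1 := orderOf_dvd_of_pow_eq_one (hb ▸ h)
    rw [hm] at h1
    have h2 := Nat.le_of_dvd (by positivity) h1
    have : 0 < 2 ^ (m - 1) := by positivity
    omega
  -- `E` has exponent two, so it contains only two elements of `⟨x⟩`
  have hxE : ∀ i : ℕ, x ^ i ∈ E → x ^ i = 1 ∨ x ^ i = b := by
    intro i hi
    have h1 : x ^ (i * 2) = 1 := by rw [pow_mul, pow_two]; exact hsq _ hi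
    have h2 := orderOf_dvd_of_pow_eq_one h1
    rw [hm, ← h2m] at h2
    obtain ⟨t, ht⟩ := Nat.dvd_of_mul_dvd_mul_right (by norm_num) h2
    rw [ht, pow_mul]
    exact pow_eq_one_or_self hb2 t
  have hbE : b ∈ E := by
    obtain ⟨i, hi, hi1⟩ := hx
    exact (hxE i hi).resolve_left hi1 ▸ hi
  have hbx : ∀ k : ℕ, b ^ k ∈ Subgroup.zpowers x := fun k =>
    Subgroup.pow_mem _ (Subgroup.pow_mem _ (Subgroup.mem_zpowers x) _) k
  have hxb : Commute x b := (Commute.refl x).pow_right _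
  set d := x * a * x⁻¹ * a⁻¹ with hd
  have hdE : d ∈ E := E.mul_mem (hE.conj_mem a ha x) (E.inv_mem ha)
  have hxa' : x * a = a * d * x := by
    rw [hcomm a ha d hdE, hd]; group
  -- the elements `b`, `d`, `a` are independent because `[x, a] = d ∉ ⟨x⟩`
  have hbd : ∀ k : ℕ, d ≠ b ^ k := fun k h => hxa (h ▸ hbx k)
  have ha1 : ∀ k : ℕ, a ≠ b ^ k := by
    intro k h
    have : Commute x a := h ▸ hxb.pow_right k
    apply hbd 0
    rw [hd, this.eq]; group
  have had : ∀ j k : ℕ, a ≠ d ^ j * b ^ k := by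
    intro j k h
    rcases pow_eq_one_or_self (hsq d hdE) j with hj | hj
    · exact ha1 k (by rw [h, hj, one_mul])
    · rw [hj] at h
      have h1 : a * d = b ^ k := by
        rw [hcomm a ha d hdE, h, ← mul_assoc, hsq d hdE, one_mul]
      apply ha1 k
      have h2 : x * a = x * b ^ k := by rw [hxa', h1, (hxb.pow_right k).eq]
      exact mul_left_cancel h2
  have hEform : ∀ u ∈ E, ∃ i j k : ℕ, u = a ^ i * d ^ j * b ^ k := fun u hu =>
    exists_eq_mul_of_card_eq_eight hcomm hsq hcard ha hdE hbE hb1 hbd had hu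
  have hxd : ∃ k : ℕ, x * d = d * b ^ k * x := by
    obtain ⟨i, j, k, h⟩ := hEform (x * d * x⁻¹) (hE.conj_mem d hdE x)
    have hxd : x * d = a ^ i * d ^ j * b ^ k * x := by rw [← h]; group
    refine ⟨k, ?_⟩
    have hbk := E.pow_mem hbE k
    rcases pow_eq_one_or_self (hsq a ha) i with hi | hi <;>
    rcases pow_eq_one_or_self (hsq d hdE) j with hj | hj <;> rw [hi, hj] at hxd
    -- `x` fixes `b`, so it cannot map `d` to a power of `b`
    · exfalso
      apply hbd k
      have h2 : x * d = x * b ^ k := by rw [hxd, (hxb.pow_right k).eq]; simp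
      exact mul_left_cancel h2
    · rw [hxd, one_mul]
    · -- here `x` would permute `a`, `ad`, `d` cyclically modulo `b`
      exfalso
      rw [mul_one] at hxd
      have h3 : Commute (x ^ 3) a := by
        have e1 : x ^ 3 * a = x * (x * (x * a)) := by
          simp only [pow_succ, pow_zero, one_mul, mul_assoc]
        rw [Commute, SemiconjBy, e1, hxa']
        have e2 : x * (a * d * x) = d * b ^ k * x * x := by
          calc x * (a * d * x) = x * a * d * x := by group
            _ = a * d * (x * d) * x := by rw [hxa']; group
            _ = a * (d * a) * b ^ k * x * x := by rw [hxd]; group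
            _ = (a * a) * d * b ^ k * x * x := by rw [hcomm d hdE a ha]; group
            _ = _ := by rw [hsq a ha, one_mul]
        rw [e2]
        calc x * (d * b ^ k * x * x) = x * d * b ^ k * x * x := by group
          _ = a * b ^ k * (x * b ^ k) * x * x := by rw [hxd]; group
          _ = a * (b ^ k * b ^ k) * x * x * x := by rw [(hxb.pow_right k).eq]; group
          _ = a * x ^ 3 := by
            rw [hsq _ hbk]; simp only [pow_succ, pow_zero, one_mul, mul_one, mul_assoc]
      have h4 : x ∈ Subgroup.zpowers (x ^ 3) := mem_zpowers_pow_of_odd hP x (by decide)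
      obtain ⟨t, ht⟩ := h4
      have h5 : Commute x a := by
        rw [← ht]; exact h3.zpow_left t
      apply hbd 0
      rw [hd, h5.eq]; group
    -- `x` maps `a` to `a * d`, so it cannot map `d` to the same element modulo `b`
    · exfalso
      apply ha1 k
      have h2 : x * d = x * (a * b ^ k) := by
        rw [hxd, mul_assoc (a * d), ← (hxb.pow_right k).eq, ← mul_assoc, ← hxa', mul_assoc]
      have h3 := mul_left_cancel h2
      have h4 : x * a = (a * d) * x := hxa'
      have h5 : d * a = b ^ k := by
        rw [h3, hcomm a ha _ hbk, mul_assoc, hsq a ha, mul_one]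
      have h6 : x * a = x * b ^ k := by
        rw [hxa', hcomm a ha d hdE, h5, (hxb.pow_right k).eq]
      exact mul_left_cancel h6
  obtain ⟨e, he01, hxd⟩ : ∃ e : ℕ, (e = 0 ∨ e = 1) ∧ x * d = d * b ^ e * x := by
    obtain ⟨k, hk⟩ := hxd
    rcases pow_eq_one_or_self hb2 k with h | h
    · exact ⟨0, Or.inl rfl, by rw [hk, h, pow_zero]⟩
    · exact ⟨1, Or.inr rfl, by rw [hk, h, pow_one]⟩
  have hm2 : 2 ≤ m := by
    by_contra hlt
    have : m = 1 := by omega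
    have h1 : b = x := by rw [hb, this]; simp
    apply hbd 0
    rw [hd, ← h1, hcomm b hbE a ha]; group
  refine ⟨d, b, m, e, hE, hcomm, hsq, hcard, ha, hdE, hbE, hEform, hm2, ?_, hxa', hxd, rfl, hm,
    ?_, ?_⟩
  · rcases he01 with h | h
    · exact Or.inl h
    · refine Or.inr ⟨h, ?_⟩
      by_contra hlt
      -- otherwise `b = x ^ 2`, which does not commute with `a`
      have hm : m = 2 := by omega
      have h1 : x ^ 2 = b := by rw [hb, hm]; norm_num
      have h2 : x ^ 2 * a = a * b * x ^ 2 := by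
        calc x ^ 2 * a = x * (x * a) := by rw [pow_two, mul_assoc]
          _ = x * (a * d * x) := by rw [hxa']
          _ = x * a * d * x := by simp only [mul_assoc]
          _ = a * d * (x * d) * x := by rw [hxa']; simp only [mul_assoc]
          _ = a * (d * d) * b * x * x := by rw [hxd, h, pow_one]; simp only [mul_assoc]
          _ = _ := by rw [hsq d hdE, pow_two, mul_one]; simp only [mul_assoc]
      rw [h1, hcomm b hbE a ha] at h2
      have h3 : a * b * b = a * b * 1 := by rw [← h2, mul_one]
      exact hb1 (mul_left_cancel h3)
  · intro g
    obtain ⟨i, u, hu, rfl⟩ := hgen g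
    obtain ⟨j, k, l, rfl⟩ := hEform u hu
    refine ⟨i + 2 ^ (m - 1) * l, j, k, ?_⟩
    have h1 : a ^ j * d ^ k * b ^ l = b ^ l * (a ^ j * d ^ k) :=
      hcomm _ (E.mul_mem (E.pow_mem ha _) (E.pow_mem hdE _)) _ (E.pow_mem hbE _)
    rw [h1, pow_add, pow_mul, ← hb]
    group
  · intro i j k h
    rw [mul_assoc] at h
    have h1 : a ^ j * d ^ k = (x ^ i)⁻¹ := eq_inv_of_mul_eq_one_right h
    have h2 : x ^ i ∈ E := by
      rw [← inv_inv (x ^ i), ← h1]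
      exact E.inv_mem (E.mul_mem (E.pow_mem ha _) (E.pow_mem hdE _))
    obtain ⟨t, ht⟩ : ∃ t : ℕ, a ^ j * d ^ k = b ^ t := by
      rw [h1, hinv _ h2]
      rcases hxE i h2 with h3 | h3
      · exact ⟨0, by rw [h3, pow_zero]⟩
      · exact ⟨1, by rw [h3, pow_one]⟩
    have hdk := E.pow_mem hdE k
    have hj : Even j := by
      by_contra hj
      rw [pow_eq_self_of_odd (hsq a ha) (Nat.not_even_iff_odd.1 hj)] at ht
      apply had k t
      rw [hcomm _ hdk _ (E.pow_mem hbE t), ← ht, mul_assoc, hsq _ hdk, mul_one]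
    refine ⟨hj, ?_⟩
    by_contra hk
    rw [pow_eq_one_of_even (hsq a ha) hj, one_mul,
      pow_eq_self_of_odd (hsq d hdE) (Nat.not_even_iff_odd.1 hk)] at ht
    exact hbd t ht

end CyclicExtension

/-! ### Bicyclic 2-groups -/

section Bicyclic

variable {P : Type*} [Group P] [Finite P]

theorem exists_pow_eq_of_mem_zpowers {x z : P} (h : z ∈ Subgroup.zpowers x) :
    ∃ k : ℕ, z = x ^ k := by
  obtain ⟨k, rfl⟩ := (Submonoid.mem_powers_iff _ _).1
    (((isOfFinOrder_of_finite x).mem_powers_iff_mem_zpowers).2 h)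
  exact ⟨k, rfl⟩

omit [Finite P] in
theorem exists_zpowers_eq_of_le {C : Subgroup P} {x : P} (h : C ≤ Subgroup.zpowers x) :
    ∃ t, Subgroup.zpowers t = C := by
  have : IsCyclic C := isCyclic_of_injective (Subgroup.inclusion h) (Subgroup.inclusion_injective h)
  exact (Subgroup.isCyclic_iff_exists_zpowers_eq_top C).1 this

omit [Group P] [Finite P] in
theorem ncard_four_le (a b c d : P) : ({a, b, c, d} : Set P).ncard ≤ 4 := by
  refine (Set.ncard_insert_le _ _).trans (Nat.succ_le_succ ?_)
  refine (Set.ncard_insert_le _ _).trans (Nat.succ_le_succ ?_)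
  exact (Set.ncard_insert_le _ _).trans (by rw [Set.ncard_singleton])

/-- A nontrivial normal subgroup of a finite `p`-group contains a nontrivial central element. -/
theorem IsPGroup.exists_mem_center_of_normal {p : ℕ} [Fact p.Prime] (hP : IsPGroup p P)
    {N : Subgroup P} (hN : N.Normal) (hN1 : N ≠ ⊥) : ∃ z ∈ N, z ≠ 1 ∧ ∀ g : P, g * z = z * g := by
  have hP' : IsPGroup p (ConjAct P) := hP.of_equiv ConjAct.toConjAct
  have hdvd : p ∣ Nat.card N := by
    have : Nontrivial N := (Subgroup.nontrivial_iff_ne_bot N).2 hN1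
    obtain ⟨n, hn0, hn⟩ := (hP.to_subgroup N).nontrivial_iff_card.1 this
    rw [hn]
    exact dvd_pow_self p hn0.ne'
  obtain ⟨z, hz, hz1⟩ := hP'.exists_fixed_point_of_prime_dvd_card_of_fixed_point N hdvd
    (a := 1) (fun g => smul_one g)
  refine ⟨z, z.2, fun h => hz1 (Subtype.ext h.symm), fun g => ?_⟩
  have h1 := congrArg (fun r : N => (r : P)) (hz (ConjAct.toConjAct g))
  have h2 : g * (z : P) * g⁻¹ = z := h1
  exact mul_inv_eq_iff_eq_mul.1 h2

/-- A nontrivial normal subgroup of the `p`-group `P ⧸ K` meets the center nontrivially. -/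
theorem IsPGroup.exists_commutator_mem {p : ℕ} [Fact p.Prime] (hP : IsPGroup p P)
    {K N : Subgroup P} (hK : K.Normal) (hN : N.Normal) (hKN : ¬ N ≤ K) :
    ∃ z ∈ N, z ∉ K ∧ ∀ g : P, z⁻¹ * (g * z * g⁻¹) ∈ K := by
  have hmap : (N.map (QuotientGroup.mk' K)).Normal :=
    hN.map _ (QuotientGroup.mk'_surjective K)
  have hne : N.map (QuotientGroup.mk' K) ≠ ⊥ := by
    intro h
    rw [Subgroup.map_eq_bot_iff, QuotientGroup.ker_mk'] at h
    exact hKN h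
  obtain ⟨_, ⟨z, hz, rfl⟩, hz1, hzc⟩ := (hP.to_quotient K).exists_mem_center_of_normal hmap hne
  refine ⟨z, hz, fun h => hz1 ((QuotientGroup.eq_one_iff z).2 h), fun g => ?_⟩
  rw [← QuotientGroup.eq]
  have := hzc (QuotientGroup.mk' K g)
  exact (mul_inv_eq_iff_eq_mul.2 this).symm

/-- A basis of a normal elementary abelian subgroup of order `8` of a `2`-group adapted to a chain
of normal subgroups. -/
theorem exists_flag (hP : IsPGroup 2 P) {E : Subgroup P} (hE : E.Normal)
    (hcomm : ∀ u ∈ E, ∀ v ∈ E, u * v = v * u) (hsq : ∀ u ∈ E, u * u = 1)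
    (hcard : Nat.card E = 8) : ∃ u₁ ∈ E, ∃ u₂ ∈ E, ∃ u₃ ∈ E, u₁ ≠ 1 ∧ (∀ k : ℕ, u₂ ≠ u₁ ^ k) ∧
      (∀ j k : ℕ, u₃ ≠ u₂ ^ j * u₁ ^ k) ∧ (∀ g : P, g * u₁ * g⁻¹ = u₁) ∧
      (∀ g : P, ∃ k : ℕ, g * u₂ * g⁻¹ = u₂ * u₁ ^ k) ∧
      (∀ g : P, ∃ j k : ℕ, g * u₃ * g⁻¹ = u₃ * (u₂ ^ j * u₁ ^ k)) := by
  have hE1 : E ≠ ⊥ := by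
    rintro rfl
    rw [Subgroup.card_bot] at hcard
    norm_num at hcard
  obtain ⟨u₁, hu₁, hu₁1, hc⟩ := hP.exists_mem_center_of_normal hE hE1
  have hc' : ∀ g : P, g * u₁ * g⁻¹ = u₁ := fun g => mul_inv_eq_iff_eq_mul.2 (hc g)
  have hc'' : ∀ (g : P) (k : ℕ), g * u₁ ^ k * g⁻¹ = u₁ ^ k := fun g k => by rw [← conj_pow, hc' g]
  have hmemK : ∀ z, z ∈ Subgroup.zpowers u₁ → ∃ k : ℕ, z = u₁ ^ k := fun z hz =>
    exists_pow_eq_of_mem_zpowers hz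
  have hK : (Subgroup.zpowers u₁).Normal := by
    refine ⟨fun n hn g => ?_⟩
    obtain ⟨k, rfl⟩ := hmemK n hn
    rw [hc'']
    exact Subgroup.pow_mem _ (Subgroup.mem_zpowers u₁) k
  have hEK : ¬ E ≤ Subgroup.zpowers u₁ := by
    intro h
    have h1 := Subgroup.card_le_of_le h
    rw [hcard, Nat.card_zpowers] at h1
    have h2 : orderOf u₁ ∣ 2 := orderOf_dvd_of_pow_eq_one (by rw [pow_two]; exact hsq _ hu₁)
    have := Nat.le_of_dvd (by norm_num) h2
    omega
  obtain ⟨u₂, hu₂, hu₂K, hu₂c⟩ := hP.exists_commutator_mem hK hE hEK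
  have hu₂n : ∀ k : ℕ, u₂ ≠ u₁ ^ k := fun k h =>
    hu₂K (h ▸ Subgroup.pow_mem _ (Subgroup.mem_zpowers u₁) k)
  have hu₂c' : ∀ g : P, ∃ k : ℕ, g * u₂ * g⁻¹ = u₂ * u₁ ^ k := by
    intro g
    obtain ⟨k, hk⟩ := hmemK _ (hu₂c g)
    exact ⟨k, by rw [← hk, mul_inv_cancel_left]⟩
  have hex : ∃ u₃ ∈ E, ∀ j k : ℕ, u₃ ≠ u₂ ^ j * u₁ ^ k := by
    by_contra! hall
    have hsub : (E : Set P) ⊆ ({1, u₁, u₂, u₂ * u₁} : Set P) := by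
      intro u hu
      obtain ⟨j, k, rfl⟩ := hall u hu
      rcases pow_eq_one_or_self (hsq _ hu₂) j with h | h <;>
      rcases pow_eq_one_or_self (hsq _ hu₁) k with h' | h' <;> simp [h, h']
    have h1 := Set.ncard_le_ncard hsub (Set.toFinite _)
    have h2 : (E : Set P).ncard = 8 := hcard
    have h3 := ncard_four_le 1 u₁ u₂ (u₂ * u₁)
    omega
  obtain ⟨u₃, hu₃, hu₃n⟩ := hex
  refine ⟨u₁, hu₁, u₂, hu₂, u₃, hu₃, hu₁1, hu₂n, hu₃n, hc', hu₂c', fun g => ?_⟩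
  obtain ⟨i, j, k, h⟩ := exists_eq_mul_of_card_eq_eight hcomm hsq hcard hu₃ hu₂ hu₁ hu₁1 hu₂n hu₃n
    (hE.conj_mem u₃ hu₃ g)
  refine ⟨j, k, ?_⟩
  rcases pow_eq_one_or_self (hsq _ hu₃) i with hi | hi
  · exfalso
    rw [hi, one_mul] at h
    obtain ⟨l, hl⟩ := hu₂c' g⁻¹
    rcases pow_eq_one_or_self (hsq _ hu₂) j with hj | hj
    · apply hu₃n 0 k
      rw [pow_zero, one_mul]
      calc u₃ = g⁻¹ * (g * u₃ * g⁻¹) * g⁻¹⁻¹ := by group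
        _ = _ := by rw [h, hj, one_mul, hc'']
    · apply hu₃n 1 (l + k)
      rw [pow_one, pow_add]
      calc u₃ = g⁻¹ * (g * u₃ * g⁻¹) * g⁻¹⁻¹ := by group
        _ = (g⁻¹ * u₂ * g⁻¹⁻¹) * (g⁻¹ * u₁ ^ k * g⁻¹⁻¹) := by rw [h, hj]; group
        _ = _ := by rw [hl, hc'', mul_assoc]
  · rw [h, hi, mul_assoc]

/-- Let `P = ⟨x⟩⟨y⟩` and let `E` be normal elementary abelian of order `8`. The elements of `⟨y⟩` in
`E⟨x⟩` are the powers of some `t = x ^ i a`. As `t ^ 4 ∈ ⟨x⟩`, the group `E` is covered by four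
cosets of `E ∩ ⟨x⟩`; this forces `E ∩ ⟨x⟩` to have order `2`, and `t ^ 2` not to lie in `⟨x⟩`. The
latter is only possible if `i` is odd. -/
theorem exists_odd_pow_mul_mem_zpowers (hP : IsPGroup 2 P) {E : Subgroup P} (hE : E.Normal)
    (hcomm : ∀ u ∈ E, ∀ v ∈ E, u * v = v * u) (hsq : ∀ u ∈ E, u * u = 1)
    (hcard : Nat.card E = 8) {x y : P} (hxy : ∀ g : P, ∃ i j : ℕ, g = x ^ i * y ^ j) :
    ∃ i : ℕ, ∃ a ∈ E, Odd i ∧ x ^ i * a ∈ Subgroup.zpowers y ∧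
      (∃ l : ℕ, x ^ l ∈ E ∧ x ^ l ≠ 1) ∧ ∃ a ∈ E, x * a * x⁻¹ * a⁻¹ ∉ Subgroup.zpowers x := by
  obtain ⟨u₁, hu₁, u₂, hu₂, u₃, hu₃, hu₁1, hu₂n, hu₃n, hc₁, hc₂, hc₃⟩ :=
    exists_flag hP hE hcomm hsq hcard
  have hEform : ∀ u ∈ E, ∃ i j k : ℕ, u = u₃ ^ i * u₂ ^ j * u₁ ^ k := fun u hu =>
    exists_eq_mul_of_card_eq_eight hcomm hsq hcard hu₃ hu₂ hu₁ hu₁1 hu₂n hu₃n hu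
  have hinv : ∀ u ∈ E, u⁻¹ = u := fun u hu => inv_eq_of_mul_eq_one_right (hsq u hu)
  have hc₁' : ∀ (g : P) (k : ℕ), g * u₁ ^ k * g⁻¹ = u₁ ^ k := fun g k => by
    rw [← conj_pow, hc₁ g]
  have hu₁E : ∀ k : ℕ, u₁ ^ k ∈ E := fun k => E.pow_mem hu₁ k
  have hu₂E : ∀ k : ℕ, u₂ ^ k ∈ E := fun k => E.pow_mem hu₂ k
  -- conjugation on `⟨u₁, u₂⟩`
  have hc₂' : ∀ (g : P) (j k : ℕ), ∃ l : ℕ,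
      g * (u₂ ^ j * u₁ ^ k) * g⁻¹ = u₂ ^ j * u₁ ^ k * u₁ ^ l := by
    intro g j k
    obtain ⟨l, hl⟩ := hc₂ g
    refine ⟨l * j, ?_⟩
    have h1 : g * u₂ ^ j * g⁻¹ = u₂ ^ j * u₁ ^ (l * j) := by
      rw [← conj_pow, hl, (show Commute u₂ (u₁ ^ l) from hcomm _ hu₂ _ (hu₁E l)).mul_pow, ← pow_mul]
    calc g * (u₂ ^ j * u₁ ^ k) * g⁻¹ = (g * u₂ ^ j * g⁻¹) * (g * u₁ ^ k * g⁻¹) := by group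
      _ = _ := by
        rw [h1, hc₁', mul_assoc, mul_assoc, ← pow_add, ← pow_add, add_comm]
  -- `[P, E]` is contained in `⟨u₁, u₂⟩`
  have hD : ∀ (g : P), ∀ u ∈ E, ∃ j k : ℕ, g * u * g⁻¹ = u * (u₂ ^ j * u₁ ^ k) := by
    intro g u hu
    obtain ⟨i, j, k, rfl⟩ := hEform u hu
    obtain ⟨l, hl⟩ := hc₂' g j k
    rcases pow_eq_one_or_self (hsq _ hu₃) i with hi | hi
    · refine ⟨0, l, ?_⟩
      rw [hi, one_mul, hl, pow_zero, one_mul]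
    · obtain ⟨j', k', h'⟩ := hc₃ g
      refine ⟨j', k' + l, ?_⟩
      rw [hi]
      have hv := E.mul_mem (hu₂E j') (hu₁E k')
      have hw := E.mul_mem (hu₂E j) (hu₁E k)
      calc g * (u₃ * u₂ ^ j * u₁ ^ k) * g⁻¹
          = (g * u₃ * g⁻¹) * (g * (u₂ ^ j * u₁ ^ k) * g⁻¹) := by group
        _ = u₃ * ((u₂ ^ j' * u₁ ^ k') * (u₂ ^ j * u₁ ^ k)) * u₁ ^ l := by
          rw [h', hl]; simp only [mul_assoc]
        _ = _ := by rw [hcomm _ hv _ hw, pow_add]; simp only [mul_assoc]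
  set B := Subgroup.zpowers x ⊓ E with hB
  obtain ⟨β, hβ⟩ : ∃ β, Subgroup.zpowers β = B := exists_zpowers_eq_of_le inf_le_left
  have hβB : β ∈ B := hβ ▸ Subgroup.mem_zpowers β
  have hB2 : ∀ u ∈ B, u = 1 ∨ u = β := by
    intro u hu
    rw [← hβ] at hu
    obtain ⟨k, rfl⟩ := exists_pow_eq_of_mem_zpowers hu
    exact pow_eq_one_or_self (hsq β hβB.2) k
  set H := Subgroup.zpowers x ⊔ E with hH
  have hxH : ∀ k : ℕ, x ^ k ∈ H := fun k =>
    Subgroup.mem_sup_left (Subgroup.pow_mem _ (Subgroup.mem_zpowers x) k)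
  obtain ⟨t, ht⟩ : ∃ t, Subgroup.zpowers t = Subgroup.zpowers y ⊓ H :=
    exists_zpowers_eq_of_le inf_le_left
  have htH : t ∈ Subgroup.zpowers y ⊓ H := ht ▸ Subgroup.mem_zpowers t
  obtain ⟨x', hx', a, ha, htx⟩ := Subgroup.mem_sup_of_normal_right.1 htH.2
  obtain ⟨i, rfl⟩ := exists_pow_eq_of_mem_zpowers hx'
  set g := x ^ i with hg
  -- an element of `E` is a product of a power of `x` and of a power of `y`; the latter lies in `H`
  have hEt : ∀ u ∈ E, ∃ p l : ℕ, u = x ^ p * t ^ l := by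
    intro u hu
    obtain ⟨p, q, h⟩ := hxy u
    have h1 : y ^ q ∈ Subgroup.zpowers y ⊓ H := by
      refine ⟨Subgroup.pow_mem _ (Subgroup.mem_zpowers y) q, ?_⟩
      have : y ^ q = (x ^ p)⁻¹ * u := by rw [h]; group
      rw [this]
      exact H.mul_mem (H.inv_mem (hxH p)) (Subgroup.mem_sup_right hu)
    rw [← ht] at h1
    obtain ⟨l, hl⟩ := exists_pow_eq_of_mem_zpowers h1
    exact ⟨p, l, by rw [h, hl]⟩
  obtain ⟨j, k, hjk⟩ := hD g⁻¹ a ha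
  rw [inv_inv] at hjk
  obtain ⟨l, hl⟩ := hc₂' g⁻¹ j k
  rw [inv_inv] at hl
  set v := u₂ ^ j * u₁ ^ k with hv
  have hvE : v ∈ E := E.mul_mem (hu₂E j) (hu₁E k)
  have hag : a * g = g * (a * v) := by rw [← hjk]; group
  have hvg : v * g = g * (v * u₁ ^ l) := by rw [← hl]; group
  have hug : u₁ ^ l * g = g * u₁ ^ l := (mul_inv_eq_iff_eq_mul.1 (hc₁' g l)).symm
  -- with `v = [a, g] ∈ ⟨u₁, u₂⟩`, the powers of `t = g * a` up to the fourth are computed modulo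
  -- `⟨x⟩`
  have ht2 : t ^ 2 = g ^ 2 * v := by
    calc t ^ 2 = g * (a * g) * a := by rw [← htx, pow_two]; simp only [mul_assoc]
      _ = g * g * (a * v * a) := by rw [hag]; simp only [mul_assoc]
      _ = _ := by rw [hcomm a ha v hvE, mul_assoc v, hsq a ha, mul_one, pow_two]
  have hvg2 : v * g ^ 2 = g ^ 2 * v := by
    calc v * g ^ 2 = v * g * g := by rw [pow_two, ← mul_assoc]
      _ = g * v * (u₁ ^ l * g) := by rw [hvg]; simp only [mul_assoc]
      _ = g * (v * g) * u₁ ^ l := by rw [hug]; simp only [mul_assoc]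
      _ = g * g * v * (u₁ ^ l * u₁ ^ l) := by rw [hvg]; simp only [mul_assoc]
      _ = _ := by rw [hsq _ (hu₁E l), mul_one, pow_two]
  have ht4 : t ^ 4 = g ^ 4 := by
    calc t ^ 4 = t ^ 2 * t ^ 2 := by rw [← pow_add]
      _ = g ^ 2 * (v * g ^ 2) * v := by rw [ht2]; simp only [mul_assoc]
      _ = g ^ 2 * g ^ 2 * (v * v) := by rw [hvg2]; simp only [mul_assoc]
      _ = g ^ 4 := by rw [hsq v hvE, mul_one, ← pow_add]
  have ht3 : t ^ 3 = g ^ 3 * (v * u₁ ^ l * a) := by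
    calc t ^ 3 = t ^ 2 * t := by rw [← pow_succ]
      _ = g ^ 2 * (v * g) * a := by rw [ht2, ← htx]; simp only [mul_assoc]
      _ = g ^ 2 * g * (v * u₁ ^ l * a) := by rw [hvg]; simp only [mul_assoc]
      _ = _ := by rw [← pow_succ]
  set w := v * u₁ ^ l * a with hw
  have hwE : w ∈ E := E.mul_mem (E.mul_mem hvE (hu₁E l)) ha
  -- the four cosets of `E ∩ ⟨x⟩` covering `E`
  have hcover : ∀ u ∈ E, ∃ c ∈ B, u = c ∨ u = c * a ∨ u = c * v ∨ u = c * w := by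
    intro u hu
    obtain ⟨p, n, hpn⟩ := hEt u hu
    have hn : x ^ p * t ^ n = x ^ (p + i * (4 * (n / 4))) * t ^ (n % 4) := by
      conv_lhs => rw [← Nat.div_add_mod n 4]
      rw [pow_add t, pow_mul t, ht4, hg, ← pow_mul, ← pow_mul, ← mul_assoc, ← pow_add]
    rw [hn] at hpn
    have hmem : ∀ (q : ℕ) (z : P), z ∈ E → u = x ^ q * z → x ^ q ∈ B := by
      intro q z hz h
      refine ⟨Subgroup.pow_mem _ (Subgroup.mem_zpowers x) q, ?_⟩
      have : x ^ q = u * z⁻¹ := by rw [h]; group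
      rw [this]
      exact E.mul_mem hu (E.inv_mem hz)
    generalize p + i * (4 * (n / 4)) = q at hpn
    have hgpow : ∀ r : ℕ, x ^ q * g ^ r = x ^ (q + i * r) := fun r => by
      rw [hg, ← pow_mul, ← pow_add]
    have hlt : n % 4 < 4 := Nat.mod_lt _ (by norm_num)
    interval_cases h4 : n % 4
    · rw [pow_zero] at hpn
      exact ⟨x ^ q, hmem q 1 E.one_mem hpn, Or.inl (by rw [hpn, mul_one])⟩
    · have h1 : u = x ^ (q + i * 1) * a := by rw [hpn, ← hgpow, pow_one, pow_one, ← htx, mul_assoc]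
      exact ⟨_, hmem _ _ ha h1, Or.inr (Or.inl h1)⟩
    · have h1 : u = x ^ (q + i * 2) * v := by rw [hpn, ← hgpow, ht2, mul_assoc]
      exact ⟨_, hmem _ _ hvE h1, Or.inr (Or.inr (Or.inl h1))⟩
    · have h1 : u = x ^ (q + i * 3) * w := by rw [hpn, ← hgpow, ht3, mul_assoc]
      exact ⟨_, hmem _ _ hwE h1, Or.inr (Or.inr (Or.inr h1))⟩
  have hE8 : (E : Set P).ncard = 8 := hcard
  -- four cosets of the trivial group do not cover the eight elements of `E`
  have hβ1 : β ≠ 1 := by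
    intro h
    have hsub : (E : Set P) ⊆ ({1, a, v, w} : Set P) := by
      intro u hu
      obtain ⟨c, hc, h'⟩ := hcover u hu
      have hc1 : c = 1 := by rcases hB2 c hc with h2 | h2 <;> simp [h2, h]
      rw [hc1] at h'
      simpa using h'
    have h1 := Set.ncard_le_ncard hsub (Set.toFinite _)
    have h3 := ncard_four_le 1 a v w
    omega
  -- if `v ∈ ⟨x⟩`, only two different cosets are left, which do not cover `E` either
  have hvB : v ∉ B := by
    intro hvB
    have hvg' : v * g = g * v := by
      obtain ⟨r, hr⟩ := exists_pow_eq_of_mem_zpowers hvB.1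
      rw [hr, hg, ← pow_add, ← pow_add, add_comm]
    have hul : u₁ ^ l = 1 := by
      rw [hvg'] at hvg
      have := mul_left_cancel hvg
      exact (mul_eq_left.1 this.symm)
    have hwv : w = v * a := by rw [hw, hul, mul_one]
    have hββ : β * β = 1 := hsq β hβB.2
    have hsub : (E : Set P) ⊆ ({1, β, a, β * a} : Set P) := by
      intro u hu
      obtain ⟨c, hc, h'⟩ := hcover u hu
      rw [hwv] at h'
      rcases hB2 c hc with rfl | rfl <;> rcases hB2 v hvB with h2 | h2 <;>
        rw [h2] at h' <;> simp only [one_mul, mul_one, ← mul_assoc, hββ] at h' <;>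
        simp only [Set.mem_insert_iff, Set.mem_singleton_iff] <;> tauto
    have h1 := Set.ncard_le_ncard hsub (Set.toFinite _)
    have h3 := ncard_four_le 1 β a (β * a)
    omega
  refine ⟨i, a, ha, ?_, ?_, ?_, ?_⟩
  · -- otherwise `g = h ^ 2`, the element `v` is `u₁`, and `⟨u₁⟩` is the centralizer of `h` in `E`
    by_contra hi
    obtain ⟨s, hs⟩ := Nat.not_odd_iff_even.1 hi
    set h := x ^ s with hh
    have hgh : g = h * h := by rw [hg, hs, pow_add]
    obtain ⟨j', k', h1⟩ := hD h⁻¹ a ha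
    rw [inv_inv] at h1
    obtain ⟨l', h2⟩ := hc₂' h⁻¹ j' k'
    rw [inv_inv] at h2
    set v' := u₂ ^ j' * u₁ ^ k' with hv'
    have hv'E : v' ∈ E := E.mul_mem (hu₂E j') (hu₁E k')
    clear_value v'
    have h3 : v = u₁ ^ l' := by
      have : a * v = a * u₁ ^ l' := by
        calc a * v = g⁻¹ * a * g := hjk.symm
          _ = (h⁻¹ * (h⁻¹ * a * h) * h) := by rw [hgh]; group
          _ = h⁻¹ * (a * v') * h := by rw [h1]
          _ = (h⁻¹ * a * h) * (h⁻¹ * v' * h) := by group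
          _ = a * (v' * v') * u₁ ^ l' := by rw [h1, h2]; simp only [mul_assoc]
          _ = _ := by rw [hsq v' hv'E, mul_one]
      exact mul_left_cancel this
    have h4 : u₁ ^ l' = u₁ := by
      rcases pow_eq_one_or_self (hsq _ hu₁) l' with h5 | h5
      · exact absurd (by rw [h3, h5]; exact B.one_mem) hvB
      · exact h5
    rw [h4] at h2 h3
    have hv'n : ∀ r : ℕ, v' ≠ u₁ ^ r := by
      intro r hr
      have h5 := hc₁' h⁻¹ r
      rw [inv_inv, ← hr, h2] at h5
      exact hu₁1 (mul_eq_left.1 h5)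
    have han : ∀ q r : ℕ, a ≠ v' ^ q * u₁ ^ r := by
      intro q r hqr
      rcases pow_eq_one_or_self (hsq _ hv'E) q with h5 | h5 <;> rw [h5] at hqr
      · rw [one_mul] at hqr
        have h6 := hc₁' h⁻¹ r
        rw [inv_inv, ← hqr, h1] at h6
        exact hv'n 0 (by rw [pow_zero]; exact mul_eq_left.1 h6)
      · have h6 : h⁻¹ * a * h = a * u₁ := by
          have h7 := hc₁' h⁻¹ r
          rw [inv_inv] at h7
          calc h⁻¹ * a * h = (h⁻¹ * v' * h) * (h⁻¹ * u₁ ^ r * h) := by rw [hqr]; group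
            _ = v' * (u₁ * u₁ ^ r) := by rw [h2, h7, mul_assoc]
            _ = _ := by rw [hcomm _ hu₁ _ (hu₁E r), hqr, mul_assoc]
        rw [h1] at h6
        exact hv'n 1 (by rw [pow_one]; exact mul_left_cancel h6)
    obtain ⟨p, q, r, hpqr⟩ := exists_eq_mul_of_card_eq_eight hcomm hsq hcard ha hv'E hu₁ hu₁1
      hv'n han hβB.2
    have hβh : h⁻¹ * β * h = β := by
      obtain ⟨n, hn⟩ := exists_pow_eq_of_mem_zpowers hβB.1
      rw [hn, hh]
      group
    have h7 := hc₁' h⁻¹ r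
    rw [inv_inv] at h7
    have hp : a ^ p = 1 := by
      rcases pow_eq_one_or_self (hsq _ ha) p with h5 | h5
      · exact h5
      exfalso
      rcases pow_eq_one_or_self (hsq _ hv'E) q with h6 | h6 <;> rw [h5, h6] at hpqr
      · have h8 : h⁻¹ * β * h = v' * β := by
          calc h⁻¹ * β * h = (h⁻¹ * a * h) * (h⁻¹ * u₁ ^ r * h) := by rw [hpqr]; group
            _ = v' * a * u₁ ^ r := by rw [h1, h7, hcomm _ ha _ hv'E]
            _ = _ := by rw [hpqr]; group
        rw [hβh] at h8
        exact hv'n 0 (by rw [pow_zero]; exact mul_eq_right.1 h8.symm)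
      · have h8 : h⁻¹ * β * h = (v' * u₁) * β := by
          calc h⁻¹ * β * h = (h⁻¹ * a * h) * (h⁻¹ * v' * h) * (h⁻¹ * u₁ ^ r * h) := by
                rw [hpqr]; group
            _ = (a * v') * (v' * u₁) * u₁ ^ r := by rw [h1, h7, h2]
            _ = _ := by
              rw [hpqr, hcomm _ (E.mul_mem ha hv'E) _ (E.mul_mem hv'E hu₁)]
              simp only [mul_assoc]
        rw [hβh] at h8
        have h9 := mul_eq_right.1 h8.symm
        exact hv'n 1 (by rw [pow_one]; exact (eq_inv_of_mul_eq_one_left h9).trans (hinv _ hu₁))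
    have hq : v' ^ q = 1 := by
      rcases pow_eq_one_or_self (hsq _ hv'E) q with h6 | h6
      · exact h6
      exfalso
      rw [hp, h6, one_mul] at hpqr
      have h8 : h⁻¹ * β * h = u₁ * β := by
        calc h⁻¹ * β * h = (h⁻¹ * v' * h) * (h⁻¹ * u₁ ^ r * h) := by rw [hpqr]; group
          _ = u₁ * v' * u₁ ^ r := by rw [h2, h7, hcomm _ hv'E _ hu₁]
          _ = _ := by rw [hpqr, mul_assoc]
      rw [hβh] at h8
      exact hu₁1 (mul_eq_right.1 h8.symm)
    rw [hp, hq, one_mul, one_mul] at hpqr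
    rcases pow_eq_one_or_self (hsq _ hu₁) r with h8 | h8 <;> rw [h8] at hpqr
    · exact hβ1 hpqr
    · exact hvB (by rw [h3, ← hpqr]; exact hβB)
  · rw [htx]
    exact htH.1
  · obtain ⟨n, hn⟩ := exists_pow_eq_of_mem_zpowers hβB.1
    exact ⟨n, hn ▸ hβB.2, hn ▸ hβ1⟩
  -- if `[x, E] ≤ ⟨x⟩`, then `[x ^ i, a] ∈ ⟨x⟩`, contrary to `v ∉ ⟨x⟩`
  · by_contra! hall
    have hx : x ∈ Subgroup.zpowers x := Subgroup.mem_zpowers x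
    have hpow : ∀ n : ℕ, ∀ u ∈ E, x ^ n * u * (x ^ n)⁻¹ * u⁻¹ ∈ Subgroup.zpowers x := by
      intro n
      induction n with
      | zero => intro u _; simp
      | succ n ih =>
        intro u hu
        have h1 : x ^ (n + 1) * u * (x ^ (n + 1))⁻¹ * u⁻¹ =
            x * (x ^ n * u * (x ^ n)⁻¹ * u⁻¹) * x⁻¹ * (x * u * x⁻¹ * u⁻¹) := by
          rw [pow_succ']; group
        rw [h1]
        exact Subgroup.mul_mem _ (Subgroup.mul_mem _ (Subgroup.mul_mem _ hx (ih u hu))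
          (Subgroup.inv_mem _ hx)) (hall u hu)
    have h1 := hpow i a ha
    rw [← hg] at h1
    have hgx : g ∈ Subgroup.zpowers x := Subgroup.pow_mem _ hx i
    apply hvB
    refine ⟨?_, hvE⟩
    have h2 : v = g⁻¹ * (g * a * g⁻¹ * a⁻¹)⁻¹ * g := by
      have : v = a⁻¹ * (g⁻¹ * a * g) := by rw [hjk, inv_mul_cancel_left]
      have h3 : a⁻¹ * (g⁻¹ * a * g) = (g⁻¹ * a * g) * a⁻¹ :=
        hcomm _ (E.inv_mem ha) _ (by rw [hjk]; exact E.mul_mem ha hvE)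
      rw [this, h3]
      group
    rw [h2]
    exact Subgroup.mul_mem _ (Subgroup.mul_mem _ (Subgroup.inv_mem _ hgx)
      (Subgroup.inv_mem _ h1)) hgx

end Bicyclic

/-! ### Computations in cyclic extensions -/

section CyclicExtension

variable {P : Type*} [Group P]

/-- If `P = ⟨x⟩⟨y⟩`, an odd power of `x` lies in `E⟨y⟩`, so that `P = E⟨y⟩`. The remaining
properties of `y` follow by exchanging the roles of `x` and `y`. -/
theorem exists_cyclicExtension_of_isBicyclic [Finite P] (hP : IsPGroup 2 P) (hbi : IsBicyclic P)
    {E : Subgroup P} (hE : E.Normal) (hcomm : ∀ u ∈ E, ∀ v ∈ E, u * v = v * u)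
    (hsq : ∀ u ∈ E, u * u = 1) (hcard : Nat.card E = 8) :
    ∃ x a d b m e, CyclicExtension E x a d b m e := by
  obtain ⟨x, y, hxy⟩ := hbi
  have hxy1 : ∀ g : P, ∃ i j : ℕ, g = x ^ i * y ^ j := by
    intro g
    obtain ⟨s, hs, t, ht, rfl⟩ := hxy g
    obtain ⟨i, rfl⟩ := exists_pow_eq_of_mem_zpowers hs
    obtain ⟨j, rfl⟩ := exists_pow_eq_of_mem_zpowers ht
    exact ⟨i, j, rfl⟩
  have hyx : ∀ g : P, ∃ i j : ℕ, g = y ^ i * x ^ j := by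
    intro g
    obtain ⟨s, hs, t, ht, h⟩ := hxy g⁻¹
    obtain ⟨i, hi⟩ := exists_pow_eq_of_mem_zpowers (Subgroup.inv_mem _ hs)
    obtain ⟨j, hj⟩ := exists_pow_eq_of_mem_zpowers (Subgroup.inv_mem _ ht)
    refine ⟨j, i, ?_⟩
    rw [← hi, ← hj, ← mul_inv_rev, ← h, inv_inv]
  obtain ⟨i, a, ha, hi, hia, -, -⟩ := exists_odd_pow_mul_mem_zpowers hP hE hcomm hsq hcard hxy1
  obtain ⟨-, -, -, -, -, hy, a', ha', hya⟩ :=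
    exists_odd_pow_mul_mem_zpowers hP hE hcomm hsq hcard hyx
  have hx : x ∈ Subgroup.zpowers y ⊔ E := by
    have h1 : x ^ i ∈ Subgroup.zpowers y ⊔ E := by
      have : x ^ i = x ^ i * a * a⁻¹ := by group
      rw [this]
      exact Subgroup.mul_mem _ (Subgroup.mem_sup_left hia)
        (Subgroup.mem_sup_right (E.inv_mem ha))
    exact (Subgroup.zpowers_le.2 h1) (mem_zpowers_pow_of_odd hP x hi)
  have hgen : ∀ g : P, ∃ i : ℕ, ∃ u ∈ E, g = y ^ i * u := by
    intro g
    have h1 : g ∈ Subgroup.zpowers y ⊔ E := by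
      obtain ⟨p, q, rfl⟩ := hxy1 g
      exact Subgroup.mul_mem _ (Subgroup.pow_mem _ hx p)
        (Subgroup.mem_sup_left (Subgroup.pow_mem _ (Subgroup.mem_zpowers y) q))
    obtain ⟨s, hs, u, hu, rfl⟩ := Subgroup.mem_sup_of_normal_right.1 h1
    obtain ⟨k, rfl⟩ := exists_pow_eq_of_mem_zpowers hs
    exact ⟨k, u, hu, rfl⟩
  obtain ⟨d, b, m, e, h⟩ := exists_cyclicExtension hP hE hcomm hsq hcard hgen hy ha' hya
  exact ⟨y, a', d, b, m, e, h⟩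

namespace CyclicExtension

variable {E : Subgroup P} {x a d b : P} {m e : ℕ}

theorem a2 (h : CyclicExtension E x a d b m e) : a * a = 1 := h.sq a h.ha
theorem d2 (h : CyclicExtension E x a d b m e) : d * d = 1 := h.sq d h.hd
theorem b2 (h : CyclicExtension E x a d b m e) : b * b = 1 := h.sq b h.hbE

theorem xb (h : CyclicExtension E x a d b m e) : Commute x b := by
  rw [← h.hb]; exact (Commute.refl x).pow_right _

theorem pow_eq_one_iff (h : CyclicExtension E x a d b m e) {i : ℕ} : x ^ i = 1 ↔ 2 ^ m ∣ i := by
  rw [← h.ord]; exact orderOf_dvd_iff_pow_eq_one.symm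

theorem two_pow (h : CyclicExtension E x a d b m e) : 2 ^ (m - 1) * 2 = 2 ^ m := by
  rw [← pow_succ]
  have := h.two_le
  congr 1; omega

theorem b_ne_one (h : CyclicExtension E x a d b m e) : b ≠ 1 := by
  intro hb
  have h1 := h.pow_eq_one_iff.1 (h.hb.trans hb)
  have h2 := Nat.le_of_dvd (by positivity) h1
  have : 0 < 2 ^ (m - 1) := by positivity
  have := h.two_pow
  omega

theorem b_pow_eq_one_iff (h : CyclicExtension E x a d b m e) {i : ℕ} : b ^ i = 1 ↔ Even i := by
  refine ⟨fun hi => ?_, pow_eq_one_of_even h.b2⟩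
  by_contra hne
  rw [pow_eq_self_of_odd h.b2 (Nat.not_even_iff_odd.1 hne)] at hi
  exact h.b_ne_one hi

theorem eq_b_pow_of_sq (h : CyclicExtension E x a d b m e) {i : ℕ} (hi : x ^ (2 * i) = 1) :
    ∃ t, x ^ i = b ^ t := by
  rw [h.pow_eq_one_iff, ← h.two_pow, mul_comm 2 i] at hi
  obtain ⟨t, ht⟩ := Nat.dvd_of_mul_dvd_mul_right (by norm_num) hi
  exact ⟨t, by rw [ht, pow_mul, h.hb]⟩

theorem b_comm (h : CyclicExtension E x a d b m e) (g : P) : Commute b g := by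
  obtain ⟨i, j, k, rfl⟩ := h.gen g
  exact ((h.xb.symm.pow_right i).mul_right
    ((show Commute b a from h.comm _ h.hbE _ h.ha).pow_right j)).mul_right
    ((show Commute b d from h.comm _ h.hbE _ h.hd).pow_right k)

theorem be_comm (h : CyclicExtension E x a d b m e) (q : ℕ) (g : P) : Commute ((b ^ e) ^ q) g :=
  ((h.b_comm g).pow_left e).pow_left q

theorem x2d (h : CyclicExtension E x a d b m e) : Commute (x ^ 2) d := by
  have hc : ∀ g, Commute (b ^ e) g := fun g => (h.b_comm g).pow_left e
  have hcc : b ^ e * b ^ e = 1 := h.sq _ (E.pow_mem h.hbE e)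
  calc x ^ 2 * d = x * (x * d) := by rw [pow_two, mul_assoc]
    _ = x * (d * b ^ e * x) := by rw [h.xd]
    _ = (x * d) * (b ^ e * x) := by simp only [mul_assoc]
    _ = d * (b ^ e * (x * b ^ e)) * x := by rw [h.xd]; simp only [mul_assoc]
    _ = d * (b ^ e * b ^ e) * x * x := by rw [(hc x).symm.eq]; simp only [mul_assoc]
    _ = d * x ^ 2 := by rw [hcc, mul_one, pow_two, mul_assoc]

theorem x2a (h : CyclicExtension E x a d b m e) : x ^ 2 * a = a * b ^ e * x ^ 2 := by
  calc x ^ 2 * a = x * (x * a) := by rw [pow_two, mul_assoc]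
    _ = x * (a * d * x) := by rw [h.xa]
    _ = (x * a) * (d * x) := by simp only [mul_assoc]
    _ = a * d * (x * d) * x := by rw [h.xa]; simp only [mul_assoc]
    _ = a * (d * d) * b ^ e * (x * x) := by rw [h.xd]; simp only [mul_assoc]
    _ = _ := by rw [h.d2, mul_one, pow_two]

theorem x2n_a (h : CyclicExtension E x a d b m e) (i : ℕ) :
    x ^ (2 * i) * a = a * (b ^ e) ^ i * x ^ (2 * i) := by
  induction i with
  | zero => simp
  | succ i ih =>
    calc x ^ (2 * (i + 1)) * a = x ^ (2 * i) * (x ^ 2 * a) := by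
          rw [mul_add, pow_add, mul_one, mul_assoc]
      _ = x ^ (2 * i) * a * (b ^ e * x ^ 2) := by rw [h.x2a]; simp only [mul_assoc]
      _ = a * (b ^ e) ^ i * (x ^ (2 * i) * b ^ e) * x ^ 2 := by rw [ih]; simp only [mul_assoc]
      _ = a * ((b ^ e) ^ i * b ^ e) * (x ^ (2 * i) * x ^ 2) := by
        rw [((h.b_comm (x ^ (2 * i))).pow_left e).symm.eq]; simp only [mul_assoc]
      _ = _ := by rw [← pow_succ, ← pow_add, mul_add, mul_one]

theorem x4_comm (h : CyclicExtension E x a d b m e) (g : P) : Commute (x ^ 4) g := by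
  have h1 : Commute (x ^ 4) a := by
    have h2 := h.x2n_a 2
    have hcc : (b ^ e) ^ 2 = 1 := by rw [pow_two]; exact h.sq _ (E.pow_mem h.hbE e)
    rw [hcc, mul_one] at h2
    exact h2
  have h2 : Commute (x ^ 4) d := by
    have : x ^ 4 = (x ^ 2) ^ 2 := by rw [← pow_mul]
    rw [this]
    exact h.x2d.pow_left 2
  obtain ⟨i, j, k, rfl⟩ := h.gen g
  exact ((((Commute.refl x).pow_left 4).pow_right i).mul_right (h1.pow_right j)).mul_right
    (h2.pow_right k)

theorem x4n_comm (h : CyclicExtension E x a d b m e) (i : ℕ) (g : P) : Commute (x ^ (4 * i)) g := by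
  rw [pow_mul]; exact (h.x4_comm g).pow_left i

theorem x2n_d (h : CyclicExtension E x a d b m e) (i : ℕ) : Commute (x ^ (2 * i)) d := by
  rw [pow_mul]; exact h.x2d.pow_left i

theorem x_odd_a (h : CyclicExtension E x a d b m e) (s : ℕ) :
    x ^ (2 * s + 1) * a = a * (d * (b ^ e) ^ s) * x ^ (2 * s + 1) := by
  calc x ^ (2 * s + 1) * a = x ^ (2 * s) * (x * a) := by rw [pow_succ, mul_assoc]
    _ = x ^ (2 * s) * a * (d * x) := by rw [h.xa]; simp only [mul_assoc]
    _ = a * (b ^ e) ^ s * (x ^ (2 * s) * d) * x := by rw [h.x2n_a]; simp only [mul_assoc]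
    _ = a * ((b ^ e) ^ s * d) * (x ^ (2 * s) * x) := by rw [(h.x2n_d s).eq]; simp only [mul_assoc]
    _ = _ := by rw [(h.be_comm s d).eq, ← pow_succ]

theorem x_odd_d (h : CyclicExtension E x a d b m e) (s : ℕ) :
    x ^ (2 * s + 1) * d = d * b ^ e * x ^ (2 * s + 1) := by
  calc x ^ (2 * s + 1) * d = x ^ (2 * s) * (x * d) := by rw [pow_succ, mul_assoc]
    _ = x ^ (2 * s) * d * (b ^ e * x) := by rw [h.xd]; simp only [mul_assoc]
    _ = d * (x ^ (2 * s) * b ^ e) * x := by rw [(h.x2n_d s).eq]; simp only [mul_assoc]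
    _ = d * b ^ e * (x ^ (2 * s) * x) := by
      rw [((h.b_comm (x ^ (2 * s))).pow_left e).symm.eq]; simp only [mul_assoc]
    _ = _ := by rw [← pow_succ]

/-- `[E, x]` is contained in `⟨d, b ^ e⟩`. -/
theorem w_mul_x (h : CyclicExtension E x a d b m e) (i j k : ℕ) : ∃ p q : ℕ,
    a ^ j * d ^ k * x ^ i = x ^ i * (a ^ j * d ^ k) * (d ^ p * (b ^ e) ^ q) := by
  have hcc : b ^ e * b ^ e = 1 := h.sq _ (E.pow_mem h.hbE e)
  have hc : ∀ g, Commute (b ^ e) g := fun g => (h.b_comm g).pow_left e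
  have hdx : d * x = x * d * b ^ e := by
    rw [h.xd, mul_assoc, mul_assoc, (hc x).symm.eq, ← mul_assoc (b ^ e), hcc, one_mul]
  have hax : a * x = x * a * (d * b ^ e) := by
    calc a * x = a * (d * d) * x := by rw [h.d2, mul_one]
      _ = a * d * (d * x) := by simp only [mul_assoc]
      _ = (a * d * x) * (d * b ^ e) := by rw [hdx]; simp only [mul_assoc]
      _ = _ := by rw [← h.xa]
  have had : Commute a d := h.comm _ h.ha _ h.hd
  have key : ∃ p q : ℕ, a ^ j * d ^ k * x = x * (a ^ j * d ^ k) * (d ^ p * (b ^ e) ^ q) := by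
    rcases pow_eq_one_or_self h.a2 j with hj | hj <;>
    rcases pow_eq_one_or_self h.d2 k with hk | hk <;> rw [hj, hk]
    · exact ⟨0, 0, by simp⟩
    · exact ⟨0, 1, by simp only [one_mul, pow_zero, pow_one]; exact hdx⟩
    · exact ⟨1, 1, by simp only [mul_one, pow_one]; exact hax⟩
    · refine ⟨1, 0, ?_⟩
      rw [pow_one, pow_zero, mul_one]
      calc a * d * x = a * x * d * b ^ e := by rw [mul_assoc, hdx]; simp only [mul_assoc]
        _ = x * a * d * (b ^ e * d) * b ^ e := by rw [hax]; simp only [mul_assoc]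
        _ = x * a * d * d * (b ^ e * b ^ e) := by rw [(hc d).eq]; simp only [mul_assoc]
        _ = _ := by rw [hcc, mul_one]; simp only [mul_assoc]
  obtain ⟨p₀, q₀, h₀⟩ := key
  induction i with
  | zero => exact ⟨0, 0, by simp⟩
  | succ i ih =>
    obtain ⟨p, q, ih⟩ := ih
    obtain ⟨q', hq'⟩ : ∃ q', d ^ p * x = x * d ^ p * (b ^ e) ^ q' := by
      rcases pow_eq_one_or_self h.d2 p with hp | hp <;> rw [hp]
      · exact ⟨0, by simp⟩
      · exact ⟨1, by rw [pow_one]; exact hdx⟩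
    refine ⟨p₀ + p, q₀ + q' + q, ?_⟩
    calc a ^ j * d ^ k * x ^ (i + 1) = a ^ j * d ^ k * x ^ i * x := by rw [pow_succ, ← mul_assoc]
      _ = x ^ i * (a ^ j * d ^ k) * d ^ p * ((b ^ e) ^ q * x) := by rw [ih]; simp only [mul_assoc]
      _ = x ^ i * (a ^ j * d ^ k) * (d ^ p * x) * (b ^ e) ^ q := by
        rw [(h.be_comm q x).eq]; simp only [mul_assoc]
      _ = x ^ i * (a ^ j * d ^ k * x) * d ^ p * ((b ^ e) ^ q' * (b ^ e) ^ q) := by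
        rw [hq']; simp only [mul_assoc]
      _ = x ^ i * x * (a ^ j * d ^ k) * d ^ p₀ * ((b ^ e) ^ q₀ * d ^ p) *
          ((b ^ e) ^ q' * (b ^ e) ^ q) := by rw [h₀]; simp only [mul_assoc]
      _ = _ := by
        rw [(h.be_comm q₀ (d ^ p)).eq, pow_succ, pow_add, pow_add, pow_add]; simp only [mul_assoc]

theorem wE (h : CyclicExtension E x a d b m e) (j k : ℕ) : a ^ j * d ^ k ∈ E :=
  E.mul_mem (E.pow_mem h.ha j) (E.pow_mem h.hd k)

theorem sE (h : CyclicExtension E x a d b m e) (p q : ℕ) : d ^ p * (b ^ e) ^ q ∈ E :=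
  E.mul_mem (E.pow_mem h.hd p) (E.pow_mem (E.pow_mem h.hbE e) q)

/-- Commutators in `P` are contained in `⟨d, b ^ e⟩`. -/
theorem mul_comm' (h : CyclicExtension E x a d b m e) (g g' : P) :
    ∃ p q : ℕ, g * g' = g' * g * (d ^ p * (b ^ e) ^ q) := by
  obtain ⟨i, j, k, rfl⟩ := h.gen g
  obtain ⟨i', j', k', rfl⟩ := h.gen g'
  obtain ⟨p, q, h1⟩ := h.w_mul_x i' j k
  obtain ⟨p', q', h2⟩ := h.w_mul_x i j' k'
  have hw := h.wE j k
  have hw' := h.wE j' k'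
  have hs := h.sE p q
  have hs' := h.sE p' q'
  refine ⟨p + p', q + q', ?_⟩
  have e1 : x ^ i * a ^ j * d ^ k * (x ^ i' * a ^ j' * d ^ k') =
      x ^ i * x ^ i' * ((a ^ j * d ^ k) * (a ^ j' * d ^ k')) * (d ^ p * (b ^ e) ^ q) := by
    calc _ = x ^ i * (a ^ j * d ^ k * x ^ i') * (a ^ j' * d ^ k') := by simp only [mul_assoc]
      _ = x ^ i * x ^ i' * (a ^ j * d ^ k) * ((d ^ p * (b ^ e) ^ q) * (a ^ j' * d ^ k')) := by
        rw [h1]; simp only [mul_assoc]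
      _ = _ := by rw [h.comm _ hs _ hw']; simp only [mul_assoc]
  have e2 : x ^ i' * a ^ j' * d ^ k' * (x ^ i * a ^ j * d ^ k) =
      x ^ i' * x ^ i * ((a ^ j' * d ^ k') * (a ^ j * d ^ k)) * (d ^ p' * (b ^ e) ^ q') := by
    calc _ = x ^ i' * (a ^ j' * d ^ k' * x ^ i) * (a ^ j * d ^ k) := by simp only [mul_assoc]
      _ = x ^ i' * x ^ i * (a ^ j' * d ^ k') * ((d ^ p' * (b ^ e) ^ q') * (a ^ j * d ^ k)) := by
        rw [h2]; simp only [mul_assoc]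
      _ = _ := by rw [h.comm _ hs' _ hw]; simp only [mul_assoc]
  have e3 : d ^ (p + p') * (b ^ e) ^ (q + q') =
      (d ^ p' * (b ^ e) ^ q') * (d ^ p * (b ^ e) ^ q) := by
    rw [h.comm _ hs' _ hs, pow_add, pow_add, mul_assoc, mul_assoc, ← mul_assoc (d ^ p'),
      ← (h.be_comm q (d ^ p')).eq, mul_assoc]
  rw [e1, e2, e3, h.comm _ hw' _ hw, ← pow_add, ← pow_add, add_comm i' i]
  rw [mul_assoc _ (d ^ p' * (b ^ e) ^ q'), ← mul_assoc (d ^ p' * (b ^ e) ^ q'), h.sq _ hs', one_mul]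

/-- The squares lie in `⟨x ^ 2⟩⟨d, b ^ e⟩`. -/
theorem sq_eq (h : CyclicExtension E x a d b m e) (i j k : ℕ) :
    ∃ p q : ℕ, (x ^ i * a ^ j * d ^ k) ^ 2 = x ^ (2 * i) * (d ^ p * (b ^ e) ^ q) := by
  obtain ⟨p, q, h1⟩ := h.w_mul_x i j k
  refine ⟨p, q, ?_⟩
  calc (x ^ i * a ^ j * d ^ k) ^ 2 = x ^ i * (a ^ j * d ^ k * x ^ i) * (a ^ j * d ^ k) := by
        rw [pow_two]; simp only [mul_assoc]
    _ = x ^ i * x ^ i * ((a ^ j * d ^ k) * (d ^ p * (b ^ e) ^ q) * (a ^ j * d ^ k)) := by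
      rw [h1]; simp only [mul_assoc]
    _ = x ^ i * x ^ i * ((a ^ j * d ^ k) * (a ^ j * d ^ k) * (d ^ p * (b ^ e) ^ q)) := by
      rw [mul_assoc (a ^ j * d ^ k), h.comm _ (h.sE p q) _ (h.wE j k)]; simp only [mul_assoc]
    _ = _ := by rw [h.sq _ (h.wE j k), one_mul, ← pow_add, two_mul]

theorem pow_four_eq (h : CyclicExtension E x a d b m e) (i j k : ℕ) :
    (x ^ i * a ^ j * d ^ k) ^ 4 = x ^ (4 * i) := by
  obtain ⟨p, q, h1⟩ := h.sq_eq i j k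
  have h2 : Commute (x ^ (2 * i)) (d ^ p * (b ^ e) ^ q) :=
    ((h.x2n_d i).pow_right p).mul_right (h.be_comm q _).symm
  have h3 : (x ^ i * a ^ j * d ^ k) ^ 4 = ((x ^ i * a ^ j * d ^ k) ^ 2) ^ 2 := by rw [← pow_mul]
  rw [h3, h1, h2.mul_pow, pow_two (d ^ p * (b ^ e) ^ q), h.sq _ (h.sE p q), mul_one, ← pow_mul]
  congr 1; ring

theorem even_sq_eq (h : CyclicExtension E x a d b m e) (i j k : ℕ) :
    (x ^ (2 * i) * a ^ j * d ^ k) ^ 2 = x ^ (4 * i) * (b ^ e) ^ (i * j) := by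
  have hcc : ∀ q, (b ^ e) ^ q * (b ^ e) ^ q = 1 := fun q =>
    h.sq _ (E.pow_mem (E.pow_mem h.hbE e) q)
  have h1 : a ^ j * x ^ (2 * i) = x ^ (2 * i) * a ^ j * (b ^ e) ^ (i * j) := by
    induction j with
    | zero => simp
    | succ j ih =>
      have h2 : a * x ^ (2 * i) = x ^ (2 * i) * a * (b ^ e) ^ i := by
        rw [h.x2n_a, mul_assoc, mul_assoc, ← (h.be_comm i (x ^ (2 * i))).eq,
          ← mul_assoc ((b ^ e) ^ i), hcc, one_mul]
      calc a ^ (j + 1) * x ^ (2 * i) = a ^ j * (a * x ^ (2 * i)) := by rw [pow_succ, mul_assoc]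
        _ = a ^ j * x ^ (2 * i) * (a * (b ^ e) ^ i) := by rw [h2]; simp only [mul_assoc]
        _ = x ^ (2 * i) * a ^ j * ((b ^ e) ^ (i * j) * a) * (b ^ e) ^ i := by
          rw [ih]; simp only [mul_assoc]
        _ = x ^ (2 * i) * (a ^ j * a) * ((b ^ e) ^ (i * j) * (b ^ e) ^ i) := by
          rw [(h.be_comm (i * j) a).eq]; simp only [mul_assoc]
        _ = _ := by rw [← pow_succ, ← pow_add]; rfl
  calc (x ^ (2 * i) * a ^ j * d ^ k) ^ 2
      = x ^ (2 * i) * a ^ j * (d ^ k * x ^ (2 * i)) * (a ^ j * d ^ k) := by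
        rw [pow_two]; simp only [mul_assoc]
    _ = x ^ (2 * i) * (a ^ j * x ^ (2 * i)) * (d ^ k * (a ^ j * d ^ k)) := by
      rw [((h.x2n_d i).pow_right k).symm.eq]; simp only [mul_assoc]
    _ = x ^ (2 * i) * x ^ (2 * i) * a ^ j * ((b ^ e) ^ (i * j) * (d ^ k * (a ^ j * d ^ k))) := by
      rw [h1]; simp only [mul_assoc]
    _ = x ^ (2 * i) * x ^ (2 * i) * ((a ^ j * d ^ k) * (a ^ j * d ^ k)) * (b ^ e) ^ (i * j) := by
      rw [(h.be_comm (i * j) _).eq]; simp only [mul_assoc]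
    _ = _ := by rw [h.sq _ (h.wE j k), mul_one, ← pow_add]; congr 2; ring

theorem d_ne_b_pow (h : CyclicExtension E x a d b m e) (t : ℕ) : d ≠ b ^ t := by
  intro hd
  have h1 : x ^ (2 ^ (m - 1) * t) * a ^ 0 * d ^ 1 = 1 := by
    rw [pow_mul, h.hb, pow_zero, mul_one, pow_one, hd, h.sq _ (E.pow_mem h.hbE t)]
  exact absurd (h.indep _ _ _ h1).2 (by decide)

theorem d_ne_one (h : CyclicExtension E x a d b m e) : d ≠ 1 := by
  simpa using h.d_ne_b_pow 0

end CyclicExtension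

end CyclicExtension

/-! ### Automorphisms of odd order of cyclic extensions -/

section CyclicExtension

variable {P : Type*} [Group P]

/-- The special case of `mem_fixed_of_zpow_mul` where `N` is generated by an element commuting with
`g`. -/
theorem IsOddAut.mem_fixed_of_zpow_mul_of_commute (hP : IsPGroup 2 P) {R : Subgroup P} {f : P → P}
    (hf : IsOddAut R f) {g n : P} {i : ℤ} (hg : g ∈ R) (hn : n ∈ hf.fixed) (hgn : Commute g n)
    (h : f g = g ^ i * n) : g ∈ hf.fixed := by
  refine hf.mem_fixed_of_zpow_mul hP (N := Subgroup.zpowers n) (Subgroup.zpowers_le.2 hn) hg ?_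
    (Subgroup.mem_zpowers n) h
  refine Subgroup.mem_normalizer_iff.2 fun y => ?_
  have key : ∀ (g : P), Commute g n → ∀ y ∈ Subgroup.zpowers n, g * y * g⁻¹ = y := by
    rintro g hg _ ⟨k, rfl⟩
    exact mul_inv_eq_iff_eq_mul.2 (hg.zpow_right k)
  constructor
  · intro hy
    rw [key g hgn y hy]
    exact hy
  · intro hy
    have h1 := key g⁻¹ hgn.inv_left _ hy
    have h2 : g⁻¹ * (g * y * g⁻¹) * g⁻¹⁻¹ = y := by group
    rw [h2] at h1
    rw [h1]
    exact hy

namespace CyclicExtension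

variable {E : Subgroup P} {x a d b : P} {m e : ℕ}

theorem be_eq_one (h : CyclicExtension E x a d b m e) (hm : m < 3) : b ^ e = 1 := by
  rcases h.he with he | ⟨_, hm'⟩
  · rw [he, pow_zero]
  · omega

theorem dvd_of_dvd_odd_mul {k m i n : ℕ} (hi : Odd i) (h : 2 ^ m ∣ 2 ^ k * (i * n)) :
    2 ^ m ∣ 2 ^ k * n := by
  have h1 : 2 ^ k * (i * n) = i * (2 ^ k * n) := by ring
  rw [h1] at h
  exact Nat.Coprime.dvd_of_dvd_mul_left
    (Nat.Coprime.pow_left _ (Nat.coprime_two_left.2 hi)) h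

/-- In a cyclic extension the generator `x` may be replaced by any element of an odd coset of
`E⟨x ^ 2⟩`. -/
theorem exists_of_odd [Finite P] (hP : IsPGroup 2 P) (h : CyclicExtension E x a d b m e)
    {i : ℕ} (hi : Odd i) (j k : ℕ) :
    ∃ d' b' m' e', CyclicExtension E (x ^ i * a ^ j * d ^ k) a d' b' m' e' := by
  set g := x ^ i * a ^ j * d ^ k with hg
  have hm := h.two_le
  have hgen : ∀ y : P, ∃ n : ℕ, ∃ u ∈ E, y = g ^ n * u := by
    intro y
    have hx : x ∈ Subgroup.zpowers g ⊔ E := by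
      have h1 : x ^ i ∈ Subgroup.zpowers g ⊔ E := by
        have : x ^ i = g * (a ^ j * d ^ k)⁻¹ := by rw [hg]; group
        rw [this]
        exact Subgroup.mul_mem _ (Subgroup.mem_sup_left (Subgroup.mem_zpowers g))
          (Subgroup.mem_sup_right (E.inv_mem (h.wE j k)))
      exact (Subgroup.zpowers_le.2 h1) (mem_zpowers_pow_of_odd hP x hi)
    have hy : y ∈ Subgroup.zpowers g ⊔ E := by
      obtain ⟨p, q, r, rfl⟩ := h.gen y
      rw [mul_assoc]
      exact Subgroup.mul_mem _ (Subgroup.pow_mem _ hx p) (Subgroup.mem_sup_right (h.wE q r))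
    have := h.normal
    obtain ⟨s, hs, u, hu, rfl⟩ := Subgroup.mem_sup_of_normal_right.1 hy
    obtain ⟨n, rfl⟩ := exists_pow_eq_of_mem_zpowers hs
    exact ⟨n, u, hu, rfl⟩
  obtain ⟨p, q, hsq⟩ := h.sq_eq i j k
  rw [← hg] at hsq
  have hg4 : g ^ 4 = x ^ (4 * i) := h.pow_four_eq i j k
  have hbi : x ^ (2 ^ (m - 1) * i) = b := by
    rw [pow_mul, h.hb, pow_eq_self_of_odd h.b2 hi]
  refine exists_cyclicExtension hP h.normal h.comm h.sq h.card hgen ?_ h.ha ?_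
  -- `⟨g⟩` meets `E` nontrivially: it contains `x ^ (2 * i) * d ^ p` if `m = 2`, and `b` if `m ≥ 3`
  · rcases Nat.lt_or_ge m 3 with hm3 | hm3
    · have hm2 : m = 2 := by omega
      rw [h.be_eq_one hm3, one_pow, mul_one] at hsq
      have hx2 : x ^ (2 * i) = b := by
        rw [← hbi, hm2]; norm_num
      refine ⟨2, ?_, fun h1 => ?_⟩
      · rw [hsq, hx2]
        exact E.mul_mem h.hbE (E.pow_mem h.hd p)
      · rw [hsq] at h1
        have h2 := (h.indep (2 * i) 0 p (by rw [pow_zero, mul_one]; exact h1)).2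
        rw [pow_eq_one_of_even h.d2 h2, mul_one, hx2] at h1
        exact h.b_ne_one h1
    · refine ⟨2 ^ (m - 1), ?_⟩
      have h1 : g ^ 2 ^ (m - 1) = b := by
        have h2 : 2 ^ (m - 1) = 4 * 2 ^ (m - 3) := by
          rw [show m - 1 = 2 + (m - 3) by omega, pow_add]; norm_num
        rw [h2, pow_mul, hg4, ← pow_mul, ← hbi, h2]
        congr 1; ring
      rw [h1]
      exact ⟨h.hbE, h.b_ne_one⟩
  -- `[g, a] = d * (b ^ e) ^ s` is not a power `g ^ n`: as it has order two, `4` divides `n`, so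
  -- that `g ^ n` is a power of `x`, whereas `d ∉ ⟨x⟩`
  · obtain ⟨s, hs⟩ := hi
    have hcomm : g * a * g⁻¹ * a⁻¹ = d * (b ^ e) ^ s := by
      have h1 : g * a = a * (d * (b ^ e) ^ s) * g := by
        calc g * a = x ^ i * ((a ^ j * d ^ k) * a) := by rw [hg]; simp only [mul_assoc]
          _ = x ^ i * a * (a ^ j * d ^ k) := by rw [h.comm _ (h.wE j k) _ h.ha, mul_assoc]
          _ = a * (d * (b ^ e) ^ s) * x ^ i * (a ^ j * d ^ k) := by rw [hs, h.x_odd_a]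
          _ = _ := by rw [hg]; simp only [mul_assoc]
      have h2 : d * (b ^ e) ^ s ∈ E := E.mul_mem h.hd (E.pow_mem (E.pow_mem h.hbE e) s)
      rw [h1, h.comm _ h.ha _ h2]
      group
    rw [hcomm]
    intro hmem
    obtain ⟨n, hn⟩ := exists_pow_eq_of_mem_zpowers hmem
    have hD : (d * (b ^ e) ^ s) * (d * (b ^ e) ^ s) = 1 :=
      h.sq _ (E.mul_mem h.hd (E.pow_mem (E.pow_mem h.hbE e) s))
    have h2n : g ^ (2 * n) = 1 := by rw [two_mul, pow_add, ← hn, hD]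
    have h4n : 2 ^ m ∣ 2 ^ 2 * n := by
      have h1 : x ^ (2 ^ 2 * (i * n)) = 1 := by
        have : 2 ^ 2 * (i * n) = 4 * i * n := by ring
        rw [this, pow_mul, ← hg4, ← pow_mul]
        have : 4 * n = 2 * n * 2 := by ring
        rw [this, pow_mul, h2n, one_pow]
      exact dvd_of_dvd_odd_mul ⟨s, hs⟩ (h.pow_eq_one_iff.1 h1)
    rcases Nat.lt_or_ge m 3 with hm3 | hm3
    · have hm2 : m = 2 := by omega
      rw [h.be_eq_one hm3, one_pow, mul_one] at hn hsq
      have hcd : Commute (x ^ (2 * i)) (d ^ p) := (h.x2n_d i).pow_right p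
      have h3 : x ^ (2 * i * n) * a ^ 0 * d ^ (p * n) = 1 := by
        rw [pow_zero, mul_one, pow_mul x (2 * i) n, pow_mul d p n, ← hcd.mul_pow, ← hsq,
          ← pow_mul, h2n]
      have h4 := (h.indep _ _ _ h3).2
      rw [pow_eq_one_of_even h.d2 h4, pow_zero, mul_one, mul_one, h.pow_eq_one_iff, hm2] at h3
      have h5 : 2 ∣ n := by
        have h6 : 2 ^ 2 ∣ 2 ^ 1 * n := by
          refine dvd_of_dvd_odd_mul ⟨s, hs⟩ ?_
          rw [pow_one, ← mul_assoc]; exact h3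
        omega
      obtain ⟨t, rfl⟩ := h5
      rw [pow_mul, hsq, hcd.mul_pow] at hn
      have h6 : x ^ (2 * i * t) * a ^ 0 * d ^ (p * t + 1) = 1 := by
        rw [pow_zero, mul_one, pow_mul x, pow_add, pow_one, pow_mul d, ← mul_assoc, ← hn, h.d2]
      have h7 := (h.indep _ _ _ h6).2
      rw [pow_eq_one_of_even h.d2 h7, pow_zero, mul_one, mul_one, h.pow_eq_one_iff, hm2] at h6
      have h8 : 2 ∣ t := by
        have h6 : 2 ^ 2 ∣ 2 ^ 1 * t := by
          refine dvd_of_dvd_odd_mul ⟨s, hs⟩ ?_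
          rw [pow_one, ← mul_assoc]; exact h6
        omega
      obtain ⟨r, rfl⟩ := h8
      rw [Nat.even_add_one] at h7
      exact h7 ⟨p * r, by ring⟩
    · have h4 : 4 ∣ 2 * n := by
        have : 2 ^ m = 8 * 2 ^ (m - 3) := by
          rw [show m = 3 + (m - 3) by omega, pow_add]; norm_num
        rw [this] at h4n
        obtain ⟨r, hr⟩ := h4n
        exact ⟨2 ^ (m - 3) * r, by nlinarith⟩
      obtain ⟨t, rfl⟩ : 2 ∣ n := by omega
      have h5 : x ^ (4 * i * t) = 1 := by
        rw [pow_mul, ← hg4, ← pow_mul, ← h2n]; congr 1; ring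
      have h6 : 2 ^ m ∣ 2 ^ 2 * t := by
        refine dvd_of_dvd_odd_mul ⟨s, hs⟩ ?_
        rw [← h.pow_eq_one_iff, ← h5]; congr 1; ring
      obtain ⟨r, rfl⟩ : 2 ∣ t := by
        have : 2 ^ m = 8 * 2 ^ (m - 3) := by
          rw [show m = 3 + (m - 3) by omega, pow_add]; norm_num
        rw [this] at h6
        obtain ⟨r, hr⟩ := h6
        exact ⟨2 ^ (m - 3) * r, by nlinarith⟩
      have h7 : d * (b ^ e) ^ s = x ^ (4 * i * r) := by
        rw [hn, pow_mul x, ← hg4, ← pow_mul]; congr 1; ring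
      have h8 : x ^ (4 * i * r + 2 ^ (m - 1) * (e * s)) * a ^ 0 * d ^ 1 = 1 := by
        rw [pow_add, pow_mul x (2 ^ (m - 1)), h.hb, pow_mul b, ← h7, pow_zero, mul_one, pow_one,
          mul_assoc d, h.sq _ (E.pow_mem (E.pow_mem h.hbE e) s), mul_one, h.d2]
      exact absurd (h.indep _ _ _ h8).2 (by decide)

variable (hP : IsPGroup 2 P) {R : Subgroup P} {f : P → P}

include hP in
/-- An automorphism of odd order of `P` is trivial, provided that `[P, P] = ⟨d⟩`. -/
theorem fixed_top_of_zero (h : CyclicExtension E x a d b m 0) (hf : IsOddAut ⊤ f) (r : P) :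
    r ∈ hf.fixed := by
  have hT : ∀ r : P, r ∈ (⊤ : Subgroup P) := fun _ => trivial
  have hmul : ∀ r s, f (r * s) = f r * f s := fun r s => hf.map_mul r trivial s trivial
  -- `f d = [f x, f a]` lies in `[P, P] = ⟨d⟩`
  have hd : d ∈ hf.fixed := by
    obtain ⟨p, q, hpq⟩ := h.mul_comm' (f x) (f a)
    rw [pow_zero, one_pow, mul_one] at hpq
    have h1 : x * a = a * (x * d) := by
      rw [h.xa, h.xd, pow_zero, mul_one, mul_assoc]
    have h2 : f a * f x * f d = f a * f x * d ^ p := by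
      rw [← hpq, ← hmul, ← hmul, ← hmul, h1, mul_assoc]
    refine hf.mem_fixed_of_zpow hP (i := p) (hT d) ?_
    rw [mul_left_cancel h2, zpow_natCast]
  have hsurj : ∀ r, ∃ s, f s = r := by
    intro r
    obtain ⟨k, ⟨l, rfl⟩, hk⟩ := hf.odd
    exact ⟨f^[2 * l] r, (Function.iterate_succ_apply' f (2 * l) r).symm.trans (hk r trivial)⟩
  have hc0 : ∀ q : ℕ, (b ^ 0) ^ q = 1 := fun q => by rw [pow_zero, one_pow]
  -- `f b` is a central involution, and these are contained in `⟨b, d⟩`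
  have hb : b ∈ hf.fixed := by
    obtain ⟨i, j, k, hijk⟩ := h.gen (f b)
    have hcomm : ∀ r, f b * r = r * f b := by
      intro r
      obtain ⟨s, rfl⟩ := hsurj r
      rw [← hmul, ← hmul, (h.b_comm s).eq]
    have hdc : ∀ r, Commute d r := by
      intro r
      obtain ⟨i, j, k, rfl⟩ := h.gen r
      have h1 : Commute d x := by
        have := h.xd
        rw [pow_zero, mul_one] at this
        exact this.symm
      exact ((h1.pow_right i).mul_right
        ((show Commute d a from h.comm _ h.hd _ h.ha).pow_right j)).mul_right
        ((Commute.refl d).pow_right k)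
    have hj : a ^ j = 1 := by
      rcases pow_eq_one_or_self h.a2 j with hj | hj
      · exact hj
      exfalso
      have h1 := hcomm x
      rw [hijk, hj] at h1
      have h2 : a * x = x * a := by
        apply mul_left_cancel (a := x ^ i)
        apply mul_right_cancel (b := d ^ k)
        calc x ^ i * (a * x) * d ^ k = x ^ i * a * (x * d ^ k) := by simp only [mul_assoc]
          _ = x ^ i * a * d ^ k * x := by
            rw [((hdc x).symm.pow_right k).eq]; simp only [mul_assoc]
          _ = (x * x ^ i) * a * d ^ k := by rw [h1]; simp only [mul_assoc]
          _ = _ := by rw [((Commute.refl x).pow_right i).eq]; simp only [mul_assoc]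
      rw [h.xa] at h2
      have h3 : a * x * d = a * x := by
        conv_rhs => rw [h2]
        rw [mul_assoc, mul_assoc, (hdc x).eq]
      exact h.d_ne_one (mul_eq_left.1 h3)
    have hi : Even i := by
      by_contra hi
      obtain ⟨s, rfl⟩ := Nat.not_even_iff_odd.1 hi
      have h1 := hcomm a
      rw [hijk, hj, mul_one] at h1
      have h2 : x ^ (2 * s + 1) * a = a * x ^ (2 * s + 1) := by
        apply mul_right_cancel (b := d ^ k)
        rw [mul_assoc, ← ((hdc a).pow_left k).eq, ← mul_assoc, h1, mul_assoc]
      rw [h.x_odd_a, hc0, mul_one] at h2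
      have h3 := mul_right_cancel h2
      exact h.d_ne_one (mul_eq_left.1 h3)
    obtain ⟨s, rfl⟩ := hi.two_dvd
    have h2 : (f b) ^ 2 = 1 := by
      rw [← hf.map_pow (hT b), pow_two, h.b2, hf.map_one]
    rw [hijk, h.even_sq_eq, hc0, mul_one] at h2
    obtain ⟨t, ht⟩ := h.eq_b_pow_of_sq (i := 2 * s) (by rw [← h2]; congr 1; ring)
    rw [hj, mul_one, ht] at hijk
    refine hf.mem_fixed_of_zpow_mul_of_commute hP (i := t) (hT b) (hf.fixed.pow_mem hd k)
      (h.b_comm _) ?_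
    rw [hijk, zpow_natCast]
  -- the involution `f a` is of the form `b ^ t * a ^ j * d ^ k`
  have ha : a ∈ hf.fixed := by
    obtain ⟨i, j, k, hijk⟩ := h.gen (f a)
    have h2 : (f a) ^ 2 = 1 := by
      rw [← hf.map_pow (hT a), pow_two, h.a2, hf.map_one]
    obtain ⟨p, q, hpq⟩ := h.sq_eq i j k
    rw [hijk, hpq, hc0, mul_one] at h2
    have h3 := (h.indep (2 * i) 0 p (by rw [pow_zero, mul_one]; exact h2)).2
    rw [pow_eq_one_of_even h.d2 h3, mul_one] at h2
    obtain ⟨t, ht⟩ := h.eq_b_pow_of_sq h2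
    refine hf.mem_fixed_of_sq hP (i := j) (n := d ^ k * b ^ t) (hT a) ?_
      (hf.fixed.mul_mem (hf.fixed.pow_mem hd k) (hf.fixed.pow_mem hb t)) ?_
    · rw [pow_two, h.a2]; exact hf.fixed.one_mem
    · rw [hijk, ht, zpow_natCast, mul_assoc, ((h.b_comm _).pow_left t).eq, mul_assoc]
  have hEfix : E ≤ hf.fixed := by
    intro u hu
    obtain ⟨i, j, k, rfl⟩ := h.form u hu
    exact hf.fixed.mul_mem (hf.fixed.mul_mem (hf.fixed.pow_mem ha i) (hf.fixed.pow_mem hd j))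
      (hf.fixed.pow_mem hb k)
  have hx : x ∈ hf.fixed := by
    obtain ⟨i, j, k, hijk⟩ := h.gen (f x)
    have := h.normal
    refine hf.mem_fixed_of_zpow_mul hP hEfix (i := i) (n := a ^ j * d ^ k) (hT x) ?_ (h.wE j k) ?_
    · rw [Subgroup.normalizer_eq_top]; trivial
    · rw [hijk, zpow_natCast, mul_assoc]
  obtain ⟨i, j, k, rfl⟩ := h.gen r
  exact hf.fixed.mul_mem (hf.fixed.mul_mem (hf.fixed.pow_mem hx i) (hf.fixed.pow_mem ha j))
    (hf.fixed.pow_mem hd k)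

/-- For `e = 1` the involution `b` is a power of `x ^ 4`. -/
theorem x4_pow_eq_b (h : CyclicExtension E x a d b m 1) : (x ^ 4) ^ 2 ^ (m - 3) = b := by
  have hm : 3 ≤ m := by
    rcases h.he with h0 | h0
    · norm_num at h0
    · exact h0.2
  rw [← h.hb, ← pow_mul]
  congr 1
  rw [show m - 1 = 2 + (m - 3) by omega, pow_add]; norm_num

theorem three_le (h : CyclicExtension E x a d b m 1) : 3 ≤ m := by
  rcases h.he with h0 | h0
  · norm_num at h0
  · exact h0.2

include hP in
/-- An automorphism of odd order of `P` is trivial, also if `[P, P] = ⟨d, b⟩`: the elements `x ^ 4`,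
`b`, `d`, `x ^ 2`, `a` and `x` are fixed, one after the other. -/
theorem fixed_top_of_one (h : CyclicExtension E x a d b m 1) (hf : IsOddAut ⊤ f) (r : P) :
    r ∈ hf.fixed := by
  have hm := h.three_le
  have hT : ∀ r : P, r ∈ (⊤ : Subgroup P) := fun _ => trivial
  have hmul : ∀ r s, f (r * s) = f r * f s := fun r s => hf.map_mul r trivial s trivial
  have hx4 : x ^ 4 ∈ hf.fixed := by
    obtain ⟨i, j, k, hijk⟩ := h.gen (f x)
    refine hf.mem_fixed_of_zpow hP (i := i) (hT _) ?_
    rw [hf.map_pow (hT x), hijk, h.pow_four_eq, pow_mul, zpow_natCast]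
  have hb : b ∈ hf.fixed := by
    rw [← h.x4_pow_eq_b]; exact hf.fixed.pow_mem hx4 _
  have hd : d ∈ hf.fixed := by
    obtain ⟨p, q, hpq⟩ := h.mul_comm' (f x) (f a)
    rw [pow_one] at hpq
    have h1 : x * a = a * x * (d * b) := by
      rw [mul_assoc a x, ← mul_assoc x d, h.xd, pow_one, h.xa]
      rw [mul_assoc (d * b), h.xb.eq, mul_assoc d b, ← mul_assoc b b, h.b2, one_mul, mul_assoc]
    have h2 : f a * f x * (f d * b) = f a * f x * (d ^ p * b ^ q) := by
      rw [← hpq, ← hmul x a, h1, hmul (a * x) (d * b), hmul a x, hmul d b, hb.2]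
    have h3 := mul_left_cancel h2
    refine hf.mem_fixed_of_sq hP (i := p) (n := b ^ q * b) (hT d) ?_
      (hf.fixed.mul_mem (hf.fixed.pow_mem hb q) hb) ?_
    · rw [pow_two, h.d2]; exact hf.fixed.one_mem
    · rw [zpow_natCast, ← mul_assoc, ← h3, mul_assoc, h.b2, mul_one]
  have hx2 : x ^ 2 ∈ hf.fixed := by
    obtain ⟨i, j, k, hijk⟩ := h.gen (f x)
    obtain ⟨p, q, hpq⟩ := h.sq_eq i j k
    rw [pow_one] at hpq
    refine hf.mem_fixed_of_zpow_mul_of_commute hP (i := i) (n := d ^ p * b ^ q) (hT _)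
      (hf.fixed.mul_mem (hf.fixed.pow_mem hd p) (hf.fixed.pow_mem hb q))
      ((h.x2d.pow_right p).mul_right ((h.b_comm _).symm.pow_right q)) ?_
    rw [hf.map_pow (hT x), hijk, hpq, pow_mul, zpow_natCast]
  have ha : a ∈ hf.fixed := by
    obtain ⟨i, j, k, hijk⟩ := h.gen (f a)
    -- `f a` commutes with `f d = d`, and odd powers of `x` do not
    have hcd : f a * d = d * f a := by
      have : f (a * d) = f (d * a) := by rw [h.comm _ h.ha _ h.hd]
      rwa [hmul, hmul, hd.2] at this
    have hi : Even i := by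
      by_contra hi
      obtain ⟨s, rfl⟩ := Nat.not_even_iff_odd.1 hi
      have h1 : d * b * f a = d * f a := by
        calc d * b * f a = d * b * x ^ (2 * s + 1) * (a ^ j * d ^ k) := by
              rw [hijk]; simp only [mul_assoc]
          _ = x ^ (2 * s + 1) * (d * (a ^ j * d ^ k)) := by
              have := h.x_odd_d s
              rw [pow_one] at this
              rw [← this, mul_assoc]
          _ = x ^ (2 * s + 1) * ((a ^ j * d ^ k) * d) := by
              rw [h.comm _ (h.wE j k) _ h.hd]
          _ = f a * d := by rw [hijk]; simp only [mul_assoc]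
          _ = d * f a := hcd
      have h2 := mul_right_cancel h1
      exact h.b_ne_one (mul_eq_left.1 h2)
    obtain ⟨s, rfl⟩ := hi.two_dvd
    obtain ⟨p, q, hpq⟩ := h.w_mul_x (2 * s) j k
    have hxs : x ^ (2 * s) ∈ hf.fixed := by rw [pow_mul]; exact hf.fixed.pow_mem hx2 s
    have hs : d ^ p * (b ^ 1) ^ q ∈ hf.fixed := by
      rw [pow_one]
      exact hf.fixed.mul_mem (hf.fixed.pow_mem hd p) (hf.fixed.pow_mem hb q)
    refine hf.mem_fixed_of_sq hP (i := j) (n := d ^ k * x ^ (2 * s) * (d ^ p * (b ^ 1) ^ q)⁻¹)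
      (hT a) ?_ (hf.fixed.mul_mem (hf.fixed.mul_mem (hf.fixed.pow_mem hd k) hxs)
        (hf.fixed.inv_mem hs)) ?_
    · rw [pow_two, h.a2]; exact hf.fixed.one_mem
    · rw [zpow_natCast, ← mul_assoc, ← mul_assoc, hpq, hijk, mul_assoc (x ^ (2 * s))]
      group
  have hx : x ∈ hf.fixed := by
    obtain ⟨i, j, k, hijk⟩ := h.gen (f x)
    refine hf.mem_fixed_of_sq hP (i := i) (n := a ^ j * d ^ k) (hT x) hx2
      (hf.fixed.mul_mem (hf.fixed.pow_mem ha j) (hf.fixed.pow_mem hd k)) ?_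
    rw [hijk, zpow_natCast, mul_assoc]
  obtain ⟨i, j, k, rfl⟩ := h.gen r
  exact hf.fixed.mul_mem (hf.fixed.mul_mem (hf.fixed.pow_mem hx i) (hf.fixed.pow_mem ha j))
    (hf.fixed.pow_mem hd k)

end CyclicExtension

end CyclicExtension

/-! ### Subgroups with automorphisms of odd order -/

section Enumeration

variable {P : Type*} [Group P]

namespace CyclicExtension

variable {E : Subgroup P} {x a d b : P} {m e : ℕ}

theorem odd_not_dvd {i k : ℕ} (hi : Odd i) (h : 2 ^ m ∣ 2 ^ k * i) : m ≤ k := by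
  have h1 : 2 ^ m ∣ 2 ^ k :=
    (Nat.Coprime.pow_left _ (Nat.coprime_two_left.2 hi)).dvd_of_dvd_mul_right h
  exact (Nat.pow_dvd_pow_iff_le_right (by norm_num)).1 h1

theorem w_cases (h : CyclicExtension E x a d b m e) (j k : ℕ) :
    a ^ j * d ^ k = 1 ∨ a ^ j * d ^ k = d ∨ a ^ j * d ^ k = a ∨ a ^ j * d ^ k = a * d := by
  rcases pow_eq_one_or_self h.a2 j with hj | hj <;>
  rcases pow_eq_one_or_self h.d2 k with hk | hk <;> rw [hj, hk] <;> simp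

theorem b_mem_zpowers_sq (h : CyclicExtension E x a d b m e) : b ∈ Subgroup.zpowers (x ^ 2) := by
  have := h.two_le
  have h1 : (x ^ 2) ^ 2 ^ (m - 2) = b := by
    rw [← pow_mul, ← h.hb]
    congr 1
    rw [← pow_succ']
    congr 1; omega
  rw [← h1]
  exact Subgroup.pow_mem _ (Subgroup.mem_zpowers _) _

theorem sq_mem_zpowers (h : CyclicExtension E x a d b m e) (i k : ℕ) :
    (x ^ i * d ^ k) ^ 2 ∈ Subgroup.zpowers (x ^ 2) := by
  have hxi : x ^ i * x ^ i ∈ Subgroup.zpowers (x ^ 2) :=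
    ⟨i, by
      change (x ^ 2) ^ (i : ℤ) = _
      rw [zpow_natCast, ← pow_mul, ← pow_add]; congr 1; ring⟩
  rw [pow_two (x ^ i * d ^ k)]
  rcases pow_eq_one_or_self h.d2 k with hk | hk <;> rw [hk]
  · rwa [mul_one]
  rcases Nat.even_or_odd' i with ⟨s, rfl | rfl⟩
  · have : x ^ (2 * s) * d * (x ^ (2 * s) * d) = x ^ (2 * s) * x ^ (2 * s) := by
      rw [(h.x2n_d s).eq, mul_assoc, ← mul_assoc _ d, (h.x2n_d s).eq, ← mul_assoc, ← mul_assoc,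
        h.d2, one_mul]
    rwa [this]
  · have : x ^ (2 * s + 1) * d * (x ^ (2 * s + 1) * d) =
        b ^ e * (x ^ (2 * s + 1) * x ^ (2 * s + 1)) := by
      calc _ = d * b ^ e * x ^ (2 * s + 1) * (d * b ^ e * x ^ (2 * s + 1)) := by rw [h.x_odd_d]
        _ = d * b ^ e * (x ^ (2 * s + 1) * d) * (b ^ e * x ^ (2 * s + 1)) := by
          simp only [mul_assoc]
        _ = d * (b ^ e * d) * b ^ e * (x ^ (2 * s + 1) * b ^ e) * x ^ (2 * s + 1) := by
          rw [h.x_odd_d]; simp only [mul_assoc]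
        _ = (d * d) * (b ^ e * b ^ e) * b ^ e * (x ^ (2 * s + 1) * x ^ (2 * s + 1)) := by
          rw [((h.b_comm d).pow_left e).eq, ((h.b_comm (x ^ (2 * s + 1))).pow_left e).symm.eq]
          simp only [mul_assoc]
        _ = _ := by rw [h.d2, h.sq _ (E.pow_mem h.hbE e), one_mul, one_mul]
    rw [this]
    exact Subgroup.mul_mem _ (Subgroup.pow_mem _ h.b_mem_zpowers_sq e) hxi

variable (hP : IsPGroup 2 P) {R : Subgroup P} {f : P → P}

include hP

/-- A subgroup `R` containing `x` is `P` or `⟨x, d⟩` or `⟨x⟩`, and has no nontrivial automorphism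
of odd order. -/
theorem fixed_of_mem (h : CyclicExtension E x a d b m e) (hx : x ∈ R) (hf : IsOddAut R f) :
    ∀ r ∈ R, r ∈ hf.fixed := by
  have hb : b ∈ R := by rw [← h.hb]; exact R.pow_mem hx _
  have hbe : b ^ e ∈ R := R.pow_mem hb e
  have hfull : a ∈ R → ∀ r ∈ R, r ∈ hf.fixed := by
    intro ha
    have hd : d ∈ R := by
      have : d = a⁻¹ * (x * a * x⁻¹) := by rw [h.xa]; group
      rw [this]
      exact R.mul_mem (R.inv_mem ha) (R.mul_mem (R.mul_mem hx ha) (R.inv_mem hx))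
    have hR : R = ⊤ := by
      refine top_unique fun r _ => ?_
      obtain ⟨i, j, k, rfl⟩ := h.gen r
      exact R.mul_mem (R.mul_mem (R.pow_mem hx i) (R.pow_mem ha j)) (R.pow_mem hd k)
    subst hR
    intro r _
    rcases h.he with he | ⟨he, -⟩ <;> subst he
    · exact h.fixed_top_of_zero hP hf r
    · exact h.fixed_top_of_one hP hf r
  have hw : ∀ i j k, x ^ i * a ^ j * d ^ k ∈ R → a ^ j * d ^ k ∈ R := by
    intro i j k hr
    rw [mul_assoc] at hr
    exact (R.mul_mem_cancel_left (R.pow_mem hx i)).1 hr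
  -- `R` is determined by its intersection with the transversal `1`, `d`, `a`, `a * d` of `⟨x⟩`
  by_cases ha : a ∈ R
  · exact hfull ha
  by_cases had : a * d ∈ R
  · refine hfull ?_
    have h1 : x * (a * d) * x⁻¹ = a * b ^ e := by
      calc x * (a * d) * x⁻¹ = x * a * d * x⁻¹ := by simp only [mul_assoc]
        _ = a * d * (x * d) * x⁻¹ := by rw [h.xa]; simp only [mul_assoc]
        _ = a * (d * d) * b ^ e := by rw [h.xd]; group
        _ = _ := by rw [h.d2, mul_one]
    have h2 := R.mul_mem (R.mul_mem hx had) (R.inv_mem hx)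
    rw [h1] at h2
    exact (R.mul_mem_cancel_right hbe).1 h2
  by_cases hd : d ∈ R
  · have hform : ∀ r ∈ R, ∃ i k, r = x ^ i * d ^ k := by
      intro r hr
      obtain ⟨i, j, k, rfl⟩ := h.gen r
      rcases pow_eq_one_or_self h.a2 j with hj | hj
      · exact ⟨i, k, by rw [hj, mul_one]⟩
      · have h1 := hw i j k hr
        rw [hj] at h1
        exact absurd ((R.mul_mem_cancel_right (R.pow_mem hd k)).1 h1) ha
    have hx2 : x ^ 2 ∈ hf.fixed := by
      obtain ⟨i, k, hik⟩ := hform _ (hf.maps x hx)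
      obtain ⟨t, ht⟩ := h.sq_mem_zpowers i k
      refine hf.mem_fixed_of_zpow hP (i := t) (R.pow_mem hx 2) ?_
      rw [hf.map_pow hx, hik, ← ht]
    have hdf : d ∈ hf.fixed := by
      obtain ⟨i, k, hik⟩ := hform _ (hf.maps d hd)
      rcases Nat.even_or_odd' i with ⟨s, rfl | rfl⟩
      · refine hf.mem_fixed_of_sq hP (i := k) (n := x ^ (2 * s)) hd ?_ ?_ ?_
        · rw [pow_two, h.d2]; exact hf.fixed.one_mem
        · rw [pow_mul]; exact hf.fixed.pow_mem hx2 s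
        · rw [hik, zpow_natCast, ((h.x2n_d s).pow_right k).eq]
      -- the elements of odd cosets are not involutions, as `m ≥ 2`
      · exfalso
        have h2 : (f d) ^ 2 = 1 := by rw [← hf.map_pow hd, pow_two, h.d2, hf.map_one]
        have h4 : (f d) ^ 4 = 1 := by
          have : (f d) ^ 4 = ((f d) ^ 2) ^ 2 := by rw [← pow_mul]
          rw [this, h2, one_pow]
        have h5 : f d = x ^ (2 * s + 1) * a ^ 0 * d ^ k := by rw [hik, pow_zero, mul_one]
        rw [h5, h.pow_four_eq, h.pow_eq_one_iff] at h4
        have h6 : m ≤ 2 := odd_not_dvd (i := 2 * s + 1) ⟨s, rfl⟩ h4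
        have hm : m = 2 := le_antisymm h6 h.two_le
        obtain ⟨p, q, hpq⟩ := h.sq_eq (2 * s + 1) 0 k
        rw [← h5, h2, h.be_eq_one (by omega), one_pow, mul_one] at hpq
        have h7 : x ^ (2 * (2 * s + 1)) * a ^ 0 * d ^ p = 1 := by
          rw [pow_zero, mul_one, ← hpq]
        rw [pow_eq_one_of_even h.d2 (h.indep _ _ _ h7).2, pow_zero, mul_one, mul_one,
          h.pow_eq_one_iff] at h7
        have : m ≤ 1 := odd_not_dvd (i := 2 * s + 1) ⟨s, rfl⟩ (by simpa using h7)
        omega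
    have hxf : x ∈ hf.fixed := by
      obtain ⟨i, k, hik⟩ := hform _ (hf.maps x hx)
      exact hf.mem_fixed_of_sq hP (i := i) hx hx2 (hf.fixed.pow_mem hdf k)
        (by rw [hik, zpow_natCast])
    intro r hr
    obtain ⟨i, k, rfl⟩ := hform r hr
    exact hf.fixed.mul_mem (hf.fixed.pow_mem hxf i) (hf.fixed.pow_mem hdf k)
  · have hform : ∀ r ∈ R, ∃ i, r = x ^ i := by
      intro r hr
      obtain ⟨i, j, k, rfl⟩ := h.gen r
      refine ⟨i, ?_⟩
      have h1 := hw i j k hr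
      rw [mul_assoc]
      rcases h.w_cases j k with h2 | h2 | h2 | h2 <;> rw [h2] at h1 ⊢
      · rw [mul_one]
      · exact absurd h1 hd
      · exact absurd h1 ha
      · exact absurd h1 had
    have hxf : x ∈ hf.fixed := by
      obtain ⟨i, hi⟩ := hform _ (hf.maps x hx)
      exact hf.mem_fixed_of_zpow hP (i := i) hx (by rw [hi, zpow_natCast])
    intro r hr
    obtain ⟨i, rfl⟩ := hform r hr
    exact hf.fixed.pow_mem hxf i

/-- Any element of an odd coset of `E⟨x ^ 2⟩` can play the role of `x` in `fixed_of_mem`. -/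
theorem fixed_of_odd_mem [Finite P] (h : CyclicExtension E x a d b m e) {i j k : ℕ} (hi : Odd i)
    (hr : x ^ i * a ^ j * d ^ k ∈ R) (hf : IsOddAut R f) : ∀ r ∈ R, r ∈ hf.fixed := by
  obtain ⟨d', b', m', e', h'⟩ := h.exists_of_odd hP hi j k
  exact h'.fixed_of_mem hP hr hf

/-- A subgroup with a nontrivial automorphism of odd order is contained in `E⟨x ^ 2⟩`. -/
theorem forall_even [Finite P] (h : CyclicExtension E x a d b m e) (hf : IsOddAut R f)
    (hne : ∃ r ∈ R, r ∉ hf.fixed) : ∀ r ∈ R, ∃ i j k : ℕ, r = x ^ (2 * i) * a ^ j * d ^ k := by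
  intro r hr
  obtain ⟨i, j, k, rfl⟩ := h.gen r
  rcases Nat.even_or_odd' i with ⟨s, rfl | rfl⟩
  · exact ⟨s, j, k, rfl⟩
  · obtain ⟨r, hr', hne⟩ := hne
    exact absurd (h.fixed_of_odd_mem hP ⟨s, rfl⟩ hr hf r hr') hne

omit hP in
/-- For `e = 0` the centralizer of `a` is the maximal subgroup `E⟨x ^ 2⟩`. -/
theorem mem_centralizer_iff (h : CyclicExtension E x a d b m 0) (g : P) :
    g ∈ Subgroup.centralizer {a} ↔ ∃ i j k : ℕ, g = x ^ (2 * i) * a ^ j * d ^ k := by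
  have had : Commute a d := h.comm _ h.ha _ h.hd
  have h2 : ∀ i, Commute (x ^ (2 * i)) a := by
    intro i
    have := h.x2n_a i
    rw [pow_zero, one_pow, mul_one] at this
    exact this
  rw [Subgroup.mem_centralizer_singleton_iff]
  constructor
  · intro hg
    obtain ⟨i, j, k, rfl⟩ := h.gen g
    rcases Nat.even_or_odd' i with ⟨s, rfl | rfl⟩
    · exact ⟨s, j, k, rfl⟩
    · exfalso
      have hw : a ^ j * d ^ k * a = a * (a ^ j * d ^ k) := h.comm _ (h.wE j k) _ h.ha
      rw [mul_assoc (x ^ _), mul_assoc (x ^ _), hw, ← mul_assoc, ← mul_assoc a] at hg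
      have h3 := mul_right_cancel hg
      rw [h.x_odd_a, pow_zero, one_pow, mul_one] at h3
      have h4 := mul_right_cancel h3
      exact h.d_ne_one (mul_eq_left.1 h4)
  · rintro ⟨i, j, k, rfl⟩
    exact (((h2 i).mul_left ((Commute.refl a).pow_left j)).mul_left (had.symm.pow_left k)).eq

omit hP in
theorem centralizer_comm (h : CyclicExtension E x a d b m 0) :
    ∀ r ∈ Subgroup.centralizer {a}, ∀ s ∈ Subgroup.centralizer {a}, r * s = s * r := by
  have had : Commute a d := h.comm _ h.ha _ h.hd
  have h2 : ∀ i, Commute (x ^ (2 * i)) a := by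
    intro i
    have := h.x2n_a i
    rw [pow_zero, one_pow, mul_one] at this
    exact this
  have key : ∀ s, Commute s a → Commute s d → (∀ i, Commute s (x ^ (2 * i))) →
      ∀ r ∈ Subgroup.centralizer {a}, Commute s r := by
    intro s h1 h3 h4 r hr
    obtain ⟨i, j, k, rfl⟩ := (h.mem_centralizer_iff r).1 hr
    exact ((h4 i).mul_right (h1.pow_right j)).mul_right (h3.pow_right k)
  intro r hr s hs
  exact (key r (key a (Commute.refl a) had (fun i => (h2 i).symm) r hr).symm
    (key d had.symm (Commute.refl d) (fun i => (h.x2n_d i).symm) r hr).symm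
    (fun i => (key _ (h2 i) (h.x2n_d i)
      (fun i' => (Commute.refl x).pow_pow _ _) r hr).symm) s hs).eq

/-- If `[P, P] = ⟨d⟩`, then the only self-centralizing subgroup that may have an automorphism of
odd order is the abelian maximal subgroup `C(a) = E⟨x ^ 2⟩`. -/
theorem eq_centralizer [Finite P] (h : CyclicExtension E x a d b m 0) (hf : IsOddAut R f)
    (hne : ∃ r ∈ R, r ∉ hf.fixed) (hR : Subgroup.centralizer (R : Set P) ≤ R) :
    R = Subgroup.centralizer {a} := by
  have hle : R ≤ Subgroup.centralizer {a} := fun r hr =>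
    (h.mem_centralizer_iff r).2 (h.forall_even hP hf hne r hr)
  refine le_antisymm hle fun q hq => hR ?_
  rw [Subgroup.mem_centralizer_iff]
  intro r hr
  exact h.centralizer_comm r (hle hr) q hq

/-- An abelian group `R = ⟨g⟩⟨d⟩` with `g ^ 2 ≠ 1` has no nontrivial automorphism of odd order: the
group of squares `⟨g ^ 2⟩` is cyclic and therefore fixed. -/
theorem fixed_of_two_gen [Finite P] (h : CyclicExtension E x a d b m e) (hf : IsOddAut R f) {g : P}
    (hg : g ∈ R) (hd : d ∈ R) (hgd : Commute g d) (hform : ∀ r ∈ R, ∃ i k : ℕ, r = g ^ i * d ^ k)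
    (hg2 : g ^ 2 ≠ 1) : ∀ r ∈ R, r ∈ hf.fixed := by
  have hg2f : g ^ 2 ∈ hf.fixed := by
    obtain ⟨i, k, hik⟩ := hform _ (hf.maps g hg)
    refine hf.mem_fixed_of_zpow hP (i := i) (R.pow_mem hg 2) ?_
    rw [hf.map_pow hg, hik, (hgd.pow_pow i k).mul_pow, ← pow_mul d, mul_comm k, pow_mul d,
      pow_two d, h.d2, one_pow, mul_one, ← pow_mul, mul_comm, pow_mul, zpow_natCast]
  have hdf : d ∈ hf.fixed := by
    obtain ⟨i, k, hik⟩ := hform _ (hf.maps d hd)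
    rcases Nat.even_or_odd' i with ⟨s, rfl | rfl⟩
    · refine hf.mem_fixed_of_sq hP (i := k) (n := g ^ (2 * s)) hd ?_ ?_ ?_
      · rw [pow_two, h.d2]; exact hf.fixed.one_mem
      · rw [pow_mul]; exact hf.fixed.pow_mem hg2f s
      · rw [hik, zpow_natCast, (hgd.pow_pow _ k).eq]
    -- an odd power of `g` times `d ^ k` is not an involution
    · exfalso
      have h2 : (f d) ^ 2 = 1 := by rw [← hf.map_pow hd, pow_two, h.d2, hf.map_one]
      rw [hik, (hgd.pow_pow _ k).mul_pow, ← pow_mul d, mul_comm k, pow_mul d, pow_two d,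
        h.d2, one_pow, mul_one, ← pow_mul, mul_comm, pow_mul] at h2
      obtain ⟨n, hn⟩ := mem_zpowers_pow_of_odd hP (g ^ 2) (n := 2 * s + 1) ⟨s, rfl⟩
      apply hg2
      rw [← hn]
      change ((g ^ 2) ^ (2 * s + 1)) ^ n = 1
      rw [h2, one_zpow]
  have hgf : g ∈ hf.fixed := by
    obtain ⟨i, k, hik⟩ := hform _ (hf.maps g hg)
    exact hf.mem_fixed_of_sq hP (i := i) hg hg2f (hf.fixed.pow_mem hdf k)
      (by rw [hik, zpow_natCast])
  intro r hr
  obtain ⟨i, k, rfl⟩ := hform r hr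
  exact hf.fixed.mul_mem (hf.fixed.pow_mem hgf i) (hf.fixed.pow_mem hdf k)

end CyclicExtension

end Enumeration

/-! ### Subgroups with automorphisms of odd order when the derived subgroup has order 4 -/

section Enumeration

variable {P : Type*} [Group P]

namespace CyclicExtension

variable {E : Subgroup P} {x a d b : P} {m e : ℕ} (hP : IsPGroup 2 P) {R : Subgroup P} {f : P → P}

/-- The elements of `E⟨x ^ 2⟩` modulo the central subgroup `⟨x ^ 4⟩` and `⟨d⟩`. -/
theorem even_form (h : CyclicExtension E x a d b m e) (i j k : ℕ) : ∃ n w,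
    x ^ (2 * i) * a ^ j * d ^ k = x ^ (4 * n) * d ^ k * w ∧
      (w = 1 ∨ w = x ^ 2 ∨ w = a ∨ w = x ^ 2 * a) := by
  have hda : Commute a d := h.comm _ h.ha _ h.hd
  obtain ⟨n, v, hv, hv'⟩ : ∃ n v, x ^ (2 * i) = x ^ (4 * n) * v ∧ (v = 1 ∨ v = x ^ 2) := by
    rcases Nat.even_or_odd' i with ⟨n, rfl | rfl⟩
    · exact ⟨n, 1, by rw [mul_one]; congr 1; ring, Or.inl rfl⟩
    · exact ⟨n, x ^ 2, by rw [← pow_add]; congr 1; ring, Or.inr rfl⟩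
  have hvd : Commute v d := by
    rcases hv' with rfl | rfl
    · exact Commute.one_left d
    · exact h.x2d
  refine ⟨n, v * a ^ j, ?_, ?_⟩
  · rw [hv, mul_assoc, mul_assoc, mul_assoc, ← mul_assoc v,
      ((hvd.mul_left (hda.pow_left j)).pow_right k).eq]
  · rcases hv' with rfl | rfl <;> rcases pow_eq_one_or_self h.a2 j with hj | hj <;> rw [hj] <;> simp

include hP

/-- The maximal subgroup `E⟨x ^ 2⟩` has no nontrivial automorphism of odd order if it is not
abelian. -/
theorem fixed_maximal [Finite P] (h : CyclicExtension E x a d b m 1) (hf : IsOddAut R f)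
    (ha : a ∈ R) (hd : d ∈ R) (hx2 : x ^ 2 ∈ R)
    (hform : ∀ r ∈ R, ∃ i j k : ℕ, r = x ^ (2 * i) * a ^ j * d ^ k) : ∀ r ∈ R, r ∈ hf.fixed := by
  have hm := h.three_le
  have hda : Commute a d := h.comm _ h.ha _ h.hd
  have h42 : x ^ 4 = (x ^ 2) ^ 2 := by rw [← pow_mul]
  have hx4 : x ^ 4 ∈ R := by rw [h42]; exact R.pow_mem hx2 2
  -- squares in `E⟨x ^ 2⟩` lie in `⟨x ^ 4⟩`
  have hx4f : x ^ 4 ∈ hf.fixed := by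
    obtain ⟨i, j, k, hijk⟩ := hform _ (hf.maps _ hx2)
    refine hf.mem_fixed_of_zpow hP (i := (i + 2 ^ (m - 3) * (i * j) : ℕ)) hx4 ?_
    rw [zpow_natCast, pow_add, pow_mul _ (2 ^ (m - 3)), h.x4_pow_eq_b, h42, hf.map_pow hx2, hijk,
      h.even_sq_eq, pow_one, ← h42, pow_mul x 4 i]
  have hbf : b ∈ hf.fixed := by rw [← h.x4_pow_eq_b]; exact hf.fixed.pow_mem hx4f _
  have hbpow : ∀ q, (b ^ 1) ^ q ∈ hf.fixed := fun q => by
    rw [pow_one]; exact hf.fixed.pow_mem hbf q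
  have hxa : x ^ 2 * a = a * b * x ^ 2 := by rw [h.x2a, pow_one]
  have hdf : d ∈ hf.fixed := by
    obtain ⟨i, j, k, hijk⟩ := hform _ (hf.maps _ hd)
    obtain ⟨n, w, hw, hw'⟩ := h.even_form i j k
    rw [hw] at hijk
    -- `f d` is central in `R`, as `d` is; this excludes all values of `w` but `1`.
    have hc : ∀ r ∈ R, Commute d r := by
      intro r hr
      obtain ⟨i, j, k, rfl⟩ := hform r hr
      exact ((h.x2n_d i).symm.mul_right (hda.symm.pow_right j)).mul_right
        ((Commute.refl d).pow_right k)
    have hfc : ∀ r ∈ R, Commute w r := by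
      intro r hr
      obtain ⟨s, hs, rfl⟩ : ∃ s ∈ R, f s = r := by
        obtain ⟨k, ⟨l, rfl⟩, hk⟩ := hf.odd
        exact ⟨f^[2 * l] r, hf.iterate_maps hr _,
          (Function.iterate_succ_apply' f (2 * l) r).symm.trans (hk r hr)⟩
      have h1 : Commute (f d) (f s) := by
        change f d * f s = f s * f d
        rw [← hf.map_mul _ hd _ hs, ← hf.map_mul _ hs _ hd, (hc s hs).eq]
      have h2 : w = (x ^ (4 * n) * d ^ k)⁻¹ * f d := by rw [hijk]; group
      rw [h2]
      exact (((h.x4n_comm n _).mul_left ((hc _ hr).pow_left k)).inv_left).mul_left h1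
    have hw1 : w = 1 := by
      have h1 : ¬ Commute (x ^ 2) a := by
        intro hc'
        rw [hc'.eq, mul_assoc] at hxa
        have h3 := mul_left_cancel hxa
        exact h.b_ne_one (mul_eq_right.1 h3.symm)
      rcases hw' with rfl | rfl | rfl | rfl
      · rfl
      · exact absurd (hfc a ha) h1
      · exact absurd (hfc (x ^ 2) hx2).symm h1
      · refine absurd (hfc a ha) fun h3 => h1 ?_
        have h4 := h3.mul_left (Commute.refl a).inv_left
        rwa [mul_inv_cancel_right] at h4
    rw [hw1, mul_one] at hijk
    refine hf.mem_fixed_of_zpow_mul_of_commute hP (i := k) (n := x ^ (4 * n)) hd ?_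
      (h.x4n_comm n d).symm ?_
    · rw [pow_mul]; exact hf.fixed.pow_mem hx4f n
    · rw [hijk, (h.x4n_comm n _).eq, zpow_natCast]
  have hx2f : a ∈ hf.fixed → x ^ 2 ∈ hf.fixed := by
    intro haf
    obtain ⟨i, j, k, hijk⟩ := hform _ (hf.maps _ hx2)
    refine hf.mem_fixed_of_sq hP (i := i) (n := a ^ j * d ^ k) hx2 ?_
      (hf.fixed.mul_mem (hf.fixed.pow_mem haf j) (hf.fixed.pow_mem hdf k)) ?_
    · rw [← h42]; exact hx4f
    · rw [hijk, zpow_natCast, ← pow_mul, mul_assoc]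
  have haf : a ∈ hf.fixed := by
    obtain ⟨i, j, k, hijk⟩ := hform _ (hf.maps _ ha)
    have ha2 : a ^ 2 = 1 := by rw [pow_two, h.a2]
    -- if `f a ∈ a ^ j * x ^ (2 * i) * ⟨d, b⟩`, it suffices that `x ^ (2 * i)` is fixed
    have haux : x ^ (2 * i) ∈ hf.fixed → a ∈ hf.fixed := by
      intro hxi
      refine hf.mem_fixed_of_sq hP (i := j) (n := (b ^ 1) ^ (i * j) * x ^ (2 * i) * d ^ k) ha ?_
        (hf.fixed.mul_mem (hf.fixed.mul_mem (hbpow _) hxi) (hf.fixed.pow_mem hdf k)) ?_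
      · rw [ha2]; exact hf.fixed.one_mem
      · have h1 : x ^ (2 * i) * a ^ j = a ^ j * ((b ^ 1) ^ (i * j) * x ^ (2 * i)) := by
          rcases pow_eq_one_or_self h.a2 j with hj | hj
          · have h2 : Even j ∨ a = 1 := by
              by_contra! h3
              exact h3.2 (by rw [← hj, pow_eq_self_of_odd h.a2 (Nat.not_even_iff_odd.1 h3.1)])
            rcases h2 with h2 | h2
            · have h3 : (b ^ 1) ^ (i * j) = 1 := by
                rw [pow_one]; exact pow_eq_one_of_even h.b2 (h2.mul_left i)
              rw [hj, h3, one_mul, mul_one, one_mul]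
            · rw [h2, mul_one] at hxa
              rw [one_mul] at hxa
              exact absurd (mul_eq_right.1 hxa.symm) h.b_ne_one
          · have h2 : Odd j ∨ a = 1 := by
              by_contra! h3
              exact h3.2 (by rw [← hj, pow_eq_one_of_even h.a2 (Nat.not_odd_iff_even.1 h3.1)])
            rcases h2 with ⟨t, rfl⟩ | h2
            · rw [hj, h.x2n_a, mul_assoc]
              have h4 : (b ^ 1) ^ (i * (2 * t + 1)) = (b ^ 1) ^ i := by
                rw [pow_one, mul_add, mul_one, pow_add,
                  pow_eq_one_of_even h.b2 ((even_two_mul t).mul_left i), one_mul]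
              rw [h4]
            · rw [h2, mul_one, one_mul] at hxa
              exact absurd (mul_eq_right.1 hxa.symm) h.b_ne_one
        rw [hijk, zpow_natCast, h1]; simp only [mul_assoc]
    rcases Nat.even_or_odd i with ⟨s, hi⟩ | hi
    · refine haux ?_
      rw [show 2 * i = 4 * s by omega, pow_mul]
      exact hf.fixed.pow_mem hx4f s
    · refine haux ?_
      -- for odd `i` the involution `f a` lies in the coset of `x ^ 2`; comparison of squares forces
      -- `m = 3`, and then `f` fixes `x ^ 2`
      have h2 : (f a) ^ 2 = 1 := by rw [← hf.map_pow ha, ha2, hf.map_one]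
      rw [hijk, h.even_sq_eq, pow_one] at h2
      have h4 : x ^ (2 ^ 3 * i) = 1 := by
        have h5 : (x ^ (4 * i) * b ^ (i * j)) ^ 2 = 1 := by rw [h2, one_pow]
        rw [(h.x4n_comm i _).mul_pow, pow_two (b ^ (i * j)), h.sq _ (E.pow_mem h.hbE _), mul_one,
          ← pow_mul] at h5
        rw [← h5]; congr 1; ring
      have hm3 : m = 3 := le_antisymm (odd_not_dvd hi (h.pow_eq_one_iff.1 h4)) hm
      have hb4 : x ^ 4 = b := by rw [← h.x4_pow_eq_b, hm3]; norm_num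
      have hj : Odd j := by
        rw [pow_mul, hb4, ← pow_add, h.b_pow_eq_one_iff] at h2
        have : ¬ Even i := Nat.not_even_iff_odd.2 hi
        rw [← Nat.not_even_iff_odd]
        intro hj
        exact this ((Nat.even_add.1 h2).2 (hj.mul_left i))
      rw [pow_mul]
      refine hf.fixed.pow_mem ?_ i
      obtain ⟨i', j', k', h'⟩ := hform _ (hf.maps _ hx2)
      have h6 : b ^ (i' + i' * j' + 1) = 1 := by
        have h7 : (f (x ^ 2)) ^ 2 = b := by rw [← hf.map_pow hx2, ← h42, hx4f.2, hb4]
        rw [h', h.even_sq_eq, pow_one, pow_mul x, hb4, ← pow_add] at h7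
        rw [pow_succ, h7, h.b2]
      rw [h.b_pow_eq_one_iff] at h6
      have hj' : Even j' := by
        by_contra hj'
        have hodd := Nat.not_even_iff_odd.1 hj'
        have : Even (i' + i' * j') := by
          have h8 : i' + i' * j' = i' * (1 + j') := by ring
          rw [h8]
          exact (Odd.add_odd odd_one hodd).mul_left i'
        exact (Nat.even_add_one.1 h6) this
      rw [pow_eq_one_of_even h.a2 hj', mul_one, pow_mul] at h'
      exact hf.mem_fixed_of_sq hP (i := i') (n := d ^ k') hx2 (by rw [← h42]; exact hx4f)
        (hf.fixed.pow_mem hdf k') (by rw [h', zpow_natCast])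
  intro r hr
  obtain ⟨i, j, k, rfl⟩ := hform r hr
  refine hf.fixed.mul_mem (hf.fixed.mul_mem ?_ (hf.fixed.pow_mem haf j)) (hf.fixed.pow_mem hdf k)
  rw [pow_mul]
  exact hf.fixed.pow_mem (hx2f haf) i

/-- If `[P, P] = ⟨d, b⟩`, then a self-centralizing subgroup `R` with a nontrivial automorphism of
odd order is generated by `x ^ 4`, `d` and an involution `u` on which `x` acts as on `a`. -/
theorem exists_involution [Finite P] (h : CyclicExtension E x a d b m 1) (hf : IsOddAut R f)
    (hne : ∃ r ∈ R, r ∉ hf.fixed) (hR : Subgroup.centralizer (R : Set P) ≤ R) :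
    x ^ 4 ∈ R ∧ d ∈ R ∧ ∃ u ∈ R, u * u = 1 ∧ x * u = u * d * x ∧ Commute u d ∧
      (∀ r ∈ R, ∃ i k l : ℕ, r = x ^ (4 * i) * d ^ k * u ^ l) ∧
      ∀ g, ∃ i : ℤ, ∃ r ∈ R, g = x ^ i * r := by
  have hm := h.three_le
  have hda : Commute a d := h.comm _ h.ha _ h.hd
  have heven := h.forall_even hP hf hne
  have h42 : x ^ 4 = (x ^ 2) ^ 2 := by rw [← pow_mul]
  -- `x ^ 4` and `d` centralize `E⟨x ^ 2⟩`, which contains `R`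
  have hx4 : x ^ 4 ∈ R := hR (Subgroup.mem_centralizer_iff.2 fun r _ => (h.x4_comm r).symm.eq)
  have hd : d ∈ R := by
    refine hR (Subgroup.mem_centralizer_iff.2 fun r hr => ?_)
    obtain ⟨i, j, k, rfl⟩ := heven r hr
    exact (((h.x2n_d i).mul_left (hda.pow_left j)).mul_left ((Commute.refl d).pow_left k)).eq
  have hform : ∀ r ∈ R, ∃ n k w, r = x ^ (4 * n) * d ^ k * w ∧ w ∈ R ∧
      (w = 1 ∨ w = x ^ 2 ∨ w = a ∨ w = x ^ 2 * a) := by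
    intro r hr
    obtain ⟨i, j, k, rfl⟩ := heven r hr
    obtain ⟨n, w, hw, hw'⟩ := h.even_form i j k
    refine ⟨n, k, w, hw, ?_, hw'⟩
    rw [hw] at hr
    refine (R.mul_mem_cancel_left ?_).1 hr
    rw [pow_mul]
    exact R.mul_mem (R.pow_mem hx4 n) (R.pow_mem hd k)
  have hcontra : (∀ r ∈ R, r ∈ hf.fixed) → False := fun H => by
    obtain ⟨r, hr, hr'⟩ := hne
    exact hr' (H r hr)
  -- modulo `⟨x ^ 4, d⟩`, the group `R` consists of some of the elements `1`, `x ^ 2`, `a`, `x ^ 2 *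
  -- a`
  by_cases ha : a ∈ R
  · by_cases hx2 : x ^ 2 ∈ R
    · exact (hcontra (h.fixed_maximal hP hf ha hd hx2 heven)).elim
    refine ⟨hx4, hd, a, ha, h.a2, h.xa, hda, ?_, ?_⟩
    · intro r hr
      obtain ⟨n, k, w, hw, hwR, hw'⟩ := hform r hr
      rcases hw' with rfl | rfl | rfl | rfl
      · exact ⟨n, k, 0, by rw [hw, pow_zero]⟩
      · exact absurd hwR hx2
      · exact ⟨n, k, 1, by rw [hw, pow_one]⟩
      · exact absurd ((R.mul_mem_cancel_right ha).1 hwR) hx2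
    · intro g
      obtain ⟨i, j, k, rfl⟩ := h.gen g
      exact ⟨i, a ^ j * d ^ k, R.mul_mem (R.pow_mem ha j) (R.pow_mem hd k),
        by rw [zpow_natCast, mul_assoc]⟩
  by_cases hx2 : x ^ 2 ∈ R
  · refine (hcontra ?_).elim
    refine h.fixed_of_two_gen hP hf hx2 hd h.x2d ?_ ?_
    · intro r hr
      obtain ⟨n, k, w, hw, hwR, hw'⟩ := hform r hr
      have hxa : x ^ 2 * a ∉ R := fun hxa => ha ((R.mul_mem_cancel_left hx2).1 hxa)
      rcases hw' with rfl | rfl | rfl | rfl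
      · exact ⟨2 * n, k, by rw [hw, ← pow_mul, mul_one]; congr 2; ring⟩
      · refine ⟨2 * n + 1, k, ?_⟩
        rw [hw, mul_assoc, ← (h.x2d.pow_right k).eq, ← mul_assoc, ← pow_add, ← pow_mul]
        congr 2; ring
      · exact absurd hwR ha
      · exact absurd hwR hxa
    · intro h1
      rw [← h42, h.pow_eq_one_iff] at h1
      have := (Nat.pow_dvd_pow_iff_le_right (x := 2) (by norm_num)).1 (show 2 ^ m ∣ 2 ^ 2 from h1)
      omega
  by_cases hv : x ^ 2 * a ∈ R
  · have hvd : Commute (x ^ 2 * a) d := h.x2d.mul_left hda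
    have hv2 : (x ^ 2 * a) ^ 2 = x ^ 4 * b := by
      have := h.even_sq_eq 1 1 0
      simpa using this
    have hform' : ∀ r ∈ R, ∃ i k l : ℕ, r = x ^ (4 * i) * d ^ k * (x ^ 2 * a) ^ l := by
      intro r hr
      obtain ⟨n, k, w, hw, hwR, hw'⟩ := hform r hr
      rcases hw' with rfl | rfl | rfl | rfl
      · exact ⟨n, k, 0, by rw [hw, pow_zero]⟩
      · exact absurd hwR hx2
      · exact absurd hwR ha
      · exact ⟨n, k, 1, by rw [hw, pow_one]⟩
    -- the square `x ^ 4 * b` of `x ^ 2 * a` is trivial exactly for `m = 3`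
    rcases Nat.lt_or_ge m 4 with hm4 | hm4
    · have hm3 : m = 3 := by omega
      have hb4 : x ^ 4 = b := by rw [← h.x4_pow_eq_b, hm3]; norm_num
      refine ⟨hx4, hd, x ^ 2 * a, hv, ?_, ?_, hvd, hform', ?_⟩
      · rw [← pow_two, hv2, hb4, h.b2]
      · have h1 : x * x ^ 2 = x ^ 2 * x := ((Commute.refl x).pow_right 2).eq
        rw [← mul_assoc, h1, mul_assoc, h.xa]; simp only [mul_assoc]
      · intro g
        obtain ⟨i, j, k, rfl⟩ := h.gen g
        rcases pow_eq_one_or_self h.a2 j with hj | hj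
        · exact ⟨i, d ^ k, R.pow_mem hd k, by rw [hj, mul_one, zpow_natCast]⟩
        · refine ⟨i - 2, x ^ 2 * a * d ^ k, R.mul_mem hv (R.pow_mem hd k), ?_⟩
          have h3 : x ^ ((i : ℤ) - 2) = x ^ i * (x ^ 2)⁻¹ := by
            rw [zpow_sub, zpow_natCast, zpow_ofNat]
          rw [hj, h3]; simp only [mul_assoc, inv_mul_cancel_left]
    · refine (hcontra ?_).elim
      -- `x ^ 4` is a power of `(x ^ 2 * a) ^ 2 = (x ^ 4) ^ (1 + 2 ^ (m - 3))`.
      have hv2' : (x ^ 2 * a) ^ 2 = (x ^ 4) ^ (2 ^ (m - 3) + 1) := by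
        rw [hv2, pow_succ _ (2 ^ (m - 3)), h.x4_pow_eq_b, (h.x4_comm b).eq]
      have hodd : Odd (2 ^ (m - 3) + 1) := by
        refine Even.add_one ?_
        exact (Nat.even_pow.2 ⟨even_two, by omega⟩)
      obtain ⟨t, ht⟩ := exists_pow_eq_of_mem_zpowers (mem_zpowers_pow_of_odd hP (x ^ 4) hodd)
      rw [← hv2', ← pow_mul] at ht
      refine h.fixed_of_two_gen hP hf hv hd hvd ?_ ?_
      · intro r hr
        obtain ⟨i, k, l, rfl⟩ := hform' r hr
        refine ⟨2 * t * i + l, k, ?_⟩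
        rw [pow_mul, pow_add, pow_mul _ (2 * t), ← ht, mul_assoc, mul_assoc,
          (hvd.pow_pow l k).eq]
      · intro h1
        rw [pow_mul, h1, one_pow, h.pow_eq_one_iff] at ht
        have := (Nat.pow_dvd_pow_iff_le_right (x := 2) (by norm_num)).1 (show 2 ^ m ∣ 2 ^ 2 from ht)
        omega
  -- otherwise `R = ⟨x ^ 4, d⟩` is centralized by `a`
  · refine absurd (hR (Subgroup.mem_centralizer_iff.2 fun r hr => ?_)) ha
    obtain ⟨n, k, w, hw, hwR, hw'⟩ := hform r hr
    rcases hw' with rfl | rfl | rfl | rfl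
    · rw [hw, mul_one]
      exact ((h.x4n_comm n a).mul_left (hda.symm.pow_left k)).eq
    · exact absurd hwR hx2
    · exact absurd hwR ha
    · exact absurd hwR hv

end CyclicExtension

end Enumeration

/-! ### Transvections in groups of automorphisms -/

section Transvections

/-- Burnside's transfer theorem for a cyclic Sylow `2`-subgroup. -/
theorem exists_normal_complement {A : Type*} [Group A] [Finite A] (S : Sylow 2 A)
    (hS : IsCyclic S) : ∃ K : Subgroup A, Odd (Nat.card K) ∧
      (∀ g h : A, g * h * g⁻¹ * h⁻¹ ∈ K) ∧ ∀ g : A, ∃ s ∈ S, g * s ∈ K := by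
  rcases Nat.even_or_odd (Nat.card A) with h2 | h2
  · have hmin : (Nat.card A).minFac = 2 := (Nat.minFac_eq_two_iff _).2 h2.two_dvd
    have hle := hS.normalizer_le_centralizer hmin
    have hc : ∀ a b : S, a * b = b * a := fun a b =>
      Subtype.ext (hle (Subgroup.le_normalizer b.2) a a.2)
    have hK := MonoidHom.ker_transferSylow_isComplement' S hle
    refine ⟨(MonoidHom.transferSylow S hle).ker, ?_, fun g h => ?_, fun g => ?_⟩
    · rw [← Nat.not_even_iff_odd, even_iff_two_dvd]
      exact MonoidHom.not_dvd_card_ker_transferSylow S hle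
    · rw [MonoidHom.mem_ker, map_mul, map_mul, map_mul, map_inv, map_inv,
        hc (MonoidHom.transferSylow S hle g), mul_inv_cancel_right, mul_inv_cancel]
    · obtain ⟨⟨⟨k, hk⟩, ⟨s, hs⟩⟩, rfl⟩ := hK.2 g
      exact ⟨s⁻¹, S.inv_mem hs, by change k * s * s⁻¹ ∈ _; rwa [mul_inv_cancel_right]⟩
  · exact ⟨⊤, by rwa [Subgroup.card_top], fun _ _ => trivial, fun g => ⟨1, S.one_mem, trivial⟩⟩

variable {Q : Type*} [Group Q]

theorem isOddAut_mulAut {κ : MulAut Q} {k : ℕ} (hk : Odd k) (hκ : κ ^ k = 1) :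
    IsOddAut (⊤ : Subgroup Q) κ where
  maps _ _ := trivial
  map_mul r _ s _ := map_mul κ r s
  odd := by
    refine ⟨k, hk, fun r _ => ?_⟩
    have h1 : ∀ n, (κ ^ n) r = κ^[n] r := by
      intro n
      induction n with
      | zero => rfl
      | succ n ih => rw [Function.iterate_succ_apply', ← ih, pow_succ', MulAut.mul_apply]
    rw [← h1, hκ, MulAut.one_apply]

/-- Let `τ` be a transvection with centre `c` in a group of automorphisms `A` of a `2`-group with
commutators of odd order. The commutator of `g ∈ A` with `τ` has odd order; if `τ` fixes `g c`, it
acts unipotently and is therefore trivial. -/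
theorem conj_transvection_eq (hQ : IsPGroup 2 Q) {A : Subgroup (MulAut Q)}
    (hA : ∀ g ∈ A, ∀ h ∈ A, ∃ k, Odd k ∧ (g * h * g⁻¹ * h⁻¹) ^ k = 1) {τ g : MulAut Q} (hτ : τ ∈ A)
    (hg : g ∈ A) {c : Q} (hc : c * c = 1) (hτc : τ c = c) (hτq : ∀ q, τ q = q ∨ τ q = q * c)
    (hgc : τ (g c) = g c) : g * τ * g⁻¹ = τ := by
  obtain ⟨k, hk, hk1⟩ := hA g hg τ hτ
  set κ := g * τ * g⁻¹ * τ⁻¹ with hκ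
  have hf := isOddAut_mulAut hk hk1
  have hT : ∀ q : Q, q ∈ (⊤ : Subgroup Q) := fun _ => trivial
  have hτinv : ∀ q, τ⁻¹ q = q ∨ τ⁻¹ q = q * c := by
    intro q
    rcases hτq (τ⁻¹ q) with h | h
    · left; rwa [MulAut.apply_inv_self, eq_comm] at h
    · right
      rw [MulAut.apply_inv_self] at h
      calc τ⁻¹ q = τ⁻¹ q * (c * c) := by rw [hc, mul_one]
        _ = q * c := by rw [← mul_assoc, ← h]
  have hκq : ∀ q, κ q = (g * τ * g⁻¹) (τ⁻¹ q) := fun q => rfl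
  have hσq : ∀ q, (g * τ * g⁻¹) q = q ∨ (g * τ * g⁻¹) q = q * g c := by
    intro q
    have h1 : (g * τ * g⁻¹) q = g (τ (g⁻¹ q)) := rfl
    rw [h1]
    rcases hτq (g⁻¹ q) with h | h <;> rw [h]
    · left; rw [MulAut.apply_inv_self]
    · right; rw [map_mul, MulAut.apply_inv_self]
  have hτic : τ⁻¹ c = c := by
    conv_lhs => rw [← hτc]
    exact MulAut.inv_apply_self Q τ c
  -- `κ` fixes `g c`; as it moves `c` by a power of `g c`, it fixes `c`; as it moves all elements by
  -- elements of `⟨c, g c⟩`, it is trivial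
  have hu : g c ∈ hf.fixed := by
    refine ⟨trivial, ?_⟩
    have h1 : τ⁻¹ (g c) = g c := by
      conv_lhs => rw [← hgc]
      exact MulAut.inv_apply_self Q τ (g c)
    have h2 : (g * τ * g⁻¹) (g c) = g (τ (g⁻¹ (g c))) := rfl
    rw [hκq, h1, h2, MulAut.inv_apply_self, hτc]
  have hcf : c ∈ hf.fixed := by
    refine hf.mem_fixed_of_inv_mul_mem hQ (hT c) ?_
    rw [hκq, hτic]
    rcases hσq c with h | h <;> rw [h]
    · rw [inv_mul_cancel]; exact hf.fixed.one_mem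
    · rw [inv_mul_cancel_left]; exact hu
  have hall : ∀ q, q ∈ hf.fixed := by
    intro q
    have hσ : ∃ n ∈ hf.fixed, (g * τ * g⁻¹) q = q * n := by
      rcases hσq q with h | h
      · exact ⟨1, hf.fixed.one_mem, by rw [h, mul_one]⟩
      · exact ⟨g c, hu, h⟩
    obtain ⟨n, hn, hσ⟩ := hσ
    have hσc : (g * τ * g⁻¹) c = c := by
      have := hcf.2
      rwa [hκq, hτic] at this
    refine hf.mem_fixed_of_inv_mul_mem hQ (hT q) ?_
    rw [hκq]
    rcases hτinv q with h | h <;> rw [h]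
    · rw [hσ, inv_mul_cancel_left]; exact hn
    · rw [map_mul, hσ, hσc, mul_assoc, inv_mul_cancel_left]; exact hf.fixed.mul_mem hn hcf
  have h1 : κ = 1 := by
    ext q
    exact (hall q).2
  rw [hκ] at h1
  exact mul_inv_eq_one.1 h1

namespace FusionSystem

variable {P : Type*} [Group P] [Finite P] {F : FusionSystem P}

/-- If the Sylow subgroup `Aut_P(R)` of `Aut_F(R)` is cyclic, then `Aut_F(R)` is the product of a
normal subgroup of odd order and `Aut_P(R)`. -/
theorem IsSaturated.autGroup_complement (hF : F.IsSaturated 2) (hP : IsPGroup 2 P) {R : Subgroup P}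
    (hR : F.IsFullyNormalized R) (hc : IsCyclic (conjAut R)) :
    (∀ g ∈ F.autGroup R, ∀ h ∈ F.autGroup R, ∃ k, Odd k ∧ (g * h * g⁻¹ * h⁻¹) ^ k = 1) ∧
      ∀ g ∈ F.autGroup R, ∃ s ∈ conjAut R, ∃ k, Odd k ∧ (g * s) ^ k = 1 := by
  obtain ⟨S, hS⟩ := hF.exists_sylow_eq_conjAut hP R hR
  have hSc : IsCyclic S := by
    have h1 : IsCyclic ((conjAut R).subgroupOf (F.autGroup R)) :=
      (Subgroup.subgroupOfEquivOfLe (conjAut_le_autGroup F R)).symm.isCyclic.1 hc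
    rw [← hS] at h1
    exact h1
  obtain ⟨K, hK, h1, h2⟩ := exists_normal_complement S hSc
  have hpow : ∀ g ∈ K, (g : MulAut R) ^ Nat.card K = 1 := by
    intro g hg
    exact congrArg (fun g : K => ((g : F.autGroup R) : MulAut R))
      (pow_card_eq_one' (x := (⟨g, hg⟩ : K)))
  refine ⟨fun g hg h hh => ⟨_, hK, hpow _ (h1 ⟨g, hg⟩ ⟨h, hh⟩)⟩, fun g hg => ?_⟩
  obtain ⟨s, hs, hgs⟩ := h2 ⟨g, hg⟩
  have hs' : s ∈ (conjAut R).subgroupOf (F.autGroup R) := by rw [← hS]; exact hs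
  exact ⟨s, hs', _, hK, hpow _ hgs⟩

end FusionSystem

end Transvections

/-! ### Nilpotency when the derived subgroup has order 4 -/

section NilpotentCase

namespace FusionSystem

variable {P : Type*} [Group P]

/-- If `P = ⟨x⟩R` with `R` abelian and normal, then `Aut_P(R)` is generated by the conjugation with
`x`. -/
theorem isCyclic_conjAut {R : Subgroup P} {x : P} (hcomm : ∀ r ∈ R, ∀ s ∈ R, r * s = s * r)
    (hgen : ∀ g : P, ∃ i : ℤ, ∃ r ∈ R, g = x ^ i * r) {ξ : MulAut R}
    (hξ : ∀ q, (ξ q : P) = x * q * x⁻¹) : IsCyclic (conjAut R) := by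
  have hmem : ξ ∈ conjAut R := ⟨x, hξ⟩
  refine ⟨⟨⟨ξ, hmem⟩, ?_⟩⟩
  have hinv : ∀ q, ((ξ⁻¹) q : P) = x⁻¹ * q * x := by
    intro q
    have h1 := hξ (ξ⁻¹ q)
    rw [MulAut.apply_inv_self] at h1
    rw [h1]; group
  have hpow : ∀ i : ℤ, ∀ q, ((ξ ^ i) q : P) = x ^ i * q * (x ^ i)⁻¹ := by
    intro i
    induction i with
    | zero => intro q; simp
    | succ n ih =>
      intro q
      rw [zpow_add_one, zpow_add_one, MulAut.mul_apply, ih, hξ]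
      group
    | pred n ih =>
      intro q
      rw [zpow_sub_one, zpow_sub_one, MulAut.mul_apply, ih, hinv]
      group
  rintro ⟨α, g, hg⟩
  obtain ⟨i, r, hr, rfl⟩ := hgen g
  refine ⟨i, Subtype.ext (MulEquiv.ext fun q => Subtype.ext ?_)⟩
  change ((ξ ^ i) q : P) = α q
  rw [hpow, hg, mul_inv_rev]
  have : r * q * r⁻¹ = q := by rw [hcomm r hr q q.2, mul_inv_cancel_right]
  calc x ^ i * q * (x ^ i)⁻¹ = x ^ i * (r * q * r⁻¹) * (x ^ i)⁻¹ := by rw [this]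
    _ = _ := by group

end FusionSystem

namespace CyclicExtension

open FusionSystem

variable {P : Type*} [Group P] [Finite P] {F : FusionSystem P} {E : Subgroup P} {x a d b : P}
  {m : ℕ} {R : Subgroup P} {f : P → P}

/-- In the notation of `exists_involution`, the square of the conjugation with `x` is a transvection
of `R` with centre `b`. The involutions that it moves are the four `P`-conjugates of `u`. If
`k ∈ Aut_F(R)` mapped `b` to `u`, then `d` and `d * b`, which are not `F`-conjugate to `b`, would be
mapped to fixed points of the transvection, and hence so would `b`. Therefore `b` is fixed by
`Aut_F(R)`, which then acts on the fixed points `⟨x ^ 4, d⟩` of the transvection. -/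
theorem fixed_of_one (hP : IsPGroup 2 P) (hF : F.IsSaturated 2) (h : CyclicExtension E x a d b m 1)
    (hRn : F.IsFullyNormalized R) (hRc : Subgroup.centralizer (R : Set P) ≤ R) (hmor : F.IsMor R f)
    (hf : IsOddAut R f) : ∀ r ∈ R, r ∈ hf.fixed := by
  by_contra! hne
  obtain ⟨hx4, hd, u, hu, hu2, hxu, hud, hform, hgen⟩ := h.exists_involution hP hf hne hRc
  have hbR : b ∈ R := by rw [← h.x4_pow_eq_b]; exact R.pow_mem hx4 _
  have hxd : x * d = d * b * x := by rw [h.xd, pow_one]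
  have hcomm : ∀ r ∈ R, ∀ s ∈ R, r * s = s * r := by
    have hcu : ∀ s ∈ R, Commute u s := by
      intro s hs
      obtain ⟨i, k, l, rfl⟩ := hform s hs
      exact ((h.x4n_comm i u).symm.mul_right (hud.pow_right k)).mul_right
        ((Commute.refl u).pow_right l)
    have hcd : ∀ s ∈ R, Commute d s := by
      intro s hs
      obtain ⟨i, k, l, rfl⟩ := hform s hs
      exact ((h.x4n_comm i d).symm.mul_right ((Commute.refl d).pow_right k)).mul_right
        (hud.symm.pow_right l)
    intro r hr s hs
    obtain ⟨i, k, l, rfl⟩ := hform r hr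
    exact (((h.x4n_comm i s).mul_left ((hcd s hs).pow_left k)).mul_left ((hcu s hs).pow_left l)).eq
  have hxR : ∀ q ∈ R, x * q * x⁻¹ ∈ R := by
    have hu' : x * u * x⁻¹ = u * d := by rw [hxu, mul_inv_cancel_right]
    have hd' : x * d * x⁻¹ = d * b := by rw [hxd, mul_inv_cancel_right]
    intro q hq
    obtain ⟨i, k, l, rfl⟩ := hform q hq
    have : x * (x ^ (4 * i) * d ^ k * u ^ l) * x⁻¹ =
        x ^ (4 * i) * (x * d * x⁻¹) ^ k * (x * u * x⁻¹) ^ l := by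
      rw [conj_pow, conj_pow, ← mul_assoc, ← mul_assoc x, ← (h.x4n_comm i x).eq]
      group
    rw [this, hu', hd', pow_mul]
    exact R.mul_mem (R.mul_mem (R.pow_mem hx4 i) (R.pow_mem (R.mul_mem hd hbR) k))
      (R.pow_mem (R.mul_mem hu hd) l)
  have hxN := mem_normalizer_of_conj_mem hxR
  obtain ⟨ξ, hξ, hξq⟩ := exists_mem_conjAut hxN
  obtain ⟨hA, -⟩ := hF.autGroup_complement hP hRn (isCyclic_conjAut hcomm hgen hξq)
  set A := F.autGroup R with hAdef
  have hle : conjAut R ≤ A := conjAut_le_autGroup F R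
  set U : R := ⟨u, hu⟩ with hU
  set D : R := ⟨d, hd⟩ with hD
  set c : R := ⟨b, hbR⟩ with hc
  have hcomm' : ∀ r s : R, r * s = s * r := fun r s => Subtype.ext (hcomm r r.2 s s.2)
  have hcc : c * c = 1 := Subtype.ext h.b2
  have hDD : D * D = 1 := Subtype.ext h.d2
  have hUU : U * U = 1 := Subtype.ext hu2
  have hc1 : c ≠ 1 := fun h1 => h.b_ne_one (congrArg Subtype.val h1)
  have hDc : D ≠ c := fun h1 => h.d_ne_b_pow 1 (by rw [pow_one]; exact congrArg Subtype.val h1)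
  have hD1 : D ≠ 1 := fun h1 => h.d_ne_one (congrArg Subtype.val h1)
  have hξU : ξ U = U * D := Subtype.ext (by
    rw [hξq]; change x * u * x⁻¹ = u * d; rw [hxu, mul_inv_cancel_right])
  have hξD : ξ D = D * c := Subtype.ext (by
    rw [hξq]; change x * d * x⁻¹ = d * b; rw [hxd, mul_inv_cancel_right])
  have hξc : ξ c = c := Subtype.ext (by
    rw [hξq]; change x * b * x⁻¹ = b; rw [h.xb.eq, mul_inv_cancel_right])
  set τ := ξ * ξ with hτ
  have hτA : τ ∈ conjAut R := (conjAut R).mul_mem hξ hξ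
  have hτc : τ c = c := by change ξ (ξ c) = c; rw [hξc, hξc]
  have hτD : τ D = D := by
    change ξ (ξ D) = D
    rw [hξD, map_mul, hξD, hξc, mul_assoc, hcc, mul_one]
  have hτU : τ U = U * c := by
    change ξ (ξ U) = U * c
    rw [hξU, map_mul, hξD, hξU, mul_assoc, ← mul_assoc D, hDD, one_mul]
  have hformR : ∀ q : R, ∃ z : R, ∃ i k : ℕ, (z : P) = x ^ (4 * i) * d ^ k ∧ τ z = z ∧
      (q = z ∨ q = z * U) := by
    intro q
    obtain ⟨i, k, l, hq⟩ := hform q q.2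
    set X : R := ⟨x ^ 4, hx4⟩ with hX
    have hτX : τ X = X := Subtype.ext (by
      change ((ξ (ξ X) : R) : P) = x ^ 4
      rw [hξq, hξq]
      change x * (x * x ^ 4 * x⁻¹) * x⁻¹ = x ^ 4
      rw [(h.x4_comm x).symm.eq, mul_inv_cancel_right, (h.x4_comm x).symm.eq, mul_inv_cancel_right])
    refine ⟨X ^ i * D ^ k, i, k, ?_, ?_, ?_⟩
    · rw [pow_mul]; rfl
    · rw [map_mul, map_pow, map_pow, hτX, hτD]
    · have hq' : q = X ^ i * D ^ k * U ^ l := Subtype.ext (by rw [hq, pow_mul]; rfl)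
      rcases pow_eq_one_or_self hUU l with hl | hl
      · left; rw [hq', hl, mul_one]
      · right; rw [hq', hl]
  have hτq : ∀ q, τ q = q ∨ τ q = q * c := by
    intro q
    obtain ⟨z, i, k, -, hz, rfl | rfl⟩ := hformR q
    · exact Or.inl hz
    · right; rw [map_mul, hz, hτU, mul_assoc]
  have hUc : U * c ≠ U := fun h1 => hc1 (mul_eq_left.1 h1)
  have hfix : ∀ q, τ q = q → ∃ i k : ℕ, (q : P) = x ^ (4 * i) * d ^ k := by
    intro q hq
    obtain ⟨z, i, k, hzik, hz, rfl | rfl⟩ := hformR q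
    · exact ⟨i, k, hzik⟩
    · rw [map_mul, hz, hτU] at hq
      exact absurd (mul_left_cancel hq) hUc
  have hQ : IsPGroup 2 R := hP.to_subgroup R
  have hT : ∀ g ∈ A, τ (g c) = g c → g * τ * g⁻¹ = τ := fun g hg hgc =>
    conj_transvection_eq hQ hA (hle hτA) hg hcc hτc hτq hgc
  -- a transvection determines its centre
  have hclaim : ∀ g ∈ A, τ (g c) = g c → g c = c := by
    intro g hg hgc
    have h1 := hT g hg hgc
    have h2 : τ (g U) = g U * g c := by
      conv_lhs => rw [← h1]
      change g (τ (g⁻¹ (g U))) = _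
      rw [MulAut.inv_apply_self, hτU, map_mul]
    rcases hτq (g U) with h3 | h3
    · rw [h3] at h2
      have h4 : g c = g 1 := by rw [map_one]; exact mul_eq_left.1 h2.symm
      exact absurd (g.injective h4) hc1
    · rw [h3] at h2
      exact (mul_left_cancel h2).symm
  -- The involutions moved by `τ` are conjugate to `U` in `P`.
  have hconj : ∀ q : R, q * q = 1 → τ q ≠ q → ∃ γ ∈ conjAut R, q = γ U := by
    intro q hq hτ'
    obtain ⟨z, i, k, hzik, hz, rfl | rfl⟩ := hformR q
    · exact absurd hz hτ'
    have hz2 : z * z = 1 := by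
      calc z * z = (z * U) * (z * U) := by
            rw [hcomm' z U, mul_assoc U, ← mul_assoc z, hcomm' z U, ← mul_assoc, ← mul_assoc,
              hUU, one_mul]
        _ = 1 := hq
    have hz3 : x ^ (2 * (4 * i)) = 1 := by
      have h1 : (z : P) * z = 1 := congrArg Subtype.val hz2
      rw [hzik, ← pow_two, ((h.x4n_comm i d).pow_right k).mul_pow, ← pow_mul d, mul_comm k,
        pow_mul d, pow_two d, h.d2, one_pow, mul_one, ← pow_mul, mul_comm] at h1
      exact h1
    obtain ⟨t, ht⟩ := h.eq_b_pow_of_sq hz3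
    have hz4 : z = c ^ t * D ^ k := Subtype.ext (by rw [hzik, ht]; rfl)
    rcases pow_eq_one_or_self hcc t with h1 | h1 <;>
    rcases pow_eq_one_or_self hDD k with h2 | h2 <;> rw [hz4, h1, h2]
    · exact ⟨1, Subgroup.one_mem _, by simp⟩
    · exact ⟨ξ, hξ, by rw [hξU, one_mul, hcomm']⟩
    · exact ⟨τ, hτA, by rw [hτU, mul_one, hcomm']⟩
    · refine ⟨ξ * τ, Subgroup.mul_mem _ hξ hτA, ?_⟩
      rw [MulAut.mul_apply, hτU, map_mul, hξU, hξc, hcomm' _ c, mul_assoc, hcomm' D U]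
  have hgc : ∀ g ∈ A, g c = c := by
    intro g hg
    by_contra hgc
    have h1 : τ (g c) ≠ g c := fun h1 => hgc (hclaim g hg h1)
    obtain ⟨γ, hγ, hγU⟩ := hconj (g c) (by rw [← map_mul, hcc, map_one]) h1
    -- up to a conjugation in `P`, the automorphism `g` maps `b` to `u`
    set k := γ⁻¹ * g with hk
    have hkA : k ∈ A := A.mul_mem (A.inv_mem (hle hγ)) hg
    have hkc : k c = U := by
      change γ⁻¹ (g c) = U
      rw [hγU, MulAut.inv_apply_self]
    -- an involution `q ≠ b` fixed by `τ` is not conjugate to `b`, so `k q` is not conjugate to `u =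
    -- k b` and is fixed by `τ`
    have key : ∀ q : R, q * q = 1 → τ q = q → q ≠ c → τ (k q) = k q := by
      intro q hq hτ' hqc
      by_contra h2
      obtain ⟨γ', hγ', h3⟩ := hconj (k q) (by rw [← map_mul, hq, map_one]) h2
      have h4 : q = (k⁻¹ * γ' * k) c := by
        change q = k⁻¹ (γ' (k c))
        rw [hkc, ← h3, MulAut.inv_apply_self]
      have h5 := hclaim (k⁻¹ * γ' * k)
        (A.mul_mem (A.mul_mem (A.inv_mem hkA) (hle hγ')) hkA) (by rw [← h4, hτ'])
      exact hqc (h4.trans h5)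
    have h2 := key D hDD hτD hDc
    have h3 := key (D * c) (by
      rw [mul_assoc, hcomm' c, mul_assoc, hcc, mul_one, hDD]) (by rw [map_mul, hτD, hτc])
      (fun h => hD1 (mul_eq_right.1 h))
    rw [map_mul, hkc, map_mul, h2, hτU] at h3
    exact hUc (mul_left_cancel h3)
  -- `f` commutes with `τ` and preserves its fixed points `⟨x ^ 4, d⟩`; hence it fixes `b`, `d`, `x
  -- ^ 4` and `u`
  obtain ⟨α, hα, hαf⟩ := hmor.exists_mulAut hf.maps
  have hατ := hT α hα (by rw [hgc α hα, hτc])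
  have hpres : ∀ q : R, τ q = q → ∃ i k : ℕ, f q = x ^ (4 * i) * d ^ k := by
    intro q hq
    rw [← hαf]
    refine hfix (α q) ?_
    conv_lhs => rw [← hατ]
    change α (τ (α⁻¹ (α q))) = _
    rw [MulAut.inv_apply_self, hq]
  have hbf : b ∈ hf.fixed := ⟨hbR, by rw [← hαf c, hgc α hα]⟩
  have hdf : d ∈ hf.fixed := by
    obtain ⟨i, k, hik⟩ := hpres D hτD
    have hik' : f d = x ^ (4 * i) * d ^ k := hik
    have h1 : (f d) ^ 2 = 1 := by rw [← hf.map_pow hd, pow_two, h.d2, hf.map_one]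
    rw [hik', ((h.x4n_comm i d).pow_right k).mul_pow, ← pow_mul d, mul_comm k,
        pow_mul d, pow_two d, h.d2, one_pow, mul_one, ← pow_mul, mul_comm] at h1
    obtain ⟨t, ht⟩ := h.eq_b_pow_of_sq h1
    refine hf.mem_fixed_of_zpow_mul_of_commute hP (i := k) (n := b ^ t) hd (hf.fixed.pow_mem hbf t)
      ((h.b_comm d).symm.pow_right t) ?_
    rw [hik', ht, ((h.b_comm _).pow_left t).eq, zpow_natCast]
  have hxf : x ^ 4 ∈ hf.fixed := by
    have hτX : τ ⟨x ^ 4, hx4⟩ = ⟨x ^ 4, hx4⟩ := Subtype.ext (by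
      change ((ξ (ξ ⟨x ^ 4, hx4⟩) : R) : P) = x ^ 4
      rw [hξq, hξq]
      change x * (x * x ^ 4 * x⁻¹) * x⁻¹ = x ^ 4
      rw [(h.x4_comm x).symm.eq, mul_inv_cancel_right, (h.x4_comm x).symm.eq, mul_inv_cancel_right])
    obtain ⟨i, k, hik⟩ := hpres _ hτX
    exact hf.mem_fixed_of_zpow_mul_of_commute hP (i := i) (n := d ^ k) hx4 (hf.fixed.pow_mem hdf k)
      ((h.x4_comm d).pow_right k) (by rw [zpow_natCast, ← pow_mul]; exact hik)
  have huf : u ∈ hf.fixed := by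
    obtain ⟨i, k, l, hikl⟩ := hform _ (hf.maps u hu)
    refine hf.mem_fixed_of_zpow_mul_of_commute hP (i := l) (n := x ^ (4 * i) * d ^ k) hu ?_
      ((h.x4n_comm i u).symm.mul_right (hud.pow_right k)) ?_
    · rw [pow_mul]; exact hf.fixed.mul_mem (hf.fixed.pow_mem hxf i) (hf.fixed.pow_mem hdf k)
    · rw [hikl, zpow_natCast]
      exact (((h.x4n_comm i u).symm.mul_right (hud.pow_right k)).pow_left l).eq.symm
  obtain ⟨r, hr, hr'⟩ := hne
  obtain ⟨i, k, l, rfl⟩ := hform r hr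
  refine hr' (hf.fixed.mul_mem (hf.fixed.mul_mem ?_ (hf.fixed.pow_mem hdf k))
    (hf.fixed.pow_mem huf l))
  rw [pow_mul]; exact hf.fixed.pow_mem hxf i

end CyclicExtension

namespace FusionSystem

variable {P : Type*} [Group P] [Finite P] {F : FusionSystem P}

omit [Finite P] in
theorem exists_fun {S T : Subgroup P} (φ : S →* T) : ∃ f : P → P, ∀ s : S, (φ s : P) = f s := by
  classical
  exact ⟨fun p => if hp : p ∈ S then (φ ⟨p, hp⟩ : P) else 1, fun s => by simp⟩

omit [Finite P] in
theorem isMor_inner_iff {S : Subgroup P} {f : P → P} :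
    (inner P).IsMor S f ↔ ∃ g, ∀ s ∈ S, f s = g * s * g⁻¹ := by
  constructor
  · rintro ⟨φ, ⟨g, hg⟩, hφ⟩
    exact ⟨g, fun s hs => by rw [← hφ ⟨s, hs⟩]; exact hg ⟨s, hs⟩⟩
  · rintro ⟨g, hg⟩
    exact (IsMor.conj (inner P) S g).congr fun s hs => (hg s hs).symm

/-- A fusion system in which self-centralizing subgroups have no automorphisms of odd order is
nilpotent. -/
theorem IsSaturated.isNilpotent (hF : F.IsSaturated 2) (hP : IsPGroup 2 P)
    (H : ∀ R f, F.IsFullyNormalized R → Subgroup.centralizer (R : Set P) ≤ R → F.IsMor R f →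
      IsOddAut R f → ∀ r ∈ R, f r = r) : F.IsNilpotent := by
  have key : ∀ S f, F.IsMor S f → ∃ g, ∀ s ∈ S, f s = g * s * g⁻¹ := by
    refine hF.induction hP (fun S f => ∃ g, ∀ s ∈ S, f s = g * s * g⁻¹) ?_ ?_ ?_ ?_ ?_
    · rintro S f g ⟨y, hy⟩ hfg
      exact ⟨y, fun s hs => by rw [← hfg s hs, hy s hs]⟩
    · rintro S T f ⟨y, hy⟩ hTS
      exact ⟨y, fun s hs => hy s (hTS hs)⟩
    · rintro S T f g - ⟨y, hy⟩ ⟨z, hz⟩ hST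
      refine ⟨z * y, fun s hs => ?_⟩
      rw [Function.comp_apply, hz _ (hST s hs), hy s hs]; group
    · rintro S f g hf ⟨y, hy⟩ hgf
      refine ⟨y⁻¹, fun t ht => ?_⟩
      obtain ⟨s, hs, rfl⟩ := hf.mem_mapSub_iff.1 ht
      rw [hgf s hs, hy s hs]; group
    · intro R f hR hRc hf hfR
      exact hF.exists_conj hP hR (fun f hf hodd => H R f hR hRc hf hodd) hf hfR
  have hiff : ∀ S f, F.IsMor S f ↔ (inner P).IsMor S f := fun S f => by
    rw [isMor_inner_iff]
    refine ⟨key S f, ?_⟩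
    rintro ⟨g, hg⟩
    exact (IsMor.conj F S g).congr fun s hs => (hg s hs).symm
  refine FusionSystem.ext (funext fun S => funext fun T => Set.ext fun φ => ?_)
  obtain ⟨f, hφ⟩ := exists_fun φ
  rw [mem_hom_iff hφ, mem_hom_iff hφ, hiff]

end FusionSystem

end NilpotentCase

/-! ### Minimal nonabelian groups of type (m, 1) -/

section MinimalNonabelian

/-- The elements `x` and `y` generate `P` and satisfy the relations of a minimal nonabelian
`2`-group of type `(m, 1)`, where `c = [x, y]`. -/
structure MinimalNonabelianGenerators {P : Type*} [Group P] (m : ℕ) (x y c : P) : Prop where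
  x_pow : x ^ 2 ^ m = 1
  y_sq : y * y = 1
  c_sq : c * c = 1
  conj : x * y = y * c * x
  cx : Commute c x
  cy : Commute c y
  closure_eq_top : Subgroup.closure {x, y} = ⊤

namespace MinimalNonabelianGenerators

variable {P : Type*} [Group P] {m : ℕ} {x y c : P}

theorem commute_c (h : MinimalNonabelianGenerators m x y c) (g : P) : Commute c g := by
  have h1 : Subgroup.closure {x, y} ≤ Subgroup.centralizer {c} := by
    rw [Subgroup.closure_le]
    rintro _ (rfl | rfl)
    · exact Subgroup.mem_centralizer_singleton_iff.2 h.cx.eq.symm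
    · exact Subgroup.mem_centralizer_singleton_iff.2 h.cy.eq.symm
  rw [h.closure_eq_top] at h1
  exact (Subgroup.mem_centralizer_singleton_iff.1 (h1 (Subgroup.mem_top g))).symm

theorem y_pow_mul (h : MinimalNonabelianGenerators m x y c) (i j : ℕ) :
    y ^ j * x ^ i = x ^ i * y ^ j * c ^ (i * j) := by
  have hyx : y * x = x * y * c := by
    rw [h.conj, mul_assoc, mul_assoc, ← h.cx.eq, ← mul_assoc c, h.c_sq, one_mul]
  have h1 : ∀ i, y * x ^ i = x ^ i * y * c ^ i := by
    intro i
    induction i with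
    | zero => simp
    | succ i ih =>
      calc y * x ^ (i + 1) = y * x ^ i * x := by rw [pow_succ, mul_assoc]
        _ = x ^ i * y * (c ^ i * x) := by rw [ih, mul_assoc]
        _ = x ^ i * (y * x) * c ^ i := by
          rw [(h.cx.pow_left i).eq]; simp only [mul_assoc]
        _ = x ^ i * x * y * (c * c ^ i) := by rw [hyx]; simp only [mul_assoc]
        _ = _ := by rw [← pow_succ, ← pow_succ']
  induction j with
  | zero => simp
  | succ j ih =>
    calc y ^ (j + 1) * x ^ i = y ^ j * (y * x ^ i) := by rw [pow_succ, mul_assoc]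
      _ = y ^ j * x ^ i * (y * c ^ i) := by rw [h1]; simp only [mul_assoc]
      _ = x ^ i * y ^ j * (c ^ (i * j) * y) * c ^ i := by rw [ih]; simp only [mul_assoc]
      _ = x ^ i * (y ^ j * y) * (c ^ (i * j) * c ^ i) := by
        rw [(h.cy.pow_left _).eq]; simp only [mul_assoc]
      _ = _ := by rw [← pow_succ, ← pow_add]; rfl

theorem mul_form (h : MinimalNonabelianGenerators m x y c) (i j k i' j' k' : ℕ) :
    x ^ i * y ^ j * c ^ k * (x ^ i' * y ^ j' * c ^ k') =
      x ^ (i + i') * y ^ (j + j') * c ^ (i' * j + k + k') := by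
  calc _ = x ^ i * y ^ j * x ^ i' * y ^ j' * c ^ k' * c ^ k := by
        rw [mul_assoc _ (c ^ k), ((h.commute_c _).pow_left k).eq]; simp only [mul_assoc]
    _ = x ^ i * (x ^ i' * y ^ j * c ^ (i' * j)) * y ^ j' * c ^ k' * c ^ k := by
        rw [← h.y_pow_mul]; simp only [mul_assoc]
    _ = x ^ i * x ^ i' * (y ^ j * y ^ j') * c ^ (i' * j) * c ^ k' * c ^ k := by
      simp only [mul_assoc]
      rw [← mul_assoc (c ^ (i' * j)), ((h.cy.pow_pow (i' * j) j')).eq]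
      simp only [mul_assoc]
    _ = _ := by
      rw [← pow_add, ← pow_add, mul_assoc, mul_assoc, ← pow_add, ← pow_add]
      congr 2; ring

theorem exists_form (h : MinimalNonabelianGenerators m x y c) (g : P) :
    ∃ i j k : ℕ, g = x ^ i * y ^ j * c ^ k := by
  have hxinv : ∀ i, (x ^ i)⁻¹ = x ^ ((2 ^ m - 1) * i) := by
    intro i
    refine inv_eq_of_mul_eq_one_right ?_
    have : i + (2 ^ m - 1) * i = 2 ^ m * i := by
      have := Nat.one_le_two_pow (n := m)
      calc i + (2 ^ m - 1) * i = (1 + (2 ^ m - 1)) * i := by ring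
        _ = _ := by congr 1; omega
    rw [← pow_add, this, pow_mul, h.x_pow, one_pow]
  let H : Subgroup P :=
    { carrier := {g | ∃ i j k : ℕ, g = x ^ i * y ^ j * c ^ k}
      one_mem' := ⟨0, 0, 0, by simp⟩
      mul_mem' := by
        rintro _ _ ⟨i, j, k, rfl⟩ ⟨i', j', k', rfl⟩
        exact ⟨_, _, _, h.mul_form i j k i' j' k'⟩
      inv_mem' := by
        rintro _ ⟨i, j, k, rfl⟩
        have hy : (y ^ j)⁻¹ = y ^ j := inv_eq_of_mul_eq_one_right (by
          rw [← pow_add, ← two_mul, pow_mul, pow_two, h.y_sq, one_pow])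
        have hc : (c ^ k)⁻¹ = c ^ k := inv_eq_of_mul_eq_one_right (by
          rw [← pow_add, ← two_mul, pow_mul, pow_two, h.c_sq, one_pow])
        rw [mul_inv_rev, mul_inv_rev, hy, hc, hxinv, h.y_pow_mul, ((h.commute_c _).pow_left k).eq]
        exact ⟨_, _, _, by rw [mul_assoc _ (c ^ _), ← pow_add]⟩ }
  have h1 : Subgroup.closure {x, y} ≤ H := by
    rw [Subgroup.closure_le]
    rintro _ (rfl | rfl)
    · exact ⟨1, 0, 0, by simp⟩
    · exact ⟨0, 1, 0, by simp⟩
  rw [h.closure_eq_top] at h1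
  exact h1 (Subgroup.mem_top g)

/-- The map sending `(i, j, k)` to the normal form `x ^ i * y ^ j * c ^ k`. -/
def normalForm (m : ℕ) (x y c : P) (t : Fin (2 ^ m) × Fin 2 × Fin 2) : P :=
  x ^ (t.1 : ℕ) * y ^ (t.2.1 : ℕ) * c ^ (t.2.2 : ℕ)

theorem normalForm_surjective (h : MinimalNonabelianGenerators m x y c) :
    Function.Surjective (normalForm m x y c) := by
  intro g
  obtain ⟨i, j, k, rfl⟩ := h.exists_form g
  refine ⟨⟨⟨i % 2 ^ m, Nat.mod_lt _ (by positivity)⟩, ⟨j % 2, Nat.mod_lt _ (by norm_num)⟩,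
    ⟨k % 2, Nat.mod_lt _ (by norm_num)⟩⟩, ?_⟩
  have h2 : ∀ {u : P}, u * u = 1 → ∀ j, u ^ (j % 2) = u ^ j := fun hu j =>
    (pow_eq_pow_mod j (by rw [pow_two, hu])).symm
  change x ^ (i % 2 ^ m) * y ^ (j % 2) * c ^ (k % 2) = _
  rw [h2 h.y_sq, h2 h.c_sq, ← pow_eq_pow_mod i h.x_pow]

theorem card_le (h : MinimalNonabelianGenerators m x y c) :
    Finite P ∧ Nat.card P ≤ 2 ^ (m + 2) := by
  refine ⟨Finite.of_surjective _ h.normalForm_surjective, ?_⟩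
  refine (Nat.card_le_card_of_surjective _ h.normalForm_surjective).trans (le_of_eq ?_)
  rw [Nat.card_prod, Nat.card_prod, Nat.card_fin, Nat.card_fin, pow_add]; norm_num

/-- If the order of `P` is as large as the relations permit, then normal forms are unique. -/
theorem indep (h : MinimalNonabelianGenerators m x y c) (hcard : Nat.card P = 2 ^ (m + 2))
    {i j k : ℕ} (hijk : x ^ i * y ^ j * c ^ k = 1) : 2 ^ m ∣ i ∧ Even j ∧ Even k := by
  have hinj : Function.Injective (normalForm m x y c) := by
    have hf := h.card_le.1
    have := Fintype.ofFinite P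
    refine ((Fintype.bijective_iff_surjective_and_card _).2 ⟨h.normalForm_surjective, ?_⟩).1
    rw [← Nat.card_eq_fintype_card (α := P), hcard, Fintype.card_prod, Fintype.card_prod,
      Fintype.card_fin, Fintype.card_fin, pow_add]; norm_num
  have h2 : ∀ {u : P}, u * u = 1 → ∀ j, u ^ (j % 2) = u ^ j := fun hu j =>
    (pow_eq_pow_mod j (by rw [pow_two, hu])).symm
  have h1 : normalForm m x y c ⟨⟨i % 2 ^ m, Nat.mod_lt _ (by positivity)⟩,
      ⟨j % 2, Nat.mod_lt _ (by norm_num)⟩, ⟨k % 2, Nat.mod_lt _ (by norm_num)⟩⟩ =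
      normalForm m x y c ⟨⟨0, by positivity⟩, ⟨0, by norm_num⟩, ⟨0, by norm_num⟩⟩ := by
    change x ^ (i % 2 ^ m) * y ^ (j % 2) * c ^ (k % 2) = x ^ 0 * y ^ 0 * c ^ 0
    rw [h2 h.y_sq, h2 h.c_sq, ← pow_eq_pow_mod i h.x_pow, hijk]
    simp
  have h3 := hinj h1
  simp only [Prod.mk.injEq, Fin.mk.injEq] at h3
  exact ⟨Nat.dvd_of_mod_eq_zero h3.1, Nat.even_iff.2 h3.2.1, Nat.even_iff.2 h3.2.2⟩

/-- The canonical generators of the presented group satisfy the relations. -/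
theorem of_presentedGroup (m : ℕ) :
    MinimalNonabelianGenerators (P := PresentedGroup (minimalNonabelianRels 2 m 1)) m
      (PresentedGroup.of 0) (PresentedGroup.of 1)
      (PresentedGroup.of 0 * PresentedGroup.of 1 * (PresentedGroup.of 0)⁻¹ *
        (PresentedGroup.of 1)⁻¹) := by
  set X : PresentedGroup (minimalNonabelianRels 2 m 1) := PresentedGroup.of 0
  set Y : PresentedGroup (minimalNonabelianRels 2 m 1) := PresentedGroup.of 1
  have hrel : ∀ r ∈ minimalNonabelianRels 2 m 1,
      PresentedGroup.mk (minimalNonabelianRels 2 m 1) r = 1 := fun r hr =>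
    PresentedGroup.one_of_mem hr
  have h1 : X ^ 2 ^ m = 1 := by
    exact hrel _ (Set.mem_insert _ _)
  have h2 : Y ^ 2 ^ 1 = 1 := by
    exact hrel _ (Set.mem_insert_of_mem _ (Set.mem_insert _ _))
  have h3 : (X * Y * X⁻¹ * Y⁻¹) ^ 2 = 1 :=
    hrel _ (Set.mem_insert_of_mem _ (Set.mem_insert_of_mem _ (Set.mem_insert _ _)))
  have h4 : X * (X * Y * X⁻¹ * Y⁻¹) * X⁻¹ * (X * Y * X⁻¹ * Y⁻¹)⁻¹ = 1 :=
    hrel _ (Set.mem_insert_of_mem _ (Set.mem_insert_of_mem _ (Set.mem_insert_of_mem _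
      (Set.mem_insert _ _))))
  have h5 : Y * (X * Y * X⁻¹ * Y⁻¹) * Y⁻¹ * (X * Y * X⁻¹ * Y⁻¹)⁻¹ = 1 :=
    hrel _ (Set.mem_insert_of_mem _ (Set.mem_insert_of_mem _ (Set.mem_insert_of_mem _
      (Set.mem_insert_of_mem _ rfl))))
  have hY : Commute (X * Y * X⁻¹ * Y⁻¹) Y :=
    (mul_inv_eq_iff_eq_mul.1 (mul_inv_eq_one.1 h5)).symm
  refine ⟨h1, by rw [← pow_two]; simpa using h2, by rw [← pow_two]; exact h3, ?_,
    (mul_inv_eq_iff_eq_mul.1 (mul_inv_eq_one.1 h4)).symm, hY, ?_⟩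
  · rw [← hY.eq]; group
  · have := PresentedGroup.closure_range_of (minimalNonabelianRels 2 m 1)
    rw [← this]
    congr 1
    ext g
    simp [Fin.exists_fin_two, X, Y, eq_comm]

theorem exists_mulEquiv (h : MinimalNonabelianGenerators m x y c)
    (hcard : Nat.card P = 2 ^ (m + 2)) :
    ∃ φ : PresentedGroup (minimalNonabelianRels 2 m 1) ≃* P,
      φ (PresentedGroup.of 0) = x ∧ φ (PresentedGroup.of 1) = y := by
  have hc : x * y * x⁻¹ * y⁻¹ = c := by
    rw [h.conj, mul_inv_cancel_right, ← h.cy.eq, mul_inv_cancel_right]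
  have hrels : ∀ r ∈ minimalNonabelianRels 2 m 1, FreeGroup.lift ![x, y] r = 1 := by
    rintro _ (rfl | rfl | rfl | rfl | rfl)
    · simpa using h.x_pow
    · simpa [pow_two] using h.y_sq
    · simp only [map_pow, map_mul, map_inv, FreeGroup.lift_apply_of, Matrix.cons_val_zero,
        Matrix.cons_val_one, hc]
      rw [pow_two, h.c_sq]
    · simp only [map_mul, map_inv, FreeGroup.lift_apply_of, Matrix.cons_val_zero,
        Matrix.cons_val_one, hc]
      rw [← h.cx.eq, mul_inv_cancel_right, mul_inv_cancel]
    · simp only [map_mul, map_inv, FreeGroup.lift_apply_of, Matrix.cons_val_zero,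
        Matrix.cons_val_one, hc]
      rw [← h.cy.eq, mul_inv_cancel_right, mul_inv_cancel]
  have hx : PresentedGroup.toGroup hrels (PresentedGroup.of 0) = x := by simp
  have hy : PresentedGroup.toGroup hrels (PresentedGroup.of 1) = y := by simp
  have hsurj : Function.Surjective (PresentedGroup.toGroup hrels) := by
    rw [← MonoidHom.range_eq_top, eq_top_iff, ← h.closure_eq_top, Subgroup.closure_le]
    rintro _ (rfl | rfl)
    · exact ⟨_, hx⟩
    · exact ⟨_, hy⟩
  -- the presented group maps onto `P` and is not larger than `P`
  have hle := (of_presentedGroup m).card_le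
  have h1 := hle.1
  have h2 := h.card_le.1
  have hbij : Function.Bijective (PresentedGroup.toGroup hrels) := by
    have := Fintype.ofFinite P
    have := Fintype.ofFinite (PresentedGroup (minimalNonabelianRels 2 m 1))
    refine (Fintype.bijective_iff_surjective_and_card _).2 ⟨hsurj, ?_⟩
    rw [← Nat.card_eq_fintype_card, ← Nat.card_eq_fintype_card]
    refine le_antisymm (hle.2.trans hcard.ge) (Nat.card_le_card_of_surjective _ hsurj)
  exact ⟨MulEquiv.ofBijective _ hbij, hx, hy⟩

/-- Two groups of the same maximal order with generators of this kind are isomorphic. -/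
theorem exists_mulEquiv' {P' : Type*} [Group P'] {x' y' c' : P'}
    (h : MinimalNonabelianGenerators m x y c) (hcard : Nat.card P = 2 ^ (m + 2))
    (h' : MinimalNonabelianGenerators m x' y' c') (hcard' : Nat.card P' = 2 ^ (m + 2)) :
    ∃ γ : P ≃* P', γ x = x' ∧ γ y = y' ∧ γ c = c' := by
  obtain ⟨φ, hx, hy⟩ := h.exists_mulEquiv hcard
  obtain ⟨φ', hx', hy'⟩ := h'.exists_mulEquiv hcard'
  have e1 : (φ.symm.trans φ') x = x' := by rw [← hx]; simp [hx']
  have e2 : (φ.symm.trans φ') y = y' := by rw [← hy]; simp [hy']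
  refine ⟨φ.symm.trans φ', e1, e2, ?_⟩
  have hc : x * y * x⁻¹ * y⁻¹ = c := by
    rw [h.conj, mul_inv_cancel_right, ← h.cy.eq, mul_inv_cancel_right]
  have hc' : x' * y' * x'⁻¹ * y'⁻¹ = c' := by
    rw [h'.conj, mul_inv_cancel_right, ← h'.cy.eq, mul_inv_cancel_right]
  rw [← hc, ← hc', map_mul, map_mul, map_mul, map_inv, map_inv, e1, e2]

end MinimalNonabelianGenerators

end MinimalNonabelian

/-! ### Automorphism groups generated by transvections -/

section TransvectionGroups

variable {Q : Type*} [Group Q]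

/-- A group `A` of automorphisms of an abelian `2`-group `Q` that contains a transvection `τ`
with centre `c`, such that `A` is the product of a normal subgroup of odd order and `⟨τ⟩`, and such
that the fixed points of `τ` are generated by `X` and `c`. -/
structure IsTransvectionGroup (A : Subgroup (MulAut Q)) (τ : MulAut Q) (c X : Q) : Prop where
  isPGroup : IsPGroup 2 Q
  comm : ∀ r s : Q, r * s = s * r
  comm_odd : ∀ g ∈ A, ∀ h ∈ A, ∃ k, Odd k ∧ (g * h * g⁻¹ * h⁻¹) ^ k = 1
  odd : ∀ g ∈ A, (∃ k, Odd k ∧ g ^ k = 1) ∨ ∃ k, Odd k ∧ (g * τ) ^ k = 1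
  mem : τ ∈ A
  c_sq : c * c = 1
  c_ne : c ≠ 1
  map_c : τ c = c
  map_or : ∀ q, τ q = q ∨ τ q = q * c
  map_X : τ X = X
  fixed : ∀ q, τ q = q → ∃ i k : ℕ, q = X ^ i * c ^ k
  exists_ne : ∃ q, τ q ≠ q

namespace IsTransvectionGroup

variable {A : Subgroup (MulAut Q)} {τ : MulAut Q} {c X : Q}

theorem conj_eq (h : IsTransvectionGroup A τ c X) {g : MulAut Q} (hg : g ∈ A)
    (hgc : τ (g c) = g c) : g * τ * g⁻¹ = τ :=
  conj_transvection_eq h.isPGroup h.comm_odd h.mem hg h.c_sq h.map_c h.map_or hgc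

/-- A transvection determines its centre. -/
theorem map_eq (h : IsTransvectionGroup A τ c X) {g : MulAut Q} (hg : g ∈ A)
    (hgc : τ (g c) = g c) : g c = c := by
  obtain ⟨q, hq⟩ := h.exists_ne
  have hq' := (h.map_or q).resolve_left hq
  have h2 : τ (g q) = g q * g c := by
    conv_lhs => rw [← h.conj_eq hg hgc]
    change g (τ (g⁻¹ (g q))) = _
    rw [MulAut.inv_apply_self, hq', map_mul]
  rcases h.map_or (g q) with h3 | h3
  · rw [h3] at h2
    have h4 : g c = g 1 := by rw [map_one]; exact mul_eq_left.1 h2.symm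
    exact absurd (g.injective h4) h.c_ne
  · rw [h3] at h2
    exact (mul_left_cancel h2).symm

theorem inv_eq (h : IsTransvectionGroup A τ c X) : τ⁻¹ = τ := by
  refine inv_eq_of_mul_eq_one_right (MulEquiv.ext fun q => ?_)
  change τ (τ q) = q
  rcases h.map_or q with h1 | h1
  · rw [h1, h1]
  · rw [h1, map_mul, h1, h.map_c, mul_assoc, h.c_sq, mul_one]

/-- The conjugate `α τ α⁻¹` is a transvection with centre `α c`. -/
theorem sigma_or (h : IsTransvectionGroup A τ c X) (α : MulAut Q) (q : Q) :
    (α * τ * α⁻¹) q = q ∨ (α * τ * α⁻¹) q = q * α c := by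
  have h1 : (α * τ * α⁻¹) q = α (τ (α⁻¹ q)) := rfl
  rw [h1]
  rcases h.map_or (α⁻¹ q) with h2 | h2 <;> rw [h2]
  · left; rw [MulAut.apply_inv_self]
  · right; rw [map_mul, MulAut.apply_inv_self]

section

variable {α : MulAut Q} (h : IsTransvectionGroup A τ c X) (hα : α ∈ A) (hne : τ (α c) ≠ α c)

include h hne

theorem map_v : τ (α c) = α c * c := (h.map_or _).resolve_left hne

include hα

/-- If `τ` moves `α c`, then `α τ α⁻¹` moves `c`. -/
theorem sigma_c : (α * τ * α⁻¹) c = c * α c := by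
  refine (h.sigma_or α c).resolve_left fun h1 => hne ?_
  have h2 : τ (α⁻¹ c) = α⁻¹ c := by
    rw [← MulAut.inv_apply_self Q α (τ (α⁻¹ c))]
    exact congrArg (fun w => α⁻¹ w) h1
  have h3 := h.conj_eq (A.inv_mem hα) h2
  have h4 : α * τ = τ * α := by
    rw [← mul_inv_eq_iff_eq_mul]
    calc α * τ * α⁻¹ = α * (α⁻¹ * τ * α⁻¹⁻¹) * α⁻¹ := by rw [h3]
      _ = τ := by group
  calc τ (α c) = (τ * α) c := rfl
    _ = α (τ c) := by rw [← h4]; rfl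
    _ = α c := by rw [h.map_c]

omit hne hα in
theorem v_sq : α c * α c = 1 := by rw [← map_mul, h.c_sq, map_one]

/-- Every element of `Q` is fixed by one of the three transvections `τ`, `α τ α⁻¹`,
`τ α τ α⁻¹ τ⁻¹`. -/
theorem exists_conj_fixing (q : Q) : ∃ g ∈ A, (g = 1 ∨ g = α ∨ g = τ * α) ∧
    (g * τ * g⁻¹) q = q := by
  by_cases h1 : τ q = q
  · exact ⟨1, A.one_mem, Or.inl rfl, by rw [one_mul, inv_one, mul_one]; exact h1⟩
  have h1' := (h.map_or q).resolve_left h1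
  rcases h.sigma_or α q with h2 | h2
  · exact ⟨α, hα, Or.inr (Or.inl rfl), h2⟩
  refine ⟨τ * α, A.mul_mem h.mem hα, Or.inr (Or.inr rfl), ?_⟩
  have h3 : (τ * α * τ * (τ * α)⁻¹) q = τ ((α * τ * α⁻¹) (τ⁻¹ q)) := by
    rw [mul_inv_rev]; rfl
  have h4 : c * α c = α c * c := h.comm _ _
  rw [h3, h.inv_eq, h1', map_mul, h2, h.sigma_c hα hne, h4, mul_assoc, ← mul_assoc (α c),
    h.v_sq, one_mul, map_mul, h1', h.map_c, mul_assoc, h.c_sq, mul_one]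

/-- By `exists_conj_fixing` and `conj_eq`, there are only three conjugates of `τ` in `A`, and each
of them determines its centre. -/
theorem exists_conj_apply {β : MulAut Q} (hβ : β ∈ A) : ∃ g ∈ A, (g = 1 ∨ g = α ∨ g = τ * α) ∧
    β * τ * β⁻¹ = g * τ * g⁻¹ ∧ β c = g c := by
  obtain ⟨g, hg, hg', hfix⟩ := h.exists_conj_fixing hα hne (β c)
  have h1 : τ ((g⁻¹ * β) c) = (g⁻¹ * β) c := by
    change τ (g⁻¹ (β c)) = g⁻¹ (β c)
    rw [← MulAut.inv_apply_self Q g (τ (g⁻¹ (β c)))]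
    exact congrArg (fun w => g⁻¹ w) hfix
  have hmem := A.mul_mem (A.inv_mem hg) hβ
  refine ⟨g, hg, hg', ?_, ?_⟩
  · calc β * τ * β⁻¹ = g * (g⁻¹ * β * τ * (g⁻¹ * β)⁻¹) * g⁻¹ := by group
      _ = _ := by rw [h.conj_eq hmem h1]
  · have h2 : g⁻¹ (β c) = c := h.map_eq hmem h1
    rw [← MulAut.apply_inv_self Q g (β c), h2]

/-- The three involutions `c`, `α c` and `α c * c` are permuted by `A`. -/
theorem apply_mem_iff {β : MulAut Q} (hβ : β ∈ A) (q : Q) :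
    (β q = c ∨ β q = α c ∨ β q = α c * c) ↔ (q = c ∨ q = α c ∨ q = α c * c) := by
  have key : ∀ β ∈ A, ∀ q, (q = c ∨ q = α c ∨ q = α c * c) →
      (β q = c ∨ β q = α c ∨ β q = α c * c) := by
    intro β hβ q hq
    obtain ⟨g, hg, rfl⟩ : ∃ g ∈ A, q = g c := by
      rcases hq with rfl | rfl | rfl
      · exact ⟨1, A.one_mem, rfl⟩
      · exact ⟨α, hα, rfl⟩
      · exact ⟨τ * α, A.mul_mem h.mem hα, (h.map_v hne).symm⟩
    obtain ⟨g', -, hg', -, h2⟩ := h.exists_conj_apply hα hne (A.mul_mem hβ hg)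
    have h3 : β (g c) = g' c := h2
    rw [h3]
    rcases hg' with rfl | rfl | rfl
    · exact Or.inl rfl
    · exact Or.inr (Or.inl rfl)
    · exact Or.inr (Or.inr (h.map_v hne))
  refine ⟨fun hq => ?_, key β hβ q⟩
  have := key β⁻¹ (A.inv_mem hβ) _ hq
  rwa [MulAut.inv_apply_self] at this

/-- The intersection of the fixed point subgroups of the transvections in `A` is generated by `X`
or by `X * c`, and is centralized by `A`. -/
theorem exists_fixed : ∃ X', (X' = X ∨ X' = X * c) ∧ ∀ β ∈ A, β X' = X' := by
  set σ := α * τ * α⁻¹ with hσ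
  have hσA : σ ∈ A := A.mul_mem (A.mul_mem hα h.mem) (A.inv_mem hα)
  obtain ⟨X', hX', hσX⟩ : ∃ X', (X' = X ∨ X' = X * c) ∧ σ X' = X' := by
    rcases h.sigma_or α X with h1 | h1
    · exact ⟨X, Or.inl rfl, h1⟩
    · refine ⟨X * c, Or.inr rfl, ?_⟩
      rw [map_mul, h1, h.sigma_c hα hne, h.comm c, mul_assoc, ← mul_assoc (α c), h.v_sq, one_mul]
  refine ⟨X', hX', ?_⟩
  have hτX : τ X' = X' := by
    rcases hX' with rfl | rfl
    · exact h.map_X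
    · rw [map_mul, h.map_X, h.map_c]
  -- `X'` is fixed by all transvections in `A`, and `β X'` with `β ∈ A` is as well; so it is a power
  -- of `X'`
  have hgX : ∀ β ∈ A, (β * τ * β⁻¹) X' = X' := by
    intro β hβ
    obtain ⟨g, hg, hg', h1, -⟩ := h.exists_conj_apply hα hne hβ
    rw [h1]
    rcases hg' with rfl | rfl | rfl
    · rw [one_mul, inv_one, mul_one]; exact hτX
    · exact hσX
    · have h3 : (τ * α * τ * (τ * α)⁻¹) X' = τ (σ (τ⁻¹ X')) := by
        rw [mul_inv_rev]; rfl
      rw [h3, h.inv_eq, hτX, hσX, hτX]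
  have hfix : ∀ q, τ q = q → σ q = q → ∃ i : ℕ, q = X' ^ i := by
    intro q h1 h2
    obtain ⟨i, k, hq⟩ : ∃ i k : ℕ, q = X' ^ i * c ^ k := by
      obtain ⟨i, k, hq⟩ := h.fixed q h1
      rcases hX' with rfl | rfl
      · exact ⟨i, k, hq⟩
      · refine ⟨i, i + k, ?_⟩
        rw [hq, (show Commute X c from h.comm _ _).mul_pow, mul_assoc, ← pow_add, ← add_assoc,
          ← two_mul, pow_add, pow_mul, pow_two c, h.c_sq, one_pow, one_mul]
    refine ⟨i, ?_⟩
    rcases pow_eq_one_or_self h.c_sq k with hk | hk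
    · rw [hq, hk, mul_one]
    · rw [hq, hk, map_mul, map_pow, hσX, h.sigma_c hα hne, ← mul_assoc] at h2
      have h3 : α c = α 1 := by rw [map_one]; exact mul_eq_left.1 h2
      exact absurd (α.injective h3) h.c_ne
  have hpow : ∀ β ∈ A, ∃ i : ℕ, β X' = X' ^ i := by
    intro β hβ
    have key : ∀ g ∈ A, (g * τ * g⁻¹) (β X') = β X' := by
      intro g hg
      have h1 := hgX (β⁻¹ * g) (A.mul_mem (A.inv_mem hβ) hg)
      have h2 : (g * τ * g⁻¹) (β X') = β ((β⁻¹ * g * τ * (β⁻¹ * g)⁻¹) X') := by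
        rw [← MulAut.mul_apply, ← MulAut.mul_apply]
        congr 1; group
      rw [h2, h1]
    refine hfix _ ?_ (key α hα)
    have := key 1 A.one_mem
    rwa [one_mul, inv_one, mul_one] at this
  -- an automorphism of odd order of the `2`-group `⟨X'⟩` is trivial
  have hodd : ∀ β ∈ A, (∃ k, Odd k ∧ β ^ k = 1) → β X' = X' := by
    rintro β hβ ⟨k, hk, hβk⟩
    obtain ⟨i, hi⟩ := hpow β hβ
    have hf := isOddAut_mulAut hk hβk
    exact (hf.mem_fixed_of_zpow h.isPGroup (i := i) (Subgroup.mem_top X')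
      (by rw [zpow_natCast]; exact hi)).2
  intro β hβ
  rcases h.odd β hβ with h1 | h1
  · exact hodd β hβ h1
  · have h2 := hodd (β * τ) (A.mul_mem hβ h.mem) h1
    rwa [MulAut.mul_apply, hτX] at h2

end

end IsTransvectionGroup

end TransvectionGroups

/-! ### The standard description of a fusion system -/

section Standard

variable {P : Type*} [Group P]

/-- `β` restricts to an automorphism of `C(y)` that fixes `x ^ 2` and permutes the involutions
`c`, `y` and `y * c`. The values of `β` outside `C(y)` are irrelevant. -/
structure IsStandardAut (x y c : P) (β : P → P) : Prop where
  maps : ∀ q ∈ Subgroup.centralizer {y}, β q ∈ Subgroup.centralizer {y}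
  map_mul : ∀ q ∈ Subgroup.centralizer {y}, ∀ r ∈ Subgroup.centralizer {y}, β (q * r) = β q * β r
  map_sq : β (x ^ 2) = x ^ 2
  mem_iff : ∀ q ∈ Subgroup.centralizer {y},
    (β q = c ∨ β q = y ∨ β q = y * c) ↔ (q = c ∨ q = y ∨ q = y * c)

/-- All morphisms of `F` are conjugations in `P` or restrictions of the automorphisms of `C(y)` that
fix `x ^ 2` and permute `c`, `y` and `y * c`. This determines `F`. -/
structure FusionSystem.IsStandard (F : FusionSystem P) (x y c : P) : Prop where
  mor : ∀ S f, F.IsMor S f → (∃ g, ∀ s ∈ S, f s = g * s * g⁻¹) ∨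
    (S ≤ Subgroup.centralizer {y} ∧ ∃ β, IsStandardAut x y c β ∧ ∀ s ∈ S, f s = β s)
  aut : ∀ β, IsStandardAut x y c β → F.IsMor (Subgroup.centralizer {y}) β

namespace FusionSystem

variable {F : FusionSystem P}

/-- Suppose that `Q` is an abelian normal subgroup that is the only self-centralizing subgroup with
nontrivial automorphisms of odd order. Then every morphism is a conjugation or the restriction of an
automorphism of `Q`. -/
theorem IsSaturated.conj_or_aut [Finite P] (hF : F.IsSaturated 2) (hP : IsPGroup 2 P)
    {Q : Subgroup P} (hQ : Q.Normal)
    (H : ∀ (R : Subgroup P) f, Subgroup.centralizer (R : Set P) ≤ R → (∀ hf : IsOddAut R f,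
      (∃ r ∈ R, r ∉ hf.fixed) → R = Q)) (S : Subgroup P) (f : P → P) (hf : F.IsMor S f) :
    (∃ g, ∀ s ∈ S, f s = g * s * g⁻¹) ∨
      (S ≤ Q ∧ ∃ β ∈ F.autGroup Q, ∀ s ∈ S, f s = extFun β s) := by
  have hconj : ∀ y, ∃ β ∈ F.autGroup Q, ∀ q ∈ Q, y * q * y⁻¹ = extFun β q := by
    intro y
    have hy : y ∈ Subgroup.normalizer (Q : Set P) := by
      rw [Subgroup.normalizer_eq_top Q]; trivial
    obtain ⟨β, hβ, h⟩ := exists_mem_conjAut hy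
    exact ⟨β, conjAut_le_autGroup F Q hβ, fun q hq => by
      rw [← h ⟨q, hq⟩, ← extFun_coe]⟩
  have hcase : ∀ {S : Subgroup P} {f : P → P}, S ≤ Q → ((∃ g, ∀ s ∈ S, f s = g * s * g⁻¹) ∨
      (S ≤ Q ∧ ∃ β ∈ F.autGroup Q, ∀ s ∈ S, f s = extFun β s)) →
      ∃ β ∈ F.autGroup Q, ∀ s ∈ S, f s = extFun β s := by
    rintro S f hS (⟨g, hg⟩ | ⟨-, h⟩)
    · obtain ⟨β, hβ, h⟩ := hconj g
      exact ⟨β, hβ, fun s hs => by rw [hg s hs, h s (hS hs)]⟩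
    · exact h
  refine hF.induction hP (fun S f => (∃ g, ∀ s ∈ S, f s = g * s * g⁻¹) ∨
      (S ≤ Q ∧ ∃ β ∈ F.autGroup Q, ∀ s ∈ S, f s = extFun β s)) ?_ ?_ ?_ ?_ ?_ S f hf
  · rintro S f g (⟨y, hy⟩ | ⟨hS, β, hβ, hy⟩) hfg
    · exact Or.inl ⟨y, fun s hs => by rw [← hfg s hs, hy s hs]⟩
    · exact Or.inr ⟨hS, β, hβ, fun s hs => by rw [← hfg s hs, hy s hs]⟩
  · rintro S T f (⟨y, hy⟩ | ⟨hS, β, hβ, hy⟩) hTS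
    · exact Or.inl ⟨y, fun s hs => hy s (hTS hs)⟩
    · exact Or.inr ⟨hTS.trans hS, β, hβ, fun s hs => hy s (hTS hs)⟩
  · intro S T f g hf h1 h2 hST
    by_cases hSQ : S ≤ Q
    · right
      obtain ⟨β, hβ, hy⟩ := hcase hSQ h1
      refine ⟨hSQ, ?_⟩
      have hfQ : ∀ s ∈ S, f s ∈ Q := fun s hs => by rw [hy s hs]; exact extFun_mem β (hSQ hs)
      rcases h2 with ⟨z, hz⟩ | ⟨hT, γ, hγ, hz⟩
      · obtain ⟨γ, hγ, hz'⟩ := hconj z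
        refine ⟨γ * β, Subgroup.mul_mem _ hγ hβ, fun s hs => ?_⟩
        rw [Function.comp_apply, hz _ (hST s hs), hz' _ (hfQ s hs), hy s hs,
          extFun_coe β ⟨s, hSQ hs⟩, extFun_coe, extFun_coe (γ * β) ⟨s, hSQ hs⟩, MulAut.mul_apply]
      · refine ⟨γ * β, Subgroup.mul_mem _ hγ hβ, fun s hs => ?_⟩
        rw [Function.comp_apply, hz _ (hST s hs), hy s hs,
          extFun_coe β ⟨s, hSQ hs⟩, extFun_coe, extFun_coe (γ * β) ⟨s, hSQ hs⟩, MulAut.mul_apply]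
    · left
      obtain ⟨y, hy⟩ := h1.resolve_right fun h => hSQ h.1
      have h2' : ∃ z, ∀ s ∈ T, g s = z * s * z⁻¹ := by
        refine h2.resolve_right fun h => hSQ fun s hs => ?_
        have h3 := hQ.conj_mem _ (h.1 (hST s hs)) y⁻¹
        rw [hy s hs] at h3
        have h4 : y⁻¹ * (y * s * y⁻¹) * y⁻¹⁻¹ = s := by group
        rwa [h4] at h3
      obtain ⟨z, hz⟩ := h2'
      refine ⟨z * y, fun s hs => ?_⟩
      rw [Function.comp_apply, hz _ (hST s hs), hy s hs]; group
  · rintro S f g hf (⟨y, hy⟩ | ⟨hS, β, hβ, hy⟩) hgf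
    · refine Or.inl ⟨y⁻¹, fun t ht => ?_⟩
      obtain ⟨s, hs, rfl⟩ := hf.mem_mapSub_iff.1 ht
      rw [hgf s hs, hy s hs]; group
    · have hfQ : ∀ s ∈ S, f s ∈ Q := fun s hs => by rw [hy s hs]; exact extFun_mem β (hS hs)
      refine Or.inr ⟨hf.mapSub_le hfQ, β⁻¹, Subgroup.inv_mem _ hβ, fun t ht => ?_⟩
      obtain ⟨s, hs, rfl⟩ := hf.mem_mapSub_iff.1 ht
      rw [hgf s hs, hy s hs, extFun_coe β ⟨s, hS hs⟩, extFun_coe, MulAut.inv_apply_self]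
  · intro R f hR hRc hf hfR
    by_cases hRQ : R = Q
    · subst hRQ
      obtain ⟨β, hβ, h⟩ := hf.exists_mulAut hfR
      exact Or.inr ⟨le_rfl, β, hβ, fun s hs => by rw [← h ⟨s, hs⟩, ← extFun_coe]⟩
    · refine Or.inl (hF.exists_conj hP hR (fun f _ hodd r hr => ?_) hf hfR)
      by_contra hne
      exact hRQ (H R f hRc hodd ⟨r, hr, fun h => hne h.2⟩)

end FusionSystem

namespace CyclicExtension

open FusionSystem

variable {E : Subgroup P} {x a d b : P} {m : ℕ}

theorem minimalNonabelianGenerators (h : CyclicExtension E x a d b m 0) :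
    MinimalNonabelianGenerators m x a d where
  x_pow := h.pow_eq_one_iff.2 dvd_rfl
  y_sq := h.a2
  c_sq := h.d2
  conj := h.xa
  cx := by
    have := h.xd
    rw [pow_zero, mul_one] at this
    exact this.symm
  cy := h.comm _ h.hd _ h.ha
  closure_eq_top := by
    refine top_unique fun g _ => ?_
    have hx : x ∈ Subgroup.closure {x, a} := Subgroup.subset_closure (Or.inl rfl)
    have ha : a ∈ Subgroup.closure {x, a} := Subgroup.subset_closure (Or.inr rfl)
    have hd : d ∈ Subgroup.closure {x, a} := by
      have : d = a⁻¹ * (x * a * x⁻¹) := by rw [h.xa]; group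
      rw [this]
      exact Subgroup.mul_mem _ (Subgroup.inv_mem _ ha)
        (Subgroup.mul_mem _ (Subgroup.mul_mem _ hx ha) (Subgroup.inv_mem _ hx))
    obtain ⟨i, j, k, rfl⟩ := h.gen g
    exact Subgroup.mul_mem _ (Subgroup.mul_mem _ (Subgroup.pow_mem _ hx i)
      (Subgroup.pow_mem _ ha j)) (Subgroup.pow_mem _ hd k)

/-- The normal forms `x ^ i * a ^ j * d ^ k` are unique. -/
theorem card_eq (h : CyclicExtension E x a d b m 0) : Nat.card P = 2 ^ (m + 2) := by
  have hg := h.minimalNonabelianGenerators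
  have hinj : Function.Injective (MinimalNonabelianGenerators.normalForm m x a d) := by
    rintro ⟨⟨i, hi⟩, ⟨j, hj⟩, ⟨k, hk⟩⟩ ⟨⟨i', hi'⟩, ⟨j', hj'⟩, ⟨k', hk'⟩⟩ heq
    change x ^ i * a ^ j * d ^ k = x ^ i' * a ^ j' * d ^ k' at heq
    have h1 : x ^ (2 ^ m - i' + i) * a ^ (j + j') * d ^ (k + k') = 1 := by
      have h2 : x ^ (2 ^ m - i' + i) * a ^ j * d ^ k = a ^ j' * d ^ k' := by
        rw [pow_add, mul_assoc, mul_assoc, ← mul_assoc (x ^ i), heq, ← mul_assoc, ← mul_assoc,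
          ← pow_add, Nat.sub_add_cancel hi'.le, hg.x_pow, one_mul]
      calc x ^ (2 ^ m - i' + i) * a ^ (j + j') * d ^ (k + k')
          = x ^ (2 ^ m - i' + i) * a ^ j * (a ^ j' * d ^ k) * d ^ k' := by
            rw [pow_add a, pow_add d]; simp only [mul_assoc]
        _ = x ^ (2 ^ m - i' + i) * a ^ j * (d ^ k * a ^ j') * d ^ k' := by
            rw [((show Commute a d from h.comm _ h.ha _ h.hd).pow_pow j' k).eq]
        _ = x ^ (2 ^ m - i' + i) * a ^ j * d ^ k * (a ^ j' * d ^ k') := by simp only [mul_assoc]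
        _ = 1 := by rw [h2, h.sq _ (h.wE j' k')]
    obtain ⟨hj2, hk2⟩ := h.indep _ _ _ h1
    rw [pow_eq_one_of_even h.a2 hj2, pow_eq_one_of_even h.d2 hk2, mul_one, mul_one,
      h.pow_eq_one_iff] at h1
    obtain ⟨t, ht⟩ := h1
    have ht1 : t = 1 := by
      have hpos : 0 < 2 ^ m := by positivity
      rcases Nat.lt_trichotomy t 1 with h3 | h3 | h3
      · have : t = 0 := by omega
        subst this
        omega
      · exact h3
      · have : 2 ^ m * 2 ≤ 2 ^ m * t := Nat.mul_le_mul_left _ h3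
        omega
    subst ht1
    obtain ⟨p, hp⟩ := hj2
    obtain ⟨q, hq⟩ := hk2
    have e1 : i = i' := by omega
    have e2 : j = j' := by omega
    have e3 : k = k' := by omega
    subst e1 e2 e3
    rfl
  have hfin := hg.card_le.1
  refine le_antisymm hg.card_le.2 ?_
  have := Nat.card_le_card_of_injective _ hinj
  rw [Nat.card_prod, Nat.card_prod, Nat.card_fin, Nat.card_fin] at this
  rw [pow_add]
  linarith

theorem centralizer_normal (h : CyclicExtension E x a d b m 0) :
    (Subgroup.centralizer {a} : Subgroup P).Normal := by
  refine ⟨fun q hq g => ?_⟩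
  obtain ⟨p, q', hpq⟩ := h.mul_comm' g q
  have hd : d ∈ Subgroup.centralizer {a} :=
    Subgroup.mem_centralizer_singleton_iff.2 (h.comm _ h.hd _ h.ha)
  rw [pow_zero, one_pow, mul_one] at hpq
  have : g * q * g⁻¹ = q * d ^ p := by
    rw [hpq, mul_assoc q, ← (h.minimalNonabelianGenerators.commute_c g |>.pow_left p).eq,
      ← mul_assoc, mul_inv_cancel_right]
  rw [this]
  exact Subgroup.mul_mem _ hq (Subgroup.pow_mem _ hd p)

end CyclicExtension

end Standard

/-! ### Automorphisms of the abelian maximal subgroup -/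

section Standard

variable {P : Type*} [Group P] [Finite P] {F : FusionSystem P} {E : Subgroup P}
  {x a d b : P} {m : ℕ}

namespace CyclicExtension

open FusionSystem

omit [Finite P] in
theorem exists_conj_or (h : CyclicExtension E x a d b m 0) (g : P) :
    ∃ q ∈ Subgroup.centralizer {a}, g = q ∨ g = x * q := by
  obtain ⟨i, j, k, rfl⟩ := h.gen g
  rcases Nat.even_or_odd' i with ⟨s, rfl | rfl⟩
  · exact ⟨_, (h.mem_centralizer_iff _).2 ⟨s, j, k, rfl⟩, Or.inl rfl⟩
  · refine ⟨_, (h.mem_centralizer_iff _).2 ⟨s, j, k, rfl⟩, Or.inr ?_⟩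
    rw [pow_succ']; simp only [mul_assoc]

/-- The conjugation `τ` with `x` is a transvection of the abelian group `C(a)` with centre `d` and
fixed points `⟨x ^ 2, d⟩`, and it generates the Sylow subgroup `Aut_P(C(a))` of `Aut_F(C(a))`. -/
theorem isTransvectionGroup (hP : IsPGroup 2 P) (hF : F.IsSaturated 2)
    (h : CyclicExtension E x a d b m 0) {Q : Subgroup P} (hQ : Q = Subgroup.centralizer {a})
    {τ : MulAut Q} (hτ : ∀ q, (τ q : P) = x * q * x⁻¹) {X D : Q}
    (hX : (X : P) = x ^ 2) (hD : (D : P) = d) : IsTransvectionGroup (F.autGroup Q) τ D X := by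
  have hQn : Q.Normal := hQ ▸ h.centralizer_normal
  have hg := h.minimalNonabelianGenerators
  have hcomm : ∀ r ∈ Q, ∀ s ∈ Q, r * s = s * r := hQ ▸ h.centralizer_comm
  have haQ : a ∈ Q := hQ ▸ Subgroup.mem_centralizer_singleton_iff.2 rfl
  have hdQ : d ∈ Q := hD ▸ D.2
  have hgen : ∀ g : P, ∃ i : ℤ, ∃ r ∈ Q, g = x ^ i * r := by
    intro g
    obtain ⟨q, hq, h1 | h1⟩ := h.exists_conj_or g <;> rw [← hQ] at hq
    · exact ⟨0, q, hq, by rw [h1, zpow_zero, one_mul]⟩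
    · exact ⟨1, q, hq, by rw [h1, zpow_one]⟩
  obtain ⟨hA, hodd⟩ := hF.autGroup_complement hP (isFullyNormalized_of_normal hQn)
    (isCyclic_conjAut hcomm hgen hτ)
  have hDD : D * D = 1 := Subtype.ext (by rw [Subgroup.coe_mul, hD]; exact h.d2)
  have hτD : τ D = D := Subtype.ext (by rw [hτ, hD, hg.cx.eq.symm, mul_inv_cancel_right])
  have hτX : τ X = X := Subtype.ext (by
    rw [hτ, hX, ((Commute.refl x).pow_right 2).eq, mul_inv_cancel_right])
  have hτa : τ ⟨a, haQ⟩ = ⟨a, haQ⟩ * D := Subtype.ext (by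
    rw [hτ, Subgroup.coe_mul, hD]
    change x * a * x⁻¹ = a * d
    rw [h.xa, mul_inv_cancel_right])
  have hform : ∀ q : Q, ∃ i j k : ℕ, q = X ^ i * ⟨a, haQ⟩ ^ j * D ^ k := by
    intro q
    obtain ⟨i, j, k, hq⟩ := (h.mem_centralizer_iff q).1 (hQ ▸ q.2)
    refine ⟨i, j, k, Subtype.ext ?_⟩
    simp only [Subgroup.coe_mul, Subgroup.coe_pow, hX, hD, ← pow_mul]
    exact hq
  have hτor : ∀ q, τ q = q ∧ (∃ i k : ℕ, q = X ^ i * D ^ k) ∨ τ q = q * D := by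
    intro q
    obtain ⟨i, j, k, rfl⟩ := hform q
    have haa : (⟨a, haQ⟩ : Q) * ⟨a, haQ⟩ = 1 := Subtype.ext h.a2
    rcases pow_eq_one_or_self haa j with hj | hj <;> rw [hj]
    · left
      exact ⟨by simp only [map_mul, map_pow, hτX, hτD, mul_one], i, k, by rw [mul_one]⟩
    · right
      simp only [map_mul, map_pow, hτX, hτD, hτa]
      rw [mul_assoc, mul_assoc, mul_assoc, mul_assoc,
        ((Commute.refl D).pow_right k).eq]
  have hD1 : D ≠ 1 := fun h1 => h.d_ne_one (by rw [← hD, h1]; rfl)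
  refine ⟨hP.to_subgroup Q, fun r s => Subtype.ext (hcomm r r.2 s s.2), hA, fun g hgA => ?_,
    conjAut_le_autGroup F Q ⟨x, hτ⟩, hDD, hD1, hτD, fun q => (hτor q).imp_left And.left, hτX, ?_,
    ⟨⟨a, haQ⟩, fun h1 => hD1 (mul_eq_left.1 (hτa.symm.trans h1))⟩⟩
  · obtain ⟨s, ⟨y, hy⟩, k, hk, hgs⟩ := hodd g hgA
    obtain ⟨r, hr, rfl | rfl⟩ := h.exists_conj_or y <;> rw [← hQ] at hr
    · left
      have hs : s = 1 := MulEquiv.ext fun q => Subtype.ext (by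
        rw [hy, hcomm _ hr _ q.2, mul_inv_cancel_right]; rfl)
      exact ⟨k, hk, by rwa [hs, mul_one] at hgs⟩
    · right
      have hs : s = τ := MulEquiv.ext fun q => Subtype.ext (by
        have h1 : r * q * r⁻¹ = q := by rw [hcomm _ hr _ q.2, mul_inv_cancel_right]
        rw [hy, hτ]
        calc x * r * q * (x * r)⁻¹ = x * (r * q * r⁻¹) * x⁻¹ := by group
          _ = _ := by rw [h1])
      exact ⟨k, hk, by rwa [hs] at hgs⟩
  · intro q hq
    rcases hτor q with h1 | h1
    · exact h1.2
    · rw [hq] at h1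
      exact absurd (mul_eq_left.1 h1.symm) hD1

/-- If the transvection `τ` fixed `α D` for all `α ∈ Aut_F(C(a))`, then every `α` would commute with
`τ`, fix its centre `D` and act on its fixed points; thus automorphisms of odd order would be
trivial, and `F` would be nilpotent. -/
theorem exists_aut_moving (hP : IsPGroup 2 P) (hF : F.IsSaturated 2) (hnil : ¬ F.IsNilpotent)
    (h : CyclicExtension E x a d b m 0) {Q : Subgroup P} (hQ : Q = Subgroup.centralizer {a})
    {τ : MulAut Q} (hτ : ∀ q, (τ q : P) = x * q * x⁻¹) {X D : Q}
    (hX : (X : P) = x ^ 2) (hD : (D : P) = d) : ∃ α ∈ F.autGroup Q, τ (α D) ≠ α D := by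
  by_contra! hall
  refine hnil (hF.isNilpotent hP fun R f _ hRc hmor hf => ?_)
  by_contra! hne
  have hne' : ∃ r ∈ R, r ∉ hf.fixed := by
    obtain ⟨r, hr, hr'⟩ := hne
    exact ⟨r, hr, fun h1 => hr' h1.2⟩
  have hRQ : R = Q := (h.eq_centralizer hP hf hne' hRc).trans hQ.symm
  subst hRQ
  have hT := h.isTransvectionGroup hP hF hQ hτ hX hD
  obtain ⟨α, hα, hαf⟩ := hmor.exists_mulAut hf.maps
  have hαD := hT.map_eq hα (hall α hα)
  have hατ := hT.conj_eq hα (hall α hα)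
  have hc : ∀ r ∈ R, ∀ s ∈ R, r * s = s * r := hQ ▸ h.centralizer_comm
  have hdf : d ∈ hf.fixed := ⟨hD ▸ D.2, by rw [← hD, ← hαf, hαD]⟩
  have hx2f : x ^ 2 ∈ hf.fixed := by
    have h1 : τ (α X) = α X := by
      conv_lhs => rw [← hατ]
      change α (τ (α⁻¹ (α X))) = _
      rw [MulAut.inv_apply_self, hT.map_X]
    obtain ⟨i, k, hik⟩ := hT.fixed _ h1
    refine hf.mem_fixed_of_zpow_mul_of_commute hP (i := i) (n := d ^ k) (hX ▸ X.2)
      (hf.fixed.pow_mem hdf k) (hc _ (hX ▸ X.2) _ (hf.fixed.pow_mem hdf k).1) ?_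
    rw [← hX, ← hαf, hik, zpow_natCast, ← hD]
    rfl
  have haf : a ∈ hf.fixed := by
    have ha : a ∈ R := hQ ▸
      Subgroup.mem_centralizer_singleton_iff.2 rfl
    obtain ⟨i, j, k, hijk⟩ := (h.mem_centralizer_iff _).1 (hQ ▸ hf.maps a ha)
    have h1 : x ^ (2 * i) ∈ hf.fixed := by rw [pow_mul]; exact hf.fixed.pow_mem hx2f i
    have h2 : x ^ (2 * i) * d ^ k ∈ hf.fixed := hf.fixed.mul_mem h1 (hf.fixed.pow_mem hdf k)
    refine hf.mem_fixed_of_zpow_mul_of_commute hP (i := j) (n := x ^ (2 * i) * d ^ k) ha h2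
      (hc _ ha _ h2.1) ?_
    rw [hijk, zpow_natCast, ((show Commute a (x ^ (2 * i)) from hc _ ha _ h1.1).pow_left j).eq.symm,
      mul_assoc]
  obtain ⟨r, hr, hr'⟩ := hne'
  obtain ⟨i, j, k, rfl⟩ := (h.mem_centralizer_iff r).1 (hQ ▸ hr)
  refine hr' (hf.fixed.mul_mem (hf.fixed.mul_mem ?_ (hf.fixed.pow_mem haf j))
    (hf.fixed.pow_mem hdf k))
  rw [pow_mul]; exact hf.fixed.pow_mem hx2f i

omit [Finite P] in
/-- The generators `x` and `a` can be replaced by `x` or `x * v` and `v`, for any involution `v` of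
`C(a)` not centralized by `x`. -/
theorem change_generators (h : CyclicExtension E x a d b m 0) {v x' : P}
    (hv : v ∈ Subgroup.centralizer {a}) (hvv : v * v = 1) (hxv : x * v = v * d * x)
    (hx' : x' = x ∨ x' = x * v) :
    MinimalNonabelianGenerators m x' v d ∧
      (Subgroup.centralizer {v} : Subgroup P) = Subgroup.centralizer {a} := by
  have hg := h.minimalNonabelianGenerators
  have hx'v : x' * v = v * d * x' := by
    rcases hx' with rfl | rfl
    · exact hxv
    · rw [mul_assoc, hvv, mul_one, ← mul_assoc, ← hxv, mul_assoc, hvv, mul_one]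
  obtain ⟨i, j, k, hijk⟩ := (h.mem_centralizer_iff v).1 hv
  -- otherwise `v ∈ ⟨x, d⟩` would be centralized by `x`
  have hj : a ^ j = a := by
    refine (pow_eq_one_or_self h.a2 j).resolve_left fun hj => h.d_ne_one ?_
    rw [hj, mul_one] at hijk
    have h1 : Commute x v := by
      rw [hijk]
      exact ((Commute.refl x).pow_right _).mul_right (hg.cx.symm.pow_right k)
    rw [h1.eq] at hxv
    exact mul_eq_left.1 (mul_right_cancel hxv).symm
  have hx'4 : x' ^ 4 = x ^ 4 := by
    have h4 : x ^ (4 * (2 * i)) = 1 := by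
      rw [← h.pow_four_eq (2 * i) j k, ← hijk]
      calc v ^ 4 = (v * v) * (v * v) := by
            simp only [pow_succ, pow_zero, one_mul, mul_assoc]
        _ = 1 := by rw [hvv, one_mul]
    rcases hx' with rfl | rfl
    · rfl
    · have h5 : x * v = x ^ (2 * i + 1) * a ^ j * d ^ k := by
        rw [hijk, pow_succ']; simp only [mul_assoc]
      rw [h5, h.pow_four_eq, mul_add, pow_add, h4, one_mul]
  have hxcl : x ∈ Subgroup.closure {x', v} := by
    have h1 : x' ∈ Subgroup.closure {x', v} := Subgroup.subset_closure (Or.inl rfl)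
    have h2 : v ∈ Subgroup.closure {x', v} := Subgroup.subset_closure (Or.inr rfl)
    rcases hx' with rfl | rfl
    · exact h1
    · exact (Subgroup.mul_mem_cancel_right _ h2).1 h1
  refine ⟨⟨?_, hvv, h.d2, hx'v, hg.commute_c _, hg.commute_c _, ?_⟩, ?_⟩
  · have hm := h.two_le
    have h1 : 2 ^ m = 4 * 2 ^ (m - 2) := by
      rw [show m = 2 + (m - 2) by omega, pow_add]; norm_num
    rw [h1, pow_mul, hx'4, ← pow_mul, ← h1, hg.x_pow]
  · have hvcl : v ∈ Subgroup.closure {x', v} := Subgroup.subset_closure (Or.inr rfl)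
    have hdcl : d ∈ Subgroup.closure {x', v} := by
      have h1 : d = v⁻¹ * (x * v * x⁻¹) := by rw [hxv]; group
      rw [h1]
      exact Subgroup.mul_mem _ (Subgroup.inv_mem _ hvcl)
        (Subgroup.mul_mem _ (Subgroup.mul_mem _ hxcl hvcl) (Subgroup.inv_mem _ hxcl))
    have hacl : a ∈ Subgroup.closure {x', v} := by
      rw [hijk, hj,
        Subgroup.mul_mem_cancel_right _ (Subgroup.pow_mem _ (by rwa [hijk, hj] at hdcl) k),
        Subgroup.mul_mem_cancel_left _ (Subgroup.pow_mem _ (by rwa [hijk, hj] at hxcl) _)] at hvcl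
      rwa [hijk, hj]
    rw [eq_top_iff, ← hg.closure_eq_top, Subgroup.closure_le]
    rintro _ (rfl | rfl)
    · exact hxcl
    · exact hacl
  · refine le_antisymm (fun g hgv => ?_) fun q hq =>
      Subgroup.mem_centralizer_singleton_iff.2 (h.centralizer_comm q hq v hv)
    obtain ⟨q, hq, rfl | rfl⟩ := h.exists_conj_or g
    · exact hq
    · exfalso
      have h1 := Subgroup.mem_centralizer_singleton_iff.1 hgv
      rw [mul_assoc, h.centralizer_comm q hq v hv, ← mul_assoc, ← mul_assoc] at h1
      have h2 := mul_right_cancel h1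
      rw [hxv, mul_assoc, mul_right_inj] at h2
      exact h.d_ne_one (mul_eq_right.1 h2)

end CyclicExtension

end Standard

/-! ### Nonnilpotent fusion systems are standard -/

section Standard

variable {P : Type*} [Group P] [Finite P] {F : FusionSystem P} {E : Subgroup P}
  {x a d b : P} {m : ℕ}

namespace CyclicExtension

open FusionSystem

/-- The automorphism group of `C(a)` acts as the full symmetric group on three involutions and fixes
the square of a generator `x'`; this determines all morphisms. -/
theorem exists_isStandard (hP : IsPGroup 2 P) (hF : F.IsSaturated 2) (hnil : ¬ F.IsNilpotent)
    (h : CyclicExtension E x a d b m 0) : ∃ x' y, MinimalNonabelianGenerators m x' y d ∧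
      (Subgroup.centralizer {y} : Subgroup P) = Subgroup.centralizer {a} ∧ F.IsStandard x' y d ∧
      ∃ β, F.IsMor (Subgroup.centralizer {y}) β ∧ (∀ q ∈ Subgroup.centralizer {y},
        β q ∈ Subgroup.centralizer {y}) ∧ β d = y := by
  obtain ⟨Q, hQ⟩ : ∃ Q : Subgroup P, Q = Subgroup.centralizer {a} := ⟨_, rfl⟩
  have hQn : Q.Normal := hQ ▸ h.centralizer_normal
  have hcomm : ∀ r ∈ Q, ∀ s ∈ Q, r * s = s * r := hQ ▸ h.centralizer_comm
  have hx2Q : x ^ 2 ∈ Q := hQ ▸ (h.mem_centralizer_iff _).2 ⟨1, 0, 0, by simp⟩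
  have hdQ : d ∈ Q := hQ ▸ (h.mem_centralizer_iff _).2 ⟨0, 0, 1, by simp⟩
  have hxN : x ∈ Subgroup.normalizer (Q : Set P) := by
    rw [Subgroup.normalizer_eq_top Q]; trivial
  obtain ⟨τ, -, hτ⟩ := exists_mem_conjAut hxN
  set X : Q := ⟨x ^ 2, hx2Q⟩ with hX
  set D : Q := ⟨d, hdQ⟩ with hD
  obtain ⟨α, hα, hne⟩ := h.exists_aut_moving hP hF hnil hQ hτ (X := X) (D := D) rfl rfl
  have hT := h.isTransvectionGroup hP hF hQ hτ (X := X) (D := D) rfl rfl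
  obtain ⟨Z, hZ, hZfix⟩ := hT.exists_fixed hα hne
  set A := F.autGroup Q with hA
  obtain ⟨V, hV⟩ : ∃ V, V = α D := ⟨_, rfl⟩
  have hVV : V * V = 1 := hV ▸ hT.v_sq
  have hτV : τ V = V * D := hV ▸ hT.map_v hne
  have hxv : x * V = V * d * x := by
    have h1 : ((τ V : Q) : P) = x * V * x⁻¹ := hτ V
    rw [hτV] at h1
    rw [← mul_inv_eq_iff_eq_mul, ← h1]; rfl
  have hvv : (V : P) * V = 1 := congrArg Subtype.val hVV
  -- the square of `x * V` is `x ^ 2 * d`, so the fixed element `Z` is a square of a generator in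
  -- both cases
  obtain ⟨x', hx', hx'2⟩ : ∃ x', (x' = x ∨ x' = x * V) ∧ x' ^ 2 = Z := by
    rcases hZ with rfl | rfl
    · exact ⟨x, Or.inl rfl, rfl⟩
    · refine ⟨x * V, Or.inr rfl, ?_⟩
      have h1 : (V : P) * x = x * V * d := by
        rw [hxv, mul_assoc, mul_assoc, ← (h.minimalNonabelianGenerators.cx).eq, ← mul_assoc d,
          h.d2, one_mul]
      calc (x * (V : P)) ^ 2 = x * (V * x) * V := by rw [pow_two]; simp only [mul_assoc]
        _ = x * x * (V * d * V) := by rw [h1]; simp only [mul_assoc]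
        _ = x ^ 2 * d := by rw [mul_assoc (V : P), hcomm _ hdQ _ V.2, ← mul_assoc (V : P), hvv,
            one_mul, pow_two]
        _ = _ := rfl
  obtain ⟨hgen, hcent⟩ := h.change_generators (hQ ▸ V.2) hvv hxv hx'
  rw [← hQ] at hcent ⊢
  suffices hst : F.IsStandard x' V d by
    refine ⟨x', V, hgen, hcent, hst, ?_⟩
    rw [hcent]
    refine ⟨extFun α, mem_autGroup_iff.1 hα, fun q hq => extFun_mem α hq, ?_⟩
    rw [hV, ← extFun_coe]
  have hmemV : ∀ {β : MulAut Q}, β ∈ A → ∀ q : Q, (β q = D ∨ β q = V ∨ β q = V * D) ↔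
      (q = D ∨ q = V ∨ q = V * D) := fun hβ q => by
    have := hT.apply_mem_iff hα hne hβ q
    rwa [← hV] at this
  have hcoe : ∀ q : Q, ((q : P) = d ∨ (q : P) = V ∨ (q : P) = V * d) ↔
      (q = D ∨ q = V ∨ q = V * D) := fun q => by
    simp only [Subtype.ext_iff, hD, Subgroup.coe_mul]
  -- `Z`, `V` and `d` generate `Q`
  have hform : ∀ q : Q, ∃ i j k : ℕ, q = Z ^ i * V ^ j * D ^ k := by
    intro q
    obtain ⟨i, j, k, hq⟩ := hgen.exists_form q
    have hw : (V : P) ^ j * d ^ k ∈ Q := Q.mul_mem (Q.pow_mem V.2 j) (Q.pow_mem hdQ k)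
    rcases Nat.even_or_odd' i with ⟨s, rfl | rfl⟩
    · exact ⟨s, j, k, Subtype.ext (by rw [hq, pow_mul, hx'2]; rfl)⟩
    · exfalso
      have hxi : x' ^ (2 * s + 1) ∈ Q := by
        have h1 := q.2
        rw [hq, mul_assoc] at h1
        exact (Q.mul_mem_cancel_right hw).1 h1
      have hx'Q : x' ∈ Q := by
        rw [pow_succ, pow_mul, hx'2] at hxi
        exact (Q.mul_mem_cancel_left (Q.pow_mem Z.2 s)).1 hxi
      have hxQ : x ∈ Q := by
        rcases hx' with rfl | rfl
        · exact hx'Q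
        · exact (Q.mul_mem_cancel_right V.2).1 hx'Q
      rw [hcomm x hxQ V V.2] at hxv
      exact h.d_ne_one (mul_eq_left.1 (mul_right_cancel hxv).symm)
  constructor
  · intro S f hf
    refine (hF.conj_or_aut hP hQn ?_ S f hf).imp_right ?_
    · intro R f hRc hf hne'
      exact (h.eq_centralizer hP hf hne' hRc).trans hQ.symm
    · rintro ⟨hS, β, hβ, hfβ⟩
      rw [hcent]
      refine ⟨hS, extFun β, ?_, hfβ⟩
      constructor
      · rw [hcent]; exact fun q hq => extFun_mem β hq
      · rw [hcent]
        intro q hq r hr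
        have h1 := extFun_coe β (⟨q, hq⟩ * ⟨r, hr⟩)
        rw [map_mul, Subgroup.coe_mul, Subgroup.coe_mul, ← extFun_coe, ← extFun_coe] at h1
        exact h1
      · rw [hx'2, extFun_coe, hZfix β hβ]
      · rw [hcent]
        intro q hq
        have h1 := extFun_coe β ⟨q, hq⟩
        simp only at h1
        rw [h1, hcoe, hmemV hβ, ← hcoe]
  · intro β hβ
    rw [hcent]
    have hmaps := hβ.maps
    have hmul := hβ.map_mul
    have hmem := hβ.mem_iff
    rw [hcent] at hmaps hmul hmem
    have hβ1 : β 1 = 1 := by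
      have := hmul 1 Q.one_mem 1 Q.one_mem
      simpa using this
    have hpow : ∀ q ∈ Q, ∀ n : ℕ, β (q ^ n) = β q ^ n := by
      intro q hq n
      induction n with
      | zero => simpa using hβ1
      | succ n ih => rw [pow_succ, hmul _ (Q.pow_mem hq n) _ hq, ih, pow_succ]
    -- `β` induces a permutation of the involutions `d`, `V`, `V * d`, which is determined by the
    -- images `U` and `W` of `V` and `d`
    set U : Q := ⟨β V, hmaps V V.2⟩ with hU
    set W : Q := ⟨β d, hmaps d hdQ⟩ with hW
    have hU3 : U = D ∨ U = V ∨ U = V * D :=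
      (hcoe U).1 ((hmem V V.2).2 (Or.inr (Or.inl rfl)))
    have hW3 : W = D ∨ W = V ∨ W = V * D :=
      (hcoe W).1 ((hmem d hdQ).2 (Or.inl rfl))
    have hUW : U ≠ W := by
      intro h1
      have h2 : β (V * d) = 1 := by
        rw [hmul _ V.2 _ hdQ]
        have h3 : β V = β d := congrArg Subtype.val h1
        rw [← h3, ← hmul _ V.2 _ V.2, hvv, hβ1]
      have h4 := (hmem (V * d) (Q.mul_mem V.2 hdQ)).2 (Or.inr (Or.inr rfl))
      rw [h2, ← hβ1] at h4
      have h5 := (hmem 1 Q.one_mem).1 h4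
      have hV1 : V ≠ 1 := by
        intro h6
        rw [hV, ← map_one α] at h6
        exact hT.c_ne (α.injective h6)
      have hVD : V ≠ D := fun h6 => hne (by rw [← hV, h6, hT.map_c])
      rcases h5 with h5 | h5 | h5
      · exact h.d_ne_one h5.symm
      · exact hV1 (Subtype.ext h5.symm)
      · apply hVD
        refine Subtype.ext ?_
        rw [← mul_one (V : P), ← h.d2, ← mul_assoc]
        change (V * d) * d = d
        rw [← h5, one_mul]
    -- The transvections `τ` and `σ` generate all permutations of the three involutions.
    obtain ⟨γ, hγ, hγV, hγD⟩ : ∃ γ ∈ A, γ V = U ∧ γ D = W := by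
      set σ := α * τ * α⁻¹ with hσ
      have hσA : σ ∈ A := A.mul_mem (A.mul_mem hα hT.mem) (A.inv_mem hα)
      have hσV : σ V = V := by
        rw [hV]
        change α (τ (α⁻¹ (α D))) = _
        rw [MulAut.inv_apply_self, hT.map_c]
      have hσD : σ D = V * D := by
        rw [hT.comm V, hV]; exact hT.sigma_c hα hne
      have hτD := hT.map_c
      have hDD := hT.c_sq
      have hVVD : V * (V * D) = D := by rw [← mul_assoc, hVV, one_mul]
      have hVDD : V * D * D = V := by rw [mul_assoc, hDD, mul_one]
      have hVDV : V * D * V = D := by rw [hT.comm V, mul_assoc, hVV, mul_one]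
      rcases hU3 with hU3 | hU3 | hU3 <;> rcases hW3 with hW3 | hW3 | hW3 <;> rw [hU3, hW3] at hUW ⊢
      · exact absurd rfl hUW
      · refine ⟨τ * (σ * τ), A.mul_mem hT.mem (A.mul_mem hσA hT.mem), ?_, ?_⟩
        · simp only [MulAut.mul_apply, hτV, hσV, hσD, hτD, map_mul, hVVD]
        · simp only [MulAut.mul_apply, hτV, hσD, hτD, map_mul, hVDD]
      · refine ⟨σ * τ, A.mul_mem hσA hT.mem, ?_, ?_⟩
        · simp only [MulAut.mul_apply, hτV, hσV, hσD, map_mul, hVVD]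
        · simp only [MulAut.mul_apply, hσD, hτD]
      · exact ⟨1, A.one_mem, rfl, rfl⟩
      · exact absurd rfl hUW
      · exact ⟨σ, hσA, hσV, hσD⟩
      · exact ⟨τ, hT.mem, hτV, hτD⟩
      · refine ⟨τ * σ, A.mul_mem hT.mem hσA, ?_, ?_⟩
        · simp only [MulAut.mul_apply, hτV, hσV]
        · simp only [MulAut.mul_apply, hτV, hσD, hτD, map_mul, hVDD]
      · exact absurd rfl hUW
    refine (mem_autGroup_iff.1 hγ).congr fun q hq => ?_
    obtain ⟨i, j, k, hqf⟩ := hform ⟨q, hq⟩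
    have hqf' : q = (Z : P) ^ i * (V : P) ^ j * d ^ k := congrArg Subtype.val hqf
    have h1 := extFun_coe γ ⟨q, hq⟩
    simp only at h1
    have h2 : β (Z : P) = Z := by rw [← hx'2]; exact hβ.map_sq
    rw [h1, hqf, map_mul, map_mul, map_pow, map_pow, map_pow, hγV, hγD, hZfix γ hγ, hqf',
      hmul _ (Q.mul_mem (Q.pow_mem Z.2 i) (Q.pow_mem V.2 j)) _ (Q.pow_mem hdQ k),
      hmul _ (Q.pow_mem Z.2 i) _ (Q.pow_mem V.2 j), hpow _ Z.2, hpow _ V.2, hpow _ hdQ, h2]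
    rfl

end CyclicExtension

end Standard

/-! ### Cyclic groups and the structure of the abelian maximal subgroup -/

section CyclicGroups

variable {G : Type*} [Group G] {n : ℕ}

/-- The homomorphism from `C_n` that maps the canonical generator to `g`. -/
def cyclicHom (g : G) (hg : g ^ n = 1) : CyclicGroup n →* G :=
  AddMonoidHom.toMultiplicativeLeft
    (ZMod.lift n ⟨zmultiplesHom (Additive G) (Additive.ofMul g), by
      rw [zmultiplesHom_apply, ← ofMul_zpow, zpow_natCast, hg]; rfl⟩)

theorem cyclicHom_ofAdd_one (g : G) (hg : g ^ n = 1) :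
    cyclicHom g hg (Multiplicative.ofAdd 1) = g := by
  have h1 : ((1 : ℤ) : ZMod n) = 1 := Int.cast_one
  change (ZMod.lift n _ (1 : ZMod n) : Additive G).toMul = g
  rw [← h1, ZMod.lift_coe]
  simp

theorem CyclicGroup.exists_pow [NeZero n] (u : CyclicGroup n) :
    ∃ i : ℕ, u = (Multiplicative.ofAdd (1 : ZMod n)) ^ i := by
  refine ⟨(Multiplicative.toAdd u).val, ?_⟩
  rw [← ofAdd_nsmul, nsmul_one, ZMod.natCast_val, ZMod.cast_id', id]
  rfl

theorem CyclicGroup.pow_eq_one_iff {i : ℕ} :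
    (Multiplicative.ofAdd (1 : ZMod n)) ^ i = 1 ↔ n ∣ i := by
  rw [← ofAdd_nsmul, nsmul_one, ← ofAdd_zero, Multiplicative.ofAdd.apply_eq_iff_eq,
    ZMod.natCast_eq_zero_iff]

end CyclicGroups

theorem IsStronglyEmbedded.map {p : ℕ} {X Y : Type*} [Group X] [Group Y] {H : Subgroup X}
    (h : IsStronglyEmbedded p H) (e : X ≃* Y) : IsStronglyEmbedded p (H.map e.toMonoidHom) := by
  obtain ⟨h1, h2, h3, h4⟩ := h
  have hinj : Function.Injective e.toMonoidHom := e.injective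
  have hc : ∀ K : Subgroup X, Nat.card (K.map e.toMonoidHom) = Nat.card K := fun K =>
    (Nat.card_congr (K.equivMapOfInjective _ hinj).toEquiv).symm
  have hi : (H.map e.toMonoidHom).index = H.index := Subgroup.index_map_equiv H e
  refine ⟨by rwa [hc], by rwa [hi], by rwa [hi], fun y hy => ?_⟩
  obtain ⟨x, rfl⟩ := e.surjective y
  have hx : x ∉ H := fun hx => hy ⟨x, hx, rfl⟩
  have h5 : (H.map e.toMonoidHom).map (MulAut.conj (e x)).toMonoidHom =
      (H.map (MulAut.conj x).toMonoidHom).map e.toMonoidHom := by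
    rw [Subgroup.map_map, Subgroup.map_map]
    congr 1
    ext z
    simp
  rw [h5, ← Subgroup.map_inf _ _ _ hinj, hc]
  exact h4 x hx

namespace MinimalNonabelianGenerators

variable {P : Type*} [Group P] {m : ℕ} {x y c : P}

/-- Commutators are powers of `c`. -/
theorem mul_comm_c (h : MinimalNonabelianGenerators m x y c) (g g' : P) :
    ∃ n : ℕ, g * g' = g' * g * c ^ n := by
  obtain ⟨i, j, k, rfl⟩ := h.exists_form g
  obtain ⟨i', j', k', rfl⟩ := h.exists_form g'
  refine ⟨(i * j' + k' + k) + (i' * j + k + k'), ?_⟩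
  rw [h.mul_form, h.mul_form, add_comm i' i, add_comm j' j, mul_assoc _ (c ^ (i * j' + k' + k)),
    ← pow_add, ← add_assoc (i * j' + k' + k), ← two_mul (i * j' + k' + k),
    pow_add c (2 * (i * j' + k' + k)), pow_eq_one_of_even h.c_sq (even_two_mul _), one_mul]

theorem c_ne_one (h : MinimalNonabelianGenerators m x y c) (hcard : Nat.card P = 2 ^ (m + 2)) :
    c ≠ 1 := by
  intro hc
  have := (h.indep hcard (i := 0) (j := 0) (k := 1) (by rw [hc]; simp)).2.2
  exact absurd this (by decide)

theorem mem_centralizer_iff (h : MinimalNonabelianGenerators m x y c)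
    (hcard : Nat.card P = 2 ^ (m + 2)) (g : P) :
    g ∈ Subgroup.centralizer {y} ↔ ∃ i j k : ℕ, g = x ^ (2 * i) * y ^ j * c ^ k := by
  have key : ∀ i j k : ℕ, y * (x ^ i * y ^ j * c ^ k) = x ^ i * y ^ j * c ^ k * y * c ^ i := by
    intro i j k
    have h1 := h.y_pow_mul i 1
    rw [pow_one, mul_one] at h1
    calc y * (x ^ i * y ^ j * c ^ k) = y * x ^ i * (y ^ j * c ^ k) := by simp only [mul_assoc]
      _ = x ^ i * y * (c ^ i * (y ^ j * c ^ k)) := by rw [h1]; simp only [mul_assoc]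
      _ = x ^ i * (y * y ^ j) * (c ^ k * c ^ i) := by
        rw [((h.commute_c _).pow_left i).eq]; simp only [mul_assoc]
      _ = x ^ i * y ^ j * (y * c ^ k) * c ^ i := by
        rw [((Commute.refl y).pow_right j).eq]; simp only [mul_assoc]
      _ = _ := by rw [← (h.cy.pow_left k).eq]; simp only [mul_assoc]
  rw [Subgroup.mem_centralizer_singleton_iff]
  constructor
  · intro hg
    obtain ⟨i, j, k, rfl⟩ := h.exists_form g
    rw [key] at hg
    have h1 : c ^ i = 1 := mul_eq_left.1 hg.symm
    rcases Nat.even_or_odd' i with ⟨s, rfl | rfl⟩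
    · exact ⟨s, j, k, rfl⟩
    · rw [pow_eq_self_of_odd h.c_sq ⟨s, rfl⟩] at h1
      exact absurd h1 (h.c_ne_one hcard)
  · rintro ⟨i, j, k, rfl⟩
    rw [key, pow_eq_one_of_even h.c_sq (even_two_mul i), mul_one]

theorem centralizer_comm (h : MinimalNonabelianGenerators m x y c)
    (hcard : Nat.card P = 2 ^ (m + 2)) :
    ∀ r ∈ Subgroup.centralizer {y}, ∀ s ∈ Subgroup.centralizer {y}, r * s = s * r := by
  intro r hr s hs
  obtain ⟨i, j, k, rfl⟩ := (h.mem_centralizer_iff hcard r).1 hr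
  obtain ⟨i', j', k', rfl⟩ := (h.mem_centralizer_iff hcard s).1 hs
  rw [h.mul_form, h.mul_form, add_comm (2 * i') (2 * i), add_comm j' j]
  congr 1
  rw [pow_add, pow_add, pow_add, pow_add, pow_eq_one_of_even h.c_sq ((even_two_mul i').mul_right j),
    pow_eq_one_of_even h.c_sq ((even_two_mul i).mul_right j'), one_mul, one_mul, ← pow_add,
    ← pow_add, add_comm]

theorem centralizer_normal (h : MinimalNonabelianGenerators m x y c) :
    (Subgroup.centralizer {y} : Subgroup P).Normal := by
  refine ⟨fun q hq g => ?_⟩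
  obtain ⟨n, hn⟩ := h.mul_comm_c g q
  have : g * q * g⁻¹ = q * c ^ n := by
    rw [hn, mul_assoc q, ← ((h.commute_c g).pow_left n).eq, ← mul_assoc,
      mul_inv_cancel_right]
  rw [this]
  exact Subgroup.mul_mem _ hq (Subgroup.pow_mem _
    (Subgroup.mem_centralizer_singleton_iff.2 h.cy.eq) n)

/-- The abelian group `C(y)` is the direct product of `⟨x ^ 2⟩`, `⟨y⟩` and `⟨c⟩`. -/
theorem nonempty_mulEquiv (h : MinimalNonabelianGenerators m x y c) (hm : 2 ≤ m)
    (hcard : Nat.card P = 2 ^ (m + 2)) : Nonempty ((Subgroup.centralizer {y} : Subgroup P) ≃*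
      CyclicGroup (2 ^ (m - 1)) × CyclicGroup 2 × CyclicGroup 2) := by
  set Q : Subgroup P := Subgroup.centralizer {y} with hQ
  have hmem := h.mem_centralizer_iff hcard
  have hcomm : ∀ r s : Q, Commute r s := fun r s =>
    Subtype.ext (h.centralizer_comm hcard r r.2 s s.2)
  have h2m : 2 * 2 ^ (m - 1) = 2 ^ m := by rw [← pow_succ']; congr 1; omega
  set X : Q := ⟨x ^ 2, (hmem _).2 ⟨1, 0, 0, by simp⟩⟩ with hX
  set Y : Q := ⟨y, (hmem _).2 ⟨0, 1, 0, by simp⟩⟩ with hY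
  set C : Q := ⟨c, (hmem _).2 ⟨0, 0, 1, by simp⟩⟩ with hC
  have hXp : X ^ 2 ^ (m - 1) = 1 := Subtype.ext (by
    change (x ^ 2) ^ 2 ^ (m - 1) = 1
    rw [← pow_mul, h2m, h.x_pow])
  have hYp : Y ^ 2 = 1 := Subtype.ext (by change y ^ 2 = 1; rw [pow_two, h.y_sq])
  have hCp : C ^ 2 = 1 := Subtype.ext (by change c ^ 2 = 1; rw [pow_two, h.c_sq])
  let ψ : CyclicGroup (2 ^ (m - 1)) × CyclicGroup 2 × CyclicGroup 2 →* Q :=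
    (cyclicHom X hXp).noncommCoprod ((cyclicHom Y hYp).noncommCoprod (cyclicHom C hCp)
      (fun _ _ => hcomm _ _)) (fun _ _ => hcomm _ _)
  have hψ : ∀ i j k : ℕ, ψ (Multiplicative.ofAdd 1 ^ i, Multiplicative.ofAdd 1 ^ j,
      Multiplicative.ofAdd 1 ^ k) = X ^ i * (Y ^ j * C ^ k) := by
    intro i j k
    simp only [ψ, MonoidHom.noncommCoprod_apply, map_pow, cyclicHom_ofAdd_one]
  refine ⟨(MulEquiv.ofBijective ψ ⟨?_, ?_⟩).symm⟩
  · rw [injective_iff_map_eq_one]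
    rintro ⟨u, v, w⟩ huvw
    obtain ⟨i, rfl⟩ := CyclicGroup.exists_pow u
    obtain ⟨j, rfl⟩ := CyclicGroup.exists_pow v
    obtain ⟨k, rfl⟩ := CyclicGroup.exists_pow w
    rw [hψ] at huvw
    have h1 : x ^ (2 * i) * y ^ j * c ^ k = 1 := by
      rw [mul_assoc, pow_mul]; exact congrArg Subtype.val huvw
    obtain ⟨hi, hj, hk⟩ := h.indep hcard h1
    rw [← h2m] at hi
    rw [CyclicGroup.pow_eq_one_iff.2 (Nat.dvd_of_mul_dvd_mul_left (by norm_num) hi),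
      CyclicGroup.pow_eq_one_iff.2 hj.two_dvd, CyclicGroup.pow_eq_one_iff.2 hk.two_dvd]
    rfl
  · intro q
    obtain ⟨i, j, k, hq⟩ := (hmem q).1 q.2
    refine ⟨(Multiplicative.ofAdd 1 ^ i, Multiplicative.ofAdd 1 ^ j,
      Multiplicative.ofAdd 1 ^ k), ?_⟩
    rw [hψ]
    exact Subtype.ext (by rw [hq, mul_assoc, pow_mul]; rfl)

end MinimalNonabelianGenerators

/-! ### The essential subgroup -/

section Essential

namespace FusionSystem

variable {P : Type*} [Group P] [Finite P] {F : FusionSystem P} {p : ℕ}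

omit [Finite P] in
theorem IsEssential.centralizer_le {R : Subgroup P} (h : F.IsEssential p R) :
    Subgroup.centralizer (R : Set P) ≤ R := by
  have h1 : F.Isomorphic R R := ⟨MulEquiv.refl R, F.mem_of_conj 1 _ (fun s => by simp)⟩
  rw [h.centric R h1]
  rintro _ ⟨r, -, rfl⟩
  exact r.2

/-- Strongly embedded subgroups are proper, of index prime to `2`, so `Aut_F(R)` is not a
`2`-group. -/
theorem IsEssential.exists_isOddAut {R : Subgroup P} (h : F.IsEssential 2 R) :
    ∃ f, F.IsMor R f ∧ ∃ hf : IsOddAut R f, ∃ r ∈ R, r ∉ hf.fixed := by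
  by_contra! hall
  have h1 : IsPGroup 2 (F.autGroup R) := isPGroup_autGroup fun f hf hodd r hr =>
    (hall f hf hodd r hr).2
  obtain ⟨H, -, hH, hH1, -⟩ := h.stronglyEmbedded
  have h2 : IsPGroup 2 (F.outGroup R) := h1.to_quotient _
  obtain ⟨k, hk⟩ := h2.index H
  rcases k with _ | k
  · rw [hk] at hH1
    norm_num at hH1
  · exact hH (hk ▸ dvd_pow_self 2 (Nat.succ_ne_zero k))

namespace IsStandard

variable {m : ℕ} {x y c : P}

/-- An automorphism in `Aut_F(C(y))` fixes `x ^ 2` and permutes the involutions `c`, `y`, `y * c`.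
Those fixing one involution form a strongly embedded subgroup of order two. -/
theorem isEssential (hF : F.IsStandard x y c) (h : MinimalNonabelianGenerators m x y c)
    (hcard : Nat.card P = 2 ^ (m + 2)) {β : P → P}
    (hβ : F.IsMor (Subgroup.centralizer {y}) β)
    (hβm : ∀ q ∈ Subgroup.centralizer {y}, β q ∈ Subgroup.centralizer {y}) (hβc : β c = y) :
    F.IsEssential 2 (Subgroup.centralizer {y}) := by
  obtain ⟨Q, hQ⟩ : ∃ Q : Subgroup P, Q = Subgroup.centralizer {y} := ⟨_, rfl⟩
  have hmem : ∀ g, g ∈ Q ↔ ∃ i j k : ℕ, g = x ^ (2 * i) * y ^ j * c ^ k :=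
    hQ ▸ h.mem_centralizer_iff hcard
  have hcomm : ∀ r ∈ Q, ∀ s ∈ Q, r * s = s * r := hQ ▸ h.centralizer_comm hcard
  have hn : Q.Normal := hQ ▸ h.centralizer_normal
  have hx2 : x ^ 2 ∈ Q := (hmem _).2 ⟨1, 0, 0, by simp⟩
  have hy : y ∈ Q := (hmem _).2 ⟨0, 1, 0, by simp⟩
  have hc : c ∈ Q := (hmem _).2 ⟨0, 0, 1, by simp⟩
  have hc1 := h.c_ne_one hcard
  have hx2c : ∀ g, Commute (x ^ 2) g := by
    intro g
    have h1 : Subgroup.closure {x, y} ≤ Subgroup.centralizer {x ^ 2} := by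
      rw [Subgroup.closure_le]
      rintro _ (rfl | rfl)
      · exact Subgroup.mem_centralizer_singleton_iff.2 ((Commute.refl _).pow_right 2).eq
      · refine Subgroup.mem_centralizer_singleton_iff.2 ?_
        rw [hQ] at hx2
        exact (Subgroup.mem_centralizer_singleton_iff.1 hx2).symm
    rw [h.closure_eq_top] at h1
    exact (Subgroup.mem_centralizer_singleton_iff.1 (h1 (Subgroup.mem_top g))).symm
  have hyc : y ≠ c := by
    intro h1
    have h2 := h.conj
    rw [h1, ← h.cx.eq, h.c_sq, one_mul] at h2
    exact hc1 (mul_eq_right.1 h2)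
  have hycy : y * c ≠ y := fun h1 => hc1 (mul_eq_left.1 h1)
  have hycc : y * c ≠ c := by
    intro h1
    have hy1 : y = 1 := mul_eq_right.1 h1
    have h2 := h.conj
    rw [hy1, mul_one, one_mul] at h2
    exact hc1 (mul_eq_right.1 h2.symm)
  have hmaps : ∀ f, F.IsMor Q f → ∀ q ∈ Q, f q ∈ Q := by
    intro f hf q hq
    rcases hF.mor Q f hf with ⟨g, hg⟩ | ⟨-, β, hβ, hfβ⟩
    · rw [hg q hq]; exact hn.conj_mem q hq g
    · have := hβ.maps
      rw [← hQ] at this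
      rw [hfβ q hq]; exact this q hq
  set A := F.autGroup Q with hA
  set X : Q := ⟨x ^ 2, hx2⟩ with hX
  set Y : Q := ⟨y, hy⟩ with hY
  set C : Q := ⟨c, hc⟩ with hC
  have hYC : Y ≠ C := fun h1 => hyc (congrArg Subtype.val h1)
  have hYCY : Y * C ≠ Y := fun h1 => hycy (congrArg Subtype.val h1)
  have hYCC : Y * C ≠ C := fun h1 => hycc (congrArg Subtype.val h1)
  have hstd : ∀ α ∈ A, α X = X ∧ (α C = C ∨ α C = Y ∨ α C = Y * C) := by
    intro α hα
    have e := extFun_coe α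
    rcases hF.mor Q _ (mem_autGroup_iff.1 hα) with ⟨g, hg⟩ | ⟨-, β, hβ, hfβ⟩
    · refine ⟨Subtype.ext ?_, Or.inl (Subtype.ext ?_)⟩
      · rw [← e, hg _ X.2]
        change g * x ^ 2 * g⁻¹ = x ^ 2
        rw [← (hx2c g).eq, mul_inv_cancel_right]
      · rw [← e, hg _ C.2]
        change g * c * g⁻¹ = c
        rw [← (h.commute_c g).eq, mul_inv_cancel_right]
    · refine ⟨Subtype.ext ?_, ?_⟩
      · rw [← e, hfβ _ X.2]
        exact hβ.map_sq
      · have h1 := (hβ.mem_iff c (hQ ▸ hc)).2 (Or.inl rfl)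
        have h2 : ((α C : Q) : P) = β c := by rw [← e, hfβ _ C.2]
        simp only [Subtype.ext_iff, h2]
        exact h1
  -- An automorphism is determined by its action on `C` and `Y`.
  have hdet : ∀ α ∈ A, α C = C → α Y = Y → α = 1 := by
    intro α hα h1 h2
    refine MulEquiv.ext fun q => ?_
    obtain ⟨i, j, k, hq⟩ := (hmem q).1 q.2
    have hq' : q = X ^ i * Y ^ j * C ^ k := Subtype.ext (by rw [hq, pow_mul]; rfl)
    rw [hq', map_mul, map_mul, map_pow, map_pow, map_pow, (hstd α hα).1, h1, h2]
    rfl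
  have hxN : x ∈ Subgroup.normalizer (Q : Set P) := by
    rw [Subgroup.normalizer_eq_top Q]; trivial
  obtain ⟨τ, hτ, hτq⟩ := exists_mem_conjAut hxN
  have hτA : τ ∈ A := conjAut_le_autGroup F Q hτ
  have hτC : τ C = C := Subtype.ext (by
    rw [hτq]
    change x * c * x⁻¹ = c
    rw [← h.cx.eq, mul_inv_cancel_right])
  have hτY : τ Y = Y * C := Subtype.ext (by
    rw [hτq]
    change x * y * x⁻¹ = y * c
    rw [h.conj, mul_inv_cancel_right])
  obtain ⟨α, hα, hαβ⟩ := IsMor.exists_mulAut (hQ ▸ hβ) (hQ ▸ hβm)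
  have hαC : α C = Y := Subtype.ext ((hαβ C).trans hβc)
  set H : Subgroup A := MulAction.stabilizer A C with hH
  have hmemH : ∀ g : A, g ∈ H ↔ (g : MulAut Q) C = C := fun g => Iff.rfl
  have hτ2 : (⟨⟨τ, hτA⟩, hτC⟩ : H) ^ 2 = 1 := by
    refine Subtype.ext (Subtype.ext (hdet (τ ^ 2) (A.pow_mem hτA 2) ?_ ?_))
    · change τ (τ C) = C
      rw [hτC, hτC]
    · change τ (τ Y) = Y
      rw [hτY, map_mul, hτY, hτC, mul_assoc, show C * C = 1 from Subtype.ext h.c_sq, mul_one]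
  have hτ1 : (⟨⟨τ, hτA⟩, hτC⟩ : H) ≠ 1 := by
    intro h1
    have h2 : τ = 1 := congrArg (fun g : H => ((g : A) : MulAut Q)) h1
    rw [h2] at hτY
    exact hYCY hτY.symm
  -- `H` is the stabilizer of `c` in the action on the three involutions, which is transitive due to
  -- `β` and `x`
  have hidx : H.index = 3 := by
    rw [hH, MulAction.index_stabilizer]
    have horb : MulAction.orbit A C = {C, Y, Y * C} := by
      ext q
      constructor
      · rintro ⟨g, rfl⟩
        exact (hstd g g.2).2
      · rintro (rfl | rfl | rfl)
        · exact MulAction.mem_orbit_self _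
        · exact ⟨⟨α, hα⟩, hαC⟩
        · refine ⟨⟨τ * α, A.mul_mem hτA hα⟩, ?_⟩
          change τ (α C) = Y * C
          rw [hαC, hτY]
    rw [horb, Set.ncard_insert_of_notMem, Set.ncard_pair]
    · exact fun h1 => hYCY h1.symm
    · rintro (h1 | h1)
      · exact hYC h1.symm
      · exact hYCC h1.symm
  have hHs : IsStronglyEmbedded 2 H := by
    refine ⟨?_, by rw [hidx]; norm_num, by rw [hidx]; norm_num, fun g hg => ?_⟩
    · rw [← orderOf_eq_prime hτ2 hτ1]
      exact orderOf_dvd_natCard _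
    -- an automorphism fixing two of the three involutions is trivial
    · have hbot : H ⊓ H.map (MulAut.conj g).toMonoidHom = ⊥ := by
        rw [eq_bot_iff]
        rintro κ ⟨hκ, k, hk, rfl⟩
        rw [Subgroup.mem_bot]
        refine Subtype.ext (hdet _ (Subtype.prop _) hκ ?_)
        set κ : MulAut Q := (((MulAut.conj g).toMonoidHom k : A) : MulAut Q) with hκdef
        have hκC : κ C = C := hκ
        have hκg : κ ((g : MulAut Q) C) = (g : MulAut Q) C := by
          have h1 : κ = (g : MulAut Q) * k * (g : MulAut Q)⁻¹ := rfl
          rw [h1]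
          change (g : MulAut Q) ((k : MulAut Q) ((g : MulAut Q)⁻¹ ((g : MulAut Q) C))) = _
          rw [MulAut.inv_apply_self, (hmemH k).1 hk]
        rcases (hstd g g.2).2 with h1 | h1 | h1
        · exact absurd h1 hg
        · rwa [h1] at hκg
        · rw [h1, map_mul, hκC] at hκg
          exact mul_right_cancel hκg
      rw [hbot, Subgroup.card_bot]
      norm_num
  refine ⟨?_, ?_, ?_⟩
  · exact isFullyNormalized_of_normal (hQ ▸ hn)
  · intro R hR
    obtain ⟨f, hf, hfR⟩ := isomorphic_iff.1 hR
    rw [← hQ] at hf hfR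
    rw [hf.mapSub_eq_of_maps (hmaps f hf)] at hfR
    subst hfR
    ext g
    constructor
    · intro hg
      have hgQ : g ∈ Q := by
        rw [hQ]
        refine Subgroup.mem_centralizer_singleton_iff.2 ?_
        exact (Subgroup.mem_centralizer_iff.1 hg y hy).symm
      exact ⟨⟨g, hgQ⟩, Subgroup.mem_center_iff.2 fun r => Subtype.ext (hcomm r r.2 g hgQ), rfl⟩
    · rintro ⟨r, -, rfl⟩
      exact Subgroup.mem_centralizer_iff.2 fun s hs => hcomm s hs r r.2
  · rw [← hQ]
    -- `Q` is abelian, so `Out_F(Q)` is `Aut_F(Q)`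
    have hbot : (MulAut.conj (G := Q)).range.subgroupOf (F.autGroup Q) = ⊥ := by
      rw [eq_bot_iff]
      rintro κ ⟨r, hr⟩
      rw [Subgroup.mem_bot]
      refine Subtype.ext (MulEquiv.ext fun q => ?_)
      change ((κ : F.autGroup Q) : MulAut Q) q = q
      have h1 : ((κ : F.autGroup Q) : MulAut Q) = MulAut.conj r := hr.symm
      rw [h1, MulAut.conj_apply, show r * q = q * r from Subtype.ext (hcomm r r.2 q q.2),
        mul_inv_cancel_right]
    let e : F.autGroup Q ≃* F.outGroup Q :=
      (QuotientGroup.quotientBot (G := F.autGroup Q)).symm.trans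
        (QuotientGroup.quotientMulEquivOfEq hbot.symm)
    exact ⟨_, hHs.map e⟩

end IsStandard

end FusionSystem

end Essential

/-! ### Permutations of four points and extensions of the alternating group -/

section Permutations

open Equiv

set_option maxRecDepth 100000

/-- The elements of the normal Klein four-group of `S_4`. -/
def kleinList : List (Perm (Fin 4)) :=
  [1, swap 0 1 * swap 2 3, swap 0 2 * swap 1 3, swap 0 3 * swap 1 2]

theorem mem_kleinList_iff :
    ∀ σ : Perm (Fin 4), σ ∈ kleinList ↔ Perm.sign σ = 1 ∧ σ * σ = 1 := by
  decide +kernel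

theorem mul_mem_kleinList :
    ∀ v ∈ kleinList, ∀ w ∈ kleinList, v * w ∈ kleinList ∧ v * w = w * v := by
  decide +kernel

/-- The normal Klein four-group of `S_4`. -/
def kleinFour : Subgroup (Perm (Fin 4)) where
  carrier := {σ | σ ∈ kleinList}
  one_mem' := by decide
  mul_mem' := fun {v w} hv hw => (mul_mem_kleinList v hv w hw).1
  inv_mem' := fun {v} hv => by
    have h1 := ((mem_kleinList_iff v).1 hv).2
    rwa [Set.mem_ofPred_eq, inv_eq_of_mul_eq_one_left h1]

theorem mem_kleinFour_iff {σ : Perm (Fin 4)} :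
    σ ∈ kleinFour ↔ Perm.sign σ = 1 ∧ σ * σ = 1 := mem_kleinList_iff σ

instance : kleinFour.Normal where
  conj_mem := by
    intro σ hσ ρ
    rw [mem_kleinFour_iff] at hσ ⊢
    refine ⟨by simp [hσ.1], ?_⟩
    rw [_root_.conj_mul, hσ.2, mul_one, mul_inv_cancel]

theorem card_kleinFour : Nat.card kleinFour = 4 := by
  have h1 : (kleinFour : Set (Perm (Fin 4))) = (kleinList.toFinset : Set (Perm (Fin 4))) := by
    ext σ
    simp only [List.coe_toFinset, Set.mem_ofPred_eq]
    rfl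
  rw [← SetLike.coe_sort_coe, Nat.card_coe_set_eq, h1, Set.ncard_coe_finset]
  decide +kernel

theorem kleinFour_comm {v w : Perm (Fin 4)} (hv : v ∈ kleinFour) (hw : w ∈ kleinFour) :
    v * w = w * v := (mul_mem_kleinList v hv w hw).2

theorem exists_conj_ne_of_isSwap {τ : Perm (Fin 4)} (hτ : τ.IsSwap) :
    ∃ v ∈ kleinFour, τ * v * τ⁻¹ ≠ v := by
  have key : ∀ i j : Fin 4, i ≠ j →
      ∃ v ∈ kleinList, swap i j * v * (swap i j)⁻¹ ≠ v := by decide +kernel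
  obtain ⟨i, j, hij, rfl⟩ := hτ
  exact key i j hij

theorem eq_of_mem_kleinFour {v w u : Perm (Fin 4)} (hv : v ∈ kleinFour) (hw : w ∈ kleinFour)
    (hv1 : v ≠ 1) (hw1 : w ≠ 1) (hvw : v ≠ w) (hu : u ∈ kleinFour) :
    u = 1 ∨ u = w ∨ u = v ∨ u = v * w := by
  have key : ∀ v ∈ kleinList, ∀ w ∈ kleinList, v ≠ 1 → w ≠ 1 → v ≠ w → ∀ u ∈ kleinList,
      u = 1 ∨ u = w ∨ u = v ∨ u = v * w := by decide +kernel
  exact key v hv w hw hv1 hw1 hvw u hu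

/-- Modulo the Klein four-group, a transposition is self-centralizing. -/
theorem mem_kleinFour_or_of_conj_mul {τ : Perm (Fin 4)} (hτ : τ.IsSwap) {u : Perm (Fin 4)}
    (hu : u ∈ kleinFour) {h : Perm (Fin 4)} (hh : h * (u * τ) * h⁻¹ * τ⁻¹ ∈ kleinFour) :
    h ∈ kleinFour ∨ h * τ⁻¹ ∈ kleinFour := by
  have key : ∀ i j : Fin 4, i ≠ j → ∀ u ∈ kleinList, ∀ h : Perm (Fin 4),
      h * (u * swap i j) * h⁻¹ * (swap i j)⁻¹ ∈ kleinList →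
        h ∈ kleinList ∨ h * (swap i j)⁻¹ ∈ kleinList := by decide +kernel
  obtain ⟨i, j, hij, rfl⟩ := hτ
  exact key i j hij u hu h hh

/-- `S_4` induces all permutations of the three involutions of the Klein four-group. -/
theorem exists_conj_eq_of_mem_kleinFour {v w v' w' : Perm (Fin 4)} (hv : v ∈ kleinFour)
    (hw : w ∈ kleinFour) (hv' : v' ∈ kleinFour) (hw' : w' ∈ kleinFour) (hv1 : v ≠ 1) (hw1 : w ≠ 1)
    (hvw : v ≠ w) (hv1' : v' ≠ 1) (hw1' : w' ≠ 1) (hvw' : v' ≠ w') :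
    ∃ h : Perm (Fin 4), h * v * h⁻¹ = v' ∧ h * w * h⁻¹ = w' := by
  have key : ∀ v ∈ kleinList, ∀ w ∈ kleinList, ∀ v' ∈ kleinList, ∀ w' ∈ kleinList,
      v ≠ 1 → w ≠ 1 → v ≠ w → v' ≠ 1 → w' ≠ 1 → v' ≠ w' →
        ∃ h : Perm (Fin 4), h * v * h⁻¹ = v' ∧ h * w * h⁻¹ = w' := by decide +kernel
  exact key v hv w hw v' hv' w' hw' hv1 hw1 hvw hv1' hw1' hvw'

theorem isSwap_sq {τ : Perm (Fin 4)} (hτ : τ.IsSwap) : τ * τ = 1 := by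
  obtain ⟨i, j, -, rfl⟩ := hτ
  exact swap_mul_self i j

end Permutations

section AlternatingExtension

open Equiv SemidirectProduct

variable {N : ℕ} {θ : CyclicGroup N →* MulAut (alternatingGroup (Fin 4))} {τ : Perm (Fin 4)}

theorem exists_actsAsTransposition (hN : Even N) :
    ∃ θ : CyclicGroup N →* MulAut (alternatingGroup (Fin 4)), ActsAsTransposition θ := by
  have h1 : conjA4 (swap 0 1) ^ N = 1 := by
    obtain ⟨k, rfl⟩ := hN
    rw [← two_mul, pow_mul, pow_two, conjA4, ← map_mul, swap_mul_self, map_one, one_pow]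
  exact ⟨cyclicHom _ h1, swap 0 1, ⟨0, 1, by decide, rfl⟩, cyclicHom_ofAdd_one _ h1⟩

/-- Transpositions are conjugate in `S_4`, so the group `A_4 ⋊ C_N` does not depend on the choice of
the transposition. -/
theorem nonempty_mulEquiv_of_actsAsTransposition [NeZero N]
    {θ' : CyclicGroup N →* MulAut (alternatingGroup (Fin 4))} (hθ : ActsAsTransposition θ)
    (hθ' : ActsAsTransposition θ') :
    Nonempty ((alternatingGroup (Fin 4) ⋊[θ] CyclicGroup N) ≃*
      (alternatingGroup (Fin 4) ⋊[θ'] CyclicGroup N)) := by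
  obtain ⟨τ, ⟨i, j, hij, rfl⟩, hτ⟩ := hθ
  obtain ⟨τ', ⟨k, l, hkl, rfl⟩, hτ'⟩ := hθ'
  obtain ⟨ρ, hρ⟩ := isConj_iff.1 (Perm.isConj_swap hij hkl)
  have h1 : conjA4 ρ * θ (Multiplicative.ofAdd 1) = θ' (Multiplicative.ofAdd 1) * conjA4 ρ := by
    rw [hτ, hτ', conjA4, conjA4, conjA4, ← map_mul, ← map_mul, ← hρ, inv_mul_cancel_right]
  refine ⟨SemidirectProduct.congr (conjA4 ρ) (MulEquiv.refl _) fun u => ?_⟩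
  obtain ⟨s, rfl⟩ := CyclicGroup.exists_pow u
  have h2 : conjA4 ρ * θ (Multiplicative.ofAdd 1) ^ s =
      θ' (Multiplicative.ofAdd 1) ^ s * conjA4 ρ :=
    (SemiconjBy.pow_right (a := conjA4 ρ) h1 s)
  rw [MulEquiv.refl_apply, map_pow, map_pow]
  exact h2

/-- The natural homomorphism from `A_4 ⋊ C_N` onto `S_4`. -/
theorem exists_toPerm [NeZero N] (hN : Even N) (hτ : τ.IsSwap)
    (hθ : θ (Multiplicative.ofAdd 1) = conjA4 τ) :
    ∃ π : (alternatingGroup (Fin 4) ⋊[θ] CyclicGroup N) →* Perm (Fin 4),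
      (∀ u, π (inl u) = u) ∧ π (inr (Multiplicative.ofAdd 1)) = τ := by
  have h1 : τ ^ N = 1 := pow_eq_one_of_even (isSwap_sq hτ) hN
  refine ⟨SemidirectProduct.lift (alternatingGroup (Fin 4)).subtype (cyclicHom τ h1) fun u => ?_,
    fun u => by rw [lift_inl]; rfl, by rw [lift_inr, cyclicHom_ofAdd_one]⟩
  obtain ⟨s, rfl⟩ := CyclicGroup.exists_pow u
  ext1 u
  rw [map_pow, map_pow, hθ, cyclicHom_ofAdd_one, ← map_pow]
  rfl

theorem exists_eq_inl_mul_pow [NeZero N] (g : alternatingGroup (Fin 4) ⋊[θ] CyclicGroup N) :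
    ∃ u, ∃ k : ℕ, g = inl u * inr (Multiplicative.ofAdd 1) ^ k := by
  obtain ⟨k, hk⟩ := CyclicGroup.exists_pow g.right
  refine ⟨g.left, k, ?_⟩
  rw [← map_pow, ← hk, inl_left_mul_inr_right]

theorem inr_conj_inl (hθ : θ (Multiplicative.ofAdd 1) = conjA4 τ) (u : alternatingGroup (Fin 4)) :
    (inr (Multiplicative.ofAdd 1) * inl u * (inr (Multiplicative.ofAdd 1))⁻¹ :
      alternatingGroup (Fin 4) ⋊[θ] CyclicGroup N) = inl (conjA4 τ u) := by
  rw [← hθ, inl_aut, map_inv]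

/-- Since a transposition has order two, the square of the generator of `C_N` is central. -/
theorem inr_sq_comm [NeZero N] (hτ : τ.IsSwap) (hθ : θ (Multiplicative.ofAdd 1) = conjA4 τ)
    (g : alternatingGroup (Fin 4) ⋊[θ] CyclicGroup N) :
    Commute (inr (Multiplicative.ofAdd 1) ^ 2) g := by
  obtain ⟨u, k, rfl⟩ := exists_eq_inl_mul_pow g
  refine Commute.mul_right ?_ ((Commute.refl _).pow_pow 2 k)
  have h1 : conjA4 τ (conjA4 τ u) = u := by
    rw [← MulAut.mul_apply, conjA4, ← map_mul, isSwap_sq hτ, map_one, MulAut.one_apply]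
  have h2 := inr_conj_inl hθ (conjA4 τ u)
  rw [← inr_conj_inl hθ u, h1] at h2
  refine eq_mul_of_mul_inv_eq (Eq.trans ?_ h2)
  simp only [pow_two, mul_assoc, mul_inv_rev]

/-- The subgroup `V ⋊ C_N` of `A_4 ⋊ C_N`, where `V` is the Klein four-group. -/
def kleinExtension (θ : CyclicGroup N →* MulAut (alternatingGroup (Fin 4))) :
    Subgroup (alternatingGroup (Fin 4) ⋊[θ] CyclicGroup N) where
  carrier := {g | (g.left : Perm (Fin 4)) ∈ kleinFour}
  one_mem' := kleinFour.one_mem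
  mul_mem' := by
    intro g h hg hh
    refine kleinFour.mul_mem hg ?_
    rw [Set.mem_ofPred_eq, mem_kleinFour_iff] at hh
    refine mem_kleinFour_iff.2 ⟨(θ g.right h.left).2, ?_⟩
    have h1 : h.left * h.left = 1 := Subtype.ext hh.2
    rw [← Subgroup.coe_mul, ← map_mul, h1, map_one, Subgroup.coe_one]
  inv_mem' := by
    intro g hg
    rw [Set.mem_ofPred_eq, mem_kleinFour_iff] at hg
    refine mem_kleinFour_iff.2 ⟨(g⁻¹.left).2, ?_⟩
    have h1 : g.left * g.left = 1 := Subtype.ext hg.2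
    rw [← Subgroup.coe_mul, inv_left, ← map_mul, ← mul_inv_rev, h1, inv_one, map_one,
      Subgroup.coe_one]

theorem card_kleinExtension : Nat.card (kleinExtension θ) = 4 * N := by
  have h1 : Nat.card (kleinFour.subgroupOf (alternatingGroup (Fin 4))) = 4 := by
    rw [Nat.card_congr (Subgroup.subgroupOfEquivOfLe _).toEquiv, card_kleinFour]
    intro σ hσ
    exact (mem_kleinFour_iff.1 hσ).1
  have e : kleinExtension θ ≃ kleinFour.subgroupOf (alternatingGroup (Fin 4)) × CyclicGroup N :=
    { toFun := fun g => (⟨g.1.left, g.2⟩, g.1.right)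
      invFun := fun p => ⟨⟨p.1.1, p.2⟩, p.1.2⟩
      left_inv := fun _ => rfl
      right_inv := fun _ => rfl }
  rw [Nat.card_congr e, Nat.card_prod, h1, Nat.card_congr Multiplicative.toAdd, Nat.card_zmod]

theorem isSylow_kleinExtension {n : ℕ}
    (θ : CyclicGroup (2 ^ n) →* MulAut (alternatingGroup (Fin 4))) :
    ∃ S : Sylow 2 (alternatingGroup (Fin 4) ⋊[θ] CyclicGroup (2 ^ n)),
      (S : Subgroup _) = kleinExtension θ := by
  have h1 : Nat.card (alternatingGroup (Fin 4)) = 12 := by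
    have h := two_mul_nat_card_alternatingGroup (α := Fin 4)
    rw [Nat.card_perm, Nat.card_fin] at h
    have : Nat.factorial 4 = 24 := rfl
    omega
  have h2 : Nat.card (alternatingGroup (Fin 4) ⋊[θ] CyclicGroup (2 ^ n)) = 2 ^ (n + 2) * 3 := by
    rw [SemidirectProduct.card, h1, Nat.card_congr Multiplicative.toAdd, Nat.card_zmod]; ring
  have : Finite (alternatingGroup (Fin 4) ⋊[θ] CyclicGroup (2 ^ n)) :=
    Nat.finite_of_card_ne_zero (by rw [h2]; positivity)
  refine ⟨Sylow.ofCard (kleinExtension θ) ?_, rfl⟩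
  rw [card_kleinExtension, h2, Nat.factorization_mul (by positivity) (by norm_num),
    Nat.factorization_pow, Finsupp.add_apply, Finsupp.smul_apply,
    Nat.Prime.factorization_self Nat.prime_two,
    Nat.factorization_eq_zero_of_not_dvd (by norm_num)]
  simp only [smul_eq_mul, mul_one, add_zero]
  ring

/-- `V ⋊ C_N` is the preimage of the Sylow subgroup `V⟨τ⟩` of `S_4`. -/
theorem mem_kleinExtension_iff [NeZero N]
    {π : (alternatingGroup (Fin 4) ⋊[θ] CyclicGroup N) →* Perm (Fin 4)}
    (hτ : τ.IsSwap) (hπ : ∀ u, π (inl u) = u) (hπt : π (inr (Multiplicative.ofAdd 1)) = τ)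
    (g : alternatingGroup (Fin 4) ⋊[θ] CyclicGroup N) :
    g ∈ kleinExtension θ ↔ π g ∈ kleinFour ∨ π g * τ⁻¹ ∈ kleinFour := by
  obtain ⟨u, k, rfl⟩ := exists_eq_inl_mul_pow g
  have hτ1 : Perm.sign τ = -1 := hτ.sign_eq
  have hu : Perm.sign (u : Perm (Fin 4)) = 1 := u.2
  have h1 : (inl u * inr (Multiplicative.ofAdd 1) ^ k :
      alternatingGroup (Fin 4) ⋊[θ] CyclicGroup N) ∈ kleinExtension θ ↔
      (u : Perm (Fin 4)) ∈ kleinFour := by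
    change ((inl u * inr (Multiplicative.ofAdd 1) ^ k :
      alternatingGroup (Fin 4) ⋊[θ] CyclicGroup N).left : Perm (Fin 4)) ∈ kleinFour ↔ _
    rw [← map_pow, mul_left, left_inr, map_one, mul_one, left_inl]
  rw [h1, map_mul, map_pow, hπ, hπt]
  rcases Nat.even_or_odd k with hk | hk
  · rw [pow_eq_one_of_even (isSwap_sq hτ) hk, mul_one]
    refine ⟨Or.inl, ?_⟩
    rintro (h | h)
    · exact h
    · have := (mem_kleinFour_iff.1 h).1
      rw [Perm.sign_mul, Perm.sign_inv, hu, hτ1] at this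
      exact absurd this (by decide)
  · rw [pow_eq_self_of_odd (isSwap_sq hτ) hk, mul_inv_cancel_right]
    refine ⟨Or.inr, ?_⟩
    rintro (h | h)
    · have := (mem_kleinFour_iff.1 h).1
      rw [Perm.sign_mul, hu, hτ1] at this
      exact absurd this (by decide)
    · exact h

end AlternatingExtension

/-! ### The fusion system of the extension of the alternating group -/

section OfGroup

namespace FusionSystem

variable {P G : Type*} [Group P] [Group G]

theorem isMor_ofGroup_iff {ι : P →* G} {hι : Function.Injective ι} {S : Subgroup P} {f : P → P} :
    (ofGroup ι hι).IsMor S f ↔ ∃ g, ∀ s ∈ S, ι (f s) = g * ι s * g⁻¹ := by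
  constructor
  · rintro ⟨φ, ⟨g, hg⟩, hφ⟩
    exact ⟨g, fun s hs => by rw [← hφ ⟨s, hs⟩]; exact hg ⟨s, hs⟩⟩
  · rintro ⟨g, hg⟩
    let φ : S →* (⊤ : Subgroup P) :=
      { toFun := fun s => ⟨f s, trivial⟩
        map_one' := Subtype.ext (hι (by rw [hg _ (1 : S).2]; simp))
        map_mul' := fun s t => Subtype.ext (hι (by
          rw [hg _ (s * t).2, Subgroup.coe_mul, Subgroup.coe_mul, map_mul, map_mul, hg _ s.2,
            hg _ t.2]
          group)) }
    exact ⟨φ, ⟨g, fun s => hg s s.2⟩, fun _ => rfl⟩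

/-- Replacing `P` by a conjugate subgroup of `G` does not change `F_P(G)`. -/
theorem ofGroup_conj {ι : P →* G} (hι : Function.Injective ι) (h : G)
    (hι' : Function.Injective ((MulAut.conj h).toMonoidHom.comp ι)) :
    ofGroup ((MulAut.conj h).toMonoidHom.comp ι) hι' = ofGroup ι hι := by
  refine FusionSystem.ext (funext fun S => funext fun T => Set.ext fun φ => ⟨?_, ?_⟩)
  · rintro ⟨g, hg⟩
    refine ⟨h⁻¹ * g * h, fun s => ?_⟩
    have h1 : h * ι (φ s : P) * h⁻¹ = g * (h * ι (s : P) * h⁻¹) * g⁻¹ := hg s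
    calc ι (φ s : P) = h⁻¹ * (h * ι (φ s : P) * h⁻¹) * h := by group
      _ = _ := by rw [h1]; group
  · rintro ⟨g, hg⟩
    refine ⟨h * g * h⁻¹, fun s => ?_⟩
    change h * ι (φ s : P) * h⁻¹ = h * g * h⁻¹ * (h * ι (s : P) * h⁻¹) * (h * g * h⁻¹)⁻¹
    rw [hg s]
    group

end FusionSystem

namespace MinimalNonabelianGenerators

variable {P P' : Type*} [Group P] [Group P'] {m : ℕ} {x y c : P}

theorem map_mulEquiv (h : MinimalNonabelianGenerators m x y c) (e : P ≃* P') :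
    MinimalNonabelianGenerators m (e x) (e y) (e c) where
  x_pow := by rw [← map_pow, h.x_pow, map_one]
  y_sq := by rw [← map_mul, h.y_sq, map_one]
  c_sq := by rw [← map_mul, h.c_sq, map_one]
  conj := by rw [← map_mul, h.conj, map_mul, map_mul]
  cx := h.cx.map e
  cy := h.cy.map e
  closure_eq_top := by
    have h1 := congrArg (Subgroup.map e.toMonoidHom) h.closure_eq_top
    rw [MonoidHom.map_closure, Set.image_pair, Subgroup.map_top_of_surjective _ e.surjective] at h1
    exact h1

theorem y_ne_one (h : MinimalNonabelianGenerators m x y c) (hcard : Nat.card P = 2 ^ (m + 2)) :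
    y ≠ 1 := by
  intro hy
  have h1 := h.conj
  rw [hy, mul_one, one_mul] at h1
  exact h.c_ne_one hcard (mul_eq_right.1 h1.symm)

theorem y_ne_c (h : MinimalNonabelianGenerators m x y c) (hcard : Nat.card P = 2 ^ (m + 2)) :
    y ≠ c := by
  intro hy
  have h1 := h.conj
  rw [hy, ← h.cx.eq, h.c_sq, one_mul] at h1
  exact h.c_ne_one hcard (mul_eq_right.1 h1)

end MinimalNonabelianGenerators

section AlternatingExtension

open Equiv SemidirectProduct

variable {n : ℕ} {θ : CyclicGroup (2 ^ n) →* MulAut (alternatingGroup (Fin 4))} {τ : Perm (Fin 4)}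

/-- The Sylow subgroup `V ⋊ C_{2^n}` is generated by the generator `t` of `C_{2^n}` and an
involution `v ∈ V` that is moved by `t`. -/
theorem exists_generators_kleinExtension (hn : 1 ≤ n) (hτ : τ.IsSwap)
    (hθ : θ (Multiplicative.ofAdd 1) = conjA4 τ) :
    ∃ (x y c : kleinExtension θ) (v w : alternatingGroup (Fin 4)),
      MinimalNonabelianGenerators n x y c ∧ (x : _ ⋊[θ] _) = inr (Multiplicative.ofAdd 1) ∧
        (y : _ ⋊[θ] _) = inl v ∧ (c : _ ⋊[θ] _) = inl w := by
  obtain ⟨v, hv, hne⟩ := exists_conj_ne_of_isSwap hτ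
  obtain ⟨π, hπ, hπt⟩ := exists_toPerm (θ := θ) (Nat.even_pow.2 ⟨even_two, by omega⟩) hτ hθ
  have hmem := mem_kleinExtension_iff (θ := θ) hτ hπ hπt
  have hinl : ∀ u : alternatingGroup (Fin 4), (u : Perm (Fin 4)) ∈ kleinFour →
      (inl u : alternatingGroup (Fin 4) ⋊[θ] CyclicGroup (2 ^ n)) ∈ kleinExtension θ :=
    fun u hu => (hmem _).2 (Or.inl (by rw [hπ]; exact hu))
  set w : Perm (Fin 4) := v * (τ * v * τ⁻¹) with hw
  have hvτ : τ * v * τ⁻¹ ∈ kleinFour := Subgroup.Normal.conj_mem inferInstance v hv τ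
  have hwk : w ∈ kleinFour := kleinFour.mul_mem hv hvτ
  have hv2 := (mem_kleinFour_iff.1 hv).2
  have hw2 := (mem_kleinFour_iff.1 hwk).2
  have hv1 : v ≠ 1 := by rintro rfl; exact hne (by simp)
  have hw1 : w ≠ 1 := by
    intro h
    rw [hw, ← hv2] at h
    exact hne (mul_left_cancel h)
  have hvw : v ≠ w := by
    intro h
    have h1 : τ * v * τ⁻¹ = 1 := mul_eq_left.1 (hw ▸ h.symm)
    exact hv1 (conj_eq_one_iff.1 h1)
  have hτw : τ * w * τ⁻¹ = w := by
    have h1 : τ⁻¹ = τ := inv_eq_of_mul_eq_one_left (isSwap_sq hτ)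
    have h2 : τ * (τ * v * τ⁻¹) * τ⁻¹ = v := by
      rw [h1]
      calc τ * (τ * v * τ) * τ = (τ * τ) * v * (τ * τ) := by simp only [mul_assoc]
        _ = v := by rw [isSwap_sq hτ, one_mul, mul_one]
    rw [hw, ← _root_.conj_mul, h2, kleinFour_comm hvτ hv]
  set V : alternatingGroup (Fin 4) := ⟨v, (mem_kleinFour_iff.1 hv).1⟩ with hV
  set W : alternatingGroup (Fin 4) := ⟨w, (mem_kleinFour_iff.1 hwk).1⟩ with hW
  set t : alternatingGroup (Fin 4) ⋊[θ] CyclicGroup (2 ^ n) := inr (Multiplicative.ofAdd 1) with ht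
  have htm : t ∈ kleinExtension θ := (hmem _).2 (Or.inr (by
    rw [hπt, mul_inv_cancel]; exact kleinFour.one_mem))
  have htV : t * inl V = inl V * inl W * t := by
    have h1 : conjA4 τ V = V * W := Subtype.ext (by
      change τ * v * τ⁻¹ = v * w
      rw [hw, ← mul_assoc, hv2, one_mul])
    have h2 := inr_conj_inl hθ V
    rw [h1, map_mul] at h2
    exact mul_inv_eq_iff_eq_mul.1 h2
  have htW : inl W * t = t * inl W := by
    have h1 : conjA4 τ W = W := Subtype.ext hτw
    have h2 := inr_conj_inl hθ W
    rw [h1] at h2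
    exact (mul_inv_eq_iff_eq_mul.1 h2).symm
  set x : kleinExtension θ := ⟨t, htm⟩ with hx
  set y : kleinExtension θ := ⟨inl V, hinl V hv⟩ with hy
  set c : kleinExtension θ := ⟨inl W, hinl W hwk⟩ with hc
  have hconj : x * y = y * c * x := Subtype.ext htV
  refine ⟨x, y, c, V, W, ⟨?_, ?_, ?_, hconj, Subtype.ext htW, ?_, ?_⟩, rfl, rfl, rfl⟩
  · refine Subtype.ext ?_
    change t ^ 2 ^ n = 1
    rw [ht, ← map_pow, CyclicGroup.pow_eq_one_iff.2 dvd_rfl, map_one]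
  · refine Subtype.ext ?_
    change inl V * inl V = 1
    rw [← map_mul, show V * V = 1 from Subtype.ext hv2, map_one]
  · refine Subtype.ext ?_
    change inl W * inl W = 1
    rw [← map_mul, show W * W = 1 from Subtype.ext hw2, map_one]
  · refine Subtype.ext ?_
    change inl W * inl V = inl V * inl W
    rw [← map_mul, ← map_mul, show W * V = V * W from Subtype.ext (kleinFour_comm hwk hv)]
  · refine top_unique fun g _ => ?_
    have hxm : x ∈ Subgroup.closure {x, y} := Subgroup.subset_closure (Or.inl rfl)
    have hym : y ∈ Subgroup.closure {x, y} := Subgroup.subset_closure (Or.inr rfl)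
    have hcm : c ∈ Subgroup.closure {x, y} := by
      have : c = y⁻¹ * (x * y * x⁻¹) := by rw [hconj]; group
      rw [this]
      exact Subgroup.mul_mem _ (Subgroup.inv_mem _ hym)
        (Subgroup.mul_mem _ (Subgroup.mul_mem _ hxm hym) (Subgroup.inv_mem _ hxm))
    obtain ⟨g, hg⟩ := g
    obtain ⟨u, k, rfl⟩ := exists_eq_inl_mul_pow g
    have hu : (inl u : alternatingGroup (Fin 4) ⋊[θ] CyclicGroup (2 ^ n)) ∈ kleinExtension θ :=
      (Subgroup.mul_mem_cancel_right _ (Subgroup.pow_mem _ htm k)).1 hg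
    have hprod : (⟨_, hg⟩ : kleinExtension θ) = ⟨inl u, hu⟩ * x ^ k := rfl
    rw [hprod]
    refine Subgroup.mul_mem _ ?_ (Subgroup.pow_mem _ hxm k)
    have huk : (u : Perm (Fin 4)) ∈ kleinFour := by
      have h1 : ((inl u : alternatingGroup (Fin 4) ⋊[θ] CyclicGroup (2 ^ n)).left :
        Perm (Fin 4)) ∈ kleinFour := hu
      rwa [left_inl] at h1
    rcases eq_of_mem_kleinFour hv hwk hv1 hw1 hvw huk with h | h | h | h
    · have : (⟨inl u, hu⟩ : kleinExtension θ) = 1 := Subtype.ext (by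
        change inl u = 1
        rw [show u = 1 from Subtype.ext h, map_one])
      rw [this]; exact Subgroup.one_mem _
    · have : (⟨inl u, hu⟩ : kleinExtension θ) = c := Subtype.ext (by
        change inl u = inl W
        rw [show u = W from Subtype.ext h])
      rw [this]; exact hcm
    · have : (⟨inl u, hu⟩ : kleinExtension θ) = y := Subtype.ext (by
        change inl u = inl V
        rw [show u = V from Subtype.ext h])
      rw [this]; exact hym
    · have : (⟨inl u, hu⟩ : kleinExtension θ) = y * c := Subtype.ext (by
        change inl u = inl V * inl W
        rw [show u = V * W from Subtype.ext h, map_mul])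
      rw [this]; exact Subgroup.mul_mem _ hym hcm

variable {P : Type*} [Group P] {x y c : P}

/-- The fusion system of `A_4 ⋊ C_{2^n}`: the preimage `C(y)` of the Klein four-group under the map
to `S_4` is normal in the whole group, which induces `S_4` on it. A morphism defined outside of
`C(y)` is induced by the Sylow subgroup, since a transposition is self-centralizing modulo the Klein
four-group. -/
theorem isStandard_ofGroup (hn : 1 ≤ n) (hτ : τ.IsSwap)
    (hθ : θ (Multiplicative.ofAdd 1) = conjA4 τ)
    {ι : P →* alternatingGroup (Fin 4) ⋊[θ] CyclicGroup (2 ^ n)} (hι : Function.Injective ι)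
    (hr : ι.range = kleinExtension θ) (h : MinimalNonabelianGenerators n x y c)
    (hcard : Nat.card P = 2 ^ (n + 2)) {v w : alternatingGroup (Fin 4)}
    (hx : ι x = inr (Multiplicative.ofAdd 1)) (hy : ι y = inl v) (hc : ι c = inl w) :
    (FusionSystem.ofGroup ι hι).IsStandard x y c := by
  obtain ⟨π, hπ, hπt⟩ := exists_toPerm (θ := θ) (Nat.even_pow.2 ⟨even_two, by omega⟩) hτ hθ
  have hmem := mem_kleinExtension_iff (θ := θ) hτ hπ hπt
  have hτ1 : Perm.sign τ = -1 := hτ.sign_eq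
  have hinl : Function.Injective
      (inl : alternatingGroup (Fin 4) →* alternatingGroup (Fin 4) ⋊[θ] CyclicGroup (2 ^ n)) :=
    inl_injective
  have hvv : v * v = 1 := hinl (by rw [map_mul, ← hy, ← map_mul, h.y_sq, map_one, map_one])
  have hww : w * w = 1 := hinl (by rw [map_mul, ← hc, ← map_mul, h.c_sq, map_one, map_one])
  have hvk : (v : Perm (Fin 4)) ∈ kleinFour :=
    mem_kleinFour_iff.2 ⟨v.2, congrArg Subtype.val hvv⟩
  have hwk : (w : Perm (Fin 4)) ∈ kleinFour :=
    mem_kleinFour_iff.2 ⟨w.2, congrArg Subtype.val hww⟩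
  have hv1 : (v : Perm (Fin 4)) ≠ 1 := fun h1 => h.y_ne_one hcard (hι (by
    rw [hy, show v = 1 from Subtype.ext h1, map_one, map_one]))
  have hw1 : (w : Perm (Fin 4)) ≠ 1 := fun h1 => h.c_ne_one hcard (hι (by
    rw [hc, show w = 1 from Subtype.ext h1, map_one, map_one]))
  have hvw : (v : Perm (Fin 4)) ≠ w := fun h1 => h.y_ne_c hcard (hι (by
    rw [hy, hc, show v = w from Subtype.ext h1]))
  have hyc : ι (y * c) = inl (v * w) := by rw [map_mul, hy, hc, map_mul]
  have hx2 : ∀ g, Commute (ι (x ^ 2)) g := fun g => by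
    rw [map_pow, hx]; exact inr_sq_comm hτ hθ g
  obtain ⟨Q, hQ⟩ : ∃ Q : Subgroup P, Q = Subgroup.centralizer {y} := ⟨_, rfl⟩
  have hmemQ : ∀ g, g ∈ Q ↔ ∃ i j k : ℕ, g = x ^ (2 * i) * y ^ j * c ^ k :=
    hQ ▸ h.mem_centralizer_iff hcard
  have hx2Q : x ^ 2 ∈ Q := (hmemQ _).2 ⟨1, 0, 0, by simp⟩
  have hyQ : y ∈ Q := (hmemQ _).2 ⟨0, 1, 0, by simp⟩
  have hcQ : c ∈ Q := (hmemQ _).2 ⟨0, 0, 1, by simp⟩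
  have hkv : ∀ u : alternatingGroup (Fin 4), (u : Perm (Fin 4)) ∈ kleinFour →
      u = 1 ∨ u = w ∨ u = v ∨ u = v * w := by
    intro u hu
    rcases eq_of_mem_kleinFour hvk hwk hv1 hw1 hvw hu with h1 | h1 | h1 | h1
    · exact Or.inl (Subtype.ext h1)
    · exact Or.inr (Or.inl (Subtype.ext h1))
    · exact Or.inr (Or.inr (Or.inl (Subtype.ext h1)))
    · exact Or.inr (Or.inr (Or.inr (Subtype.ext h1)))
  -- `Q = C(y)` is the preimage of the Klein four-group under `π`
  have hπQ : ∀ q ∈ Q, π (ι q) ∈ kleinFour := by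
    intro q hq
    obtain ⟨i, j, k, rfl⟩ := (hmemQ q).1 hq
    simp only [map_mul, map_pow, hx, hy, hc, hπ, hπt]
    rw [pow_eq_one_of_even (isSwap_sq hτ) (even_two_mul i), one_mul]
    exact kleinFour.mul_mem (kleinFour.pow_mem hvk j) (kleinFour.pow_mem hwk k)
  have hQπ : ∀ g, π g ∈ kleinFour → ∃ q ∈ Q, ι q = g := by
    intro g hg
    obtain ⟨u, k, rfl⟩ := exists_eq_inl_mul_pow g
    rw [map_mul, map_pow, hπ, hπt] at hg
    have hu : Perm.sign (u : Perm (Fin 4)) = 1 := u.2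
    rcases Nat.even_or_odd' k with ⟨s, rfl | rfl⟩
    · rw [pow_eq_one_of_even (isSwap_sq hτ) (even_two_mul s), mul_one] at hg
      have hfin : ∀ r ∈ Q, ι r = inl u → ∃ q ∈ Q, ι q = inl u *
          (inr (Multiplicative.ofAdd 1) : alternatingGroup (Fin 4) ⋊[θ] CyclicGroup (2 ^ n)) ^
            (2 * s) := fun r hr' hru =>
        ⟨r * (x ^ 2) ^ s, Q.mul_mem hr' (Q.pow_mem hx2Q s), by
          rw [map_mul, hru, map_pow, map_pow, hx, pow_mul]⟩
      rcases hkv u hg with rfl | rfl | rfl | rfl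
      · exact hfin 1 Q.one_mem (by rw [map_one, map_one])
      · exact hfin c hcQ hc
      · exact hfin y hyQ hy
      · exact hfin (y * c) (Q.mul_mem hyQ hcQ) hyc
    · rw [pow_eq_self_of_odd (isSwap_sq hτ) ⟨s, rfl⟩] at hg
      have h1 := (mem_kleinFour_iff.1 hg).1
      rw [Perm.sign_mul, hu, hτ1] at h1
      exact absurd h1 (by decide)
  -- the involutions `c`, `y` and `y * c` are the nontrivial elements of `V`
  have hinv : ∀ r ∈ Q, (r = c ∨ r = y ∨ r = y * c) ↔ ((ι r).right = 1 ∧ ι r ≠ 1) := by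
    intro r hr'
    constructor
    · have hne : ∀ r' u, ι r' = inl u → u ≠ 1 → (ι r').right = 1 ∧ ι r' ≠ 1 := by
        intro r' u hru hu
        refine ⟨by rw [hru, right_inl], fun h1 => hu (hinl ?_)⟩
        rw [← hru, h1, map_one]
      rintro (rfl | rfl | rfl)
      · exact hne _ w hc (fun h1 => hw1 (congrArg Subtype.val h1))
      · exact hne _ v hy (fun h1 => hv1 (congrArg Subtype.val h1))
      · refine hne _ _ hyc (fun h1 => hvw ?_)
        rw [← hww] at h1
        exact congrArg Subtype.val (mul_right_cancel h1)
    · rintro ⟨h1, h2⟩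
      have h3 : ι r = inl (ι r).left := by
        rw [← inl_left_mul_inr_right (ι r), h1, map_one, mul_one, left_inl]
      have h4 := hπQ r hr'
      rw [h3, hπ] at h4
      rcases hkv _ h4 with h5 | h5 | h5 | h5 <;> rw [h5] at h3
      · rw [map_one] at h3; exact absurd h3 h2
      · exact Or.inl (hι (h3.trans hc.symm))
      · exact Or.inr (Or.inl (hι (h3.trans hy.symm)))
      · exact Or.inr (Or.inr (hι (h3.trans hyc.symm)))
  have hone : ∀ g p : alternatingGroup (Fin 4) ⋊[θ] CyclicGroup (2 ^ n),
      (g * p * g⁻¹).right = 1 ↔ p.right = 1 := by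
    intro g p
    rw [mul_right, mul_right, inv_right]
    exact conj_eq_one_iff
  constructor
  · intro S f hf
    obtain ⟨g, hg⟩ := FusionSystem.isMor_ofGroup_iff.1 hf
    by_cases hS : S ≤ Q
    -- conjugation by `g` normalizes `Q` and `V`, and it fixes the central element `x ^ 2`
    · right
      have h1 : ∀ q, ∃ q', q ∈ Q → q' ∈ Q ∧ ι q' = g * ι q * g⁻¹ := by
        intro q
        by_cases hq : q ∈ Q
        · obtain ⟨q', hq', h2⟩ := hQπ (g * ι q * g⁻¹) (by
            rw [map_mul, map_mul, map_inv]
            exact Subgroup.Normal.conj_mem inferInstance _ (hπQ q hq) _)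
          exact ⟨q', fun _ => ⟨hq', h2⟩⟩
        · exact ⟨1, fun h => absurd h hq⟩
      choose β hβ using h1
      refine ⟨hQ ▸ hS, β, ⟨?_, ?_, ?_, ?_⟩, fun s hs => hι ?_⟩
      · rw [← hQ]; exact fun q hq => (hβ q hq).1
      · rw [← hQ]
        intro q hq r hr'
        apply hι
        rw [map_mul, (hβ _ (Q.mul_mem hq hr')).2, (hβ q hq).2, (hβ r hr').2, map_mul]
        group
      · apply hι
        rw [(hβ _ hx2Q).2, ← (hx2 g).eq, mul_inv_cancel_right]
      · rw [← hQ]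
        intro q hq
        rw [hinv _ (hβ q hq).1, hinv _ hq, (hβ q hq).2, hone, Ne, Ne, conj_eq_one_iff]
      · rw [hg s hs, (hβ s (hS hs)).2]
    -- `π` maps some `s ∈ S` and `f s` into the coset of `τ`, so `π g` centralizes `τ` modulo the
    -- Klein four-group, and `g` lies in the image of `P`
    · left
      obtain ⟨s, hs, hsQ⟩ := SetLike.not_le_iff_exists.1 hS
      have hrange : ∀ p, π (ι p) ∈ kleinFour ∨ π (ι p) * τ⁻¹ ∈ kleinFour := fun p =>
        (hmem _).1 (hr ▸ ⟨p, rfl⟩)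
      have hnot : π (ι s) ∉ kleinFour := fun h1 => by
        obtain ⟨q, hq, h2⟩ := hQπ _ h1
        exact hsQ (hι h2 ▸ hq)
      have h1 := (hrange s).resolve_left hnot
      have h2 : π (ι (f s)) = π g * π (ι s) * (π g)⁻¹ := by rw [hg s hs, map_mul, map_mul, map_inv]
      have h3 : π (ι (f s)) ∉ kleinFour := fun h3 => hnot (by
        rw [h2] at h3
        have h4 := Subgroup.Normal.conj_mem (H := kleinFour) inferInstance _ h3 (π g)⁻¹
        have h5 : (π g)⁻¹ * (π g * π (ι s) * (π g)⁻¹) * (π g)⁻¹⁻¹ = π (ι s) := by group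
        rwa [h5] at h4)
      have h4 := (hrange (f s)).resolve_left h3
      rw [h2, ← inv_mul_cancel_right (π (ι s)) τ] at h4
      have h5 := (hmem g).2 (mem_kleinFour_or_of_conj_mul hτ h1 h4)
      rw [← hr] at h5
      obtain ⟨p, rfl⟩ := h5
      exact ⟨p, fun s hs => hι (by rw [hg s hs, map_mul, map_mul, map_inv])⟩
  · intro β hβ
    rw [← hQ]
    have hmaps := hβ.maps
    have hmul := hβ.map_mul
    have hmem3 := hβ.mem_iff
    rw [← hQ] at hmaps hmul hmem3
    have hβ1 : β 1 = 1 := by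
      have := hmul 1 Q.one_mem 1 Q.one_mem
      simpa using this
    have hpow : ∀ q ∈ Q, ∀ n : ℕ, β (q ^ n) = β q ^ n := by
      intro q hq n
      induction n with
      | zero => simpa using hβ1
      | succ n ih => rw [pow_succ, hmul _ (Q.pow_mem hq n) _ hq, ih, pow_succ]
    have hk : ∀ q ∈ Q, (q = c ∨ q = y ∨ q = y * c) →
        ∃ u : alternatingGroup (Fin 4), ι q = inl u ∧ (u : Perm (Fin 4)) ∈ kleinFour ∧
          (u : Perm (Fin 4)) ≠ 1 := by
      intro q hq h1
      obtain ⟨h2, h3⟩ := (hinv q hq).1 h1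
      have h4 : ι q = inl (ι q).left := by
        rw [← inl_left_mul_inr_right (ι q), h2, map_one, mul_one, left_inl]
      refine ⟨(ι q).left, h4, ?_, fun h5 => h3 ?_⟩
      · have h5 := hπQ q hq
        rwa [h4, hπ] at h5
      · rw [h4, show (ι q).left = 1 from Subtype.ext h5, map_one]
    -- `β` permutes the involutions of `V`; the same permutation is induced by some `ρ ∈ S_4`, and
    -- by a preimage `g` of `ρ`
    obtain ⟨v', hv', hvk', hv1'⟩ := hk _ (hmaps y hyQ) ((hmem3 y hyQ).2 (Or.inr (Or.inl rfl)))
    obtain ⟨w', hw', hwk', hw1'⟩ := hk _ (hmaps c hcQ) ((hmem3 c hcQ).2 (Or.inl rfl))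
    have hvw' : (v' : Perm (Fin 4)) ≠ w' := by
      intro h1
      have h2 : β y = β c := hι (by rw [hv', hw', show v' = w' from Subtype.ext h1])
      have h3 : β (y * c) = 1 := by
        rw [hmul _ hyQ _ hcQ, ← h2, ← hmul _ hyQ _ hyQ, h.y_sq, hβ1]
      have h4 := (hmem3 _ (Q.mul_mem hyQ hcQ)).2 (Or.inr (Or.inr rfl))
      rw [h3, ← hβ1] at h4
      exact ((hinv 1 Q.one_mem).1 ((hmem3 1 Q.one_mem).1 h4)).2 (map_one ι)
    obtain ⟨ρ, hρv, hρw⟩ := exists_conj_eq_of_mem_kleinFour hvk hwk hvk' hwk' hv1 hw1 hvw hv1' hw1'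
      hvw'
    obtain ⟨g, rfl⟩ : ∃ g, π g = ρ := by
      rcases Int.units_eq_one_or (Perm.sign ρ) with h1 | h1
      · exact ⟨inl ⟨ρ, h1⟩, hπ _⟩
      · have h2 : Perm.sign (ρ * τ⁻¹) = 1 := by
          rw [Perm.sign_mul, Perm.sign_inv, h1, hτ1]; decide
        refine ⟨inl ⟨ρ * τ⁻¹, h2⟩ * inr (Multiplicative.ofAdd 1), ?_⟩
        rw [map_mul, hπ, hπt, inv_mul_cancel_right]
    -- conjugation by `g` on `V ≤ A_4` is conjugation by the permutation `π g`
    have hlift : ∀ u u' : alternatingGroup (Fin 4), π g * u * (π g)⁻¹ = u' →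
        g * inl u * g⁻¹ = inl u' := by
      intro u u' huu
      have h1 : (g * inl u * g⁻¹).right = 1 := (hone g _).2 (right_inl u)
      have h2 : g * inl u * g⁻¹ = inl (g * inl u * g⁻¹).left := by
        conv_lhs => rw [← inl_left_mul_inr_right (g * inl u * g⁻¹), h1, map_one, mul_one]
      rw [h2]
      congr 1
      refine Subtype.ext ?_
      rw [← hπ, ← h2, map_mul, map_mul, map_inv, hπ, huu]
    refine FusionSystem.isMor_ofGroup_iff.2 ⟨g, fun q hq => ?_⟩
    obtain ⟨i, j, k, rfl⟩ := (hmemQ q).1 hq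
    rw [pow_mul, hmul _ (Q.mul_mem (Q.pow_mem hx2Q i) (Q.pow_mem hyQ j)) _ (Q.pow_mem hcQ k),
      hmul _ (Q.pow_mem hx2Q i) _ (Q.pow_mem hyQ j), hpow _ hx2Q, hpow _ hyQ, hpow _ hcQ,
      hβ.map_sq]
    simp only [map_mul, map_pow ι (x ^ 2), map_pow ι y, map_pow ι c, map_pow ι (β y),
      map_pow ι (β c)]
    rw [hv', hw', ← hlift v v' hρv, ← hlift w w' hρw, hy, hc, conj_pow, conj_pow]
    have hA := ((hx2 g).pow_left i).eq
    generalize ι (x ^ 2) ^ i = A at hA ⊢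
    generalize (inl v : alternatingGroup (Fin 4) ⋊[θ] CyclicGroup (2 ^ n)) ^ j = V
    generalize (inl w : alternatingGroup (Fin 4) ⋊[θ] CyclicGroup (2 ^ n)) ^ k = W
    calc A * (g * V * g⁻¹) * (g * W * g⁻¹) = A * g * (V * W) * g⁻¹ := by group
      _ = g * (A * V * W) * g⁻¹ := by rw [hA]; simp only [mul_assoc]

end AlternatingExtension

end OfGroup

/-! ### Comparison of standard fusion systems -/

section Conclusion

variable {P : Type*} [Group P]

namespace FusionSystem

variable {F F' : FusionSystem P} {x y c x' y' c' : P}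

/-- An isomorphism respecting the generators maps conjugations to conjugations and standard
automorphisms to standard automorphisms. -/
theorem IsStandard.isMor_map (hF : F.IsStandard x y c) (hF' : F'.IsStandard x' y' c') (γ : P ≃* P)
    (hx : γ x = x') (hy : γ y = y') (hc : γ c = c') {S : Subgroup P} {f : P → P}
    (hf : F.IsMor S f) : F'.IsMor (S.map (γ : P →* P)) (fun p => γ (f (γ.symm p))) := by
  subst hx hy hc
  have hcent : ∀ q, q ∈ Subgroup.centralizer {γ y} ↔ γ.symm q ∈ Subgroup.centralizer {y} := by
    intro q
    rw [Subgroup.mem_centralizer_singleton_iff, Subgroup.mem_centralizer_singleton_iff,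
      ← γ.injective.eq_iff (a := γ.symm q * y), map_mul, map_mul, MulEquiv.apply_symm_apply]
  rcases hF.mor S f hf with ⟨g, hg⟩ | ⟨hS, β, hβ, hfβ⟩
  · refine (IsMor.conj F' _ (γ g)).congr ?_
    rintro _ ⟨s, hs, rfl⟩
    change γ g * γ s * (γ g)⁻¹ = γ (f (γ.symm (γ s)))
    rw [MulEquiv.symm_apply_apply, hg s hs]
    simp
  · have hβ' : IsStandardAut (γ x) (γ y) (γ c) (fun p => γ (β (γ.symm p))) := by
      refine ⟨?_, ?_, ?_, ?_⟩
      · intro q hq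
        rw [hcent] at hq ⊢
        rw [MulEquiv.symm_apply_apply]
        exact hβ.maps _ hq
      · intro q hq r hr
        rw [hcent] at hq hr
        simp only [map_mul]
        rw [hβ.map_mul _ hq _ hr, map_mul]
      · simp only [← map_pow, MulEquiv.symm_apply_apply]
        rw [hβ.map_sq]
      · intro q hq
        rw [hcent] at hq
        have := hβ.mem_iff _ hq
        simp only [← map_mul, γ.injective.eq_iff]
        rw [this, ← γ.injective.eq_iff, ← γ.injective.eq_iff (b := y),
          ← γ.injective.eq_iff (b := y * c), MulEquiv.apply_symm_apply]
    refine ((hF'.aut _ hβ').mono ?_).congr ?_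
    · rintro _ ⟨s, hs, rfl⟩
      rw [hcent]
      change γ.symm (γ s) ∈ _
      rw [MulEquiv.symm_apply_apply]
      exact hS hs
    · rintro _ ⟨s, hs, rfl⟩
      change γ (β (γ.symm (γ s))) = γ (f (γ.symm (γ s)))
      rw [MulEquiv.symm_apply_apply, hfβ s hs]

/-- The description of the morphisms in `IsStandard` depends only on the generators, so it is
transported by automorphisms of `P`. -/
theorem IsStandard.equalUpToAut (hF : F.IsStandard x y c) (hF' : F'.IsStandard x' y' c')
    (γ : P ≃* P) (hx : γ x = x') (hy : γ y = y') (hc : γ c = c') : F.EqualUpToAut F' := by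
  refine ⟨γ, fun S T => Set.ext fun ψ => ⟨fun hψ => ?_, ?_⟩⟩
  · obtain ⟨f, hf⟩ := exists_fun ψ
    have h1 := hF'.isMor_map hF γ.symm (by rw [← hx, MulEquiv.symm_apply_apply])
      (by rw [← hy, MulEquiv.symm_apply_apply]) (by rw [← hc, MulEquiv.symm_apply_apply])
      ((mem_hom_iff hf).1 hψ)
    have h2 : (S.map (γ : P →* P)).map (γ.symm : P →* P) = S := by
      ext s
      simp
    rw [h2] at h1
    refine ⟨(γ.subgroupMap T).symm.toMonoidHom.comp (ψ.comp (γ.subgroupMap S).toMonoidHom),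
      (mem_hom_iff fun s => ?_).2 h1, ?_⟩
    · have h3 : γ (((γ.subgroupMap T).symm (ψ (γ.subgroupMap S s)) : T) : P) =
          ψ (γ.subgroupMap S s) := by
        rw [← MulEquiv.coe_subgroupMap_apply, MulEquiv.apply_symm_apply]
      rw [hf] at h3
      refine γ.injective (h3.trans ?_)
      simp
    · refine MonoidHom.ext fun s => ?_
      change ψ s = γ.subgroupMap T ((γ.subgroupMap T).symm (ψ (γ.subgroupMap S
        ((γ.subgroupMap S).symm s))))
      rw [MulEquiv.apply_symm_apply, MulEquiv.apply_symm_apply]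
  · rintro ⟨φ, hφ, rfl⟩
    obtain ⟨f, hf⟩ := exists_fun φ
    refine (mem_hom_iff fun s => ?_).2 (hF.isMor_map hF' γ hx hy hc ((mem_hom_iff hf).1 hφ))
    have h3 : (((γ.subgroupMap S).symm s : S) : P) = γ.symm s := by
      refine γ.injective ?_
      rw [← MulEquiv.coe_subgroupMap_apply, MulEquiv.apply_symm_apply,
        MulEquiv.apply_symm_apply]
    rw [← h3, ← hf]
    rfl

end FusionSystem

open Equiv SemidirectProduct

variable {n : ℕ} {θ : CyclicGroup (2 ^ n) →* MulAut (alternatingGroup (Fin 4))} {x y c : P}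

/-- A minimal nonabelian group of type `(n, 1)` is isomorphic to a Sylow `2`-subgroup of
`A_4 ⋊ C_{2^n}`. -/
theorem MinimalNonabelianGenerators.exists_isSylowEmbedding
    (h : MinimalNonabelianGenerators n x y c) (hn : 1 ≤ n) (hcard : Nat.card P = 2 ^ (n + 2))
    (hθ : ActsAsTransposition θ) :
    ∃ ι : P →* alternatingGroup (Fin 4) ⋊[θ] CyclicGroup (2 ^ n), IsSylowEmbedding 2 ι := by
  obtain ⟨τ, hτ, hθτ⟩ := hθ
  obtain ⟨x', y', c', v, w, h', -⟩ := exists_generators_kleinExtension hn hτ hθτ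
  obtain ⟨γ, -⟩ := h.exists_mulEquiv' hcard h' (by rw [card_kleinExtension, pow_add]; ring)
  obtain ⟨S, hS⟩ := isSylow_kleinExtension θ
  refine ⟨(kleinExtension θ).subtype.comp γ.toMonoidHom,
    (Subgroup.subtype_injective _).comp γ.injective, S, ?_⟩
  rw [hS, MonoidHom.range_comp, MonoidHom.range_eq_top.2 γ.surjective, ← MonoidHom.range_eq_map,
    Subgroup.range_subtype]

/-- By Sylow's theorem, the Sylow subgroup may be taken to be `V ⋊ C_{2^n}`. -/
theorem FusionSystem.IsStandard.equalUpToAut_ofGroup {F : FusionSystem P}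
    (hF : F.IsStandard x y c) (h : MinimalNonabelianGenerators n x y c) (hn : 1 ≤ n)
    (hcard : Nat.card P = 2 ^ (n + 2)) (hθ : ActsAsTransposition θ)
    (ι : P →* alternatingGroup (Fin 4) ⋊[θ] CyclicGroup (2 ^ n)) (hι : IsSylowEmbedding 2 ι) :
    F.EqualUpToAut (FusionSystem.ofGroup ι hι.1) := by
  obtain ⟨hinj, S, hS⟩ := hι
  obtain ⟨τ, hτ, hθτ⟩ := hθ
  obtain ⟨S₀, hS₀⟩ := isSylow_kleinExtension θ
  have : Finite (alternatingGroup (Fin 4) ⋊[θ] CyclicGroup (2 ^ n)) :=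
    Finite.of_equiv _ SemidirectProduct.equivProd.symm
  obtain ⟨g, hg⟩ := MulAction.exists_smul_eq (alternatingGroup (Fin 4) ⋊[θ] CyclicGroup (2 ^ n))
    S S₀
  have hinj' : Function.Injective ((MulAut.conj g).toMonoidHom.comp ι) :=
    (MulAut.conj g).injective.comp hinj
  have hr : ((MulAut.conj g).toMonoidHom.comp ι).range = kleinExtension θ := by
    rw [MonoidHom.range_comp, hS, ← hS₀, ← hg, Sylow.coe_subgroup_smul]
    rfl
  rw [← FusionSystem.ofGroup_conj hinj g hinj']
  obtain ⟨x', y', c', v, w, h', hx', hy', hc'⟩ := exists_generators_kleinExtension hn hτ hθτ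
  let e : P ≃* kleinExtension θ := (MonoidHom.ofInjective hinj').trans (MulEquiv.subgroupCongr hr)
  have he : ∀ r, ((MulAut.conj g).toMonoidHom.comp ι) (e.symm r) = r := by
    intro r
    have h1 : ∀ p, ((MulAut.conj g).toMonoidHom.comp ι) p = e p := fun _ => rfl
    rw [h1, MulEquiv.apply_symm_apply]
  have h'' := h'.map_mulEquiv e.symm
  obtain ⟨γ, hγx, hγy, hγc⟩ := h.exists_mulEquiv' hcard h'' hcard
  exact hF.equalUpToAut (isStandard_ofGroup hn hτ hθτ hinj' hr h'' hcard ((he x').trans hx')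
    ((he y').trans hy') ((he c').trans hc')) γ hγx hγy hγc

end Conclusion

theorem mainTheorem10 {P : Type*} [Group P] [Finite P] (hP : IsPGroup 2 P)
    (hbi : IsBicyclic P) (F : FusionSystem P) (hsat : F.IsSaturated 2) (hF : ¬ F.IsNilpotent)
    (hE : ∃ E : Subgroup P, E.Normal ∧ IsElementaryAbelianGroup 2 E ∧ Nat.card E = 8) :
    ∃ n : ℕ, 2 ≤ n ∧
      IsMinimalNonabelianOfType 2 n 1 P ∧
      (∃ Q : Subgroup P, F.IsEssential 2 Q ∧
        Nonempty (Q ≃* CyclicGroup (2 ^ (n - 1)) × CyclicGroup 2 × CyclicGroup 2) ∧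
        ∀ R : Subgroup P, F.IsEssential 2 R → R = Q) ∧
      (∃ θ : CyclicGroup (2 ^ n) →* MulAut (alternatingGroup (Fin 4)), ActsAsTransposition θ) ∧
      (∀ θ θ' : CyclicGroup (2 ^ n) →* MulAut (alternatingGroup (Fin 4)),
        ActsAsTransposition θ → ActsAsTransposition θ' →
          Nonempty ((alternatingGroup (Fin 4) ⋊[θ] CyclicGroup (2 ^ n)) ≃*
            (alternatingGroup (Fin 4) ⋊[θ'] CyclicGroup (2 ^ n)))) ∧
      (∀ θ : CyclicGroup (2 ^ n) →* MulAut (alternatingGroup (Fin 4)), ActsAsTransposition θ →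
        (∃ ι : P →* alternatingGroup (Fin 4) ⋊[θ] CyclicGroup (2 ^ n), IsSylowEmbedding 2 ι) ∧
        ∀ (ι : P →* alternatingGroup (Fin 4) ⋊[θ] CyclicGroup (2 ^ n))
          (hι : IsSylowEmbedding 2 ι),
          F.EqualUpToAut (FusionSystem.ofGroup ι hι.1)) := by
  obtain ⟨E, hEn, ⟨hEcomm, hEsq⟩, hE8⟩ := hE
  obtain ⟨x, a, d, b, m, e, h⟩ := exists_cyclicExtension_of_isBicyclic hP hbi hEn
    (fun u hu v hv => congrArg Subtype.val (hEcomm ⟨u, hu⟩ ⟨v, hv⟩))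
    (fun u hu => by
      have := congrArg Subtype.val (hEsq ⟨u, hu⟩)
      rwa [pow_two] at this) hE8
  have hm := h.two_le
  rcases h.he with rfl | ⟨rfl, -⟩
  · have hcard := h.card_eq
    obtain ⟨x', y, hg, hcent, hstd, β, hβ, hβm, hβd⟩ := h.exists_isStandard hP hsat hF
    obtain ⟨φ, -⟩ := hg.exists_mulEquiv hcard
    refine ⟨m, hm, ⟨φ.symm⟩, ⟨Subgroup.centralizer {y}, hstd.isEssential hg hcard hβ hβm hβd,
      hg.nonempty_mulEquiv hm hcard, fun R hR => ?_⟩,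
      exists_actsAsTransposition (Nat.even_pow.2 ⟨even_two, by omega⟩),
      fun θ θ' hθ hθ' => nonempty_mulEquiv_of_actsAsTransposition hθ hθ',
      fun θ hθ => ⟨hg.exists_isSylowEmbedding (by omega) hcard hθ, fun ι hι =>
        hstd.equalUpToAut_ofGroup hg (by omega) hcard hθ ι hι⟩⟩
    obtain ⟨f, -, hf, hne⟩ := hR.exists_isOddAut
    rw [hcent]
    exact h.eq_centralizer hP hf hne hR.centralizer_le
  · refine absurd (hsat.isNilpotent hP fun R f hRn hRc hmor hf r hr => ?_) hF
    exact (h.fixed_of_one hP hsat hRn hRc hmor hf r hr).2
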